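/- **Setting.** Fix $\ell\ge 0$, $\mathcal O=\mathcal T=\mathbb R^\ell$, $\mathcal O^+=\mathcal O\oplus\mathcal T$; tensors in $(\mathcal O^+)^{\otimes2}$ are $2\times2$ block matrices, $\|\cdot\|$ is the Euclidean/Frobenius norm and $\|\cdot\|_\sigma$ the operator norm. Let $f:\mathcal O^+\times\mathcal T\to\mathbb R$, $(r,\epsilon)\mapsto f(r;\epsilon)$, $r=x\oplus y$, be measurable, $\alpha$-pseudo-Lipschitz ($|f(r;\epsilon)-f(\hat r;\epsilon)|\le L(f)\|r-\hat r\|(1+\|r\|^\alpha+\|\hat r\|^\alpha+\|\epsilon\|^\alpha)$ for some $\alpha\ge0$), with $f(0;\epsilon)$ integrable for $\epsilon\sim N(0,I)$. For every $y,\epsilon$ let $\varphi=f(\cdot\oplus y;\epsilon)$ be $C^1$ and * $\hat L$-smooth: $\varphi(\hat x)\le\varphi(x)+\langle\nabla\varphi(x),\hat x-x\rangle+\frac{\hat L}{2}\|\hat x-x\|^2$ for all $x,\hat x$; * $(\hat\mu,\hat\theta)$-RSI: for all $x$ and all $x^\star\in\arg\min\varphi$, $\langle x-x^\star,\nabla\varphi(x)\rangle\ge\hat\mu\|x-x^\star\|^2$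 if $\max\{\|x^\star\|^2,\|x-x^\star\|^2\}\le\hat\theta$, and $\ge0$ otherwise, with constants $\hat L,\hat\mu,\hat\theta>0$. Let $U\subseteq(\mathcal O^+)^{\otimes2}$ be open and $h:(\mathcal O^+)^{\otimes2}\to\mathbb R$ satisfy $h(B^T)=h(B)$, be $C^1$ on $U$, with $h(B)=\mathbb E f(r;\epsilon)$ for all positive semidefinite $B\in U$, where $r\sim N(0,B)$ and $\epsilon\sim N(0,I)$ are independent. Put $I(B)=\mathbb E[\nabla_xf(r;\epsilon)\otimes\nabla_xf(r;\epsilon)]$. Assume that $\nabla h$ on $U$ and $I$ on the positive semidefinite $B\in U$ are $\alpha$-pseudo-Lipschitz, i.e. $\|F(B)-F(\hat B)\|\le L(F)\|B-\hat B\|(1+\|B\|^\alpha+\|\hat B\|^\alpha)$. For every $d\ge1$ let $K=K_d\in\mathbb R^{d\times d}$ be a covariance matrix with smallest eigenvalue $\lambda_{\min}(K)>0$, and $X_0,X^\star\in\mathbb R^{d\times\ell}$, with $\|K\|_\sigma$, $\|X_0\|$, $\|X^\star\|$ bounded independently of $d$. Write $W=X\oplus X^\star$, i.e. the block matrix $(X,X^\star)$,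 and $B(W)=W^TKW$; assume $B(W_0)\in U$ for $W_0=X_0\oplus X^\star$. Assume $X^\star$ minimizes $\mathcal R(X)=\mathbb E f(X^Ta\oplus X^{\star T}a;\epsilon)$, where $a\sim N(0,K)$ and $\epsilon\sim N(0,I)$ are independent, and that, almost surely, $X^{\star T}a\in\arg\min_xf(x\oplus X^{\star T}a;\epsilon)$. Let $\zeta_0\in(0,1)$, $0<\zeta<1-\zeta_0$, and suppose that for every $d$ $$10\exp\Bigl(-\frac{\hat\theta}{8\|K\|_\sigma\max\{\|X_0-X^\star\|^2,\|X^\star\|^2\}}\Bigr)<\zeta_0$$ (the exponential is read as $0$ if the maximum is $0$). Let $$\gamma=\frac{2\hat\mu}{\hat L^2\,\frac1d\operatorname{tr}K}\,\zeta,$$ and assume $\gamma$ is bounded independently of $d$. *SGD.* $X_{k+1}=X_k-\frac\gamma d\,a_{k+1}\otimes\nabla_xf(X_k^Ta_{k+1}\oplus X^{\star T}a_{k+1};\epsilon_{k+1})$, with $(a_k,\epsilon_k)$ i.i.d. copies of $(a,\epsilon)$. *Deterministic equivalent.* Let $\lambda_i,\omega_i$ $(1\le i\le d)$ be eigenvalues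 and orthonormal eigenvectors of $K$. Let $\mathcal B_i(t)=\begin{bmatrix}\mathcal B_{11,i}&\mathcal B_{12,i}\\\mathcal B_{12,i}^T&\mathcal B_{22,i}\end{bmatrix}$, positive semidefinite, $\mathcal B(t)=\frac1d\sum_i\lambda_i\mathcal B_i(t)\in U$, be the solution, on its maximal interval of existence $[0,\Theta)$ with $0<\Theta\le\infty$, of $$\dot{\mathcal B}_{11,i}=-2\lambda_i\gamma\bigl(\mathcal B_{11,i}H_1+H_1\mathcal B_{11,i}+\mathcal B_{12,i}H_2^T+H_2\mathcal B_{12,i}^T\bigr)+\lambda_i\gamma^2I(\mathcal B),\quad\dot{\mathcal B}_{12,i}=-2\lambda_i\gamma\bigl(H_1\mathcal B_{12,i}+H_2\mathcal B_{22,i}\bigr),\quad\dot{\mathcal B}_{22,i}=0,$$ where $\begin{bmatrix}H_1&H_2\\H_2^T&H_3\end{bmatrix}=\nabla h(\mathcal B(t))$ and $\mathcal B_i(0)=d\,(W_0^T\omega_i)(W_0^T\omega_i)^T$. Put $\mathcal D^2(t)=\frac1d\sum_i\operatorname{tr}\bigl(\mathcal B_{11,i}-2\mathcal B_{12,i}+\mathcal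 B_{22,i}\bigr)(t)$. Let $T,\eta>0$ be independent of $d$ and assume that, for every $d$, $\|\mathcal B(t)-V\|>\eta$ for all $t\in[0,T]\cap[0,\Theta)$ and $V\notin U$. **Conclusion.** For every $d\ge1$: if $\Theta<\infty$, then $\mathcal B(t)$ converges, as $t\uparrow\Theta$, to a point outside $U$ (so $\Theta=\infty$ if $U$ is the whole space), and $\Theta>T$; and with $a=\gamma(1-\zeta_0-\zeta)\hat\mu\lambda_{\min}(K)$, $$\mathcal D^2(t)\le2e^{-at}\|X_0-X^\star\|^2\qquad\text{for all }0\le t<\Theta.$$ Moreover there is $\varepsilon>0$, independent of $d$, such that with overwhelming probability $$\sup_{0\le t\le T}\bigl|\|X_{\lfloor td\rfloor}-X^\star\|^2-\mathcal D^2(t)\bigr|\le d^{-\varepsilon},$$ i.e. this event has probability at least $1-e^{-\omega(d)}$ for some $\omega$ with $\omega(d)/\log d\to\infty$. -/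

import Mathlib

open MeasureTheory ProbabilityTheory Filter Topology Set
open scoped Matrix

/- Matrices carry the Frobenius (Hilbert-Schmidt) norm. -/
attribute [local instance] Matrix.frobeniusNormedAddCommGroup Matrix.frobeniusNormedSpace

noncomputable section

namespace SGDEquiv

/-- The output space `𝒪 = ℝ^ℓ`, equal to the latent space `𝒯`. -/
abbrev Out (l : ℕ) := EuclideanSpace ℝ (Fin l)

/-- The sum `𝒪⁺ = 𝒪 ⊕ 𝒯`. -/
abbrev OutP (l : ℕ) := EuclideanSpace ℝ (Fin l ⊕ Fin l)

/-- Tensors in `(𝒪⁺)^{⊗2}`, as `2 × 2` block matrices. -/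
abbrev MatP (l : ℕ) := Matrix (Fin l ⊕ Fin l) (Fin l ⊕ Fin l) ℝ

/-- The vector `x ⊕ y` of `𝒪⁺`. -/
def join {l : ℕ} (x y : Out l) : OutP l :=
  WithLp.toLp 2 (Sum.elim (fun i => x i) (fun i => y i))

/-- The first component `x` of `r = x ⊕ y`. -/
def fstPart {l : ℕ} (r : OutP l) : Out l := WithLp.toLp 2 (fun i => r (Sum.inl i))

/-- The second component `y` of `r = x ⊕ y`. -/
def sndPart {l : ℕ} (r : OutP l) : Out l := WithLp.toLp 2 (fun i => r (Sum.inr i))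

/-- The outer function as a function of its first variable: `x ↦ f (x ⊕ y; ε)`. -/
def slice {l : ℕ} (f : OutP l → Out l → ℝ) (y e : Out l) : Out l → ℝ :=
  fun x => f (join x y) e

/-- The partial gradient `∇ₓ f (r; ε)`. -/
def gradX {l : ℕ} (f : OutP l → Out l → ℝ) (r : OutP l) (e : Out l) : Out l :=
  gradient (slice f (sndPart r) e) (fstPart r)

/-- `f` is `α`-pseudo-Lipschitz with constant `L`. -/
def PseudoLipschitzOuter {l : ℕ} (α L : ℝ) (f : OutP l → Out l → ℝ) : Prop :=
  ∀ (r r' : OutP l) (e : Out l),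
    |f r e - f r' e| ≤ L * ‖r - r'‖ * (1 + ‖r‖ ^ α + ‖r'‖ ^ α + ‖e‖ ^ α)

/-- `F` is `α`-pseudo-Lipschitz with constant `L` on the set `s` of matrices. -/
def PseudoLipschitzOn {l : ℕ} {m : Type} [Fintype m] (α L : ℝ) (F : MatP l → Matrix m m ℝ)
    (s : Set (MatP l)) : Prop :=
  ∀ B ∈ s, ∀ B' ∈ s, ‖F B - F B'‖ ≤ L * ‖B - B'‖ * (1 + ‖B‖ ^ α + ‖B'‖ ^ α)

/-- `L`-smoothness: `φ` is `C¹` and satisfies the quadratic upper bound. -/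
def LSmooth {l : ℕ} (L : ℝ) (φ : Out l → ℝ) : Prop :=
  ContDiff ℝ 1 φ ∧
    ∀ x x' : Out l, φ x' ≤ φ x + inner ℝ (gradient φ x) (x' - x) + L / 2 * ‖x' - x‖ ^ 2

/-- The `(μ, θ)` restricted secant inequality. -/
def RSI {l : ℕ} (μ θ : ℝ) (φ : Out l → ℝ) : Prop :=
  ContDiff ℝ 1 φ ∧
    ∀ x xs : Out l, IsMinOn φ univ xs →
      (if max (‖xs‖ ^ 2) (‖x - xs‖ ^ 2) ≤ θ then μ * ‖x - xs‖ ^ 2 else 0)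
        ≤ inner ℝ (x - xs) (gradient φ x)

/-- The law of `(r, ε)` where `r ∼ N(0, B)` and `ε ∼ N(0, I)` are independent. -/
def lawB {l : ℕ} (B : MatP l) : Measure (OutP l × Out l) :=
  (multivariateGaussian 0 B).prod (stdGaussian (Out l))

/-- The expectation of `f (r; ε)` when `r ∼ N(0, B)`. -/
def meanLoss {l : ℕ} (f : OutP l → Out l → ℝ) (B : MatP l) : ℝ :=
  ∫ p, f p.1 p.2 ∂(lawB B)

/-- The Fisher matrix `I(B) = 𝔼 [∇ₓ f (r; ε)^{⊗2}]`, `r ∼ N(0, B)`. -/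
def fisher {l : ℕ} (f : OutP l → Out l → ℝ) (B : MatP l) : Matrix (Fin l) (Fin l) ℝ :=
  fun i j => ∫ p, gradX f p.1 p.2 i * gradX f p.1 p.2 j ∂(lawB B)

/-- The gradient of `h` with respect to the Frobenius inner product. -/
def matGrad {l : ℕ} (h : MatP l → ℝ) (B : MatP l) : MatP l :=
  fun i j => fderiv ℝ h B (Matrix.single i j 1)

/-- The contraction `⟨X, a⟩_𝒜 = Xᵀ a`. -/
def contract {d l : ℕ} (X : Matrix (Fin d) (Fin l) ℝ) (a : EuclideanSpace ℝ (Fin d)) : Out l :=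
  WithLp.toLp 2 (Xᵀ *ᵥ (fun i => a i))

/-- The data distribution `N(0, K ⊕ I_𝒯)` of the pair `(a, ε)`. -/
def dataLaw {d : ℕ} (l : ℕ) (K : Matrix (Fin d) (Fin d) ℝ) :
    Measure (EuclideanSpace ℝ (Fin d) × Out l) :=
  (multivariateGaussian 0 K).prod (stdGaussian (Out l))

/-- The risk `ℛ(X) = 𝔼 f (⟨X, a⟩ ⊕ ⟨X⋆, a⟩; ε)`. -/
def risk {d l : ℕ} (f : OutP l → Out l → ℝ) (K : Matrix (Fin d) (Fin d) ℝ)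
    (Xs X : Matrix (Fin d) (Fin l) ℝ) : ℝ :=
  ∫ p, f (join (contract X p.1) (contract Xs p.1)) p.2 ∂(dataLaw l K)

/-- Streaming SGD with constant step-size `γ / d`, without regularization; the step from
`X_k` to `X_{k+1}` uses the sample `(a k, e k)`. -/
def sgd {d l : ℕ} (f : OutP l → Out l → ℝ) (γ : ℝ) (X₀ Xs : Matrix (Fin d) (Fin l) ℝ)
    (a : ℕ → EuclideanSpace ℝ (Fin d)) (e : ℕ → Out l) : ℕ → Matrix (Fin d) (Fin l) ℝ
  | 0 => X₀
  | k + 1 =>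
    sgd f γ X₀ Xs a e k - (γ / d) • Matrix.vecMulVec (fun i => a k i)
      (fun j => gradX f (join (contract (sgd f γ X₀ Xs a e k) (a k)) (contract Xs (a k))) (e k) j)

/-- The tensor `B(W) = ⟨W^{⊗2}, K⟩ = Wᵀ K W` for `W = X ⊕ X⋆`. -/
def covOf {d l : ℕ} (K : Matrix (Fin d) (Fin d) ℝ) (X Xs : Matrix (Fin d) (Fin l) ℝ) : MatP l :=
  (Matrix.fromCols X Xs)ᵀ * K * Matrix.fromCols X Xs

/-- `𝓑 = (1/d) ∑ᵢ λᵢ 𝓑ᵢ`. -/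
def avgB {d l : ℕ} (lam : Fin d → ℝ) (B : Fin d → MatP l) : MatP l :=
  (1 / (d : ℝ)) • ∑ i, lam i • B i

/-- `𝓓² = (1/d) ∑ᵢ tr (𝓑₁₁,ᵢ - 2 𝓑₁₂,ᵢ + 𝓑₂₂,ᵢ)`. -/
def distSq {d l : ℕ} (B : Fin d → MatP l) : ℝ :=
  (1 / (d : ℝ)) * ∑ i, ((B i).toBlocks₁₁ - (2 : ℝ) • (B i).toBlocks₁₂ + (B i).toBlocks₂₂).trace

/-- The right-hand side of the equation for `𝓑ᵢ`, where `A = 𝓑`, `lam = λᵢ` and `M = 𝓑ᵢ`. With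
`H = ∇h(𝓑)`, the `11` block is
`-2 λᵢ γ (𝓑₁₁,ᵢ H₁ + H₁ 𝓑₁₁,ᵢ + 𝓑₁₂,ᵢ H₂ᵀ + H₂ 𝓑₁₂,ᵢᵀ) + λᵢ γ² I(𝓑)`, the `12` block is
`-2 λᵢ γ (H₁ 𝓑₁₂,ᵢ + H₂ 𝓑₂₂,ᵢ)`, and `𝓑₂₂,ᵢ` is constant. -/
def odeRHS {l : ℕ} (f : OutP l → Out l → ℝ) (h : MatP l → ℝ) (γ : ℝ) (A : MatP l) (lam : ℝ)
    (M : MatP l) : MatP l :=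
  let H₁ := (matGrad h A).toBlocks₁₁
  let H₂ := (matGrad h A).toBlocks₁₂
  let B₁₁ := M.toBlocks₁₁
  let B₁₂ := M.toBlocks₁₂
  let B₂₂ := M.toBlocks₂₂
  let D₁₁ := (-(2 * lam * γ)) • (B₁₁ * H₁ + H₁ * B₁₁ + B₁₂ * H₂ᵀ + H₂ * B₁₂ᵀ)
    + (lam * γ ^ 2) • fisher f A
  let D₁₂ := (-(2 * lam * γ)) • (H₁ * B₁₂ + H₂ * B₂₂)
  Matrix.fromBlocks D₁₁ D₁₂ D₁₂ᵀ 0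

/-- The time interval `[0, Θ)`, `Θ ≤ ∞`. -/
def timeIco (Θ : EReal) : Set ℝ := {t | 0 ≤ t ∧ (t : EReal) < Θ}

/-- `t ↦ (𝓑ᵢ(t))ᵢ` is a solution on `[0, Θ)` of the coupled equations, in positive semidefinite
matrices, with average `𝓑(t)` in `U` and `𝓑ᵢ(0) = d ⟨W₀^{⊗2}, ωᵢ^{⊗2}⟩`; the `λᵢ`, `ωᵢ` are
eigenvalues and orthonormal eigenvectors of `K`. -/
structure IsODESolution {d l : ℕ} (f : OutP l → Out l → ℝ) (h : MatP l → ℝ) (U : Set (MatP l))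
    (γ : ℝ) {K : Matrix (Fin d) (Fin d) ℝ} (hK : K.IsHermitian)
    (X₀ Xs : Matrix (Fin d) (Fin l) ℝ) (Θ : EReal) (B : ℝ → Fin d → MatP l) : Prop where
  pos : 0 < Θ
  init : ∀ i, B 0 i = (d : ℝ) • Matrix.vecMulVec
    ((Matrix.fromCols X₀ Xs)ᵀ *ᵥ (fun j => hK.eigenvectorBasis i j))
    ((Matrix.fromCols X₀ Xs)ᵀ *ᵥ (fun j => hK.eigenvectorBasis i j))
  psd : ∀ t ∈ timeIco Θ, ∀ i, (B t i).PosSemidef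
  mem : ∀ t ∈ timeIco Θ, avgB hK.eigenvalues (B t) ∈ U
  deriv : ∀ t ∈ timeIco Θ, ∀ i, HasDerivWithinAt (fun s => B s i)
    (odeRHS f h γ (avgB hK.eigenvalues (B t)) (hK.eigenvalues i) (B t i)) (timeIco Θ) t

/-- The solution on its maximal interval of existence `[0, Θ)`. -/
def IsMaximalODESolution {d l : ℕ} (f : OutP l → Out l → ℝ) (h : MatP l → ℝ) (U : Set (MatP l))
    (γ : ℝ) {K : Matrix (Fin d) (Fin d) ℝ} (hK : K.IsHermitian)
    (X₀ Xs : Matrix (Fin d) (Fin l) ℝ) (Θ : EReal) (B : ℝ → Fin d → MatP l) : Prop :=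
  IsODESolution f h U γ hK X₀ Xs Θ B ∧
    ∀ (τ : EReal) (B' : ℝ → Fin d → MatP l), IsODESolution f h U γ hK X₀ Xs τ B' → τ ≤ Θ

/-- The operator norm `‖K‖_σ`. -/
def opNorm {d : ℕ} (K : Matrix (Fin d) (Fin d) ℝ) : ℝ :=
  ‖Matrix.toEuclideanCLM (n := Fin d) (𝕜 := ℝ) K‖

/-- The smallest eigenvalue `λ_min(K)`. -/
def lamMin {d : ℕ} {K : Matrix (Fin d) (Fin d) ℝ} (hK : K.IsHermitian) : ℝ :=
  ⨅ i, hK.eigenvalues i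

/-- The step-size `γ = 2 μ ζ / (L² (1/d) tr K)`. -/
def stepSize {d : ℕ} (μ L ζ : ℝ) (K : Matrix (Fin d) (Fin d) ℝ) : ℝ :=
  2 * μ / (L ^ 2 * ((1 / (d : ℝ)) * K.trace)) * ζ

/-- The events `E d` hold with overwhelming probability as `d → ∞`. -/
def WithOverwhelmingProbability {Ω : ℕ → Type*} [∀ d, MeasurableSpace (Ω d)]
    (P : ∀ d, Measure (Ω d)) (E : ∀ d, Set (Ω d)) : Prop :=
  ∃ w : ℕ → ℝ, Tendsto (fun d : ℕ => w d / Real.log d) atTop atTop ∧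
    ∀ d, 1 ≤ d → P d (E d)ᶜ ≤ ENNReal.ofReal (Real.exp (-(w d)))

end SGDEquiv

end

open SGDEquiv

/-! The deterministic equation is controlled by a Lyapunov estimate, and SGD is compared with it
through an infinite hierarchy of weighted second moments.

Decay. Differentiating `h (B (W + s V)) = 𝔼 f` at `s = 0` expresses the Gaussian mean of `⟨Vᵀ a, ∇ₓ
f⟩` through `∇h` (`integral_inner_gradX`). Hence the derivative of `𝓓²` is `-2γ 𝔼⟨x - y, ∇ₓf⟩ + γ²
(tr K / d) 𝔼‖∇ₓf‖²` with `x ⊕ y ∼ N(0, 𝓑(t))` (`sum_diffTrace_odeRHS`). The `22` block is conserved,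
so `y` remains almost surely a minimizer. With `τ = 𝔼‖x - y‖²`, smoothness bounds the second mean by
`L² τ`. The secant inequality bounds the first from below by `μ (1 - ζ₀) τ` as long as `𝓓²` is below
a threshold: what is lost outside the region of strong secant growth is estimated by comparing
Gaussian quadratic forms, in the convex order, with one squared normal variable
(`integral_tail_le`). The step size makes the sum negative, and `τ ≥ λ_min 𝓓²`. Since `𝓓²` decreases
below the threshold, it never reaches it (`exp_decay_of_deriv_le`).

Existence. The bound on `𝓓²` and the conserved block bound all traces, hence all velocities, so the
solution has a limit at a finite `Θ`. An Euler step is a congruence plus a positive semidefinite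
matrix up to second order (`posSemidef_step`), so the field is tangent to the cone, and the solution
could be continued inside it if the limit of `𝓑` were in `U`.

Comparison. After a rotation `K` is diagonal. Let `κ` bound the eigenvalues and let level `j` be `∑ᵢ
(λᵢ/κ)^j wᵢ wᵢᵀ`, where `wᵢ` are the rows of `(X, X⋆)`. Level `0` determines `‖X - X⋆‖²`, level `1`
is `B(W)/κ`, and the drift of level `j` depends only on levels `1` and `j + 1`. No finite set of
levels is closed, but if errors are measured in units of `2^j` the shift to `j + 1` costs only a
factor `2`, and a discrete Gronwall argument runs for all levels together (`norm_le_of_hierarchy`).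

Noise. The SGD increments are a mean, equal to the drift up to a relative error of order `d^(-1/2)`,
plus a martingale difference. Moments of every order give the accumulated noise polynomial tails of
every degree (`StepSetting.prob_noiseSum_le`). The thresholds `2^j δ` make the union bound over all
levels summable, and a failure probability below every power of `1/d` is overwhelming. -/

namespace SGDEquiv

/-! ### Gaussian vectors: linear images and the convex order. -/

section Gaussian

variable {ι κ : Type*} [Fintype ι] [Fintype κ] [DecidableEq ι]

/-- The linear map of Euclidean spaces with matrix `A`. -/
noncomputable def lin (A : Matrix κ ι ℝ) : EuclideanSpace ℝ ι →L[ℝ] EuclideanSpace ℝ κ :=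
  (Matrix.toLpLin 2 2 A).toContinuousLinearMap

lemma lin_apply (A : Matrix κ ι ℝ) (a : EuclideanSpace ℝ ι) (k : κ) :
    lin A a k = ∑ i, A k i * a i := rfl

lemma lin_eq (A : Matrix κ ι ℝ) (a : EuclideanSpace ℝ ι) :
    lin A a = WithLp.toLp 2 (A *ᵥ a.ofLp) := rfl

lemma lin_lin [DecidableEq κ] {ν : Type*} [Fintype ν] (A : Matrix ν κ ℝ) (A' : Matrix κ ι ℝ)
    (a : EuclideanSpace ℝ ι) : lin A (lin A' a) = lin (A * A') a := by
  simp [lin_eq, Matrix.mulVec_mulVec]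

lemma lin_adjoint [DecidableEq κ] (A : Matrix κ ι ℝ) : (lin A).adjoint = lin Aᵀ := by
  refine ((ContinuousLinearMap.eq_adjoint_iff _ _).2 fun x y => ?_).symm
  simp only [PiLp.inner_apply, lin_apply, RCLike.inner_apply, conj_trivial, Matrix.transpose_apply,
    Finset.mul_sum, Finset.sum_mul]
  rw [Finset.sum_comm]
  exact Finset.sum_congr rfl fun i _ => Finset.sum_congr rfl fun j _ => by ring

/-- Both sides are Gaussian measures, hence determined by mean and covariance form. No invertibility
is needed, so degenerate covariances such as `Wᵀ S W` are covered. -/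
lemma map_lin_multivariateGaussian [DecidableEq κ] {S : Matrix ι ι ℝ} (hS : S.PosSemidef)
    (A : Matrix κ ι ℝ) :
    (multivariateGaussian 0 S).map (lin A) = multivariateGaussian 0 (A * S * Aᵀ) := by
  have hS' : (A * S * Aᵀ).PosSemidef := by
    simpa [Matrix.conjTranspose_eq_transpose_of_trivial] using hS.mul_mul_conjTranspose_same A
  apply IsGaussian.ext
  · simp only [id_eq, integral_id_multivariateGaussian]
    rw [ContinuousLinearMap.integral_id_map, integral_id_multivariateGaussian, map_zero]
    exact IsGaussian.integrable_id
  · ext x y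
    rw [covarianceBilin_map IsGaussian.memLp_two_id, covarianceBilin_multivariateGaussian hS,
      covarianceBilin_multivariateGaussian hS', lin_adjoint, lin_eq, lin_eq]
    simp only [← Matrix.mulVec_mulVec]
    rw [Matrix.dotProduct_mulVec x.ofLp A, ← Matrix.mulVec_transpose]

lemma map_inner_multivariateGaussian {S : Matrix ι ι ℝ} (hS : S.PosSemidef)
    (v : EuclideanSpace ℝ ι) :
    (multivariateGaussian 0 S).map (fun a => inner ℝ v a)
      = gaussianReal 0 (v.ofLp ⬝ᵥ S *ᵥ v.ofLp).toNNReal := by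
  have h := IsGaussian.map_eq_gaussianReal (μ := multivariateGaussian 0 S) (innerSL ℝ v)
  have e : ⇑(innerSL ℝ v) = fun a : EuclideanSpace ℝ ι => inner ℝ v a := by ext; simp
  rw [e] at h
  have hm : ∫ x, inner ℝ v x ∂(multivariateGaussian 0 S) = 0 := by
    have := IsGaussian.integral_dual (μ := multivariateGaussian (0 : EuclideanSpace ℝ ι) S)
      (innerSL ℝ v)
    simpa using this
  have hv : Var[fun a => inner ℝ v a; multivariateGaussian 0 S] = v.ofLp ⬝ᵥ S *ᵥ v.ofLp := by
    rw [← covarianceBilin_multivariateGaussian (μ := 0) hS, covarianceBilin_apply_eq_cov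
      IsGaussian.memLp_two_id, covariance_self]
    exact Measurable.aemeasurable (by fun_prop)
  rw [h, hm, hv]

/-- A centred Gaussian of variance zero is a Dirac mass. This handles the degenerate directions
wherever a variance occurs as a divisor. -/
lemma ae_inner_eq_zero {S : Matrix ι ι ℝ} (hS : S.PosSemidef) {v : EuclideanSpace ℝ ι}
    (h : v.ofLp ⬝ᵥ S *ᵥ v.ofLp = 0) : ∀ᵐ a ∂(multivariateGaussian 0 S), inner ℝ v a = 0 := by
  have h2 : ∀ᵐ x ∂((multivariateGaussian 0 S).map (fun a => inner ℝ v a)), x = (0 : ℝ) := by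
    rw [map_inner_multivariateGaussian hS, h, Real.toNNReal_zero, gaussianReal_zero_var]
    exact (ae_dirac_iff (measurableSet_singleton 0)).2 rfl
  exact ae_of_ae_map (by fun_prop) h2

/-- A positive combination of squares of centred jointly Gaussian variables is dominated, in the
convex order, by a multiple of one squared standard Gaussian variable. -/
lemma lintegral_convex_sum_sq_le {S : Matrix ι ι ℝ} (hS : S.PosSemidef)
    (v : κ → EuclideanSpace ℝ ι) {τ : ℝ} (hτ : ∑ j, (v j).ofLp ⬝ᵥ S *ᵥ (v j).ofLp ≤ τ)
    {ψ : ℝ → ℝ} (hψ : ConvexOn ℝ (Ici 0) ψ) (hmono : MonotoneOn ψ (Ici 0)) (hψ0 : 0 ≤ ψ 0)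
    (hm : Measurable ψ) :
    ∫⁻ a, ENNReal.ofReal (ψ (∑ j, (inner ℝ (v j) a) ^ 2)) ∂(multivariateGaussian 0 S)
      ≤ ∫⁻ x, ENNReal.ofReal (ψ (τ * x ^ 2)) ∂(gaussianReal 0 1) := by
  set σ : κ → ℝ := fun j => (v j).ofLp ⬝ᵥ S *ᵥ (v j).ofLp with hσ
  have hσ0 : ∀ j, 0 ≤ σ j := fun j => by simpa using hS.dotProduct_mulVec_nonneg (v j).ofLp
  have hlaw : ∀ j, (multivariateGaussian 0 S).map (fun a => inner ℝ (v j) a)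
      = (gaussianReal 0 1).map (fun x => √(σ j) * x) := fun j => by
    rw [map_inner_multivariateGaussian hS, gaussianReal_map_const_mul]
    congr 1
    · simp
    · ext; simp [Real.sq_sqrt (hσ0 j), hσ0 j, σ]
  set s := ∑ j, σ j with hs
  have hs0 : 0 ≤ s := Finset.sum_nonneg fun j _ => hσ0 j
  rcases hs0.eq_or_lt with h0 | hpos
  -- If the total variance is zero the weights `σ j / s` below make no sense, but then all the forms
  -- vanish almost surely.
  · have hz : ∀ j, ∀ᵐ a ∂(multivariateGaussian 0 S), inner ℝ (v j) a = 0 := fun j =>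
      ae_inner_eq_zero hS ((Finset.sum_eq_zero_iff_of_nonneg fun j _ => hσ0 j).1
        (hs ▸ h0.symm) j (Finset.mem_univ j))
    calc _ = ∫⁻ _, ENNReal.ofReal (ψ 0) ∂(multivariateGaussian 0 S) := by
          apply lintegral_congr_ae
          filter_upwards [ae_all_iff.2 hz] with a ha
          simp [ha]
      _ = ∫⁻ _, ENNReal.ofReal (ψ 0) ∂(gaussianReal 0 1) := by simp
      _ ≤ _ := by
          refine lintegral_mono fun x => ENNReal.ofReal_le_ofReal (hmono (by simp) ?_ ?_)
          · exact mul_nonneg (hs0.trans hτ) (sq_nonneg x)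
          · exact mul_nonneg (hs0.trans hτ) (sq_nonneg x)
  -- Jensen's inequality for the weights `σ j / s`: the sum of squares is their convex combination
  -- of the variables `(s / σ j) ⟨v j, a⟩²`, each of which has the law of `s x²`. The dependence
  -- between the forms plays no role. Indices with `σ j = 0` have weight `0` and a form that
  -- vanishes almost surely.
  · have key : ∀ᵐ a ∂(multivariateGaussian 0 S), ENNReal.ofReal (ψ (∑ j, (inner ℝ (v j) a) ^ 2))
        ≤ ∑ j, ENNReal.ofReal (σ j / s) * ENNReal.ofReal (ψ (s / σ j * (inner ℝ (v j) a) ^ 2)) := by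
      have hz : ∀ᵐ a ∂(multivariateGaussian 0 S), ∀ j, σ j = 0 → inner ℝ (v j) a = 0 := by
        refine ae_all_iff.2 fun j => ?_
        by_cases h : σ j = 0
        · filter_upwards [ae_inner_eq_zero hS h] with a ha _ using ha
        · simp [h]
      filter_upwards [hz] with a ha
      have e : ∑ j, (inner ℝ (v j) a) ^ 2
          = ∑ j, (σ j / s) • (s / σ j * (inner ℝ (v j) a) ^ 2) := by
        refine Finset.sum_congr rfl fun j _ => ?_
        by_cases h : σ j = 0
        · simp [h, ha j h]
        · simp only [smul_eq_mul]; field_simp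
      have hnn : ∀ j, 0 ≤ ψ (s / σ j * (inner ℝ (v j) a) ^ 2) := fun j =>
        hψ0.trans (hmono (by simp) (mem_Ici.2 (by have := hσ0 j; positivity))
          (by have := hσ0 j; positivity))
      simp_rw [← ENNReal.ofReal_mul (div_nonneg (hσ0 _) hs0)]
      rw [← ENNReal.ofReal_sum_of_nonneg (fun j _ => mul_nonneg (div_nonneg (hσ0 j) hs0) (hnn j)), e]
      refine ENNReal.ofReal_le_ofReal (hψ.map_sum_le (fun j _ => div_nonneg (hσ0 j) hs0) ?_ ?_)
      · rw [← Finset.sum_div, ← hs, div_self hpos.ne']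
      · intro j _; have := hσ0 j; exact mem_Ici.2 (by positivity)
    refine (lintegral_mono_ae key).trans ?_
    rw [lintegral_finsetSum]
    swap
    · fun_prop
    have each : ∀ j, ∫⁻ a, ENNReal.ofReal (σ j / s)
          * ENNReal.ofReal (ψ (s / σ j * (inner ℝ (v j) a) ^ 2)) ∂(multivariateGaussian 0 S)
        ≤ ENNReal.ofReal (σ j / s)
          * ∫⁻ x, ENNReal.ofReal (ψ (τ * x ^ 2)) ∂(gaussianReal 0 1) := fun j => by
      rw [lintegral_const_mul _ (by fun_prop)]
      by_cases h : σ j = 0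
      · simp [h]
      refine mul_le_mul_right ?_ _
      have : ∫⁻ a, ENNReal.ofReal (ψ (s / σ j * (inner ℝ (v j) a) ^ 2)) ∂(multivariateGaussian 0 S)
          = ∫⁻ y, ENNReal.ofReal (ψ (s / σ j * y ^ 2))
            ∂((multivariateGaussian 0 S).map (fun a => inner ℝ (v j) a)) := by
        rw [lintegral_map (by fun_prop) (by fun_prop)]
      rw [this, hlaw j, lintegral_map (by fun_prop) (by fun_prop)]
      refine lintegral_mono fun x => ENNReal.ofReal_le_ofReal ?_
      have hj : 0 < σ j := lt_of_le_of_ne (hσ0 j) (Ne.symm h)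
      rw [mul_pow, Real.sq_sqrt (hσ0 j), ← mul_assoc, div_mul_cancel₀ _ h]
      exact hmono (mem_Ici.2 (by positivity))
        (mem_Ici.2 (mul_nonneg (hs0.trans hτ) (sq_nonneg x))) (by gcongr)
    refine (Finset.sum_le_sum fun j _ => each j).trans ?_
    rw [← Finset.sum_mul, ← ENNReal.ofReal_sum_of_nonneg fun j _ => div_nonneg (hσ0 j) hs0,
      ← Finset.sum_div, ← hs, div_self hpos.ne']
    simp

end Gaussian

/-! ### Random variables with moments of all orders. -/

section Moments

variable {Ω Ω' : Type*} [MeasurableSpace Ω] [MeasurableSpace Ω'] {P : Measure Ω} {P' : Measure Ω'}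

/-- A random variable all of whose moments are finite. -/
def AllMoments (X : Ω → ℝ) (P : Measure Ω) : Prop := ∀ p : ℕ, MemLp X p P

namespace AllMoments

variable {X Y : Ω → ℝ}

lemma const [IsFiniteMeasure P] (c : ℝ) : AllMoments (fun _ : Ω => c) P := fun _ => memLp_const c

lemma add (hX : AllMoments X P) (hY : AllMoments Y P) : AllMoments (fun ω => X ω + Y ω) P :=
  fun p => (hX p).add (hY p)

lemma sub (hX : AllMoments X P) (hY : AllMoments Y P) : AllMoments (fun ω => X ω - Y ω) P :=
  fun p => (hX p).sub (hY p)

lemma const_mul (hX : AllMoments X P) (c : ℝ) : AllMoments (fun ω => c * X ω) P :=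
  fun p => (hX p).const_mul c

lemma sum {κ : Type*} (s : Finset κ) {X : κ → Ω → ℝ} (hX : ∀ i ∈ s, AllMoments (X i) P) :
    AllMoments (fun ω => ∑ i ∈ s, X i ω) P := fun p => memLp_finsetSum s fun i hi => hX i hi p

/-- Hölder's inequality with exponents `2p, 2p, p`; having all moments, unlike having a fixed one,
is stable under products. -/
lemma mul (hX : AllMoments X P) (hY : AllMoments Y P) : AllMoments (fun ω => X ω * Y ω) P := by
  intro p
  have : ENNReal.HolderTriple ((2 * p : ℕ) : ENNReal) ((2 * p : ℕ) : ENNReal) (p : ENNReal) := by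
    constructor
    rcases Nat.eq_zero_or_pos p with rfl | hp
    · simp
    · push_cast
      rw [ENNReal.mul_inv (by simp) (by simp), ← add_mul, ENNReal.inv_two_add_inv_two, one_mul]
  exact MemLp.mul (hY (2 * p)) (hX (2 * p))

lemma pow [IsFiniteMeasure P] (hX : AllMoments X P) (n : ℕ) : AllMoments (fun ω => X ω ^ n) P := by
  induction n with
  | zero => simpa using const 1
  | succ n ih => simpa only [pow_succ] using ih.mul hX

lemma mono (hX : AllMoments X P) (hm : AEStronglyMeasurable Y P) (h : ∀ᵐ ω ∂P, |Y ω| ≤ X ω) :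
    AllMoments Y P := fun p => (hX p).mono' hm (by simpa using h)

lemma abs (hX : AllMoments X P) : AllMoments (fun ω => |X ω|) P := fun p => (hX p).abs

lemma integrable (hX : AllMoments X P) : Integrable X P :=
  memLp_one_iff_integrable.1 (by simpa using hX 1)

lemma comp {X : Ω' → ℝ} (hX : AllMoments X P') {φ : Ω → Ω'} (h : MeasurePreserving φ P P') :
    AllMoments (fun ω => X (φ ω)) P := fun p => (hX p).comp_measurePreserving h

/-- A real power is dominated by `1 + X ^ n` for any integer `n ≥ α`. -/
lemma rpow [IsFiniteMeasure P] (hX : AllMoments X P) (h0 : ∀ ω, 0 ≤ X ω) {α : ℝ} (hα : 0 ≤ α) :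
    AllMoments (fun ω => X ω ^ α) P := by
  obtain ⟨n, hn⟩ := exists_nat_ge α
  refine ((const (P := P) 1).add (hX.pow n)).mono ?_ (ae_of_all _ fun ω => ?_)
  · exact (((hX 0).1.aemeasurable).pow_const α).aestronglyMeasurable
  · rw [abs_of_nonneg (Real.rpow_nonneg (h0 ω) _)]
    rcases le_total (X ω) 1 with h | h
    · have := Real.rpow_le_one (h0 ω) h hα
      have := pow_nonneg (h0 ω) n
      linarith
    · have := Real.rpow_le_rpow_of_exponent_le h hn
      rw [Real.rpow_natCast] at this
      linarith

end AllMoments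

end Moments

/-! ### Moments and exponential tails of Gaussian quadratic forms. -/

section Gaussian

variable {ι κ : Type*} [Fintype ι] [Fintype κ] [DecidableEq ι]

lemma allMoments_norm_of_isGaussian {E : Type*} [NormedAddCommGroup E] [InnerProductSpace ℝ E]
    [FiniteDimensional ℝ E] [MeasurableSpace E] [BorelSpace E] (μ : Measure E) [IsGaussian μ] :
    AllMoments (fun x : E => ‖x‖) μ :=
  fun p => (IsGaussian.memLp_id μ p (by simp)).norm

lemma allMoments_inner {S : Matrix ι ι ℝ} (v : EuclideanSpace ℝ ι) :
    AllMoments (fun a => inner ℝ v a) (multivariateGaussian 0 S) :=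
  ((allMoments_norm_of_isGaussian _).const_mul ‖v‖).mono
    (Measurable.aestronglyMeasurable (by fun_prop))
    (ae_of_all _ fun a => abs_real_inner_le_norm v a)

lemma allMoments_gaussianReal : AllMoments (fun x : ℝ => x) (gaussianReal 0 1) :=
  fun p => memLp_id_gaussianReal' p (by simp)

/-- The moment of order `2 r` of the standard normal distribution. -/
noncomputable def gaussMoment (r : ℕ) : ℝ := ∫ x, (x ^ 2) ^ r ∂(gaussianReal 0 1)

lemma gaussMoment_nonneg (r : ℕ) : 0 ≤ gaussMoment r := integral_nonneg fun x => by positivity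

lemma integral_inner_pow {S : Matrix ι ι ℝ} (hS : S.PosSemidef) (v : EuclideanSpace ℝ ι) (r : ℕ) :
    ∫ a, (inner ℝ v a ^ 2) ^ r ∂(multivariateGaussian 0 S)
      = (v.ofLp ⬝ᵥ S *ᵥ v.ofLp) ^ r * gaussMoment r := by
  have h0 : 0 ≤ v.ofLp ⬝ᵥ S *ᵥ v.ofLp := by simpa using hS.dotProduct_mulVec_nonneg v.ofLp
  have hlaw : (multivariateGaussian 0 S).map (fun a => inner ℝ v a)
      = (gaussianReal 0 1).map (fun x => √(v.ofLp ⬝ᵥ S *ᵥ v.ofLp) * x) := by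
    rw [map_inner_multivariateGaussian hS, gaussianReal_map_const_mul]
    congr 1
    · simp
    · ext; simp [Real.sq_sqrt h0, h0]
  calc _ = ∫ y, (y ^ 2) ^ r ∂((multivariateGaussian 0 S).map (fun a => inner ℝ v a)) := by
        rw [integral_map (by fun_prop) (by fun_prop)]
    _ = _ := by
        rw [hlaw, integral_map (by fun_prop) (by fun_prop), gaussMoment, ← integral_const_mul]
        simp_rw [mul_pow, Real.sq_sqrt h0]

/-- The convex order with `x ↦ x ^ r`. The bound depends on the total variance only, not on the
number of forms; this keeps the later moment estimates uniform in `d`. -/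
lemma integral_sum_sq_pow_le {S : Matrix ι ι ℝ} (hS : S.PosSemidef)
    (v : κ → EuclideanSpace ℝ ι) {τ : ℝ} (hτ : ∑ j, (v j).ofLp ⬝ᵥ S *ᵥ (v j).ofLp ≤ τ) (r : ℕ) :
    ∫ a, (∑ j, (inner ℝ (v j) a) ^ 2) ^ r ∂(multivariateGaussian 0 S) ≤ τ ^ r * gaussMoment r := by
  have hτ0 : 0 ≤ τ := le_trans (Finset.sum_nonneg fun j _ => by
    simpa using hS.dotProduct_mulVec_nonneg (v j).ofLp) hτ
  rw [integral_eq_lintegral_of_nonneg_ae (ae_of_all _ fun a => by positivity)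
    (Measurable.aestronglyMeasurable (by fun_prop))]
  refine ENNReal.toReal_le_of_le_ofReal (mul_nonneg (pow_nonneg hτ0 _) (gaussMoment_nonneg r)) ?_
  refine (lintegral_convex_sum_sq_le hS v hτ (ψ := fun x => x ^ r) (convexOn_pow r)
    (fun x hx y _ h => pow_le_pow_left₀ hx h r) (by positivity) (by fun_prop)).trans ?_
  rw [gaussMoment, ← integral_const_mul, ← ofReal_integral_eq_lintegral_ofReal]
  · simp_rw [mul_pow]; exact le_rfl
  · simp_rw [mul_pow]
    exact (((allMoments_gaussianReal.pow 2).pow r).const_mul _).integrable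
  · exact ae_of_all _ fun x => by positivity

lemma gaussMoment_one : gaussMoment 1 = 1 := by
  have h := variance_fun_id_gaussianReal (μ := 0) (v := 1)
  rw [variance_eq_integral (by fun_prop)] at h
  simpa [gaussMoment] using h

/-- The fourth moment of the normal law, from `Γ(5/2) = (3/4) √π`. -/
lemma gaussMoment_two : gaussMoment 2 = 3 := by
  have h0 : ∫ x in Ioi (0 : ℝ), x ^ (4 : ℝ) * Real.exp (-(1 / 2) * x ^ (2 : ℝ))
      = (1 / 2 : ℝ) ^ (-(4 + 1 : ℝ) / 2) * (1 / 2) * Real.Gamma ((4 + 1) / 2) :=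
    integral_rpow_mul_exp_neg_mul_rpow (by norm_num) (by norm_num) (by norm_num)
  have h1 : Real.Gamma ((4 + 1) / 2) = 3 / 4 * √Real.pi := by
    rw [show ((4 + 1) / 2 : ℝ) = 1 / 2 + 1 + 1 by norm_num, Real.Gamma_add_one (by norm_num),
      Real.Gamma_add_one (by norm_num), Real.Gamma_one_half_eq]
    ring
  have h2 : (1 / 2 : ℝ) ^ (-(4 + 1 : ℝ) / 2) = 4 * √2 := by
    rw [one_div, Real.inv_rpow (by norm_num), ← Real.rpow_neg (by norm_num),
      show (-(-(4 + 1 : ℝ) / 2)) = 2 + 1 / 2 by norm_num, Real.rpow_add (by norm_num),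
      ← Real.sqrt_eq_rpow]
    norm_num
  have h3 : gaussMoment 2 = (√(2 * Real.pi))⁻¹
      * (2 * ∫ x in Ioi (0 : ℝ), x ^ (4 : ℝ) * Real.exp (-(1 / 2) * x ^ (2 : ℝ))) := by
    rw [gaussMoment, integral_gaussianReal_eq_integral_smul (by simp),
      ← integral_comp_abs (f := fun x => x ^ (4 : ℝ) * Real.exp (-(1 / 2) * x ^ (2 : ℝ))),
      ← integral_const_mul]
    refine integral_congr_ae (ae_of_all _ fun x => ?_)
    simp only [gaussianPDFReal, smul_eq_mul]
    rw [show (4 : ℝ) = ((4 : ℕ) : ℝ) by norm_num, show (2 : ℝ) = ((2 : ℕ) : ℝ) by norm_num,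
      Real.rpow_natCast, Real.rpow_natCast, sq_abs, show |x| ^ 4 = (|x| ^ 2) ^ 2 by ring, sq_abs]
    simp only [NNReal.coe_one, sub_zero, mul_one]
    push_cast
    rw [show -x ^ 2 / 2 = -(1 / 2) * x ^ 2 by ring]
    ring
  rw [h3, h0, h1, h2, Real.sqrt_mul (by norm_num)]
  have := Real.sqrt_pos.2 Real.pi_pos
  field_simp


/-- Isserlis' formula for a diagonal covariance matrix. -/
lemma integral_sq_mul_sq_diagonal {lam : ι → ℝ} (hl : ∀ i, 0 ≤ lam i) (i j : ι) :
    ∫ a, a i ^ 2 * a j ^ 2 ∂(multivariateGaussian 0 (Matrix.diagonal lam))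
      = lam i * lam j + if i = j then 2 * lam i ^ 2 else 0 := by
  have hS : (Matrix.diagonal lam).PosSemidef := Matrix.PosSemidef.diagonal hl
  set e := fun i : ι => (EuclideanSpace.single i (1 : ℝ) : EuclideanSpace ℝ ι) with he
  have hq : ∀ v : EuclideanSpace ℝ ι, ∫ a, (inner ℝ v a) ^ 4
      ∂(multivariateGaussian 0 (Matrix.diagonal lam)) = 3 * (∑ i, lam i * v i ^ 2) ^ 2 := by
    intro v
    have := integral_inner_pow hS v 2
    rw [gaussMoment_two] at this
    simp_rw [← pow_mul] at this
    rw [show (4 : ℕ) = 2 * 2 by norm_num, this, mul_comm]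
    congr 2
    simp only [dotProduct, Matrix.mulVec_diagonal]
    exact Finset.sum_congr rfl fun i _ => by ring
  have hi : ∀ i (a : EuclideanSpace ℝ ι), inner ℝ (e i) a = a i := fun i a => by
    simp [he, EuclideanSpace.inner_single_left]
  have hA : ∀ v : EuclideanSpace ℝ ι, AllMoments (fun a => (inner ℝ v a) ^ 4)
      (multivariateGaussian 0 (Matrix.diagonal lam)) := fun v => (allMoments_inner v).pow 4
  have hI : ∀ v : EuclideanSpace ℝ ι, Integrable (fun a => (inner ℝ v a) ^ 4)
      (multivariateGaussian 0 (Matrix.diagonal lam)) := fun v => (hA v).integrable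
  -- Polarization of `a i ^ 2 * a j ^ 2` into fourth powers of linear forms, whose means are three
  -- times the squared variance.
  have key : ∀ a : EuclideanSpace ℝ ι, a i ^ 2 * a j ^ 2 = 1 / 12 * (inner ℝ (e i + e j) a ^ 4
      + inner ℝ (e i - e j) a ^ 4 - 2 * (inner ℝ (e i) a ^ 4 + inner ℝ (e j) a ^ 4)) := fun a => by
    rw [inner_add_left, inner_sub_left, hi, hi]; ring
  simp_rw [key]
  rw [integral_const_mul, integral_sub ((hA _).add (hA _)).integrable
    (((hA _).add (hA _)).const_mul _).integrable,
    integral_add (hI _) (hI _), integral_const_mul, integral_add (hI _) (hI _), hq, hq, hq, hq]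
  have hs : ∀ k, ∑ x, lam x * (e k) x ^ 2 = lam k := fun k => by
    simp [he]
  rw [hs, hs]
  by_cases hij : i = j
  · subst hij
    have : ∑ x, lam x * (e i + e i) x ^ 2 = 4 * lam i := by
      rw [← hs i, Finset.mul_sum]
      exact Finset.sum_congr rfl fun x _ => by simp only [PiLp.add_apply]; ring
    rw [this]
    simp; ring
  · have hz : ∀ x, (e i) x * (e j) x = 0 := fun x => by
      simp only [he, PiLp.single_apply]
      split_ifs with h1 h2 <;> simp_all
    have hp : ∑ x, lam x * (e i + e j) x ^ 2 = lam i + lam j := by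
      rw [← hs i, ← hs j, ← Finset.sum_add_distrib]
      exact Finset.sum_congr rfl fun x _ => by
        simp only [PiLp.add_apply]; linear_combination 2 * lam x * hz x
    have hm : ∑ x, lam x * (e i - e j) x ^ 2 = lam i + lam j := by
      rw [← hs i, ← hs j, ← Finset.sum_add_distrib]
      exact Finset.sum_congr rfl fun x _ => by
        simp only [PiLp.sub_apply]; linear_combination -2 * lam x * hz x
    rw [hp, hm]
    simp [hij]; ring

lemma allMoments_coord {S : Matrix ι ι ℝ} (i : ι) :
    AllMoments (fun a : EuclideanSpace ℝ ι => a i) (multivariateGaussian 0 S) := by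
  have := allMoments_inner (S := S) (EuclideanSpace.single i (1 : ℝ))
  simpa [EuclideanSpace.inner_single_left] using this

lemma integral_sq_diagonal {lam : ι → ℝ} (hl : ∀ i, 0 ≤ lam i) (i : ι) :
    ∫ a, a i ^ 2 ∂(multivariateGaussian 0 (Matrix.diagonal lam)) = lam i := by
  have := integral_inner_pow (Matrix.PosSemidef.diagonal hl) (EuclideanSpace.single i (1 : ℝ)) 1
  simpa [EuclideanSpace.inner_single_left, gaussMoment_one, Matrix.mulVec_diagonal, dotProduct,
    Pi.single_apply] using this

/-- The variance of a diagonal quadratic form: the covariances between different coordinates vanish.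
In dimension `d` it is of order `d`, so `∑ᵢ βᵢ aᵢ²` may be replaced by its mean in the drift at a
cost of order `√d`. -/
lemma integral_quadForm_sub_sq {lam : ι → ℝ} (hl : ∀ i, 0 ≤ lam i) (α : ι → ℝ) :
    ∫ a, (∑ i, α i * a i ^ 2 - ∑ i, α i * lam i) ^ 2
      ∂(multivariateGaussian 0 (Matrix.diagonal lam)) = 2 * ∑ i, α i ^ 2 * lam i ^ 2 := by
  have h2 : ∀ i, AllMoments (fun a : EuclideanSpace ℝ ι => a i ^ 2)
      (multivariateGaussian 0 (Matrix.diagonal lam)) := fun i => (allMoments_coord i).pow 2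
  have h4 : ∀ i j, AllMoments (fun a : EuclideanSpace ℝ ι => a i ^ 2 * a j ^ 2)
      (multivariateGaussian 0 (Matrix.diagonal lam)) := fun i j => (h2 i).mul (h2 j)
  have key : ∀ a : EuclideanSpace ℝ ι, (∑ i, α i * a i ^ 2 - ∑ i, α i * lam i) ^ 2
      = ∑ i, ∑ j, α i * α j * (a i ^ 2 * a j ^ 2 - lam j * a i ^ 2 - lam i * a j ^ 2
        + lam i * lam j) := fun a => by
    rw [← Finset.sum_sub_distrib, sq, Finset.sum_mul_sum]
    exact Finset.sum_congr rfl fun i _ => Finset.sum_congr rfl fun j _ => by ring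
  have hval : ∀ i j, ∫ a : EuclideanSpace ℝ ι, α i * α j * (a i ^ 2 * a j ^ 2
      - lam j * a i ^ 2 - lam i * a j ^ 2 + lam i * lam j)
      ∂(multivariateGaussian 0 (Matrix.diagonal lam))
      = if i = j then 2 * (α i ^ 2 * lam i ^ 2) else 0 := fun i j => by
    rw [integral_const_mul, integral_add (((h4 i j).sub ((h2 i).const_mul _)).sub
      ((h2 j).const_mul _)).integrable (integrable_const _),
      integral_sub ((h4 i j).sub ((h2 i).const_mul _)).integrable ((h2 j).const_mul _).integrable,
      integral_sub (h4 i j).integrable ((h2 i).const_mul _).integrable, integral_const_mul,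
      integral_const_mul, integral_sq_mul_sq_diagonal hl, integral_sq_diagonal hl,
      integral_sq_diagonal hl]
    split_ifs with h
    · subst h; simp; ring
    · simp only [add_zero, integral_const, probReal_univ, one_smul]; ring
  have hterm : ∀ i j, Integrable (fun a : EuclideanSpace ℝ ι => α i * α j * (a i ^ 2 * a j ^ 2
      - lam j * a i ^ 2 - lam i * a j ^ 2 + lam i * lam j))
      (multivariateGaussian 0 (Matrix.diagonal lam)) := fun i j =>
    (((((h4 i j).sub ((h2 i).const_mul _)).sub ((h2 j).const_mul _)).add
      (AllMoments.const _)).const_mul _).integrable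
  simp_rw [key]
  rw [integral_finsetSum _ fun i _ => integrable_finsetSum _ fun j _ => hterm i j, Finset.mul_sum]
  refine Finset.sum_congr rfl fun i _ => ?_
  rw [integral_finsetSum _ fun j _ => hterm i j]
  simp [hval]

/-- The exponential moment behind the tail bound. -/
lemma lintegral_sq_mul_exp_le :
    ∫⁻ x, ENNReal.ofReal (x ^ 2 * Real.exp (x ^ 2 / 8)) ∂(gaussianReal 0 1)
      ≤ ENNReal.ofReal (10 / 3) := by
  -- The exponent `3/8 = 1/8 + 1/4` leaves `exp (x²/4)` to absorb the factor `x²`, and is below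
  -- `1/2`; the value is `(1 - 3/4)^(-1/2)`.
  have hint : ∫ x, Real.exp (3 / 8 * x ^ 2) ∂(gaussianReal 0 1) = 2 := by
    rw [integral_gaussianReal_eq_integral_smul (by simp)]
    have : ∀ x : ℝ, gaussianPDFReal 0 1 x • Real.exp (3 / 8 * x ^ 2)
        = (√(2 * Real.pi))⁻¹ * Real.exp (-(1 / 8) * x ^ 2) := fun x => by
      simp only [gaussianPDFReal, smul_eq_mul, NNReal.coe_one, sub_zero, mul_one]
      rw [mul_assoc, ← Real.exp_add]
      congr 2; ring
    simp_rw [this]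
    rw [integral_const_mul, integral_gaussian, show Real.pi / (1 / 8) = 2 ^ 2 * (2 * Real.pi) by ring,
      Real.sqrt_mul (x := 2 ^ 2) (by norm_num), Real.sqrt_sq (by norm_num)]
    have : √(2 * Real.pi) ≠ 0 := (Real.sqrt_pos.2 (by positivity)).ne'
    field_simp
  have hI : Integrable (fun x => Real.exp (3 / 8 * x ^ 2)) (gaussianReal 0 1) := by
    by_contra h
    rw [integral_undef h] at hint
    norm_num at hint
  -- From `u ≤ exp (u - 1)` with `u = x²/4`: the constant is `4/e`, and the final value `8/e` is
  -- below `10/3`.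
  calc _ ≤ ∫⁻ x, ENNReal.ofReal (8 / (3 * Real.exp 1) * (3 / 2) * Real.exp (3 / 8 * x ^ 2))
        ∂(gaussianReal 0 1) := by
        refine lintegral_mono fun x => ENNReal.ofReal_le_ofReal ?_
        have h1 := Real.add_one_le_exp (x ^ 2 / 4 - 1)
        rw [sub_add_cancel, Real.exp_sub] at h1
        have h2 : Real.exp (3 / 8 * x ^ 2) = Real.exp (x ^ 2 / 4) * Real.exp (x ^ 2 / 8) := by
          rw [← Real.exp_add]; congr 1; ring
        rw [h2, ← mul_assoc]
        refine mul_le_mul_of_nonneg_right ?_ (Real.exp_pos _).le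
        have : 8 / (3 * Real.exp 1) * (3 / 2) * Real.exp (x ^ 2 / 4)
          = 4 * (Real.exp (x ^ 2 / 4) / Real.exp 1) := by field_simp; norm_num
        linarith
    _ = ENNReal.ofReal (8 / (3 * Real.exp 1) * (3 / 2) * 2) := by
        rw [← ofReal_integral_eq_lintegral_ofReal (hI.const_mul _)
          (ae_of_all _ fun x => by positivity), integral_const_mul, hint]
    _ ≤ _ := by
        refine ENNReal.ofReal_le_ofReal ?_
        have := Real.exp_one_gt_d9
        rw [show 8 / (3 * Real.exp 1) * (3 / 2) * 2 = 8 / Real.exp 1 by field_simp,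
          div_le_div_iff₀ (by positivity) (by norm_num)]
        linarith

/-- The test function for the tail estimate: it is convex and increasing on the half-line, so the
convex order applies to it, and it carries both the weight `x` and an exponential. -/
lemma convexOn_mul_exp : ConvexOn ℝ (Ici 0) fun x : ℝ => x * Real.exp (x / 8) := by
  have hd : ∀ x : ℝ, HasDerivAt (fun x : ℝ => x * Real.exp (x / 8))
      (Real.exp (x / 8) * (1 + x / 8)) x := fun x => by
    have := (hasDerivAt_id x).mul ((hasDerivAt_id x).div_const 8).exp
    refine this.congr_deriv ?_
    simp; ring
  refine MonotoneOn.convexOn_of_deriv (convex_Ici 0)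
    (by fun_prop) (fun x _ => (hd x).differentiableAt.differentiableWithinAt) ?_
  rw [interior_Ici]
  intro x hx y _ h
  rw [(hd x).deriv, (hd y).deriv]
  have : 0 < x := hx
  gcongr

lemma lintegral_sum_sq_mul_exp_le {S : Matrix ι ι ℝ} (hS : S.PosSemidef)
    (v : κ → EuclideanSpace ℝ ι) {τ : ℝ} (hτ0 : 0 < τ)
    (hτ : ∑ j, (v j).ofLp ⬝ᵥ S *ᵥ (v j).ofLp ≤ τ) :
    ∫⁻ a, ENNReal.ofReal ((∑ j, (inner ℝ (v j) a) ^ 2) / τ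
      * Real.exp ((∑ j, (inner ℝ (v j) a) ^ 2) / τ / 8)) ∂(multivariateGaussian 0 S)
      ≤ ENNReal.ofReal (10 / 3) := by
  have hc : ConvexOn ℝ (Ici 0) fun x : ℝ => x / τ * Real.exp (x / τ / 8) := by
    have := convexOn_mul_exp.comp_linearMap (τ⁻¹ • LinearMap.id)
    have e : (⇑(τ⁻¹ • LinearMap.id : ℝ →ₗ[ℝ] ℝ)) ⁻¹' Ici 0 = Ici 0 := by
      ext x; simp [hτ0]
    rw [e] at this
    refine this.congr fun x _ => ?_
    simp [div_eq_inv_mul]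
  refine (lintegral_convex_sum_sq_le hS v hτ hc ?_ (by simp) (by fun_prop)).trans ?_
  · intro x hx y hy h
    have : (0 : ℝ) ≤ x := hx
    have : (0 : ℝ) ≤ y := hy
    dsimp only
    gcongr
  · simp_rw [mul_div_cancel_left₀ _ hτ0.ne']
    exact lintegral_sq_mul_exp_le

/-- The contribution of the event that one of two jointly Gaussian vectors is large. -/
lemma integral_tail_le {κ' : Type*} [Fintype κ'] {S : Matrix ι ι ℝ} (hS : S.PosSemidef)
    (v : κ → EuclideanSpace ℝ ι) (w : κ' → EuclideanSpace ℝ ι) {m θ : ℝ} (hm : 0 < m)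
    (hv : ∑ j, (v j).ofLp ⬝ᵥ S *ᵥ (v j).ofLp ≤ m) (hw : ∑ j, (w j).ofLp ⬝ᵥ S *ᵥ (w j).ofLp ≤ m) :
    ∫ a, (if max (∑ j, (inner ℝ (w j) a) ^ 2) (∑ j, (inner ℝ (v j) a) ^ 2) ≤ θ then 0
        else ∑ j, (inner ℝ (v j) a) ^ 2) ∂(multivariateGaussian 0 S)
      ≤ 10 * Real.exp (-(θ / (8 * m))) * ∑ j, (v j).ofLp ⬝ᵥ S *ᵥ (v j).ofLp := by
  set s := ∑ j, (v j).ofLp ⬝ᵥ S *ᵥ (v j).ofLp with hs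
  have hσ0 : ∀ j, 0 ≤ (v j).ofLp ⬝ᵥ S *ᵥ (v j).ofLp := fun j => by
    simpa using hS.dotProduct_mulVec_nonneg (v j).ofLp
  have hs0 : 0 ≤ s := Finset.sum_nonneg fun j _ => hσ0 j
  set X : EuclideanSpace ℝ ι → ℝ := fun a => ∑ j, (inner ℝ (v j) a) ^ 2 with hX
  set Y : EuclideanSpace ℝ ι → ℝ := fun a => ∑ j, (inner ℝ (w j) a) ^ 2 with hY
  have hX0 : ∀ a, 0 ≤ X a := fun a => by positivity
  have hY0 : ∀ a, 0 ≤ Y a := fun a => by positivity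
  rcases hs0.eq_or_lt with h0 | hpos
  · rw [← h0, mul_zero]
    refine le_of_eq (integral_eq_zero_of_ae ?_)
    have hz : ∀ j, ∀ᵐ a ∂(multivariateGaussian 0 S), inner ℝ (v j) a = 0 := fun j =>
      ae_inner_eq_zero hS ((Finset.sum_eq_zero_iff_of_nonneg fun j _ => hσ0 j).1
        (hs ▸ h0.symm) j (Finset.mem_univ j))
    filter_upwards [ae_all_iff.2 hz] with a ha
    simp [ha]
  have hXm : Measurable X := by fun_prop
  have hYm : Measurable Y := by fun_prop
  rw [integral_eq_lintegral_of_nonneg_ae]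
  rotate_left
  · refine ae_of_all _ fun a => ?_
    dsimp only [Pi.zero_apply]
    split_ifs
    · exact le_rfl
    · exact hX0 a
  · exact (Measurable.ite (measurableSet_le (hYm.max hXm) measurable_const) measurable_const
      hXm).aestronglyMeasurable
  refine ENNReal.toReal_le_of_le_ofReal (by positivity) ?_
  set E := Real.exp (-(θ / (8 * m))) with hE
  -- On the bad event `Y` or `X` exceeds `θ`, and then `E exp (Y/(8m)) ≥ 1` or `E exp (X/(8s)) ≥ 1`,
  -- the latter because `s ≤ m`. The mixed product is split by `u exp (v/8) ≤ u exp (u/8) + v exp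
  -- (v/8)`. The coefficients add up to `3`, which with the moment bound `10/3` gives the constant
  -- `10`.
  have hpt : ∀ a, (if max (Y a) (X a) ≤ θ then 0 else X a)
      ≤ E * s * (2 * (X a / s * Real.exp (X a / s / 8)) + Y a / m * Real.exp (Y a / m / 8)) := by
    intro a
    have hXs : 0 ≤ X a / s := div_nonneg (hX0 a) hs0
    have hYm' : 0 ≤ Y a / m := div_nonneg (hY0 a) hm.le
    have hXe : X a = s * (X a / s) := by field_simp
    split_ifs with h
    · positivity
    · have hcase : X a ≤ E * s * (X a / s * Real.exp (X a / s / 8))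
          ∨ X a ≤ E * s * (X a / s * Real.exp (Y a / m / 8)) := by
        rw [max_le_iff, not_and_or, not_le, not_le] at h
        rcases h with h | h
        · right
          have : 1 ≤ E * Real.exp (Y a / m / 8) := by
            rw [hE, ← Real.exp_add]
            refine Real.one_le_exp ?_
            have : θ / (8 * m) ≤ Y a / (8 * m) := by gcongr
            rw [show Y a / m / 8 = Y a / (8 * m) by field_simp]
            linarith
          calc X a = X a * 1 := (mul_one _).symm
            _ ≤ X a * (E * Real.exp (Y a / m / 8)) := by gcongr
            _ = _ := by field_simp
        · left
          have : 1 ≤ E * Real.exp (X a / s / 8) := by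
            rw [hE, ← Real.exp_add]
            refine Real.one_le_exp ?_
            have h1 : θ / (8 * m) ≤ X a / (8 * m) := by gcongr
            have h2 : X a / (8 * m) ≤ X a / (8 * s) := by
              apply div_le_div_of_nonneg_left (hX0 a) (by positivity) (by linarith)
            rw [show X a / s / 8 = X a / (8 * s) by field_simp]
            linarith
          calc X a = X a * 1 := (mul_one _).symm
            _ ≤ X a * (E * Real.exp (X a / s / 8)) := by gcongr
            _ = _ := by field_simp
      rcases hcase with h | h
      · refine h.trans ?_
        gcongr
        have : 0 ≤ X a / s * Real.exp (X a / s / 8) := by positivity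
        have : 0 ≤ Y a / m * Real.exp (Y a / m / 8) := by positivity
        linarith
      · refine h.trans ?_
        gcongr
        rcases le_total (X a / s) (Y a / m) with hc | hc
        · have h1 : 0 ≤ X a / s * Real.exp (X a / s / 8) := by positivity
          have h2 : X a / s * Real.exp (Y a / m / 8) ≤ Y a / m * Real.exp (Y a / m / 8) := by gcongr
          linarith
        · have h1 : 0 ≤ Y a / m * Real.exp (Y a / m / 8) := by positivity
          have h3 : 0 ≤ X a / s * Real.exp (X a / s / 8) := by positivity
          have h2 : X a / s * Real.exp (Y a / m / 8) ≤ X a / s * Real.exp (X a / s / 8) := by gcongr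
          linarith
  have hXI := lintegral_sum_sq_mul_exp_le hS v hpos le_rfl
  have hYI := lintegral_sum_sq_mul_exp_le hS w hm hw
  calc _ ≤ ∫⁻ a, ENNReal.ofReal (E * s) * (2 * ENNReal.ofReal (X a / s * Real.exp (X a / s / 8))
          + ENNReal.ofReal (Y a / m * Real.exp (Y a / m / 8))) ∂(multivariateGaussian 0 S) := by
        refine lintegral_mono fun a => ?_
        refine (ENNReal.ofReal_le_ofReal (hpt a)).trans (le_of_eq ?_)
        have hXs : 0 ≤ X a / s := div_nonneg (hX0 a) hs0
        have hYm' : 0 ≤ Y a / m := div_nonneg (hY0 a) hm.le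
        rw [ENNReal.ofReal_mul (by positivity), ENNReal.ofReal_add (by positivity) (by positivity),
          ENNReal.ofReal_mul (p := 2) (by positivity)]
        simp
    _ = ENNReal.ofReal (E * s) * (2 * ∫⁻ a, ENNReal.ofReal (X a / s * Real.exp (X a / s / 8))
            ∂(multivariateGaussian 0 S)
          + ∫⁻ a, ENNReal.ofReal (Y a / m * Real.exp (Y a / m / 8))
            ∂(multivariateGaussian 0 S)) := by
        rw [lintegral_const_mul _ (by fun_prop), lintegral_add_left (by fun_prop),
          lintegral_const_mul _ (by fun_prop)]
    _ ≤ ENNReal.ofReal (E * s) * (2 * ENNReal.ofReal (10 / 3) + ENNReal.ofReal (10 / 3)) := by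
        gcongr
    _ = _ := by
        rw [show (2 : ENNReal) = ENNReal.ofReal 2 by simp, ← ENNReal.ofReal_mul (by norm_num),
          ← ENNReal.ofReal_add (by norm_num) (by norm_num), ← ENNReal.ofReal_mul (by positivity)]
        congr 1; ring

end Gaussian

/-! ### The outer function: measurability and size of its gradient. -/

section Outer

variable {l : ℕ}

lemma join_parts (r : OutP l) : join (fstPart r) (sndPart r) = r := by
  ext i; cases i <;> rfl

lemma join_apply_inr (x y : Out l) (i : Fin l) : join x y (Sum.inr i) = y i := rfl

lemma join_apply_inl (x y : Out l) (i : Fin l) : join x y (Sum.inl i) = x i := rfl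

lemma measurable_join : Measurable fun p : Out l × Out l => join p.1 p.2 := by
  refine (WithLp.measurable_toLp 2 _).comp (measurable_pi_iff.2 fun i => ?_)
  cases i <;> simp only [Sum.elim_inl, Sum.elim_inr] <;> fun_prop

lemma measurable_fstPart : Measurable (fstPart : OutP l → Out l) :=
  (WithLp.measurable_toLp 2 _).comp (measurable_pi_iff.2 fun i => by fun_prop)

lemma measurable_sndPart : Measurable (sndPart : OutP l → Out l) :=
  (WithLp.measurable_toLp 2 _).comp (measurable_pi_iff.2 fun i => by fun_prop)

lemma join_lin {ι : Type*} [Fintype ι] [DecidableEq ι] (X Y : Matrix ι (Fin l) ℝ)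
    (a : EuclideanSpace ℝ ι) :
    join (lin Xᵀ a) (lin Yᵀ a) = lin (Matrix.fromCols X Y)ᵀ a := by
  ext i; cases i <;> rfl

lemma join_contract {d : ℕ} (X Y : Matrix (Fin d) (Fin l) ℝ) (a : EuclideanSpace ℝ (Fin d)) :
    join (contract X a) (contract Y a) = lin (Matrix.fromCols X Y)ᵀ a := join_lin X Y a

lemma norm_sq_join (x y : Out l) : ‖join x y‖ ^ 2 = ‖x‖ ^ 2 + ‖y‖ ^ 2 := by
  simp [EuclideanSpace.norm_sq_eq, join_apply_inl, join_apply_inr]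

lemma norm_join_zero (x : Out l) : ‖join x 0‖ = ‖x‖ := by
  have := norm_sq_join x 0
  rw [norm_zero, zero_pow two_ne_zero, add_zero] at this
  exact (pow_left_inj₀ (norm_nonneg _) (norm_nonneg _) two_ne_zero).1 this

lemma slice_apply (f : OutP l → Out l → ℝ) (y e x : Out l) : slice f y e x = f (join x y) e := rfl

variable {f : OutP l → Out l → ℝ} {L : ℝ}

/-- Each component is a pointwise limit of difference quotients, which are jointly measurable in
`(r, ε)` because `f` is. -/
lemma measurable_gradX (hf_meas : Measurable (fun p : OutP l × Out l => f p.1 p.2))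
    (hf_smooth : ∀ y e : Out l, LSmooth L (slice f y e)) :
    Measurable fun p : OutP l × Out l => gradX f p.1 p.2 := by
  have hcoord : ∀ i, Measurable fun p : OutP l × Out l => gradX f p.1 p.2 i := fun i => by
    set v : Out l := EuclideanSpace.single i (1 : ℝ) with hv
    have hlim : ∀ p : OutP l × Out l, Tendsto (fun n : ℕ => ((n : ℝ) + 1)
        * (f (join (fstPart p.1 + ((n : ℝ) + 1)⁻¹ • v) (sndPart p.1)) p.2 - f p.1 p.2)) atTop
        (𝓝 (gradX f p.1 p.2 i)) := fun p => by
      have hd : DifferentiableAt ℝ (slice f (sndPart p.1) p.2) (fstPart p.1) :=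
        (hf_smooth _ _).1.differentiable one_ne_zero _
      have h1 : HasDerivAt (fun s : ℝ => slice f (sndPart p.1) p.2 (fstPart p.1 + s • v))
          (gradX f p.1 p.2 i) 0 := by
        have hl : HasDerivAt (fun s : ℝ => fstPart p.1 + s • v) v 0 := by
          simpa using ((hasDerivAt_id (0 : ℝ)).smul_const v).const_add (fstPart p.1)
        have hd' : HasFDerivAt (slice f (sndPart p.1) p.2)
            (fderiv ℝ (slice f (sndPart p.1) p.2) (fstPart p.1))
            (fstPart p.1 + (0 : ℝ) • v) := by simpa using hd.hasFDerivAt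
        have h := hd'.comp_hasDerivAt (0 : ℝ) hl
        refine h.congr_deriv ?_
        have h2 : inner ℝ (gradX f p.1 p.2) v = gradX f p.1 p.2 i := by
          rw [hv, EuclideanSpace.inner_single_right]; simp
        rw [← h2, gradX, gradient, InnerProductSpace.toDual_symm_apply]
      have h3 := (hasDerivAt_iff_tendsto_slope_zero.1 h1).comp
        (show Tendsto (fun n : ℕ => ((n : ℝ) + 1)⁻¹) atTop (𝓝[≠] 0) from
          tendsto_nhdsWithin_iff.2 ⟨by simpa using tendsto_one_div_add_atTop_nhds_zero_nat (𝕜 := ℝ),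
            Eventually.of_forall fun n => by
              simp only [mem_compl_iff, mem_singleton_iff, inv_eq_zero]; positivity⟩)
      refine h3.congr fun n => ?_
      simp [slice_apply, join_parts]
    refine measurable_of_tendsto_metrizable (fun n => ?_) (tendsto_pi_nhds.2 hlim)
    refine Measurable.const_mul (Measurable.sub ?_ hf_meas) _
    refine hf_meas.comp (Measurable.prodMk (measurable_join.comp (Measurable.prodMk ?_ ?_))
      measurable_snd)
    · exact (measurable_fstPart.comp measurable_fst).add_const _
    · exact measurable_sndPart.comp measurable_fst
  exact (WithLp.measurable_toLp 2 _).comp (measurable_pi_iff.2 hcoord)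

lemma gradient_eq_zero_of_isMinOn {φ : Out l → ℝ} {xs : Out l}
    (hmin : IsMinOn φ univ xs) : gradient φ xs = 0 := by
  have : fderiv ℝ φ xs = 0 :=
    (IsLocalMin.fderiv_eq_zero (hmin.isLocalMin univ_mem))
  simp [gradient, this]

/-- The gradient of an `L`-smooth function grows at most linearly away from a minimizer. -/
lemma LSmooth.norm_gradient_le (hL : 0 < L) {φ : Out l → ℝ} (h : LSmooth L φ) {xs : Out l}
    (hmin : IsMinOn φ univ xs) (x : Out l) : ‖gradient φ x‖ ≤ L * ‖x - xs‖ := by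
  set g := gradient φ x
  -- One gradient step of length `1/L` lowers `φ` by at least `‖g‖²/(2L)`, and `φ` cannot fall below
  -- its minimum, which is within `(L/2) ‖x - xs‖²` of `φ x`.
  have h1 := h.2 x (x - L⁻¹ • g)
  have h2 := h.2 xs x
  rw [gradient_eq_zero_of_isMinOn hmin, inner_zero_left] at h2
  have h3 : φ xs ≤ φ (x - L⁻¹ • g) := hmin (mem_univ _)
  rw [sub_sub_cancel_left, inner_neg_right, inner_smul_right, real_inner_self_eq_norm_sq, norm_neg,
    norm_smul, Real.norm_of_nonneg (inv_nonneg.2 hL.le)] at h1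
  have h4 : L / 2 * (L⁻¹ * ‖g‖) ^ 2 = L⁻¹ / 2 * ‖g‖ ^ 2 := by field_simp
  rw [h4] at h1
  have h5 : L⁻¹ * ‖g‖ ^ 2 ≤ L * ‖x - xs‖ ^ 2 := by linarith
  have h6 : ‖g‖ ^ 2 ≤ (L * ‖x - xs‖) ^ 2 := by
    have := mul_le_mul_of_nonneg_left h5 hL.le
    rw [← mul_assoc, mul_inv_cancel₀ hL.ne', one_mul] at this
    linarith [this]
  exact le_of_sq_le_sq h6 (by positivity)

lemma norm_gradX_le (hL : 0 < L) (hf_smooth : ∀ y e : Out l, LSmooth L (slice f y e))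
    {r : OutP l} {e : Out l} (hmin : IsMinOn (slice f (sndPart r) e) univ (sndPart r)) :
    ‖gradX f r e‖ ≤ L * ‖fstPart r - sndPart r‖ :=
  (hf_smooth _ _).norm_gradient_le hL hmin _

lemma rsi_gradX {μ θ : ℝ} (hf_rsi : ∀ y e : Out l, RSI μ θ (slice f y e))
    {r : OutP l} {e : Out l} (hmin : IsMinOn (slice f (sndPart r) e) univ (sndPart r)) :
    (if max (‖sndPart r‖ ^ 2) (‖fstPart r - sndPart r‖ ^ 2) ≤ θ
      then μ * ‖fstPart r - sndPart r‖ ^ 2 else 0)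
      ≤ inner ℝ (fstPart r - sndPart r) (gradX f r e) :=
  (hf_rsi _ _).2 _ _ hmin

/-! ### Mean gradients expressed by the gradient of `h`. -/

section Formula

variable {ι : Type*} [Fintype ι] [DecidableEq ι] {S : Matrix ι ι ℝ}
  {h : MatP l → ℝ} {U : Set (MatP l)} {α Lf : ℝ}

/-- The law of `(a, ε)`, `a ∼ N(0, S)`, `ε ∼ N(0, I)`. -/
noncomputable def jointLaw (l : ℕ) (S : Matrix ι ι ℝ) : Measure (EuclideanSpace ℝ ι × Out l) :=
  (multivariateGaussian 0 S).prod (stdGaussian (Out l))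

instance : IsProbabilityMeasure (jointLaw l S) := by unfold jointLaw; infer_instance

lemma measurePreserving_fst_jointLaw :
    MeasurePreserving Prod.fst (jointLaw l S) (multivariateGaussian 0 S) :=
  measurePreserving_fst

lemma measurePreserving_snd_jointLaw :
    MeasurePreserving Prod.snd (jointLaw l S) (stdGaussian (Out l)) :=
  measurePreserving_snd

lemma map_jointLaw (hS : S.PosSemidef) (W : Matrix ι (Fin l ⊕ Fin l) ℝ) :
    (jointLaw l S).map (fun p => (lin Wᵀ p.1, p.2)) = lawB (Wᵀ * S * W) := by
  have h1 := map_lin_multivariateGaussian hS Wᵀ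
  rw [Matrix.transpose_transpose] at h1
  rw [lawB, ← h1]
  have := Measure.map_prod_map (multivariateGaussian 0 S) (stdGaussian (Out l))
    (f := lin Wᵀ) (g := id) (by fun_prop) measurable_id
  rw [Measure.map_id] at this
  exact this.symm

lemma meanLoss_eq_integral (hf_meas : Measurable (fun p : OutP l × Out l => f p.1 p.2))
    (hS : S.PosSemidef) (W : Matrix ι (Fin l ⊕ Fin l) ℝ) :
    meanLoss f (Wᵀ * S * W) = ∫ p, f (lin Wᵀ p.1) p.2 ∂(jointLaw l S) := by
  rw [meanLoss, ← map_jointLaw hS, integral_map (Measurable.aemeasurable (by fun_prop))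
    hf_meas.aestronglyMeasurable]

lemma integrable_f_lin (hα : 0 ≤ α)
    (hf_meas : Measurable (fun p : OutP l × Out l => f p.1 p.2))
    (hf_int : Integrable (f 0) (stdGaussian (Out l))) (hf_lip : PseudoLipschitzOuter α Lf f)
    (W : Matrix ι (Fin l ⊕ Fin l) ℝ) :
    Integrable (fun p => f (lin Wᵀ p.1) p.2) (jointLaw l S) := by
  have ha : AllMoments (fun p : EuclideanSpace ℝ ι × Out l => ‖lin Wᵀ p.1‖) (jointLaw l S) :=
    (((allMoments_norm_of_isGaussian (multivariateGaussian 0 S)).comp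
      measurePreserving_fst_jointLaw).const_mul ‖lin Wᵀ‖).mono
      (Measurable.aestronglyMeasurable (by fun_prop))
      (ae_of_all _ fun p => by rw [abs_norm]; exact (lin Wᵀ).le_opNorm _)
  have he : AllMoments (fun p : EuclideanSpace ℝ ι × Out l => ‖p.2‖) (jointLaw l S) :=
    (allMoments_norm_of_isGaussian (stdGaussian (Out l))).comp measurePreserving_snd_jointLaw
  have hb := ((ha.const_mul |Lf|).mul ((((AllMoments.const 1).add
    (ha.rpow (fun _ => norm_nonneg _) hα)).add (AllMoments.const ((0 : ℝ) ^ α))).add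
    (he.rpow (fun _ => norm_nonneg _) hα))).integrable.add
    (measurePreserving_snd_jointLaw.integrable_comp_of_integrable hf_int).norm
  refine hb.mono' (hf_meas.comp (by fun_prop : Measurable fun p : EuclideanSpace ℝ ι × Out l =>
    (lin Wᵀ p.1, p.2))).aestronglyMeasurable (ae_of_all _ fun p => ?_)
  have h1 := hf_lip (lin Wᵀ p.1) 0 p.2
  rw [sub_zero, norm_zero] at h1
  have h2 : Lf * ‖lin Wᵀ p.1‖ * (1 + ‖lin Wᵀ p.1‖ ^ α + 0 ^ α + ‖p.2‖ ^ α)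
      ≤ |Lf| * ‖lin Wᵀ p.1‖ * (1 + ‖lin Wᵀ p.1‖ ^ α + 0 ^ α + ‖p.2‖ ^ α) := by
    gcongr
    exact le_abs_self Lf
  have h3 := abs_sub_abs_le_abs_sub (f (lin Wᵀ p.1) p.2) (f 0 p.2)
  simp only [Pi.add_apply, Function.comp_apply, Real.norm_eq_abs]
  linarith

lemma matGrad_apply (h : MatP l → ℝ) (B : MatP l) (i j : Fin l ⊕ Fin l) :
    matGrad h B i j = fderiv ℝ h B (Matrix.single i j 1) := rfl

lemma fderiv_eq_sum_matGrad (h : MatP l → ℝ) (B D : MatP l) :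
    fderiv ℝ h B D = ∑ i, ∑ j, matGrad h B i j * D i j := by
  conv_lhs => rw [Matrix.matrix_eq_sum_single D]
  simp only [map_sum, matGrad_apply]
  refine Finset.sum_congr rfl fun i _ => Finset.sum_congr rfl fun j _ => ?_
  rw [show Matrix.single i j (D i j) = (D i j) • Matrix.single i j (1 : ℝ) by
    rw [Matrix.smul_single]; simp, map_smul, smul_eq_mul, mul_comm]

/-- Differentiate `h ∘ T = h`, `T` the transposition, at a fixed point of `T`. The identity with the
mean loss is available only at symmetric matrices, so it does not see the antisymmetric part of the
gradient; this invariance forces that part to vanish. -/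
lemma matGrad_symm (hh_symm : ∀ B, h Bᵀ = h B) {B : MatP l} (hd : DifferentiableAt ℝ h B)
    (hB : Bᵀ = B) : (matGrad h B)ᵀ = matGrad h B := by
  set T : MatP l →L[ℝ] MatP l := LinearMap.toContinuousLinearMap
    (Matrix.transposeLinearEquiv (Fin l ⊕ Fin l) (Fin l ⊕ Fin l) ℝ ℝ).toLinearMap with hT
  have hTa : ∀ D, T D = Dᵀ := fun D => rfl
  have h1 : HasFDerivAt (h ∘ T) ((fderiv ℝ h B).comp T) B := by
    refine HasFDerivAt.comp B ?_ T.hasFDerivAt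
    rw [hTa, hB]
    exact hd.hasFDerivAt
  have h2 : h ∘ T = h := funext fun D => hh_symm D
  rw [h2] at h1
  have h3 := h1.unique hd.hasFDerivAt
  ext i j
  rw [Matrix.transpose_apply, matGrad_apply, matGrad_apply]
  have := DFunLike.congr_fun h3 (Matrix.single i j 1)
  simpa [hTa] using this

lemma hasDerivAt_quad (B D E : MatP l) : HasDerivAt (fun s : ℝ => B + s • D + s ^ 2 • E) D 0 := by
  have h1 := ((hasDerivAt_id (0 : ℝ)).smul_const D).const_add B
  have h2 := ((hasDerivAt_id (0 : ℝ)).pow 2).smul_const E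
  refine (h1.add h2).congr_deriv ?_
  simp

lemma lin_add_smul_fromCols (W : Matrix ι (Fin l ⊕ Fin l) ℝ) (V : Matrix ι (Fin l) ℝ) (s : ℝ)
    (a : EuclideanSpace ℝ ι) : lin (W + s • Matrix.fromCols V 0)ᵀ a
      = lin Wᵀ a + s • join (lin Vᵀ a) 0 := by
  ext i
  cases i with
  | inl i => simp [lin_apply, join_apply_inl, Finset.sum_add_distrib, add_mul, Finset.mul_sum,
      mul_assoc]
  | inr i => simp [lin_apply, join_apply_inr]

lemma allMoments_norm_lin {κ : Type*} [Fintype κ] (A : Matrix κ ι ℝ) :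
    AllMoments (fun p : EuclideanSpace ℝ ι × Out l => ‖lin A p.1‖) (jointLaw l S) :=
  (((allMoments_norm_of_isGaussian (multivariateGaussian 0 S)).comp
    measurePreserving_fst_jointLaw).const_mul ‖lin A‖).mono
    (Measurable.aestronglyMeasurable (by fun_prop))
    (ae_of_all _ fun p => by rw [abs_norm]; exact (lin A).le_opNorm _)

lemma allMoments_norm_snd :
    AllMoments (fun p : EuclideanSpace ℝ ι × Out l => ‖p.2‖) (jointLaw l S) :=
  (allMoments_norm_of_isGaussian (stdGaussian (Out l))).comp measurePreserving_snd_jointLaw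

lemma measurable_f_lin (hf_meas : Measurable (fun p : OutP l × Out l => f p.1 p.2))
    (A : Matrix (Fin l ⊕ Fin l) ι ℝ) :
    Measurable fun p : EuclideanSpace ℝ ι × Out l => f (lin A p.1) p.2 :=
  hf_meas.comp (by fun_prop : Measurable fun p : EuclideanSpace ℝ ι × Out l => (lin A p.1, p.2))

lemma measurable_gradX_lin (hf_meas : Measurable (fun p : OutP l × Out l => f p.1 p.2))
    (hf_smooth : ∀ y e : Out l, LSmooth L (slice f y e)) (A : Matrix (Fin l ⊕ Fin l) ι ℝ) :
    Measurable fun p : EuclideanSpace ℝ ι × Out l => gradX f (lin A p.1) p.2 :=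
by
  have h1 := measurable_gradX hf_meas hf_smooth
  have h2 : Measurable fun p : EuclideanSpace ℝ ι × Out l => (lin A p.1, p.2) := by fun_prop
  generalize gradX f = G at h1 ⊢
  exact h1.comp h2

/-- Differentiation under the integral. For `|s| < 1` the pseudo-Lipschitz bound is at most a random
variable independent of `s` with all moments, which also gives integrability of the derivative. -/
lemma hasDerivAt_integral_f_lin (hα : 0 ≤ α)
    (hf_meas : Measurable (fun p : OutP l × Out l => f p.1 p.2))
    (hf_int : Integrable (f 0) (stdGaussian (Out l))) (hf_lip : PseudoLipschitzOuter α Lf f)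
    (hf_smooth : ∀ y e : Out l, LSmooth L (slice f y e))
    (W : Matrix ι (Fin l ⊕ Fin l) ℝ) (V : Matrix ι (Fin l) ℝ) :
    Integrable (fun p => inner ℝ (lin Vᵀ p.1) (gradX f (lin Wᵀ p.1) p.2)) (jointLaw l S) ∧
    HasDerivAt (fun s : ℝ => ∫ p, f (lin (W + s • Matrix.fromCols V 0)ᵀ p.1) p.2 ∂(jointLaw l S))
      (∫ p, inner ℝ (lin Vᵀ p.1) (gradX f (lin Wᵀ p.1) p.2) ∂(jointLaw l S)) 0 := by
  set bound : EuclideanSpace ℝ ι × Out l → ℝ := fun p => |Lf| * ‖lin Vᵀ p.1‖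
    * (1 + (‖lin Wᵀ p.1‖ + ‖lin Vᵀ p.1‖) ^ α + (‖lin Wᵀ p.1‖ + ‖lin Vᵀ p.1‖) ^ α + ‖p.2‖ ^ α)
    with hbound
  have hr : AllMoments (fun p : EuclideanSpace ℝ ι × Out l =>
      (‖lin Wᵀ p.1‖ + ‖lin Vᵀ p.1‖) ^ α) (jointLaw l S) :=
    ((allMoments_norm_lin Wᵀ).add (allMoments_norm_lin Vᵀ)).rpow (fun _ => by positivity) hα
  have hbI : Integrable bound (jointLaw l S) := (((allMoments_norm_lin Vᵀ).const_mul |Lf|).mul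
    ((((AllMoments.const 1).add hr).add hr).add (allMoments_norm_snd.rpow (fun _ => norm_nonneg _) hα))).integrable
  have h1 : ∀ᵐ p ∂(jointLaw l S), LipschitzOnWith (Real.nnabs <| bound p)
      (fun s : ℝ => f (lin (W + s • Matrix.fromCols V 0)ᵀ p.1) p.2) (Ioo (-1 : ℝ) 1) := by
    refine ae_of_all _ fun p => LipschitzOnWith.of_dist_le_mul fun s hs t ht => ?_
    rw [Real.dist_eq, Real.dist_eq, Real.coe_nnabs]
    refine le_trans ?_ (mul_le_mul_of_nonneg_right (le_abs_self _) (abs_nonneg _))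
    have hn : ∀ s ∈ Ioo (-1 : ℝ) 1, ‖lin (W + s • Matrix.fromCols V 0)ᵀ p.1‖ ≤ ‖lin Wᵀ p.1‖ + ‖lin Vᵀ p.1‖ := by
      intro s hs
      rw [lin_add_smul_fromCols]
      refine (norm_add_le _ _).trans ?_
      rw [norm_smul, norm_join_zero]
      have : ‖s‖ ≤ 1 := abs_le.2 ⟨hs.1.le, hs.2.le⟩
      have := mul_le_of_le_one_left (norm_nonneg (lin Vᵀ p.1)) this
      linarith
    refine (hf_lip _ _ _).trans ?_
    have hdiff : ‖lin (W + s • Matrix.fromCols V 0)ᵀ p.1 - lin (W + t • Matrix.fromCols V 0)ᵀ p.1‖ = |s - t| * ‖lin Vᵀ p.1‖ := by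
      rw [lin_add_smul_fromCols, lin_add_smul_fromCols, add_sub_add_left_eq_sub, ← sub_smul, norm_smul, norm_join_zero,
        Real.norm_eq_abs]
    rw [hdiff, hbound]
    dsimp only
    have hs1 := Real.rpow_le_rpow (norm_nonneg _) (hn s hs) hα
    have ht1 := Real.rpow_le_rpow (norm_nonneg _) (hn t ht) hα
    have hle : Lf ≤ |Lf| := le_abs_self Lf
    calc _ ≤ |Lf| * (|s - t| * ‖lin Vᵀ p.1‖) * (1 + (‖lin Wᵀ p.1‖ + ‖lin Vᵀ p.1‖) ^ α
          + (‖lin Wᵀ p.1‖ + ‖lin Vᵀ p.1‖) ^ α + ‖p.2‖ ^ α) := by gcongr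
      _ = _ := by ring
  have h2 : ∀ᵐ p ∂(jointLaw l S), HasDerivAt
      (fun s : ℝ => f (lin (W + s • Matrix.fromCols V 0)ᵀ p.1) p.2)
      (inner ℝ (lin Vᵀ p.1) (gradX f (lin Wᵀ p.1) p.2)) 0 := by
    refine ae_of_all _ fun p => ?_
    set x := fstPart (lin Wᵀ p.1)
    set y := sndPart (lin Wᵀ p.1)
    have hfun : (fun s : ℝ => f (lin (W + s • Matrix.fromCols V 0)ᵀ p.1) p.2)
        = fun s : ℝ => slice f y p.2 (x + s • lin Vᵀ p.1) := by
      funext s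
      rw [slice_apply, lin_add_smul_fromCols]
      congr 1
      ext i; cases i
      · simp [join_apply_inl, x, fstPart]
      · simp [join_apply_inr, y, sndPart]
    rw [hfun]
    have hl : HasDerivAt (fun s : ℝ => x + s • lin Vᵀ p.1) (lin Vᵀ p.1) 0 := by
      simpa using ((hasDerivAt_id (0 : ℝ)).smul_const (lin Vᵀ p.1)).const_add x
    have hdf : HasFDerivAt (slice f y p.2) (fderiv ℝ (slice f y p.2) x)
        (x + (0 : ℝ) • lin Vᵀ p.1) := by
      simpa using ((hf_smooth y p.2).1.differentiable one_ne_zero x).hasFDerivAt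
    refine (hdf.comp_hasDerivAt (0 : ℝ) hl).congr_deriv ?_
    rw [real_inner_comm, gradX, gradient, InnerProductSpace.toDual_symm_apply]
  have h3 : Integrable (fun p => f (lin (W + (0 : ℝ) • Matrix.fromCols V 0)ᵀ p.1) p.2)
      (jointLaw l S) := integrable_f_lin hα hf_meas hf_int hf_lip _
  have h4 : AEStronglyMeasurable (fun p => inner ℝ (lin Vᵀ p.1) (gradX f (lin Wᵀ p.1) p.2))
      (jointLaw l S) := (Measurable.inner (by fun_prop) (measurable_gradX_lin hf_meas hf_smooth _)).aestronglyMeasurable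
  exact hasDerivAt_integral_of_dominated_loc_of_lip
    (Ioo_mem_nhds (by norm_num) (by norm_num))
    (Eventually.of_forall fun s => (measurable_f_lin hf_meas _).aestronglyMeasurable) h3 h4 h1 hbI h2

/-- The gradient of `f` tested against a linear function of the data is given by the gradient of
`h`: differentiate `h (B (W + s V)) = 𝔼 f` at `s = 0`. -/
theorem integral_inner_gradX (hα : 0 ≤ α)
    (hf_meas : Measurable (fun p : OutP l × Out l => f p.1 p.2))
    (hf_int : Integrable (f 0) (stdGaussian (Out l))) (hf_lip : PseudoLipschitzOuter α Lf f)
    (hf_smooth : ∀ y e : Out l, LSmooth L (slice f y e)) (hU : IsOpen U)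
    (hh_symm : ∀ B, h Bᵀ = h B) (hh_risk : ∀ B ∈ U, B.PosSemidef → h B = meanLoss f B)
    (hh_C1 : ContDiffOn ℝ 1 h U) (hS : S.PosSemidef) (W : Matrix ι (Fin l ⊕ Fin l) ℝ)
    (hW : Wᵀ * S * W ∈ U) (V : Matrix ι (Fin l) ℝ) :
    ∫ p, inner ℝ (lin Vᵀ p.1) (gradX f (lin Wᵀ p.1) p.2) ∂(jointLaw l S)
      = 2 * ∑ q, ∑ s, matGrad h (Wᵀ * S * W) (Sum.inl q) s * (Wᵀ * S * V) s q := by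
  set V₀ : Matrix ι (Fin l ⊕ Fin l) ℝ := Matrix.fromCols V 0 with hV₀
  set B := Wᵀ * S * W with hB
  have hSt : Sᵀ = S := by
    have := hS.isHermitian.eq
    rwa [Matrix.conjTranspose_eq_transpose_of_trivial] at this
  have hBt : Bᵀ = B := by
    rw [hB]; simp only [Matrix.transpose_mul, Matrix.transpose_transpose, hSt, Matrix.mul_assoc]
  have hdiff : DifferentiableAt ℝ h B :=
    (hh_C1.differentiableOn one_ne_zero).differentiableAt (hU.mem_nhds hW)
  set N := Wᵀ * S * V₀ with hN
  have hNt : Nᵀ = V₀ᵀ * S * W := by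
    rw [hN]; simp only [Matrix.transpose_mul, Matrix.transpose_transpose, hSt, Matrix.mul_assoc]
  -- The covariance of the perturbed output is quadratic in `s`, so only its linear coefficient `N +
  -- Nᵀ` enters the derivative at `0`.
  have hquad : ∀ s : ℝ, (W + s • V₀)ᵀ * S * (W + s • V₀)
      = B + s • (N + Nᵀ) + s ^ 2 • (V₀ᵀ * S * V₀) := fun s => by
    rw [hNt, hN, hB]
    simp only [Matrix.transpose_add, Matrix.transpose_smul, Matrix.add_mul, Matrix.mul_add,
      Matrix.smul_mul, Matrix.mul_smul, smul_add, smul_smul, sq]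
    abel
  have hd := hasDerivAt_quad B (N + Nᵀ) (V₀ᵀ * S * V₀)
  have hleft : HasDerivAt (fun s : ℝ => h (B + s • (N + Nᵀ) + s ^ 2 • (V₀ᵀ * S * V₀)))
      (fderiv ℝ h B (N + Nᵀ)) 0 := by
    have hd' : HasFDerivAt h (fderiv ℝ h B)
        (B + (0 : ℝ) • (N + Nᵀ) + (0 : ℝ) ^ 2 • (V₀ᵀ * S * V₀)) := by
      simpa using hdiff.hasFDerivAt
    exact hd'.comp_hasDerivAt (0 : ℝ) hd
  -- The perturbed covariance is positive semidefinite for every `s`, and in the open set `U` for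
  -- small `s`; hence `h` is the mean loss along the whole curve near `0`.
  have hev : ∀ᶠ s in 𝓝 (0 : ℝ), ∫ p, f (lin (W + s • V₀)ᵀ p.1) p.2 ∂(jointLaw l S)
      = h (B + s • (N + Nᵀ) + s ^ 2 • (V₀ᵀ * S * V₀)) := by
    have hc : Tendsto (fun s : ℝ => B + s • (N + Nᵀ) + s ^ 2 • (V₀ᵀ * S * V₀)) (𝓝 0) (𝓝 B) := by
      have := hd.continuousAt.tendsto
      simp only [zero_smul, add_zero, zero_pow two_ne_zero] at this
      exact this
    filter_upwards [hc (hU.mem_nhds hW)] with s hs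
    have hs : B + s • (N + Nᵀ) + s ^ 2 • (V₀ᵀ * S * V₀) ∈ U := hs
    rw [hh_risk _ hs, ← hquad, meanLoss_eq_integral hf_meas hS]
    rw [← hquad]
    simpa [Matrix.conjTranspose_eq_transpose_of_trivial] using
      hS.conjTranspose_mul_mul_same (W + s • V₀)
  have hmain := hasDerivAt_integral_f_lin (S := S) hα hf_meas hf_int hf_lip hf_smooth W V
  rw [← hV₀] at hmain
  rw [(hmain.2.congr_of_eventuallyEq (hev.mono fun s hs => hs.symm)).unique hleft]
  rw [fderiv_eq_sum_matGrad]
  have hG := matGrad_symm hh_symm hdiff hBt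
  -- Symmetry of the gradient merges `N` and `Nᵀ` into a factor `2`. As `V₀` has zero columns in its
  -- right half, only the upper block row of the gradient survives.
  have hsum : ∑ i, ∑ j, matGrad h B i j * (N + Nᵀ) i j = 2 * ∑ j, ∑ i, matGrad h B j i * N i j := by
    have hG' : ∀ i j, matGrad h B i j = matGrad h B j i := fun i j => by
      conv_lhs => rw [← hG, Matrix.transpose_apply]
    simp only [Matrix.add_apply, Matrix.transpose_apply, mul_add, Finset.sum_add_distrib]
    rw [two_mul]
    congr 1
    rw [Finset.sum_comm]
    exact Finset.sum_congr rfl fun i _ => Finset.sum_congr rfl fun j _ => by rw [hG']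
  rw [hsum, Fintype.sum_sum_type]
  have hl : ∀ s q, N s (Sum.inl q) = (Wᵀ * S * V) s q := fun s q => by
    rw [hN, hV₀]; simp [Matrix.mul_apply]
  have hr : ∀ s q, N s (Sum.inr q) = 0 := fun s q => by
    rw [hN, hV₀]; simp [Matrix.mul_apply]
  simp [hl, hr]

end Formula
end Outer

/-! ### The drift and the Fisher term for a Gaussian output law. -/

section Drift

variable {l : ℕ} {f : OutP l → Out l → ℝ} {L : ℝ} {h : MatP l → ℝ} {U : Set (MatP l)} {α Lf : ℝ}

/-- Difference quotients in the direction of the gradient itself. This growth bound needs no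
minimizer, so it gives all moments of the gradient under `lawB B` for every `B`. -/
lemma norm_gradX_le_rpow (hα : 0 ≤ α) (hf_lip : PseudoLipschitzOuter α Lf f)
    (hf_smooth : ∀ y e : Out l, LSmooth L (slice f y e)) (r : OutP l) (e : Out l) :
    ‖gradX f r e‖ ≤ |Lf| * (1 + 2 * ‖r‖ ^ α + ‖e‖ ^ α) := by
  set g := gradX f r e with hg
  set x := fstPart r
  set y := sndPart r
  have hl : HasDerivAt (fun s : ℝ => x + s • g) g 0 := by
    simpa using ((hasDerivAt_id (0 : ℝ)).smul_const g).const_add x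
  have hdf : HasFDerivAt (slice f y e) (fderiv ℝ (slice f y e) x) (x + (0 : ℝ) • g) := by
    simpa using ((hf_smooth y e).1.differentiable one_ne_zero x).hasFDerivAt
  have h1 : HasDerivAt (fun s : ℝ => slice f y e (x + s • g)) (‖g‖ ^ 2) 0 := by
    refine (hdf.comp_hasDerivAt (0 : ℝ) hl).congr_deriv ?_
    rw [← real_inner_self_eq_norm_sq]
    conv_rhs => rw [hg, gradX, gradient, InnerProductSpace.toDual_symm_apply]
    rfl
  have h2 := (hasDerivAt_iff_tendsto_slope_zero.1 h1).abs
  have hj : ∀ s : ℝ, join (x + s • g) y = r + s • join g 0 := fun s => by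
    ext i; cases i
    · simp [join_apply_inl, x, fstPart]
    · simp [join_apply_inr, y, sndPart]
  have hc : Continuous fun s : ℝ => |Lf| * ‖g‖ * (1 + ‖r + s • join g 0‖ ^ α + ‖r‖ ^ α + ‖e‖ ^ α) := by
    have : Continuous fun s : ℝ => ‖r + s • join g 0‖ ^ α :=
      (by fun_prop : Continuous fun s : ℝ => ‖r + s • join g 0‖).rpow_const fun _ => Or.inr hα
    fun_prop
  have h3 := (hc.tendsto 0).mono_left (nhdsWithin_le_nhds (s := {0}ᶜ))
  have h4 : ‖g‖ ^ 2 ≤ |Lf| * ‖g‖ * (1 + ‖r + (0 : ℝ) • join g 0‖ ^ α + ‖r‖ ^ α + ‖e‖ ^ α) := by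
    have h5 := le_of_tendsto_of_tendsto h2 h3 (by
      filter_upwards [self_mem_nhdsWithin] with s hs
      have hs : s ≠ 0 := hs
      simp only [zero_add, zero_smul, add_zero, smul_eq_mul, slice_apply]
      rw [abs_mul, abs_inv, hj, show join x y = r from join_parts r]
      have h5 := hf_lip (r + s • join g 0) r e
      rw [add_sub_cancel_left, norm_smul, norm_join_zero, Real.norm_eq_abs] at h5
      rw [inv_mul_le_iff₀ (abs_pos.2 hs)]
      refine h5.trans ?_
      have : Lf ≤ |Lf| := le_abs_self _
      calc _ ≤ |Lf| * (|s| * ‖g‖) * (1 + ‖r + s • join g 0‖ ^ α + ‖r‖ ^ α + ‖e‖ ^ α) := by gcongr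
        _ = _ := by ring)
    rwa [abs_of_nonneg (by positivity)] at h5
  rw [zero_smul, add_zero] at h4
  have hnn : 0 ≤ |Lf| * (1 + 2 * ‖r‖ ^ α + ‖e‖ ^ α) := by positivity
  rcases (norm_nonneg g).eq_or_lt with h0 | hpos
  · rw [← h0]; exact hnn
  · refine le_of_mul_le_mul_left ?_ hpos
    calc ‖g‖ * ‖g‖ = ‖g‖ ^ 2 := by ring
      _ ≤ _ := h4
      _ = _ := by ring

lemma abs_apply_le_norm {m : Type*} [Fintype m] (v : EuclideanSpace ℝ m) (i : m) : |v i| ≤ ‖v‖ :=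
  PiLp.norm_apply_le v i

instance (B : MatP l) : IsProbabilityMeasure (lawB B) := by unfold lawB; infer_instance

lemma lawB_eq_jointLaw (B : MatP l) : lawB B = jointLaw l B := rfl

lemma allMoments_gradX (hα : 0 ≤ α) (hf_meas : Measurable (fun p : OutP l × Out l => f p.1 p.2))
    (hf_lip : PseudoLipschitzOuter α Lf f)
    (hf_smooth : ∀ y e : Out l, LSmooth L (slice f y e)) (B : MatP l) (i : Fin l) :
    AllMoments (fun p : OutP l × Out l => gradX f p.1 p.2 i) (lawB B) := by
  have h1 : AllMoments (fun p : OutP l × Out l => ‖p.1‖) (lawB B) :=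
    (allMoments_norm_of_isGaussian (multivariateGaussian 0 B)).comp
      (measurePreserving_fst_jointLaw (S := B))
  have h2 : AllMoments (fun p : OutP l × Out l => ‖p.2‖) (lawB B) := allMoments_norm_snd (S := B)
  have hm := measurable_gradX hf_meas hf_smooth
  refine ((((AllMoments.const 1).add ((h1.rpow (fun _ => norm_nonneg _) hα).const_mul 2)).add
    (h2.rpow (fun _ => norm_nonneg _) hα)).const_mul |Lf|).mono ?_ (ae_of_all _ fun p => ?_)
  · generalize gradX f = G at hm ⊢
    exact (show Measurable fun p : OutP l × Out l => G p.1 p.2 i by fun_prop).aestronglyMeasurable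
  · exact (abs_apply_le_norm _ _).trans (norm_gradX_le_rpow hα hf_lip hf_smooth _ _)

lemma fisher_posSemidef (hα : 0 ≤ α) (hf_meas : Measurable (fun p : OutP l × Out l => f p.1 p.2))
    (hf_lip : PseudoLipschitzOuter α Lf f)
    (hf_smooth : ∀ y e : Out l, LSmooth L (slice f y e)) (B : MatP l) :
    (fisher f B).PosSemidef := by
  have hA := allMoments_gradX hα hf_meas hf_lip hf_smooth B
  refine Matrix.posSemidef_iff_dotProduct_mulVec.2 ⟨?_, fun v => ?_⟩
  · ext i j
    simp only [Matrix.conjTranspose_apply, star_trivial, fisher]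
    simp_rw [mul_comm]
  · have : star v ⬝ᵥ fisher f B *ᵥ v = ∫ p, (∑ i, v i * gradX f p.1 p.2 i) ^ 2 ∂(lawB B) := by
      simp_rw [sq, Finset.sum_mul_sum]
      rw [integral_finsetSum _ fun i _ => (AllMoments.sum _ fun j _ =>
        ((hA i).const_mul (v i)).mul ((hA j).const_mul (v j))).integrable]
      simp only [dotProduct, Matrix.mulVec, star_trivial, Finset.mul_sum]
      refine Finset.sum_congr rfl fun i _ => ?_
      rw [integral_finsetSum _ fun j _ => (((hA i).const_mul (v i)).mul
        ((hA j).const_mul (v j))).integrable]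
      refine Finset.sum_congr rfl fun j _ => ?_
      rw [fisher, mul_comm _ (v j), mul_left_comm, ← integral_const_mul, ← integral_const_mul]
      exact integral_congr_ae (ae_of_all _ fun p => by ring)
    rw [this]
    exact integral_nonneg fun p => sq_nonneg _

lemma trace_fisher (hα : 0 ≤ α) (hf_meas : Measurable (fun p : OutP l × Out l => f p.1 p.2))
    (hf_lip : PseudoLipschitzOuter α Lf f)
    (hf_smooth : ∀ y e : Out l, LSmooth L (slice f y e)) (B : MatP l) :
    (fisher f B).trace = ∫ p, ‖gradX f p.1 p.2‖ ^ 2 ∂(lawB B) := by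
  have hA := allMoments_gradX hα hf_meas hf_lip hf_smooth B
  simp_rw [EuclideanSpace.real_norm_sq_eq, sq]
  rw [integral_finsetSum _ fun i _ => ((hA i).mul (hA i)).integrable]
  rfl

/-- `tr (B₁₁ - 2 B₁₂ + B₂₂)`. -/
def diffTrace (B : MatP l) : ℝ := (B.toBlocks₁₁ - (2 : ℝ) • B.toBlocks₁₂ + B.toBlocks₂₂).trace

lemma diffTrace_eq_sum (B : MatP l) : diffTrace B = ∑ j : Fin l, (B (Sum.inl j) (Sum.inl j)
    - 2 * B (Sum.inl j) (Sum.inr j) + B (Sum.inr j) (Sum.inr j)) := by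
  simp [diffTrace, Matrix.trace, Matrix.toBlocks₁₁, Matrix.toBlocks₁₂, Matrix.toBlocks₂₂]

/-- The vector `e_j ⊕ (-e_j)`. -/
noncomputable def diffVec (j : Fin l) : OutP l :=
  EuclideanSpace.single (Sum.inl j) (1 : ℝ) - EuclideanSpace.single (Sum.inr j) (1 : ℝ)

lemma inner_diffVec (j : Fin l) (r : OutP l) :
    inner ℝ (diffVec j) r = (fstPart r - sndPart r) j := by
  simp [diffVec, inner_sub_left, EuclideanSpace.inner_single_left, fstPart, sndPart]

lemma inner_single_inr (j : Fin l) (r : OutP l) :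
    inner ℝ (EuclideanSpace.single (Sum.inr j) (1 : ℝ) : OutP l) r = sndPart r j := by
  simp [EuclideanSpace.inner_single_left, sndPart]

lemma quadForm_diffVec {B : MatP l} (hB : Bᵀ = B) (j : Fin l) :
    (diffVec j).ofLp ⬝ᵥ B *ᵥ (diffVec j).ofLp = B (Sum.inl j) (Sum.inl j)
      - 2 * B (Sum.inl j) (Sum.inr j) + B (Sum.inr j) (Sum.inr j) := by
  have : B (Sum.inr j) (Sum.inl j) = B (Sum.inl j) (Sum.inr j) := by
    conv_lhs => rw [← hB, Matrix.transpose_apply]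
  simp [diffVec, Matrix.mulVec_sub, sub_dotProduct, dotProduct_sub, this]
  ring

lemma quadForm_single_inr (B : MatP l) (j : Fin l) :
    (EuclideanSpace.single (Sum.inr j) (1 : ℝ) : OutP l).ofLp
      ⬝ᵥ B *ᵥ (EuclideanSpace.single (Sum.inr j) (1 : ℝ) : OutP l).ofLp
      = B (Sum.inr j) (Sum.inr j) := by
  simp

lemma diffTrace_eq_quadForm {B : MatP l} (hB : Bᵀ = B) :
    diffTrace B = ∑ j : Fin l, (diffVec j).ofLp ⬝ᵥ B *ᵥ (diffVec j).ofLp := by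
  rw [diffTrace_eq_sum]
  exact Finset.sum_congr rfl fun j _ => (quadForm_diffVec hB j).symm

lemma transpose_of_posSemidef {m : Type*} {B : Matrix m m ℝ} (hB : B.PosSemidef) : Bᵀ = B := by
  have := hB.isHermitian.eq
  rwa [Matrix.conjTranspose_eq_transpose_of_trivial] at this

lemma diffTrace_nonneg {B : MatP l} (hB : B.PosSemidef) : 0 ≤ diffTrace B := by
  rw [diffTrace_eq_quadForm (transpose_of_posSemidef hB)]
  exact Finset.sum_nonneg fun j _ => by simpa using hB.dotProduct_mulVec_nonneg (diffVec j).ofLp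

lemma norm_sq_sub_parts (r : OutP l) :
    ‖fstPart r - sndPart r‖ ^ 2 = ∑ j, (inner ℝ (diffVec j) r) ^ 2 := by
  rw [EuclideanSpace.real_norm_sq_eq]
  simp_rw [inner_diffVec]

lemma norm_sq_sndPart (r : OutP l) : ‖sndPart r‖ ^ 2
    = ∑ j, (inner ℝ (EuclideanSpace.single (Sum.inr j) (1 : ℝ) : OutP l) r) ^ 2 := by
  rw [EuclideanSpace.real_norm_sq_eq]
  simp_rw [inner_single_inr]

lemma integral_norm_sq_sub_parts {B : MatP l} (hB : B.PosSemidef) :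
    Integrable (fun r => ‖fstPart r - sndPart r‖ ^ 2) (multivariateGaussian 0 B) ∧
    ∫ r, ‖fstPart r - sndPart r‖ ^ 2 ∂(multivariateGaussian 0 B) = diffTrace B := by
  have hA : ∀ j : Fin l, AllMoments (fun r => (inner ℝ (diffVec j) r) ^ 2)
      (multivariateGaussian 0 B) := fun j => (allMoments_inner _).pow 2
  simp_rw [norm_sq_sub_parts]
  refine ⟨(AllMoments.sum _ fun j _ => hA j).integrable, ?_⟩
  rw [integral_finsetSum _ fun j _ => (hA j).integrable,
    diffTrace_eq_quadForm (transpose_of_posSemidef hB)]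
  refine Finset.sum_congr rfl fun j _ => ?_
  simpa [gaussMoment_one] using integral_inner_pow hB (diffVec j) 1

/-- By continuity in `x`, minimality need only be tested on a dense sequence, which leaves countably
many measurable conditions. Measurability is needed to transport minimality between laws. -/
lemma measurableSet_isMinOn (hf_meas : Measurable (fun p : OutP l × Out l => f p.1 p.2))
    (hf_smooth : ∀ y e : Out l, LSmooth L (slice f y e)) :
    MeasurableSet {p : Out l × Out l | IsMinOn (slice f p.1 p.2) univ p.1} := by
  have : {p : Out l × Out l | IsMinOn (slice f p.1 p.2) univ p.1}
      = ⋂ n : ℕ, {p | f (join p.1 p.1) p.2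
        ≤ f (join (TopologicalSpace.denseSeq (Out l) n) p.1) p.2} := by
    ext p
    simp only [mem_ofPred_eq, mem_iInter]
    constructor
    · exact fun hp n => hp (mem_univ _)
    · intro hp x _
      have hcl : IsClosed {x | slice f p.1 p.2 p.1 ≤ slice f p.1 p.2 x} :=
        isClosed_le continuous_const (hf_smooth p.1 p.2).1.continuous
      have : (univ : Set (Out l)) ⊆ {x | slice f p.1 p.2 p.1 ≤ slice f p.1 p.2 x} := by
        rw [← (TopologicalSpace.denseRange_denseSeq (Out l)).closure_range]
        refine hcl.closure_subset_iff.2 ?_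
        rintro _ ⟨n, rfl⟩
        exact hp n
      exact this (mem_univ x)
  rw [this]
  refine MeasurableSet.iInter fun n => measurableSet_le ?_ ?_
  · exact hf_meas.comp (Measurable.prodMk (measurable_join.comp
      (Measurable.prodMk measurable_fst measurable_fst)) measurable_snd)
  · exact hf_meas.comp (Measurable.prodMk (measurable_join.comp
      (Measurable.prodMk measurable_const measurable_fst)) measurable_snd)

/-- The hidden parameters minimize the outer function, for any Gaussian law whose second marginal
is that of the data. -/
lemma ae_isMinOn_lawB {ι : Type*} [Fintype ι] [DecidableEq ι] {S : Matrix ι ι ℝ}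
    (hf_meas : Measurable (fun p : OutP l × Out l => f p.1 p.2))
    (hf_smooth : ∀ y e : Out l, LSmooth L (slice f y e)) (hS : S.PosSemidef)
    {Y : Matrix ι (Fin l) ℝ}
    (hmin : ∀ᵐ p ∂(jointLaw l S), IsMinOn (slice f (lin Yᵀ p.1) p.2) univ (lin Yᵀ p.1))
    {B : MatP l} (hB : B.PosSemidef) (h22 : B.toBlocks₂₂ = Yᵀ * S * Y) :
    ∀ᵐ p ∂(lawB B), IsMinOn (slice f (sndPart p.1) p.2) univ (sndPart p.1) := by
  have hms := measurableSet_isMinOn hf_meas hf_smooth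
  set A : Matrix (Fin l) (Fin l ⊕ Fin l) ℝ := Matrix.fromCols 0 1 with hA
  have hAs : ∀ r : OutP l, lin A r = sndPart r := fun r => by
    ext i; simp [lin_apply, hA, sndPart, Matrix.one_apply]
  have hAB : A * B * Aᵀ = Yᵀ * S * Y := by
    rw [← h22, hA]
    ext i j
    simp [Matrix.mul_apply, Matrix.one_apply, Matrix.toBlocks₂₂]
  -- The event depends on the second component and `ε` only, and their joint law is determined by
  -- the `22` block of `B`.
  have hmap : (lawB B).map (fun p => (sndPart p.1, p.2))
      = (jointLaw l S).map (fun p => (lin Yᵀ p.1, p.2)) := by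
    have h1 := Measure.map_prod_map (multivariateGaussian 0 S) (stdGaussian (Out l))
      (f := lin Yᵀ) (g := id) (by fun_prop) measurable_id
    have h2 := Measure.map_prod_map (multivariateGaussian 0 B) (stdGaussian (Out l))
      (f := lin A) (g := id) (by fun_prop) measurable_id
    rw [map_lin_multivariateGaussian hS, Matrix.transpose_transpose] at h1
    rw [map_lin_multivariateGaussian hB, hAB] at h2
    rw [h1] at h2
    have e : (fun p : OutP l × Out l => (sndPart p.1, p.2)) = Prod.map (lin A) id := by
      exact funext fun p => Prod.ext (hAs p.1).symm rfl
    rw [e]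
    exact h2.symm
  have h3 : ∀ᵐ q ∂((jointLaw l S).map (fun p => (lin Yᵀ p.1, p.2))),
      IsMinOn (slice f q.1 q.2) univ q.1 :=
    (ae_map_iff (Measurable.aemeasurable (by fun_prop)) hms).2 hmin
  rw [← hmap] at h3
  exact ae_of_ae_map (Measurable.aemeasurable (Measurable.prodMk
    (measurable_sndPart.comp measurable_fst) measurable_snd)) h3

/-- The Fisher term is controlled by the distance. -/
lemma integral_norm_sq_gradX_le (hL : 0 < L)
    (hf_smooth : ∀ y e : Out l, LSmooth L (slice f y e)) {B : MatP l} (hB : B.PosSemidef)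
    (hmin : ∀ᵐ p ∂(lawB B), IsMinOn (slice f (sndPart p.1) p.2) univ (sndPart p.1)) :
    ∫ p, ‖gradX f p.1 p.2‖ ^ 2 ∂(lawB B) ≤ L ^ 2 * diffTrace B := by
  obtain ⟨hI, hE⟩ := integral_norm_sq_sub_parts hB
  have hI' : Integrable (fun p : OutP l × Out l => ‖fstPart p.1 - sndPart p.1‖ ^ 2) (lawB B) :=
    (measurePreserving_fst_jointLaw (S := B)).integrable_comp_of_integrable hI
  have hE' : ∫ p, ‖fstPart p.1 - sndPart p.1‖ ^ 2 ∂(lawB B) = diffTrace B := by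
    rw [← hE]
    have := integral_map (μ := lawB B) (φ := Prod.fst) (by fun_prop)
      (f := fun r : OutP l => ‖fstPart r - sndPart r‖ ^ 2)
      (by
        have h1 := measurable_fstPart (l := l)
        have h2 := measurable_sndPart (l := l)
        exact Measurable.aestronglyMeasurable (by fun_prop))
    rw [← this]
    congr 1
    exact (measurePreserving_fst_jointLaw (l := l) (S := B)).map_eq
  rw [← hE', ← integral_const_mul]
  refine integral_mono_of_nonneg (ae_of_all _ fun p => sq_nonneg _) (hI'.const_mul _) ?_
  filter_upwards [hmin] with p hp
  have := norm_gradX_le hL hf_smooth hp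
  calc ‖gradX f p.1 p.2‖ ^ 2 ≤ (L * ‖fstPart p.1 - sndPart p.1‖) ^ 2 := by gcongr
    _ = _ := by ring

/-- The restricted secant inequality in the mean. -/
lemma le_integral_inner_gradX {μ θ ζ₀ m : ℝ} (hμ : 0 < μ) (hm : 0 < m)
    (hζ₀ : 10 * Real.exp (-(θ / (8 * m))) ≤ ζ₀)
    (hf_rsi : ∀ y e : Out l, RSI μ θ (slice f y e)) {B : MatP l} (hB : B.PosSemidef)
    (hmin : ∀ᵐ p ∂(lawB B), IsMinOn (slice f (sndPart p.1) p.2) univ (sndPart p.1))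
    (hint : Integrable (fun p : OutP l × Out l =>
      inner ℝ (fstPart p.1 - sndPart p.1) (gradX f p.1 p.2)) (lawB B))
    (h1 : diffTrace B ≤ m) (h2 : B.toBlocks₂₂.trace ≤ m) :
    μ * (1 - ζ₀) * diffTrace B
      ≤ ∫ p, inner ℝ (fstPart p.1 - sndPart p.1) (gradX f p.1 p.2) ∂(lawB B) := by
  obtain ⟨hI, hE⟩ := integral_norm_sq_sub_parts hB
  have hBt := transpose_of_posSemidef hB
  have htail := integral_tail_le hB (fun j : Fin l => diffVec j)
    (fun j : Fin l => (EuclideanSpace.single (Sum.inr j) (1 : ℝ) : OutP l)) (θ := θ) hm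
    (by rw [← diffTrace_eq_quadForm hBt]; exact h1)
    (by simp_rw [quadForm_single_inr]; exact h2)
  rw [← diffTrace_eq_quadForm hBt] at htail
  simp_rw [← norm_sq_sub_parts, ← norm_sq_sndPart] at htail
  have hm1 := measurable_fstPart (l := l)
  have hm2 := measurable_sndPart (l := l)
  -- The part of the squared distance on which the secant inequality gives only nonnegativity.
  set bad : OutP l → ℝ := fun r => if max (‖sndPart r‖ ^ 2) (‖fstPart r - sndPart r‖ ^ 2) ≤ θ
    then 0 else ‖fstPart r - sndPart r‖ ^ 2 with hbad
  have hbm : Measurable bad := by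
    refine Measurable.ite (measurableSet_le ?_ measurable_const) measurable_const ?_ <;> fun_prop
  have hbI : Integrable bad (multivariateGaussian 0 B) := by
    refine hI.mono' hbm.aestronglyMeasurable (ae_of_all _ fun r => ?_)
    simp only [hbad]
    split_ifs
    · simp
    · simp
  have hmp := measurePreserving_fst_jointLaw (l := l) (S := B)
  have hgI : Integrable (fun p : OutP l × Out l => μ * (‖fstPart p.1 - sndPart p.1‖ ^ 2
      - bad p.1)) (lawB B) :=
    ((hmp.integrable_comp_of_integrable (hI.sub hbI)).const_mul μ)
  have hge : ∫ p, μ * (‖fstPart p.1 - sndPart p.1‖ ^ 2 - bad p.1) ∂(lawB B)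
      ≤ ∫ p, inner ℝ (fstPart p.1 - sndPart p.1) (gradX f p.1 p.2) ∂(lawB B) := by
    refine integral_mono_ae hgI hint ?_
    filter_upwards [hmin] with p hp
    refine le_trans ?_ (rsi_gradX hf_rsi hp)
    simp only [hbad]
    split_ifs <;> simp
  refine le_trans ?_ hge
  have heq : ∫ p, μ * (‖fstPart p.1 - sndPart p.1‖ ^ 2 - bad p.1) ∂(lawB B)
      = μ * (diffTrace B - ∫ r, bad r ∂(multivariateGaussian 0 B)) := by
    rw [integral_const_mul, ← hE, ← integral_sub hI hbI]
    congr 1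
    have := integral_map (μ := lawB B) (φ := Prod.fst) (by fun_prop)
      (f := fun r : OutP l => ‖fstPart r - sndPart r‖ ^ 2 - bad r)
      (Measurable.aestronglyMeasurable (by fun_prop))
    rw [← this]
    congr 1
    exact hmp.map_eq
  rw [heq, mul_assoc]
  refine mul_le_mul_of_nonneg_left ?_ hμ.le
  have h3 : 10 * Real.exp (-(θ / (8 * m))) * diffTrace B ≤ ζ₀ * diffTrace B :=
    mul_le_mul_of_nonneg_right hζ₀ (diffTrace_nonneg hB)
  linarith [htail.trans h3]

end Drift

/-- The standing assumptions on the outer function `f` and the mean `h`. -/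
structure Regular {l : ℕ} (f : OutP l → Out l → ℝ) (h : MatP l → ℝ) (U : Set (MatP l))
    (α Lf Lh LI μ θ L : ℝ) : Prop where
  α_nonneg : 0 ≤ α
  μ_pos : 0 < μ
  θ_pos : 0 < θ
  L_pos : 0 < L
  f_meas : Measurable (fun p : OutP l × Out l => f p.1 p.2)
  f_int : Integrable (f 0) (stdGaussian (Out l))
  f_lip : PseudoLipschitzOuter α Lf f
  U_open : IsOpen U
  h_symm : ∀ B, h Bᵀ = h B
  h_risk : ∀ B ∈ U, B.PosSemidef → h B = meanLoss f B
  h_C1 : ContDiffOn ℝ 1 h U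
  h_lip : PseudoLipschitzOn α Lh (matGrad h) U
  I_lip : PseudoLipschitzOn α LI (fisher f) (U ∩ {B | B.PosSemidef})
  f_smooth : ∀ y e : Out l, LSmooth L (slice f y e)
  f_rsi : ∀ y e : Out l, RSI μ θ (slice f y e)

/-! ### Spectral coordinates of the covariance. -/

section Spectral

variable {d : ℕ} {K : Matrix (Fin d) (Fin d) ℝ}

lemma frob_sq {m n : Type*} [Fintype m] [Fintype n] (A : Matrix m n ℝ) :
    ‖A‖ ^ 2 = ∑ i, ∑ j, A i j ^ 2 := by
  rw [Matrix.frobenius_norm_def]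
  have h0 : 0 ≤ ∑ i, ∑ j, ‖A i j‖ ^ (2 : ℝ) := by positivity
  rw [← Real.sqrt_eq_rpow, Real.sq_sqrt h0]
  simp

lemma abs_entry_le_norm {m n : Type*} [Fintype m] [Fintype n] (A : Matrix m n ℝ) (i : m) (j : n) :
    |A i j| ≤ ‖A‖ := by
  refine abs_le_of_sq_le_sq ?_ (norm_nonneg _)
  rw [frob_sq]
  exact (Finset.single_le_sum (f := fun j => A i j ^ 2) (fun j _ => sq_nonneg _)
    (Finset.mem_univ j)).trans (Finset.single_le_sum (f := fun i => ∑ j, A i j ^ 2)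
    (fun i _ => Finset.sum_nonneg fun j _ => sq_nonneg _) (Finset.mem_univ i))

lemma eigenvalues_le_opNorm (hK : K.IsHermitian) (i : Fin d) : hK.eigenvalues i ≤ opNorm K := by
  have h1 := hK.mulVec_eigenvectorBasis i
  have h2 : Matrix.toEuclideanCLM (n := Fin d) (𝕜 := ℝ) K (hK.eigenvectorBasis i)
      = hK.eigenvalues i • hK.eigenvectorBasis i := by
    ext j
    have := congrFun h1 j
    simpa using this
  have h3 := (Matrix.toEuclideanCLM (n := Fin d) (𝕜 := ℝ) K).le_opNorm (hK.eigenvectorBasis i)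
  rw [h2, norm_smul, hK.eigenvectorBasis.orthonormal.1 i, mul_one, mul_one] at h3
  exact (le_abs_self _).trans h3

lemma lamMin_le (hK : K.IsHermitian) (i : Fin d) : lamMin hK ≤ hK.eigenvalues i :=
  ciInf_le (Set.finite_range _).bddBelow i

/-- Coordinates in the eigenbasis: `Qᵀ X`. -/
noncomputable def rot {κ : Type*} (hK : K.IsHermitian) (X : Matrix (Fin d) κ ℝ) :
    Matrix (Fin d) κ ℝ :=
  (hK.eigenvectorUnitary : Matrix (Fin d) (Fin d) ℝ)ᵀ * X

lemma unitary_mul_transpose (hK : K.IsHermitian) :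
    (hK.eigenvectorUnitary : Matrix (Fin d) (Fin d) ℝ)
      * (hK.eigenvectorUnitary : Matrix (Fin d) (Fin d) ℝ)ᵀ = 1 := by
  have := Unitary.coe_mul_star_self hK.eigenvectorUnitary
  rwa [Unitary.coe_star, Matrix.star_eq_conjTranspose, Matrix.conjTranspose_eq_transpose_of_trivial] at this

lemma unitary_transpose_mul (hK : K.IsHermitian) :
    (hK.eigenvectorUnitary : Matrix (Fin d) (Fin d) ℝ)ᵀ
      * (hK.eigenvectorUnitary : Matrix (Fin d) (Fin d) ℝ) = 1 := by
  have := Unitary.coe_star_mul_self hK.eigenvectorUnitary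
  rwa [Matrix.star_eq_conjTranspose, Matrix.conjTranspose_eq_transpose_of_trivial] at this

lemma transpose_mulVec_eigenvectorBasis {κ : Type*} (hK : K.IsHermitian)
    (X : Matrix (Fin d) κ ℝ) (i : Fin d) :
    Xᵀ *ᵥ (fun j => hK.eigenvectorBasis i j) = rot hK X i := by
  ext p
  simp only [Matrix.mulVec, dotProduct, rot, Matrix.mul_apply, Matrix.transpose_apply,
    Matrix.IsHermitian.eigenvectorUnitary_apply]
  exact Finset.sum_congr rfl fun j _ => mul_comm _ _

lemma rot_transpose_mul_rot {κ κ' : Type*} (hK : K.IsHermitian) (X : Matrix (Fin d) κ ℝ)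
    (Y : Matrix (Fin d) κ' ℝ) : (rot hK X)ᵀ * rot hK Y = Xᵀ * Y := by
  rw [rot, rot, Matrix.transpose_mul, Matrix.transpose_transpose, Matrix.mul_assoc,
    ← Matrix.mul_assoc _ _ Y, unitary_mul_transpose, Matrix.one_mul]

lemma eq_unitary_diagonal (hK : K.IsHermitian) :
    K = (hK.eigenvectorUnitary : Matrix (Fin d) (Fin d) ℝ) * Matrix.diagonal hK.eigenvalues
      * (hK.eigenvectorUnitary : Matrix (Fin d) (Fin d) ℝ)ᵀ := by
  have := hK.spectral_theorem
  rw [Unitary.conjStarAlgAut_apply, Matrix.star_eq_conjTranspose,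
    Matrix.conjTranspose_eq_transpose_of_trivial] at this
  exact this

lemma rot_diagonal_rot {κ κ' : Type*} (hK : K.IsHermitian) (X : Matrix (Fin d) κ ℝ)
    (Y : Matrix (Fin d) κ' ℝ) :
    (rot hK X)ᵀ * Matrix.diagonal hK.eigenvalues * rot hK Y = Xᵀ * K * Y := by
  conv_rhs => rw [eq_unitary_diagonal hK]
  simp only [rot, Matrix.transpose_mul, Matrix.transpose_transpose, Matrix.mul_assoc]

lemma norm_sq_eq_trace {m n : Type*} [Fintype m] [Fintype n] (A : Matrix m n ℝ) :
    ‖A‖ ^ 2 = (Aᵀ * A).trace := by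
  rw [frob_sq, Finset.sum_comm]
  simp [Matrix.trace, Matrix.mul_apply, sq]

lemma norm_rot {κ : Type*} [Fintype κ] (hK : K.IsHermitian) (X : Matrix (Fin d) κ ℝ) :
    ‖rot hK X‖ = ‖X‖ := by
  have : ‖rot hK X‖ ^ 2 = ‖X‖ ^ 2 := by
    rw [norm_sq_eq_trace, norm_sq_eq_trace, rot_transpose_mul_rot]
  exact (pow_left_inj₀ (norm_nonneg _) (norm_nonneg _) two_ne_zero).1 this

lemma trace_transpose_mul_mul_le {κ : Type*} [Fintype κ] (hK : K.IsHermitian)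
    (X : Matrix (Fin d) κ ℝ) : (Xᵀ * K * X).trace ≤ opNorm K * ‖X‖ ^ 2 := by
  rw [← rot_diagonal_rot hK, ← norm_rot hK, frob_sq, Finset.mul_sum]
  simp only [Matrix.trace, Matrix.diag, Matrix.mul_apply, Matrix.transpose_apply]
  rw [Finset.sum_comm]
  refine Finset.sum_le_sum fun i _ => ?_
  rw [Finset.mul_sum]
  refine Finset.sum_le_sum fun j _ => ?_
  have := eigenvalues_le_opNorm hK i
  simp only [Matrix.diagonal_apply, mul_ite, mul_zero, Finset.sum_ite_eq', Finset.mem_univ, if_true]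
  nlinarith [sq_nonneg (rot hK X i j)]

end Spectral

/-! ### Matrix form of the equation and the derivative of `𝓓²`. -/

section Ode

variable {l : ℕ} {f : OutP l → Out l → ℝ} {h : MatP l → ℝ} {U : Set (MatP l)}
  {α Lf Lh LI μ θ L : ℝ}

/-- The upper block row of `G`, completed by zeros. -/
def upperRow (G : MatP l) : MatP l := Matrix.fromBlocks G.toBlocks₁₁ G.toBlocks₁₂ 0 0

/-- The matrix `F` in the `11` block, completed by zeros. -/
def upperLeft (F : Matrix (Fin l) (Fin l) ℝ) : MatP l := Matrix.fromBlocks F 0 0 0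

/-- For symmetric arguments the block equations combine into `-2λγ (G M + M Gᵀ) + λγ² F`, where `G`
is the upper block row of `∇h`. This shape shows that the positive semidefinite cone is preserved,
and linearity in `M` lets the equations be averaged. -/
lemma odeRHS_eq (γ lam : ℝ) {A M : MatP l} (hG : (matGrad h A)ᵀ = matGrad h A) (hM : Mᵀ = M) :
    odeRHS f h γ A lam M = (-(2 * lam * γ)) • (upperRow (matGrad h A) * M
      + M * (upperRow (matGrad h A))ᵀ) + (lam * γ ^ 2) • upperLeft (fisher f A) := by
  have h1 : (matGrad h A).toBlocks₁₁ᵀ = (matGrad h A).toBlocks₁₁ := by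
    ext i j; exact congrFun (congrFun hG (Sum.inl i)) (Sum.inl j)
  have hM1 : M.toBlocks₁₁ᵀ = M.toBlocks₁₁ := by
    ext i j; exact congrFun (congrFun hM (Sum.inl i)) (Sum.inl j)
  have hM2 : M.toBlocks₁₂ᵀ = M.toBlocks₂₁ := by
    ext i j; exact congrFun (congrFun hM (Sum.inr i)) (Sum.inl j)
  have hM2' : M.toBlocks₂₁ᵀ = M.toBlocks₁₂ := by rw [← hM2, Matrix.transpose_transpose]
  have hM3 : M.toBlocks₂₂ᵀ = M.toBlocks₂₂ := by
    ext i j; exact congrFun (congrFun hM (Sum.inr i)) (Sum.inr j)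
  have e1 : upperRow (matGrad h A) * M = Matrix.fromBlocks
      ((matGrad h A).toBlocks₁₁ * M.toBlocks₁₁ + (matGrad h A).toBlocks₁₂ * M.toBlocks₂₁)
      ((matGrad h A).toBlocks₁₁ * M.toBlocks₁₂ + (matGrad h A).toBlocks₁₂ * M.toBlocks₂₂) 0 0 := by
    conv_lhs => rw [upperRow, ← Matrix.fromBlocks_toBlocks M, Matrix.fromBlocks_multiply]
    simp
  have e2 : M * (upperRow (matGrad h A))ᵀ = (upperRow (matGrad h A) * M)ᵀ := by
    rw [Matrix.transpose_mul, hM]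
  rw [e2, e1, Matrix.fromBlocks_transpose, Matrix.fromBlocks_add, Matrix.fromBlocks_smul,
    upperLeft, Matrix.fromBlocks_smul, Matrix.fromBlocks_add, odeRHS]
  simp only [Matrix.transpose_add, Matrix.transpose_mul, h1, hM1, hM2, hM2', hM3,
    Matrix.transpose_zero, add_zero, zero_add, smul_zero, Matrix.transpose_smul]
  congr 1
  congr 2
  abel

lemma diffTrace_add (A B : MatP l) : diffTrace (A + B) = diffTrace A + diffTrace B := by
  simp only [diffTrace_eq_sum, Matrix.add_apply, ← Finset.sum_add_distrib]
  exact Finset.sum_congr rfl fun j _ => by ring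

lemma diffTrace_smul (c : ℝ) (A : MatP l) : diffTrace (c • A) = c * diffTrace A := by
  simp only [diffTrace_eq_sum, Matrix.smul_apply, smul_eq_mul, Finset.mul_sum]
  exact Finset.sum_congr rfl fun j _ => by ring

/-- `diffTrace` as a linear map. -/
def diffTraceLin : MatP l →ₗ[ℝ] ℝ where
  toFun := diffTrace
  map_add' := diffTrace_add
  map_smul' c A := by simp [diffTrace_smul]

lemma distSq_eq {d : ℕ} (B : Fin d → MatP l) : distSq B = (1 / (d : ℝ)) * ∑ i, diffTrace (B i) := rfl

lemma diffTrace_avgB {d : ℕ} (lam : Fin d → ℝ) (B : Fin d → MatP l) :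
    diffTrace (avgB lam B) = (1 / (d : ℝ)) * ∑ i, lam i * diffTrace (B i) := by
  change diffTraceLin _ = _
  simp only [avgB, map_smul, map_sum, smul_eq_mul]
  rfl

/-- The block matrix `(1, -1)`, as a column. -/
def diffMat (l : ℕ) : Matrix (Fin l ⊕ Fin l) (Fin l) ℝ := Matrix.fromRows 1 (-1)

/-- The right side is the expression produced by `integral_inner_gradX` for the direction `(1, -1)`,
that is, for the test function `x - y`. -/
lemma diffTrace_upperRow (G : MatP l) {M : MatP l} (hM : Mᵀ = M) :
    diffTrace (upperRow G * M + M * (upperRow G)ᵀ)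
      = 2 * ∑ q, ∑ s, G (Sum.inl q) s * (M * diffMat l) s q := by
  have e2 : M * (upperRow G)ᵀ = (upperRow G * M)ᵀ := by
    rw [Matrix.transpose_mul, hM]
  have hl : ∀ q t, (upperRow G * M) (Sum.inl q) t = ∑ s, G (Sum.inl q) s * M s t := fun q t => by
    simp [Matrix.mul_apply, upperRow, Matrix.toBlocks₁₁, Matrix.toBlocks₁₂]
  have hr : ∀ q t, (upperRow G * M) (Sum.inr q) t = 0 := fun q t => by
    simp [Matrix.mul_apply, upperRow]
  have hv : ∀ s q, (M * diffMat l) s q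
      = M s (Sum.inl q) - M s (Sum.inr q) := fun s q => by
    simp [Matrix.mul_apply, Matrix.one_apply, diffMat, sub_eq_add_neg]
  rw [e2, diffTrace_eq_sum, Finset.mul_sum]
  refine Finset.sum_congr rfl fun q _ => ?_
  simp only [Matrix.add_apply, Matrix.transpose_apply, hl, hr, hv]
  simp only [mul_sub, Finset.sum_sub_distrib]
  ring

lemma diffTrace_upperLeft (F : Matrix (Fin l) (Fin l) ℝ) :
    diffTrace (upperLeft F) = F.trace := by
  simp [diffTrace, upperLeft]

lemma matGrad_transpose (R : Regular f h U α Lf Lh LI μ θ L) {A : MatP l} (hA : A ∈ U)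
    (hp : Aᵀ = A) : (matGrad h A)ᵀ = matGrad h A :=
  matGrad_symm R.h_symm ((R.h_C1.differentiableOn one_ne_zero).differentiableAt
    (R.U_open.mem_nhds hA)) hp

/-- `integral_inner_gradX` with the output vector itself as data: covariance `A`, `W = 1` and `V =
(1, -1)`. -/
lemma integral_inner_sub_gradX (R : Regular f h U α Lf Lh LI μ θ L) {A : MatP l} (hA : A ∈ U)
    (hp : A.PosSemidef) :
    Integrable (fun p : OutP l × Out l =>
      inner ℝ (fstPart p.1 - sndPart p.1) (gradX f p.1 p.2)) (lawB A) ∧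
    diffTrace (upperRow (matGrad h A) * A + A * (upperRow (matGrad h A))ᵀ)
      = ∫ p, inner ℝ (fstPart p.1 - sndPart p.1) (gradX f p.1 p.2) ∂(lawB A) := by
  have hone : (1 : MatP l)ᵀ * A * (1 : MatP l) = A := by simp
  have key := fun hi => integral_inner_gradX R.α_nonneg R.f_meas R.f_int R.f_lip R.f_smooth
    R.U_open R.h_symm R.h_risk R.h_C1 hp (1 : MatP l) hi
    (diffMat l)
  have hi := hasDerivAt_integral_f_lin (S := A) R.α_nonneg R.f_meas R.f_int R.f_lip R.f_smooth
    (1 : MatP l) (diffMat l) |>.1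
  have key := key (by rw [hone]; exact hA)
  rw [hone] at key
  have h1 : ∀ r : OutP l, lin (1 : MatP l)ᵀ r = r := fun r => by
    ext i; simp [lin_apply, Matrix.one_apply]
  have h2 : ∀ r : OutP l, lin (diffMat l)ᵀ r
      = fstPart r - sndPart r := fun r => by
    ext i
    simp [lin_apply, Matrix.one_apply, diffMat, fstPart, sndPart, sub_eq_add_neg]
  simp_rw [h1, h2] at key hi
  refine ⟨hi, ?_⟩
  rw [diffTrace_upperRow _ (transpose_of_posSemidef hp), lawB_eq_jointLaw, key,
    Matrix.transpose_one, Matrix.one_mul]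

lemma avgB_posSemidef {d : ℕ} {lam : Fin d → ℝ} (hl : ∀ i, 0 ≤ lam i) {B : Fin d → MatP l}
    (hB : ∀ i, (B i).PosSemidef) : (avgB lam B).PosSemidef :=
  (Matrix.posSemidef_sum _ fun i _ => (hB i).smul (hl i)).smul (by positivity)

/-- The derivative of `𝓓²`. -/
lemma sum_diffTrace_odeRHS (R : Regular f h U α Lf Lh LI μ θ L) {d : ℕ} {lam : Fin d → ℝ}
    (hl : ∀ i, 0 ≤ lam i) {B : Fin d → MatP l} (hB : ∀ i, (B i).PosSemidef)
    (hU : avgB lam B ∈ U) (γ : ℝ) :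
    (1 / (d : ℝ)) * ∑ i, diffTrace (odeRHS f h γ (avgB lam B) (lam i) (B i))
      = -(2 * γ) * (∫ p, inner ℝ (fstPart p.1 - sndPart p.1) (gradX f p.1 p.2)
          ∂(lawB (avgB lam B)))
        + γ ^ 2 * ((1 / (d : ℝ)) * ∑ i, lam i)
          * ∫ p, ‖gradX f p.1 p.2‖ ^ 2 ∂(lawB (avgB lam B)) := by
  have hp := avgB_posSemidef hl hB
  set A := avgB lam B with hA
  have hG := matGrad_transpose R hU (transpose_of_posSemidef hp)
  rw [← (integral_inner_sub_gradX R hU hp).2, ← trace_fisher R.α_nonneg R.f_meas R.f_lip R.f_smooth]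
  have h1 : ∀ i, diffTrace (odeRHS f h γ A (lam i) (B i))
      = -(2 * γ) * (lam i * diffTrace (upperRow (matGrad h A) * B i
        + B i * (upperRow (matGrad h A))ᵀ)) + lam i * γ ^ 2 * (fisher f A).trace := fun i => by
    rw [odeRHS_eq γ (lam i) hG (transpose_of_posSemidef (hB i)), diffTrace_add, diffTrace_smul,
      diffTrace_smul, diffTrace_upperLeft]
    ring
  -- The factor `λᵢ` in the `i`-th equation turns the plain average of the drifts into the drift at
  -- `A = (1/d) ∑ᵢ λᵢ Bᵢ`, so the derivative of `𝓓²` depends on the solution through `A` alone.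
  have h2 : diffTrace (upperRow (matGrad h A) * A + A * (upperRow (matGrad h A))ᵀ)
      = (1 / (d : ℝ)) * ∑ i, lam i * diffTrace (upperRow (matGrad h A) * B i
        + B i * (upperRow (matGrad h A))ᵀ) := by
    have : upperRow (matGrad h A) * A + A * (upperRow (matGrad h A))ᵀ
        = avgB lam (fun i => upperRow (matGrad h A) * B i + B i * (upperRow (matGrad h A))ᵀ) := by
      generalize upperRow (matGrad h A) = G
      rw [hA]
      simp only [avgB, Matrix.mul_smul, Matrix.smul_mul, Matrix.mul_sum, Matrix.sum_mul, smul_add,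
        Finset.sum_add_distrib]
    rw [this, diffTrace_avgB]
  rw [h2]
  simp_rw [h1]
  rw [Finset.sum_add_distrib, ← Finset.mul_sum, ← Finset.sum_mul, ← Finset.sum_mul]
  ring

end Ode

/-! ### Differential inequalities on `[0, Θ)`. -/

section Interval

variable {Θ : EReal}

lemma mem_timeIco_of_le {s t : ℝ} (ht : t ∈ timeIco Θ) (hs : 0 ≤ s) (hst : s ≤ t) :
    s ∈ timeIco Θ :=
  ⟨hs, lt_of_le_of_lt (EReal.coe_le_coe_iff.2 hst) ht.2⟩

lemma Icc_subset_timeIco {t : ℝ} (ht : t ∈ timeIco Θ) : Icc 0 t ⊆ timeIco Θ :=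
  fun _ hs => mem_timeIco_of_le ht hs.1 hs.2

lemma timeIco_mem_nhdsGE {t : ℝ} (ht : t ∈ timeIco Θ) : timeIco Θ ∈ 𝓝[≥] t := by
  obtain ⟨b, hb1, hb2⟩ := EReal.lt_iff_exists_real_btwn.1 ht.2
  have hb1 : t < b := EReal.coe_lt_coe_iff.1 hb1
  refine mem_of_superset (Icc_mem_nhdsGE hb1) fun s hs => ⟨ht.1.trans hs.1, ?_⟩
  exact lt_of_le_of_lt (EReal.coe_le_coe_iff.2 hs.2) hb2

lemma HasDerivWithinAt.timeIco_Ici {E : Type*} [NormedAddCommGroup E] [NormedSpace ℝ E]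
    {u : ℝ → E} {u' : E} {t : ℝ} (ht : t ∈ timeIco Θ) (h : HasDerivWithinAt u u' (timeIco Θ) t) :
    HasDerivWithinAt u u' (Ici t) t :=
  h.mono_of_mem_nhdsWithin (timeIco_mem_nhdsGE ht)

lemma HasDerivWithinAt.linMap {l : ℕ} {E : Type*} [NormedAddCommGroup E] [NormedSpace ℝ E]
    (φ : MatP l →ₗ[ℝ] E) {u : ℝ → MatP l} {u' : MatP l} {s : Set ℝ} {t : ℝ}
    (h : HasDerivWithinAt u u' s t) : HasDerivWithinAt (fun x => φ (u x)) (φ u') s t :=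
  (LinearMap.toContinuousLinearMap φ).hasFDerivAt.comp_hasDerivWithinAt t h

/-- A differential inequality which holds below a level keeps the solution below this level, and
hence holds for all times. -/
lemma exp_decay_of_deriv_le {u u' : ℝ → ℝ} {a m : ℝ} (ha : 0 < a) (hm : 0 < m) (h0 : u 0 < m)
    (hd : ∀ t ∈ timeIco Θ, HasDerivWithinAt u (u' t) (timeIco Θ) t)
    (hle : ∀ t ∈ timeIco Θ, u t ≤ m → u' t ≤ -a * u t) {t : ℝ} (ht : t ∈ timeIco Θ) :
    u t ≤ m ∧ u t ≤ u 0 * Real.exp (-a * t) := by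
  have hsub := Icc_subset_timeIco ht
  have hc : ContinuousOn u (Icc 0 t) := fun s hs =>
    ((hd s (hsub hs)).continuousWithinAt).mono hsub
  have hder : ∀ s ∈ Ico 0 t, HasDerivWithinAt u (u' s) (Ici s) s := fun s hs =>
    (hd s (hsub (Ico_subset_Icc_self hs))).timeIco_Ici (hsub (Ico_subset_Icc_self hs))
  -- Barrier argument: where `u` equals `m` its derivative is at most `-a m < 0`, so the level is
  -- never crossed.
  have h1 : ∀ s ∈ Icc 0 t, u s ≤ m := fun s hs =>
    image_le_of_deriv_right_lt_deriv_boundary hc hder h0.le (fun x => hasDerivAt_const x m)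
      (fun x hx he => by
        have := hle x (hsub (Ico_subset_Icc_self hx)) he.le
        rw [he] at this
        exact lt_of_le_of_lt this (by nlinarith)) hs
  refine ⟨h1 t (right_mem_Icc.2 ht.1), ?_⟩
  -- Gronwall's inequality with the negative rate `-a`; the differential inequality now holds on the
  -- whole interval.
  have h2 := le_gronwallBound_of_liminf_deriv_right_le (f := u) (f' := u') (δ := u 0) (K := -a)
    (ε := 0) hc (fun x hx r hr => (hder x hx).liminf_right_slope_le hr) le_rfl
    (fun x hx => by
      rw [add_zero]
      exact hle x (hsub (Ico_subset_Icc_self hx)) (h1 x (Ico_subset_Icc_self hx))) t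
    (right_mem_Icc.2 ht.1)
  rwa [gronwallBound_ε0, sub_zero] at h2

end Interval

/-! ### Conserved quantities and exponential decay of `𝓓²`. -/

section Solution

variable {l d : ℕ} {f : OutP l → Out l → ℝ} {h : MatP l → ℝ} {U : Set (MatP l)}
  {α Lf Lh LI μ θ L γ : ℝ} {K : Matrix (Fin d) (Fin d) ℝ} {hK : K.IsHermitian}
  {X₀ Xs : Matrix (Fin d) (Fin l) ℝ} {Θ : EReal} {B : ℝ → Fin d → MatP l}

lemma IsODESolution.init_apply (hB : IsODESolution f h U γ hK X₀ Xs Θ B) (i : Fin d)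
    (p q : Fin l ⊕ Fin l) : B 0 i p q = d * (rot hK (Matrix.fromCols X₀ Xs) i p
      * rot hK (Matrix.fromCols X₀ Xs) i q) := by
  rw [hB.init i, transpose_mulVec_eigenvectorBasis]
  simp [Matrix.vecMulVec_apply]

lemma rot_fromCols_inl (hK : K.IsHermitian) (X Y : Matrix (Fin d) (Fin l) ℝ) (i : Fin d)
    (p : Fin l) : rot hK (Matrix.fromCols X Y) i (Sum.inl p) = rot hK X i p := by
  simp [rot, Matrix.mul_apply]

lemma rot_fromCols_inr (hK : K.IsHermitian) (X Y : Matrix (Fin d) (Fin l) ℝ) (i : Fin d)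
    (p : Fin l) : rot hK (Matrix.fromCols X Y) i (Sum.inr p) = rot hK Y i p := by
  simp [rot, Matrix.mul_apply]

lemma rot_sub {κ : Type*} (hK : K.IsHermitian) (X Y : Matrix (Fin d) κ ℝ) :
    rot hK (X - Y) = rot hK X - rot hK Y := by
  simp [rot, Matrix.mul_sub]

/-- The field has zero `22` block. Hence the law of the hidden output never changes along the flow,
and its almost sure minimality persists. -/
lemma IsODESolution.inr_inr (hB : IsODESolution f h U γ hK X₀ Xs Θ B) {t : ℝ} (ht : t ∈ timeIco Θ)
    (i : Fin d) (p q : Fin l) :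
    B t i (Sum.inr p) (Sum.inr q) = d * (rot hK Xs i p * rot hK Xs i q) := by
  have hsub := Icc_subset_timeIco ht
  have hd : ∀ s ∈ timeIco Θ, HasDerivWithinAt (fun s => B s i (Sum.inr p) (Sum.inr q)) 0
      (timeIco Θ) s := fun s hs =>
    (hB.deriv s hs i).linMap (Matrix.entryLinearMap ℝ ℝ (Sum.inr p) (Sum.inr q))
  have := constant_of_has_deriv_right_zero (f := fun s => B s i (Sum.inr p) (Sum.inr q))
    (fun s hs => ((hd s (hsub hs)).continuousWithinAt).mono hsub)
    (fun s hs => (hd s (hsub (Ico_subset_Icc_self hs))).timeIco_Ici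
      (hsub (Ico_subset_Icc_self hs))) t (right_mem_Icc.2 ht.1)
  rw [this, hB.init_apply, rot_fromCols_inr, rot_fromCols_inr]

lemma IsODESolution.avgB_inr_inr (hd : 1 ≤ d) (hB : IsODESolution f h U γ hK X₀ Xs Θ B) {t : ℝ}
    (ht : t ∈ timeIco Θ) : (avgB hK.eigenvalues (B t)).toBlocks₂₂ = Xsᵀ * K * Xs := by
  have hd' : (d : ℝ) ≠ 0 := by positivity
  rw [← rot_diagonal_rot hK]
  ext p q
  simp only [Matrix.toBlocks₂₂, avgB, Matrix.of_apply, Matrix.smul_apply, Matrix.sum_apply,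
    hB.inr_inr ht, smul_eq_mul, Matrix.mul_apply, Matrix.transpose_apply, Matrix.diagonal_apply,
    mul_ite, mul_zero, Finset.sum_ite_eq', Finset.mem_univ, if_true, Finset.mul_sum]
  refine Finset.sum_congr rfl fun i _ => ?_
  field_simp

lemma IsODESolution.distSq_zero (hd : 1 ≤ d) (hB : IsODESolution f h U γ hK X₀ Xs Θ B) :
    distSq (B 0) = ‖X₀ - Xs‖ ^ 2 := by
  have hd' : (d : ℝ) ≠ 0 := by positivity
  rw [← norm_rot hK, frob_sq, distSq_eq, Finset.mul_sum]
  refine Finset.sum_congr rfl fun i _ => ?_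
  rw [diffTrace_eq_sum, Finset.mul_sum]
  refine Finset.sum_congr rfl fun j _ => ?_
  simp only [hB.init_apply, rot_fromCols_inl, rot_fromCols_inr, rot_sub, Matrix.sub_apply]
  field_simp
  ring

/-- The threshold of the initial condition can be increased slightly. -/
lemma exists_threshold {κ m₀ ζ₀ : ℝ} (hκ : 0 < κ) (hθ : 0 < θ) (hm₀ : 0 ≤ m₀) (hζ₀ : 0 < ζ₀)
    (hm : m₀ ≠ 0 → 10 * Real.exp (-(θ / (8 * κ * m₀))) < ζ₀) :
    ∃ m, m₀ < m ∧ 10 * Real.exp (-(θ / (8 * (κ * m)))) ≤ ζ₀ := by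
  -- If `m₀ = 0` the exponential tends to `0` as `m ↓ 0`; otherwise the strict inequality at `m₀`
  -- extends to nearby `m` by continuity.
  rcases hm₀.eq_or_lt with h0 | hpos
  · have : Tendsto (fun m : ℝ => 10 * Real.exp (-(θ / (8 * κ) * m⁻¹))) (𝓝[>] 0) (𝓝 (10 * 0)) :=
      (Real.tendsto_exp_neg_atTop_nhds_zero.comp
        ((tendsto_inv_nhdsGT_zero (𝕜 := ℝ)).const_mul_atTop (by positivity))).const_mul 10
    rw [mul_zero] at this
    obtain ⟨m, hm1, hm2⟩ := ((this.eventually_lt_const hζ₀).and self_mem_nhdsWithin).exists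
    refine ⟨m, h0 ▸ hm2, ?_⟩
    have hm2 : 0 < m := hm2
    rw [show θ / (8 * (κ * m)) = θ / (8 * κ) * m⁻¹ by field_simp]
    exact hm1.le
  · have hc : ContinuousAt (fun m : ℝ => 10 * Real.exp (-(θ / (8 * κ * m)))) m₀ := by
      have : 8 * κ * m₀ ≠ 0 := by positivity
      fun_prop (disch := assumption)
    have h1 : ∀ᶠ m in 𝓝[>] m₀, 10 * Real.exp (-(θ / (8 * κ * m))) < ζ₀ :=
      (hc.eventually_lt_const (hm hpos.ne')).filter_mono nhdsWithin_le_nhds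
    obtain ⟨m, hm1, hm2⟩ := (h1.and self_mem_nhdsWithin).exists
    refine ⟨m, hm2, ?_⟩
    rw [← mul_assoc]
    exact hm1.le

lemma stepSize_pos {ζ : ℝ} (hd : 1 ≤ d) (hμ : 0 < μ) (hL : 0 < L) (hζ : 0 < ζ) (hK : K.PosDef) :
    0 < stepSize μ L ζ K := by
  have : 0 < K.trace := by
    have : Nonempty (Fin d) := ⟨⟨0, hd⟩⟩
    exact Finset.sum_pos (fun i _ => hK.diag_pos) Finset.univ_nonempty
  have : (0 : ℝ) < d := by positivity
  unfold stepSize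
  positivity

lemma stepSize_mul {ζ : ℝ} (hd : 1 ≤ d) (hL : 0 < L) (hK : K.PosDef) :
    stepSize μ L ζ K * (L ^ 2 * ((1 / (d : ℝ)) * ∑ i, hK.isHermitian.eigenvalues i))
      = 2 * μ * ζ := by
  have h1 : 0 < K.trace := by
    have : Nonempty (Fin d) := ⟨⟨0, hd⟩⟩
    exact Finset.sum_pos (fun i _ => hK.diag_pos) Finset.univ_nonempty
  have h2 : (0 : ℝ) < d := by positivity
  have h3 : ∑ i, hK.isHermitian.eigenvalues i = K.trace := by
    rw [hK.isHermitian.trace_eq_sum_eigenvalues]; simp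
  rw [h3, stepSize]
  field_simp

lemma lamMin_pos (hd : 1 ≤ d) (hK : K.PosDef) : 0 < lamMin hK.isHermitian := by
  have : Nonempty (Fin d) := ⟨⟨0, hd⟩⟩
  obtain ⟨i, hi⟩ := exists_eq_ciInf_of_finite (f := hK.isHermitian.eigenvalues)
  rw [lamMin, ← hi]
  exact hK.eigenvalues_pos i

/-- Exponential decay of `𝓓²`. -/
theorem IsODESolution.distSq_le (R : Regular f h U α Lf Lh LI μ θ L) {ζ₀ ζ : ℝ} (hζ₀ : 0 < ζ₀)
    (hζ : 0 < ζ) (hζ' : ζ < 1 - ζ₀) (hd : 1 ≤ d) (hK : K.PosDef)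
    (hmin : ∀ᵐ p ∂(jointLaw l K), IsMinOn (slice f (lin Xsᵀ p.1) p.2) univ (lin Xsᵀ p.1))
    (h_init : max (‖X₀ - Xs‖ ^ 2) (‖Xs‖ ^ 2) ≠ 0 →
      10 * Real.exp (-(θ / (8 * opNorm K * max (‖X₀ - Xs‖ ^ 2) (‖Xs‖ ^ 2)))) < ζ₀)
    (hB : IsODESolution f h U (stepSize μ L ζ K) hK.isHermitian X₀ Xs Θ B) {t : ℝ}
    (ht : t ∈ timeIco Θ) :
    distSq (B t) ≤ ‖X₀ - Xs‖ ^ 2 * Real.exp (-(stepSize μ L ζ K * (1 - ζ₀ - ζ) * μ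
      * lamMin hK.isHermitian) * t) := by
  set γ := stepSize μ L ζ K with hγ
  set lam := hK.isHermitian.eigenvalues with hlam
  have hγ0 : 0 < γ := stepSize_pos hd R.μ_pos R.L_pos hζ hK
  have hlm := lamMin_pos hd hK
  have hl0 : ∀ i, 0 ≤ lam i := fun i => (hK.eigenvalues_pos i).le
  have hκ : 0 < opNorm K := lt_of_lt_of_le (hK.eigenvalues_pos ⟨0, hd⟩)
    (eigenvalues_le_opNorm hK.isHermitian ⟨0, hd⟩)
  -- The barrier argument needs a level strictly above the initial value of `𝓓²` at which the tail
  -- is still at most `ζ₀`.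
  obtain ⟨m, hm1, hm2⟩ := exists_threshold hκ R.θ_pos
    (le_max_of_le_left (sq_nonneg ‖X₀ - Xs‖)) hζ₀ h_init
  have hmpos : 0 < m := lt_of_le_of_lt (le_max_of_le_left (sq_nonneg ‖X₀ - Xs‖)) hm1
  have hd0 : (0 : ℝ) < d := by positivity
  set a := γ * (1 - ζ₀ - ζ) * μ * lamMin hK.isHermitian with ha
  have hμ := R.μ_pos
  have h1ζ : 0 < 1 - ζ₀ - ζ := by linarith
  have hapos : 0 < a := by positivity
  have hderiv : ∀ s ∈ timeIco Θ, HasDerivWithinAt (fun s => distSq (B s))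
      ((1 / (d : ℝ)) * ∑ i, diffTrace (odeRHS f h γ (avgB lam (B s)) (lam i) (B s i)))
      (timeIco Θ) s := fun s hs => by
    simp only [distSq_eq]
    refine HasDerivWithinAt.const_mul _ (HasDerivWithinAt.fun_sum fun i _ => ?_)
    exact (hB.deriv s hs i).linMap diffTraceLin
  have hle : ∀ s ∈ timeIco Θ, distSq (B s) ≤ m →
      (1 / (d : ℝ)) * ∑ i, diffTrace (odeRHS f h γ (avgB lam (B s)) (lam i) (B s i))
        ≤ -a * distSq (B s) := by
    intro s hs hsm
    have hpsd := hB.psd s hs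
    have hAp := avgB_posSemidef hl0 hpsd
    have hAU := hB.mem s hs
    have h22 := hB.avgB_inr_inr hd hs
    rw [sum_diffTrace_odeRHS R hl0 hpsd hAU]
    have hmin' := ae_isMinOn_lawB R.f_meas R.f_smooth hK.posSemidef hmin hAp h22
    have hdn : ∀ i, 0 ≤ diffTrace (B s i) := fun i => diffTrace_nonneg (hpsd i)
    have hτ1 : diffTrace (avgB lam (B s)) ≤ opNorm K * distSq (B s) := by
      rw [diffTrace_avgB, distSq_eq, mul_left_comm]
      refine mul_le_mul_of_nonneg_left ?_ (by positivity)
      rw [Finset.mul_sum]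
      exact Finset.sum_le_sum fun i _ =>
        mul_le_mul_of_nonneg_right (eigenvalues_le_opNorm _ i) (hdn i)
    have hτ2 : lamMin hK.isHermitian * distSq (B s) ≤ diffTrace (avgB lam (B s)) := by
      rw [diffTrace_avgB, distSq_eq, mul_left_comm]
      refine mul_le_mul_of_nonneg_left ?_ (by positivity)
      rw [Finset.mul_sum]
      exact Finset.sum_le_sum fun i _ =>
        mul_le_mul_of_nonneg_right (lamMin_le _ i) (hdn i)
    have hJ := le_integral_inner_gradX (m := opNorm K * m) R.μ_pos (by positivity) hm2 R.f_rsi hAp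
      hmin' (integral_inner_sub_gradX R hAU hAp).1
      (hτ1.trans (mul_le_mul_of_nonneg_left hsm hκ.le))
      (by
        rw [h22]
        exact (trace_transpose_mul_mul_le hK.isHermitian Xs).trans
          (mul_le_mul_of_nonneg_left ((le_max_right _ _).trans hm1.le) hκ.le))
    have hF := integral_norm_sq_gradX_le R.L_pos R.f_smooth hAp hmin'
    set τ := diffTrace (avgB lam (B s)) with hτ
    have hτ0 : 0 ≤ τ := diffTrace_nonneg hAp
    -- By the choice of step size the Fisher term is at most `2γμζ τ`, against a drift of at most
    -- `-2γμ(1 - ζ₀) τ`. The sum is `-2γμ(1 - ζ₀ - ζ) τ`; the claimed rate uses half of it and `τ ≥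
    -- λ_min 𝓓²`.
    have hgk : γ * (L ^ 2 * ((1 / (d : ℝ)) * ∑ i, lam i)) = 2 * μ * ζ := stepSize_mul hd R.L_pos hK
    have hs0 : 0 ≤ ∑ i, lam i := Finset.sum_nonneg fun i _ => hl0 i
    have h2 : γ ^ 2 * ((1 / (d : ℝ)) * ∑ i, lam i)
          * ∫ p, ‖gradX f p.1 p.2‖ ^ 2 ∂(lawB (avgB lam (B s)))
        ≤ γ ^ 2 * ((1 / (d : ℝ)) * ∑ i, lam i) * (L ^ 2 * τ) :=
      mul_le_mul_of_nonneg_left hF (by positivity)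
    have h3 : γ ^ 2 * ((1 / (d : ℝ)) * ∑ i, lam i) * (L ^ 2 * τ) = γ * (2 * μ * ζ) * τ := by
      rw [← hgk]; ring
    have h4 : (2 * γ) * (μ * (1 - ζ₀) * τ) ≤ (2 * γ) * ∫ p, inner ℝ (fstPart p.1 - sndPart p.1)
        (gradX f p.1 p.2) ∂(lawB (avgB lam (B s))) :=
      mul_le_mul_of_nonneg_left hJ (by positivity)
    have h5 : γ * (1 - ζ₀ - ζ) * μ * (lamMin hK.isHermitian * distSq (B s))
        ≤ γ * (1 - ζ₀ - ζ) * μ * τ := mul_le_mul_of_nonneg_left hτ2 (by positivity)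
    have h6 : 0 ≤ γ * (1 - ζ₀ - ζ) * μ * τ := by positivity
    rw [ha]
    nlinarith
  have h0 := hB.distSq_zero hd
  have := (exp_decay_of_deriv_le hapos hmpos (u := fun s => distSq (B s)) (by
    simp only [h0]; exact lt_of_le_of_lt (le_max_left _ _) hm1) hderiv hle ht).2
  simp only [h0] at this
  exact this

end Solution

/-! ### Invariance of closed sets under tangent vector fields. -/

section Viability

variable {E : Type*} [NormedAddCommGroup E] [NormedSpace ℝ E]

/-- A curve which solves the equation of a Lipschitz vector field stays in a closed set to which
the field is tangent. -/
lemma mem_of_tangent [ProperSpace E] {S : Set E} (hS : IsClosed S) {x₀ : E} (hx : x₀ ∈ S)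
    {ρ δ : ℝ} {G : E → E} {K : NNReal} (hG : LipschitzWith K G)
    (hsub : ∀ p ∈ S, dist p x₀ ≤ ρ → ∃ q : E, ∀ s : ℝ, 0 ≤ s → p + s • G p + s ^ 2 • q ∈ S)
    {y : ℝ → E} (hy0 : y 0 = x₀) (hyb : ∀ t ∈ Icc 0 δ, 2 * dist (y t) x₀ ≤ ρ)
    (hy : ∀ t ∈ Icc 0 δ, HasDerivWithinAt y (G (y t)) (Icc 0 δ) t) :
    ∀ t ∈ Icc 0 δ, y t ∈ S := by
  have hne : S.Nonempty := ⟨x₀, hx⟩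
  have hc : ContinuousOn (fun t => Metric.infDist (y t) S) (Icc 0 δ) := fun t ht =>
    (Metric.continuous_infDist_pt S).continuousAt.comp_continuousWithinAt
      (hy t ht).continuousWithinAt
  -- The distance to `S` starts at `0` and its lower right derivative is at most `K` times itself,
  -- so it vanishes identically.
  have key := le_gronwallBound_of_liminf_deriv_right_le (f := fun t => Metric.infDist (y t) S)
    (f' := fun t => K * Metric.infDist (y t) S) (δ := 0) (K := K) (ε := 0) hc ?_ ?_ ?_
  · intro t ht
    have := key t ht
    rw [gronwallBound_ε0, zero_mul] at this
    exact (hS.mem_iff_infDist_zero hne).2 (le_antisymm this Metric.infDist_nonneg)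
  · intro t ht r hr
    have ht' := Ico_subset_Icc_self ht
    -- A nearest point `p` of `S` is at distance at most `2 dist (y t) x₀` from `x₀`; this is the
    -- reason for the factor `2` in the hypothesis on `y`.
    obtain ⟨p, hpS, hp⟩ := hS.exists_infDist_eq_dist hne (y t)
    have hpx : dist p x₀ ≤ ρ := by
      have h1 := dist_triangle p (y t) x₀
      have h2 := Metric.infDist_le_dist_of_mem (x := y t) hx
      rw [dist_comm p (y t), ← hp] at h1
      linarith [hyb t ht']
    obtain ⟨q, hq⟩ := hsub p hpS hpx
    have hd : HasDerivWithinAt y (G (y t)) (Ioi t) t :=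
      ((hy t ht').mono_of_mem_nhdsWithin (mem_of_superset (Icc_mem_nhdsGE ht.2)
        (Icc_subset_Icc_left ht.1))).mono Ioi_subset_Ici_self
    set η := r - K * Metric.infDist (y t) S with hη
    have hη0 : 0 < η := sub_pos.2 hr
    have h1 := (hasDerivWithinAt_iff_isLittleO.1 hd).def (c := η / 2) (by positivity)
    have h2 : ∀ᶠ z in 𝓝[>] t, (z - t) * ‖q‖ < η / 2 := by
      have : Tendsto (fun z => (z - t) * ‖q‖) (𝓝[>] t) (𝓝 ((t - t) * ‖q‖)) :=
        ((continuous_id.sub continuous_const).mul continuous_const).continuousAt.tendsto.mono_left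
          nhdsWithin_le_nhds
      rw [sub_self, zero_mul] at this
      exact this.eventually_lt_const (by positivity)
    refine (Eventually.frequently ?_)
    filter_upwards [h1, h2, self_mem_nhdsWithin] with z hz1 hz2 hz3
    have hs : 0 < z - t := sub_pos.2 hz3
    set s := z - t with hs_def
    rw [Real.norm_eq_abs, abs_of_pos hs] at hz1
    -- The curve is compared with the corrected Euler step from `p`, which lies in `S`. Their
    -- distance grows at most at the rate `‖G (y t) - G p‖`, up to the differentiability error and
    -- the term `s² q`.
    have e1 : Metric.infDist (y z) S ≤ ‖y z - (p + s • G p + s ^ 2 • q)‖ := by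
      rw [← dist_eq_norm]
      exact Metric.infDist_le_dist_of_mem (hq s hs.le)
    have e2 : y z - (p + s • G p + s ^ 2 • q) = (y z - y t - s • G (y t)) + (y t - p)
        + s • (G (y t) - G p) - s ^ 2 • q := by
      rw [smul_sub]; abel
    have e3 : ‖G (y t) - G p‖ ≤ K * Metric.infDist (y t) S := by
      rw [hp, ← dist_eq_norm]; exact hG.dist_le_mul _ _
    have e4 : ‖y t - p‖ = Metric.infDist (y t) S := by rw [hp, dist_eq_norm]
    have e5 : ‖y z - (p + s • G p + s ^ 2 • q)‖ ≤ η / 2 * s + Metric.infDist (y t) S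
        + s * (K * Metric.infDist (y t) S) + s ^ 2 * ‖q‖ := by
      rw [e2]
      refine (norm_sub_le _ _).trans (add_le_add ((norm_add₃_le).trans
        (add_le_add (add_le_add hz1 e4.le) ?_)) ?_)
      · rw [norm_smul, Real.norm_eq_abs, abs_of_pos hs]
        exact mul_le_mul_of_nonneg_left e3 hs.le
      · rw [norm_smul, Real.norm_eq_abs, abs_of_pos (by positivity)]
    have e6 : Metric.infDist (y z) S - Metric.infDist (y t) S < s * r := by
      have : s * (s * ‖q‖) < s * (η / 2) := mul_lt_mul_of_pos_left hz2 hs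
      have hr' : r = η + K * Metric.infDist (y t) S := by rw [hη]; ring
      rw [hr']
      nlinarith
    rw [inv_mul_lt_iff₀ hs]
    exact e6
  · simp only [hy0]
    exact (Metric.infDist_zero_of_mem hx).le
  · intro t _
    rw [add_zero]

/-- Local existence of solutions which stay in a closed set to which the field is tangent. -/
lemma exists_solution_mem [FiniteDimensional ℝ E] {S : Set E} (hS : IsClosed S) {x₀ : E}
    (hx : x₀ ∈ S) {ρ : ℝ} (hρ : 0 < ρ) {G : E → E} {K : NNReal}
    (hG : LipschitzOnWith K G (S ∩ Metric.closedBall x₀ ρ))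
    (hsub : ∀ p ∈ S, dist p x₀ ≤ ρ → ∃ q : E, ∀ s : ℝ, 0 ≤ s → p + s • G p + s ^ 2 • q ∈ S) :
    ∃ δ > 0, ∃ y : ℝ → E, y 0 = x₀ ∧ ∀ t ∈ Icc 0 δ, y t ∈ S ∧ dist (y t) x₀ ≤ ρ ∧
      HasDerivWithinAt y (G (y t)) (Icc 0 δ) t := by
  have : ProperSpace E := FiniteDimensional.proper_real E
  have : CompleteSpace E := FiniteDimensional.complete ℝ E
  -- The field is Lipschitz only within `S`, where an iteration need not stay. The equation is
  -- solved for a global Lipschitz extension, and tangency then shows that the solution is in `S`,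
  -- where both fields agree.
  obtain ⟨G', hG', hGG'⟩ := hG.extend_finite_dimension
  set K' := lipschitzExtensionConstant E * K
  set M : NNReal := ‖G' x₀‖₊ + K' + 1 with hM
  have hMpos : (0 : ℝ) < M := by rw [hM]; push_cast; positivity
  set δ₀ : ℝ := 1 / M with hδ₀
  have hδ₀pos : 0 < δ₀ := by positivity
  have hpl : IsPicardLindelof (fun _ => G') (tmin := 0) (tmax := δ₀)
      ⟨0, left_mem_Icc.2 hδ₀pos.le⟩ x₀ 1 0 M K' := by
    refine IsPicardLindelof.of_time_independent (fun x hx => ?_) hG'.lipschitzOnWith ?_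
    · have h1 := hG'.dist_le_mul x x₀
      have h2 : dist x x₀ ≤ 1 := by simpa using hx
      rw [dist_eq_norm] at h1
      have h3 : ‖G' x‖ ≤ ‖G' x - G' x₀‖ + ‖G' x₀‖ := by
        simpa using norm_add_le (G' x - G' x₀) (G' x₀)
      have h4 : (K' : ℝ) * dist x x₀ ≤ K' * 1 := mul_le_mul_of_nonneg_left h2 K'.2
      rw [hM]; push_cast
      linarith
    · simp only [sub_zero, sub_self, NNReal.coe_one, NNReal.coe_zero]
      rw [max_eq_left hδ₀pos.le, hδ₀, mul_one_div_cancel hMpos.ne']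
  obtain ⟨y, hy0, hy⟩ := hpl.exists_eq_forall_mem_Icc_hasDerivWithinAt₀
  have hy0 : y 0 = x₀ := hy0
  have hcont : ∀ᶠ t in 𝓝[≥] (0 : ℝ), dist (y t) x₀ < ρ / 2 := by
    have h1 : ContinuousWithinAt y (Icc 0 δ₀) 0 :=
      (hy 0 (left_mem_Icc.2 hδ₀pos.le)).continuousWithinAt
    have h2 : ContinuousWithinAt y (Ici 0) 0 := h1.mono_of_mem_nhdsWithin (Icc_mem_nhdsGE hδ₀pos)
    have h3 := h2.tendsto.dist (tendsto_const_nhds (x := x₀))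
    rw [hy0, dist_self] at h3
    exact h3.eventually_lt_const (by positivity)
  obtain ⟨δ₁, hδ₁, hsub₁⟩ := (mem_nhdsGE_iff_exists_Icc_subset).1 hcont
  have hδ₁ : 0 < δ₁ := hδ₁
  set δ := min δ₀ δ₁ with hδ
  have hδpos : 0 < δ := lt_min hδ₀pos hδ₁
  have hdist : ∀ t ∈ Icc 0 δ, dist (y t) x₀ < ρ / 2 := fun t ht =>
    hsub₁ ⟨ht.1, ht.2.trans (min_le_right _ _)⟩
  have hy' : ∀ t ∈ Icc 0 δ, HasDerivWithinAt y (G' (y t)) (Icc 0 δ) t := fun t ht =>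
    (hy t ⟨ht.1, ht.2.trans (min_le_left _ _)⟩).mono (Icc_subset_Icc_right (min_le_left _ _))
  have hmem := mem_of_tangent hS hx (ρ := ρ) hG' (fun p hp hpx => by
    obtain ⟨q, hq⟩ := hsub p hp hpx
    exact ⟨q, by rw [← hGG' ⟨hp, hpx⟩]; exact hq⟩) hy0
    (fun t ht => by linarith [hdist t ht]) hy'
  refine ⟨δ, hδpos, y, hy0, fun t ht => ⟨hmem t ht, by linarith [hdist t ht], ?_⟩⟩
  rw [hGG' ⟨hmem t ht, by
    rw [Metric.mem_closedBall]; linarith [hdist t ht]⟩]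
  exact hy' t ht

end Viability

/-! ### Local bounds for the coefficients and norms of positive semidefinite matrices. -/

section Bounds

variable {l : ℕ} {f : OutP l → Out l → ℝ} {h : MatP l → ℝ} {U : Set (MatP l)}
  {α Lf Lh LI μ θ L : ℝ}

/-- Decompose into matrices `v vᵀ`, for which norm and trace coincide. -/
lemma norm_le_trace_of_posSemidef {n : Type*} [Fintype n] [DecidableEq n] {A : Matrix n n ℝ}
    (hA : A.PosSemidef) : ‖A‖ ≤ A.trace := by
  obtain ⟨m, v, rfl⟩ := Matrix.posSemidef_iff_eq_sum_vecMulVec.1 hA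
  rw [Matrix.trace_sum]
  refine (norm_sum_le _ _).trans (Finset.sum_le_sum fun i _ => ?_)
  have h0 : 0 ≤ v i ⬝ᵥ v i := Finset.sum_nonneg fun j _ => mul_self_nonneg _
  rw [star_trivial, Matrix.trace_vecMulVec]
  refine abs_le_of_sq_le_sq' ?_ h0 |>.2
  rw [frob_sq, sq, dotProduct, Finset.sum_mul_sum]
  refine (Finset.sum_congr rfl fun j _ => Finset.sum_congr rfl fun k _ => ?_).le
  rw [Matrix.vecMulVec_apply]; ring

lemma isClosed_posSemidef {n : Type*} [Fintype n] [DecidableEq n] :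
    IsClosed {A : Matrix n n ℝ | A.PosSemidef} := by
  have : {A : Matrix n n ℝ | A.PosSemidef} = {A | Aᵀ = A} ∩ ⋂ x : n → ℝ,
      {A | 0 ≤ x ⬝ᵥ A *ᵥ x} := by
    ext A
    simp only [mem_ofPred_eq, mem_inter_iff, mem_iInter, Matrix.posSemidef_iff_dotProduct_mulVec,
      Matrix.IsHermitian, Matrix.conjTranspose_eq_transpose_of_trivial, star_trivial]
  rw [this]
  refine IsClosed.inter (isClosed_eq (by fun_prop) (by fun_prop)) (isClosed_iInter fun x => ?_)
  exact isClosed_le (by fun_prop) (by fun_prop)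

lemma PseudoLipschitzOn.exists_bound {m : Type} [Fintype m] {F : MatP l → Matrix m m ℝ} {Λ : ℝ}
    {s : Set (MatP l)} (hα : 0 ≤ α) (hF : PseudoLipschitzOn α Λ F s) (ρ : ℝ) :
    ∃ c, 0 ≤ c ∧ (∀ A ∈ s, ‖A‖ ≤ ρ → ‖F A‖ ≤ c) ∧
      ∀ A ∈ s, ∀ A' ∈ s, ‖A‖ ≤ ρ → ‖A'‖ ≤ ρ → ‖F A - F A'‖ ≤ c * ‖A - A'‖ := by
  rcases (s ∩ {A | ‖A‖ ≤ ρ}).eq_empty_or_nonempty with h0 | ⟨A₀, hA₀, hA₀ρ⟩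
  · have h1 : ∀ A ∈ s, ¬ ‖A‖ ≤ ρ := fun A hA hAρ =>
      (eq_empty_iff_forall_notMem.1 h0 A) ⟨hA, hAρ⟩
    exact ⟨0, le_rfl, fun A hA hρ => absurd hρ (h1 A hA), fun A hA _ _ hρ => absurd hρ (h1 A hA)⟩
  · have hA₀ρ : ‖A₀‖ ≤ ρ := hA₀ρ
    have hρ : 0 ≤ ρ := (norm_nonneg _).trans hA₀ρ
    set c := |Λ| * (1 + ρ ^ α + ρ ^ α) with hc
    have hc0 : 0 ≤ c := by positivity
    have hlip : ∀ A ∈ s, ∀ A' ∈ s, ‖A‖ ≤ ρ → ‖A'‖ ≤ ρ → ‖F A - F A'‖ ≤ c * ‖A - A'‖ := by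
      intro A hA A' hA' h1 h2
      refine (hF A hA A' hA').trans ?_
      have e1 : ‖A‖ ^ α ≤ ρ ^ α := Real.rpow_le_rpow (norm_nonneg _) h1 hα
      have e2 : ‖A'‖ ^ α ≤ ρ ^ α := Real.rpow_le_rpow (norm_nonneg _) h2 hα
      calc Λ * ‖A - A'‖ * (1 + ‖A‖ ^ α + ‖A'‖ ^ α)
          ≤ |Λ| * ‖A - A'‖ * (1 + ρ ^ α + ρ ^ α) := by gcongr; exact le_abs_self _
        _ = _ := by rw [hc]; ring
    refine ⟨c + (‖F A₀‖ + c * (ρ + ρ)), by positivity, fun A hA hAρ => ?_, fun A hA A' hA' h1 h2 =>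
      (hlip A hA A' hA' h1 h2).trans (mul_le_mul_of_nonneg_right
        (le_add_of_nonneg_right (by positivity)) (norm_nonneg _))⟩
    have e1 := hlip A hA A₀ hA₀ hAρ hA₀ρ
    have e2 : ‖A - A₀‖ ≤ ρ + ρ := (norm_sub_le _ _).trans (add_le_add hAρ hA₀ρ)
    have e3 : ‖F A‖ ≤ ‖F A - F A₀‖ + ‖F A₀‖ := by simpa using norm_add_le (F A - F A₀) (F A₀)
    have e4 : c * ‖A - A₀‖ ≤ c * (ρ + ρ) := mul_le_mul_of_nonneg_left e2 hc0
    linarith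

/-- Bounds and Lipschitz constants of the coefficients on a bounded part of `U`. -/
structure CoeffBound (f : OutP l → Out l → ℝ) (h : MatP l → ℝ) (U : Set (MatP l)) (ρ c : ℝ) :
    Prop where
  nonneg : 0 ≤ c
  grad_le : ∀ A ∈ U, A.PosSemidef → ‖A‖ ≤ ρ → ‖upperRow (matGrad h A)‖ ≤ c
  grad_sub_le : ∀ A ∈ U, A.PosSemidef → ∀ A' ∈ U, A'.PosSemidef → ‖A‖ ≤ ρ → ‖A'‖ ≤ ρ →
    ‖upperRow (matGrad h A) - upperRow (matGrad h A')‖ ≤ c * ‖A - A'‖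
  fisher_le : ∀ A ∈ U, A.PosSemidef → ‖A‖ ≤ ρ → ‖upperLeft (fisher f A)‖ ≤ c
  fisher_sub_le : ∀ A ∈ U, A.PosSemidef → ∀ A' ∈ U, A'.PosSemidef → ‖A‖ ≤ ρ → ‖A'‖ ≤ ρ →
    ‖upperLeft (fisher f A) - upperLeft (fisher f A')‖ ≤ c * ‖A - A'‖

lemma upperRow_sub (G G' : MatP l) : upperRow (G - G') = upperRow G - upperRow G' := by
  ext (i | i) (j | j) <;> simp [upperRow, Matrix.toBlocks₁₁, Matrix.toBlocks₁₂]

lemma upperLeft_sub (F F' : Matrix (Fin l) (Fin l) ℝ) :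
    upperLeft (F - F') = upperLeft F - upperLeft F' := by
  ext (i | i) (j | j) <;> simp [upperLeft]

lemma norm_upperRow_le (G : MatP l) : ‖upperRow G‖ ≤ ‖G‖ := by
  refine (pow_le_pow_iff_left₀ (norm_nonneg _) (norm_nonneg _) two_ne_zero).1 ?_
  rw [frob_sq, frob_sq]
  refine Finset.sum_le_sum fun i _ => Finset.sum_le_sum fun j _ => ?_
  rcases i with i | i <;> rcases j with j | j <;>
    simp [upperRow, Matrix.toBlocks₁₁, Matrix.toBlocks₁₂, sq_nonneg]

lemma norm_upperLeft (F : Matrix (Fin l) (Fin l) ℝ) : ‖upperLeft F‖ = ‖F‖ := by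
  refine (pow_left_inj₀ (norm_nonneg _) (norm_nonneg _) two_ne_zero).1 ?_
  rw [frob_sq, frob_sq]
  simp [upperLeft]

/-- The constant depends on `f`, `h`, `U` and `ρ` but not on the dimension of the data, which is
what makes the comparison uniform in `d`. -/
lemma Regular.exists_coeffBound (R : Regular f h U α Lf Lh LI μ θ L) (ρ : ℝ) :
    ∃ c, CoeffBound f h U ρ c := by
  obtain ⟨c₁, h0, h1, h2⟩ := R.h_lip.exists_bound R.α_nonneg ρ
  obtain ⟨c₂, k0, k1, k2⟩ := R.I_lip.exists_bound R.α_nonneg ρ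
  refine ⟨c₁ + c₂, by positivity, fun A hA _ hρ => ?_, fun A hA _ A' hA' _ hρ hρ' => ?_,
    fun A hA hp hρ => ?_, fun A hA hp A' hA' hp' hρ hρ' => ?_⟩
  · exact (norm_upperRow_le _).trans ((h1 A hA hρ).trans (by linarith))
  · rw [← upperRow_sub]
    exact (norm_upperRow_le _).trans ((h2 A hA A' hA' hρ hρ').trans
      (mul_le_mul_of_nonneg_right (by linarith) (norm_nonneg _)))
  · rw [norm_upperLeft]
    exact (k1 A ⟨hA, hp⟩ hρ).trans (by linarith)
  · rw [← upperLeft_sub, norm_upperLeft]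
    exact (k2 A ⟨hA, hp⟩ A' ⟨hA', hp'⟩ hρ hρ').trans
      (mul_le_mul_of_nonneg_right (by linarith) (norm_nonneg _))

/-- The drift `G M + M Gᵀ`. -/
def symProd (G M : MatP l) : MatP l := G * M + M * Gᵀ

lemma norm_symProd_le (G M : MatP l) : ‖symProd G M‖ ≤ 2 * (‖G‖ * ‖M‖) := by
  refine (norm_add_le _ _).trans ?_
  have h1 := Matrix.frobenius_norm_mul G M
  have h2 := Matrix.frobenius_norm_mul M Gᵀ
  rw [Matrix.frobenius_norm_transpose] at h2
  linarith

lemma symProd_sub (G G' M M' : MatP l) :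
    symProd G M - symProd G' M' = symProd (G - G') M + symProd G' (M - M') := by
  simp only [symProd, Matrix.sub_mul, Matrix.mul_sub, Matrix.transpose_sub]
  abel

lemma norm_symProd_sub_le (G G' M M' : MatP l) :
    ‖symProd G M - symProd G' M'‖ ≤ 2 * (‖G - G'‖ * ‖M‖) + 2 * (‖G'‖ * ‖M - M'‖) := by
  rw [symProd_sub]
  exact (norm_add_le _ _).trans (add_le_add (norm_symProd_le _ _) (norm_symProd_le _ _))

/-- The matrix form of `‖x‖² ≤ 2‖x - y‖² + 2‖y‖²`; the test vectors are `e_j ⊕ (-2 e_j)`. -/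
lemma trace_le_diffTrace {A : MatP l} (hA : A.PosSemidef) :
    A.trace ≤ 2 * diffTrace A + 3 * A.toBlocks₂₂.trace := by
  have key : ∀ j : Fin l, 0 ≤ A (Sum.inl j) (Sum.inl j) - 4 * A (Sum.inl j) (Sum.inr j)
      + 4 * A (Sum.inr j) (Sum.inr j) := fun j => by
    have h1 := hA.dotProduct_mulVec_nonneg (Pi.single (Sum.inl j) 1 - (2 : ℝ) • Pi.single (Sum.inr j) 1)
    have h2 : A (Sum.inr j) (Sum.inl j) = A (Sum.inl j) (Sum.inr j) :=
      congrFun (congrFun (transpose_of_posSemidef hA) (Sum.inl j)) (Sum.inr j)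
    simp only [star_trivial, Matrix.mulVec_sub, Matrix.mulVec_smul, sub_dotProduct, smul_dotProduct,
      dotProduct_sub, dotProduct_smul, Matrix.mulVec_single_one, single_one_dotProduct,
      Matrix.col_apply, h2, smul_eq_mul] at h1
    linarith
  have h1 : A.trace = ∑ j, A (Sum.inl j) (Sum.inl j) + ∑ j, A (Sum.inr j) (Sum.inr j) := by
    simp [Matrix.trace]
  have h2 : A.toBlocks₂₂.trace = ∑ j, A (Sum.inr j) (Sum.inr j) := by
    simp [Matrix.trace, Matrix.toBlocks₂₂]
  rw [h1, h2, diffTrace_eq_sum, Finset.mul_sum, Finset.mul_sum, ← Finset.sum_add_distrib,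
    ← Finset.sum_add_distrib]
  exact Finset.sum_le_sum fun j _ => by linarith [key j]

end Bounds

/-! ### Local existence in the cone of positive semidefinite matrices. -/

section Extension

variable {l d : ℕ} {f : OutP l → Out l → ℝ} {h : MatP l → ℝ} {U : Set (MatP l)}
  {α Lf Lh LI μ θ L γ : ℝ} {lam : Fin d → ℝ}

lemma Regular.odeRHS_eq (R : Regular f h U α Lf Lh LI μ θ L) (γ lam : ℝ) {A M : MatP l}
    (hA : A ∈ U) (hAp : A.PosSemidef) (hM : M.PosSemidef) :
    odeRHS f h γ A lam M = (-(2 * lam * γ)) • symProd (upperRow (matGrad h A)) M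
      + (lam * γ ^ 2) • upperLeft (fisher f A) :=
  SGDEquiv.odeRHS_eq γ lam (matGrad_transpose R hA (transpose_of_posSemidef hAp))
    (transpose_of_posSemidef hM)

lemma upperLeft_posSemidef {F : Matrix (Fin l) (Fin l) ℝ} (hF : F.PosSemidef) :
    (upperLeft F).PosSemidef := by
  have h1 : upperLeft F = (Matrix.fromRows 1 0 : Matrix (Fin l ⊕ Fin l) (Fin l) ℝ) * F
      * (Matrix.fromRows 1 0 : Matrix (Fin l ⊕ Fin l) (Fin l) ℝ)ᴴ := by
    rw [Matrix.conjTranspose_eq_transpose_of_trivial]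
    ext (i | i) (j | j) <;> simp [upperLeft, Matrix.mul_apply, Matrix.one_apply]
  rw [h1]
  exact hF.mul_mul_conjTranspose_same _

/-- Completing the square: with the term of order `s²` added, the Euler step is the congruence `(1 -
s a G) M (1 - s a G)ᵀ` plus `s b F`. This is the tangency condition of `mem_of_tangent`. -/
lemma posSemidef_step {G M F : MatP l} (hM : M.PosSemidef) (hF : F.PosSemidef) {a b : ℝ}
    (hb : 0 ≤ b) {s : ℝ} (hs : 0 ≤ s) :
    (M + s • ((-a) • symProd G M + b • F) + s ^ 2 • (a ^ 2 • (G * M * Gᵀ))).PosSemidef := by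
  have h1 : M + s • ((-a) • symProd G M + b • F) + s ^ 2 • (a ^ 2 • (G * M * Gᵀ))
      = (1 - (s * a) • G) * M * (1 - (s * a) • G)ᴴ + (s * b) • F := by
    simp only [symProd, Matrix.conjTranspose_eq_transpose_of_trivial, Matrix.transpose_sub,
      Matrix.transpose_one, Matrix.transpose_smul, Matrix.sub_mul, Matrix.mul_sub, Matrix.one_mul,
      Matrix.mul_one, Matrix.smul_mul, Matrix.mul_smul, smul_add, smul_smul, smul_sub]
    module
  rw [h1]
  exact (hM.mul_mul_conjTranspose_same _).add (hF.smul (by positivity))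

variable (f h γ lam) in
/-- The vector field of the coupled equations. -/
noncomputable def odeField (B : Fin d → MatP l) : Fin d → MatP l :=
  fun i => odeRHS f h γ (avgB lam B) (lam i) (B i)

/-- The phase space of the coupled equations. -/
def phaseSpace (U : Set (MatP l)) (lam : Fin d → ℝ) : Set (Fin d → MatP l) :=
  {B | (∀ i, (B i).PosSemidef) ∧ avgB lam B ∈ U}

lemma avgB_sub (lam : Fin d → ℝ) (B B' : Fin d → MatP l) :
    avgB lam (B - B') = avgB lam B - avgB lam B' := by
  simp only [avgB, Pi.sub_apply, smul_sub, Finset.sum_sub_distrib]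

lemma norm_avgB_le (hlam : ∀ i, 0 ≤ lam i) (B : Fin d → MatP l) :
    ‖avgB lam B‖ ≤ (1 / (d : ℝ)) * (∑ i, lam i) * ‖B‖ := by
  rw [avgB, norm_smul, Real.norm_eq_abs, abs_of_nonneg (by positivity), mul_assoc, Finset.sum_mul]
  refine mul_le_mul_of_nonneg_left ((norm_sum_le _ _).trans (Finset.sum_le_sum fun i _ => ?_))
    (by positivity)
  rw [norm_smul, Real.norm_eq_abs, abs_of_nonneg (hlam i)]
  exact mul_le_mul_of_nonneg_left (norm_le_pi_norm B i) (hlam i)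

lemma continuous_avgB : Continuous (avgB lam : (Fin d → MatP l) → MatP l) := by
  unfold avgB
  fun_prop

lemma Regular.exists_lipschitz_odeField (R : Regular f h U α Lf Lh LI μ θ L)
    (hlam : ∀ i, 0 ≤ lam i) (γ ρ : ℝ) :
    ∃ K : NNReal, LipschitzOnWith K (odeField f h γ lam) (phaseSpace U lam ∩ {B | ‖B‖ ≤ ρ}) ∧
      ∀ B ∈ phaseSpace U lam, ‖B‖ ≤ ρ → ‖odeField f h γ lam B‖ ≤ K := by
  set N := (1 / (d : ℝ)) * ∑ i, lam i with hN
  obtain ⟨c, hc⟩ := R.exists_coeffBound (f := f) (h := h) (N * ρ)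
  have hc0 := hc.nonneg
  set Λ := ∑ i, lam i with hΛ
  have hlΛ : ∀ i, lam i ≤ Λ := fun i =>
    Finset.single_le_sum (fun i _ => hlam i) (Finset.mem_univ i)
  have hΛ0 : 0 ≤ Λ := Finset.sum_nonneg fun i _ => hlam i
  have hN0 : 0 ≤ N := by positivity
  have hAb : ∀ B : Fin d → MatP l, ‖B‖ ≤ ρ → ‖avgB lam B‖ ≤ N * ρ := fun B hB => by
    exact (norm_avgB_le hlam B).trans (mul_le_mul_of_nonneg_left hB hN0)
  have ha1 : ∀ i, ‖-(2 * lam i * γ)‖ ≤ 2 * Λ * |γ| := fun i => by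
    rw [norm_neg, Real.norm_eq_abs, abs_mul, abs_of_nonneg (mul_nonneg zero_le_two (hlam i))]
    exact mul_le_mul_of_nonneg_right (by linarith [hlΛ i]) (abs_nonneg _)
  have ha2 : ∀ i, ‖lam i * γ ^ 2‖ ≤ Λ * γ ^ 2 := fun i => by
    rw [Real.norm_eq_abs, abs_of_nonneg (mul_nonneg (hlam i) (sq_nonneg γ))]
    exact mul_le_mul_of_nonneg_right (hlΛ i) (sq_nonneg _)
  set κ₁ : ℝ := 2 * Λ * |γ| * (2 * (c * N * |ρ|) + 2 * c) + Λ * γ ^ 2 * (c * N) with hκ₁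
  set κ₂ : ℝ := 2 * Λ * |γ| * (2 * (c * |ρ|)) + Λ * γ ^ 2 * c with hκ₂
  have hκ₁0 : 0 ≤ κ₁ := by positivity
  have hκ₂0 : 0 ≤ κ₂ := by positivity
  refine ⟨(κ₁ + κ₂).toNNReal, LipschitzOnWith.of_dist_le_mul fun B hB B' hB' => ?_,
    fun B hB hBρ => ?_⟩
  · obtain ⟨⟨hBp, hBU⟩, hBρ⟩ := hB
    obtain ⟨⟨hBp', hBU'⟩, hBρ'⟩ := hB'
    have hBρ : ‖B‖ ≤ ρ := hBρ
    have hBρ' : ‖B'‖ ≤ ρ := hBρ'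
    rw [Real.coe_toNNReal _ (add_nonneg hκ₁0 hκ₂0), dist_pi_le_iff (by positivity)]
    intro i
    have hAp := avgB_posSemidef hlam hBp
    have hAp' := avgB_posSemidef hlam hBp'
    simp only [odeField]
    rw [dist_eq_norm, dist_eq_norm, R.odeRHS_eq γ (lam i) hBU hAp (hBp i),
      R.odeRHS_eq γ (lam i) hBU' hAp' (hBp' i), add_sub_add_comm, ← smul_sub, ← smul_sub]
    have hAd : ‖avgB lam B - avgB lam B'‖ ≤ N * ‖B - B'‖ := by
      rw [← avgB_sub]
      exact norm_avgB_le hlam _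
    have hi : ‖B i - B' i‖ ≤ ‖B - B'‖ := norm_le_pi_norm (B - B') i
    have hib : ‖B i‖ ≤ |ρ| := (norm_le_pi_norm B i).trans (hBρ.trans (le_abs_self _))
    have e1 := hc.grad_sub_le _ hBU hAp _ hBU' hAp' (hAb B hBρ) (hAb B' hBρ')
    have e2 := hc.fisher_sub_le _ hBU hAp _ hBU' hAp' (hAb B hBρ) (hAb B' hBρ')
    have e3 := hc.grad_le _ hBU' hAp' (hAb B' hBρ')
    set x := ‖B - B'‖
    have hx : 0 ≤ x := norm_nonneg _
    have e1' : ‖upperRow (matGrad h (avgB lam B)) - upperRow (matGrad h (avgB lam B'))‖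
        ≤ c * (N * x) := e1.trans (mul_le_mul_of_nonneg_left hAd hc0)
    have e2' : ‖upperLeft (fisher f (avgB lam B)) - upperLeft (fisher f (avgB lam B'))‖
        ≤ c * (N * x) := e2.trans (mul_le_mul_of_nonneg_left hAd hc0)
    have e4 : ‖symProd (upperRow (matGrad h (avgB lam B))) (B i)
        - symProd (upperRow (matGrad h (avgB lam B'))) (B' i)‖
        ≤ 2 * (c * (N * x) * |ρ|) + 2 * (c * x) := by
      refine (norm_symProd_sub_le _ _ _ _).trans ?_
      gcongr
    refine (norm_add_le _ _).trans ?_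
    rw [norm_smul, norm_smul]
    calc _ ≤ 2 * Λ * |γ| * (2 * (c * (N * x) * |ρ|) + 2 * (c * x))
          + Λ * γ ^ 2 * (c * (N * x)) :=
          add_le_add (mul_le_mul (ha1 i) e4 (norm_nonneg _) (by positivity))
            (mul_le_mul (ha2 i) e2' (norm_nonneg _) (by positivity))
      _ = κ₁ * x := by rw [hκ₁]; ring
      _ ≤ (κ₁ + κ₂) * x := mul_le_mul_of_nonneg_right (by linarith) hx
  · obtain ⟨hBp, hBU⟩ := hB
    rw [Real.coe_toNNReal _ (add_nonneg hκ₁0 hκ₂0), pi_norm_le_iff_of_nonneg (by positivity)]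
    intro i
    have hAp := avgB_posSemidef hlam hBp
    have hib : ‖B i‖ ≤ |ρ| := (norm_le_pi_norm B i).trans (hBρ.trans (le_abs_self _))
    have e1 := hc.grad_le _ hBU hAp (hAb B hBρ)
    have e2 := hc.fisher_le _ hBU hAp (hAb B hBρ)
    simp only [odeField]
    rw [R.odeRHS_eq γ (lam i) hBU hAp (hBp i)]
    refine (norm_add_le _ _).trans ?_
    rw [norm_smul, norm_smul]
    have e3 : ‖symProd (upperRow (matGrad h (avgB lam B))) (B i)‖ ≤ 2 * (c * |ρ|) := by
      refine (norm_symProd_le _ _).trans ?_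
      gcongr
    calc _ ≤ 2 * Λ * |γ| * (2 * (c * |ρ|)) + Λ * γ ^ 2 * c :=
          add_le_add (mul_le_mul (ha1 i) e3 (norm_nonneg _) (by positivity))
            (mul_le_mul (ha2 i) e2 (norm_nonneg _) (by positivity))
      _ = κ₂ := by rw [hκ₂]
      _ ≤ κ₁ + κ₂ := by linarith

/-- Local existence in the phase space. -/
lemma Regular.exists_local_solution (R : Regular f h U α Lf Lh LI μ θ L)
    (hlam : ∀ i, 0 ≤ lam i) (γ : ℝ) {x₀ : Fin d → MatP l} (hx₀ : x₀ ∈ phaseSpace U lam) :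
    ∃ δ > 0, ∃ y : ℝ → Fin d → MatP l, y 0 = x₀ ∧ ∀ t ∈ Icc 0 δ, y t ∈ phaseSpace U lam ∧
      HasDerivWithinAt y (odeField f h γ lam (y t)) (Icc 0 δ) t := by
  have hU : (avgB lam) ⁻¹' U ∈ 𝓝 x₀ :=
    continuous_avgB.continuousAt.preimage_mem_nhds (R.U_open.mem_nhds hx₀.2)
  obtain ⟨ρ, hρ, hball⟩ := Metric.nhds_basis_closedBall.mem_iff.1 hU
  have hball : ∀ B, dist B x₀ ≤ ρ → avgB lam B ∈ U := fun B hB => hball hB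
  obtain ⟨K, hK, -⟩ := R.exists_lipschitz_odeField (f := f) (h := h) hlam γ (‖x₀‖ + ρ)
  have hS : IsClosed {B : Fin d → MatP l | ∀ i, (B i).PosSemidef} := by
    have : {B : Fin d → MatP l | ∀ i, (B i).PosSemidef}
        = ⋂ i, (fun B => B i) ⁻¹' {A : MatP l | A.PosSemidef} := by ext; simp
    rw [this]
    exact isClosed_iInter fun i => isClosed_posSemidef.preimage (continuous_apply i)
  obtain ⟨δ, hδ, y, hy0, hy⟩ := exists_solution_mem hS (x₀ := x₀) hx₀.1 hρ
    (G := odeField f h γ lam) (K := K) (hK.mono fun B hB => ⟨⟨hB.1, hball B hB.2⟩, by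
      have h1 : dist B x₀ ≤ ρ := hB.2
      rw [dist_eq_norm] at h1
      have h2 : ‖B‖ ≤ ‖B - x₀‖ + ‖x₀‖ := by simpa using norm_add_le (B - x₀) x₀
      change ‖B‖ ≤ _
      linarith⟩) (fun p hp hpx => by
      -- The second-order correction of `posSemidef_step` for `a = 2 λᵢ γ`.
      refine ⟨fun i => (2 * lam i * γ) ^ 2 • (upperRow (matGrad h (avgB lam p)) * p i
        * (upperRow (matGrad h (avgB lam p)))ᵀ), fun s hs i => ?_⟩
      have hAp := avgB_posSemidef hlam hp
      have hAU := hball p hpx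
      simp only [Pi.add_apply, Pi.smul_apply, odeField]
      rw [R.odeRHS_eq γ (lam i) hAU hAp (hp i)]
      exact posSemidef_step (hp i) (upperLeft_posSemidef (fisher_posSemidef R.α_nonneg R.f_meas
        R.f_lip R.f_smooth _)) (mul_nonneg (hlam i) (sq_nonneg γ)) hs)
  exact ⟨δ, hδ, y, hy0, fun t ht => ⟨⟨(hy t ht).1, hball _ (hy t ht).2.1⟩, (hy t ht).2.2⟩⟩

end Extension

/-! ### Continuation of bounded solutions and exit from `U`. -/

section Maximal

variable {l d : ℕ} {f : OutP l → Out l → ℝ} {h : MatP l → ℝ} {U : Set (MatP l)}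
  {α Lf Lh LI μ θ L γ : ℝ} {K : Matrix (Fin d) (Fin d) ℝ} {hK : K.IsHermitian}
  {X₀ Xs : Matrix (Fin d) (Fin l) ℝ} {Θ : EReal} {B : ℝ → Fin d → MatP l}

/-- `𝓓²` and the conserved block control the full traces, with a bound that does not involve `d`. -/
lemma IsODESolution.sum_trace_le (hd : 1 ≤ d) (hB : IsODESolution f h U γ hK X₀ Xs Θ B) {t : ℝ}
    (ht : t ∈ timeIco Θ) (hD : distSq (B t) ≤ ‖X₀ - Xs‖ ^ 2) :
    (1 / (d : ℝ)) * ∑ i, (B t i).trace ≤ 2 * ‖X₀ - Xs‖ ^ 2 + 3 * ‖Xs‖ ^ 2 := by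
  have hd' : (d : ℝ) ≠ 0 := by positivity
  have h1 : (1 / (d : ℝ)) * ∑ i, (B t i).toBlocks₂₂.trace = ‖Xs‖ ^ 2 := by
    rw [← norm_rot hK, frob_sq, Finset.mul_sum]
    refine Finset.sum_congr rfl fun i _ => ?_
    simp only [Matrix.trace, Matrix.diag, Matrix.toBlocks₂₂, Matrix.of_apply, hB.inr_inr ht,
      Finset.mul_sum]
    refine Finset.sum_congr rfl fun p _ => ?_
    field_simp
  have h2 : (1 / (d : ℝ)) * ∑ i, (B t i).trace
      ≤ (1 / (d : ℝ)) * ∑ i, (2 * diffTrace (B t i) + 3 * (B t i).toBlocks₂₂.trace) :=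
    mul_le_mul_of_nonneg_left (Finset.sum_le_sum fun i _ => trace_le_diffTrace (hB.psd t ht i))
      (by positivity)
  rw [Finset.sum_add_distrib, ← Finset.mul_sum, ← Finset.mul_sum, mul_add, mul_left_comm,
    mul_left_comm _ (3 : ℝ), h1, ← distSq_eq] at h2
  linarith

lemma timeIco_coe (a : ℝ) : timeIco (a : EReal) = Ico 0 a := by
  ext t
  simp [timeIco]

lemma IsODESolution.hasDerivWithinAt (hB : IsODESolution f h U γ hK X₀ Xs Θ B) {t : ℝ}
    (ht : t ∈ timeIco Θ) :
    HasDerivWithinAt B (odeField f h γ hK.eigenvalues (B t)) (timeIco Θ) t :=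
  hasDerivWithinAt_pi.2 fun i => hB.deriv t ht i

lemma IsODESolution.mem_phaseSpace (hB : IsODESolution f h U γ hK X₀ Xs Θ B) {t : ℝ}
    (ht : t ∈ timeIco Θ) : B t ∈ phaseSpace U hK.eigenvalues :=
  ⟨hB.psd t ht, hB.mem t ht⟩

/-- A bounded solution has a limit at a finite end of its interval of existence, and it can be
extended if this limit is in the phase space. -/
lemma IsODESolution.exists_extension (R : Regular f h U α Lf Lh LI μ θ L)
    (hlam : ∀ i, 0 ≤ hK.eigenvalues i) {a ρ : ℝ} (hB : IsODESolution f h U γ hK X₀ Xs a B)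
    (hbdd : ∀ t ∈ timeIco a, ‖B t‖ ≤ ρ) :
    ∃ x₁ : Fin d → MatP l, Tendsto B (𝓝[<] a) (𝓝 x₁) ∧ (avgB hK.eigenvalues x₁ ∈ U →
      ∃ b : ℝ, a < b ∧ ∃ B', IsODESolution f h U γ hK X₀ Xs b B') := by
  set lam := hK.eigenvalues with hlam_def
  have ha : 0 < a := by simpa using hB.pos
  have hBp : ∀ t ∈ Ico 0 a, B t ∈ phaseSpace U lam := fun t ht =>
    hB.mem_phaseSpace ((timeIco_coe a).symm ▸ ht)
  have hBd : ∀ t ∈ Ico 0 a, HasDerivWithinAt B (odeField f h γ lam (B t)) (Ico 0 a) t := by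
    intro t ht
    have := hB.hasDerivWithinAt ((timeIco_coe a).symm ▸ ht)
    rwa [timeIco_coe] at this
  have hbdd : ∀ t ∈ Ico 0 a, ‖B t‖ ≤ ρ := fun t ht => hbdd t ((timeIco_coe a).symm ▸ ht)
  obtain ⟨κ, hκ, hκb⟩ := R.exists_lipschitz_odeField (f := f) (h := h) hlam γ ρ
  -- A bounded solution has bounded velocity, so it is Lipschitz in time and extends continuously to
  -- the endpoint.
  have hlip : LipschitzOnWith κ B (Ico 0 a) :=
    (convex_Ico 0 a).lipschitzOnWith_of_nnnorm_hasDerivWithin_le hBd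
      (fun t ht => hκb _ (hBp t ht) (hbdd t ht))
  obtain ⟨g, hg, hgB⟩ := hlip.extend_finite_dimension
  have hBg : B =ᶠ[𝓝[<] a] g :=
    mem_of_superset (Ico_mem_nhdsLT ha) fun t ht => hgB ht
  have hgt : Tendsto g (𝓝[<] a) (𝓝 (g a)) := hg.continuous.continuousAt.continuousWithinAt
  refine ⟨g a, hgt.congr' hBg.symm, fun hU => ?_⟩
  have hev : ∀ᶠ t in 𝓝[<] a, g t ∈ phaseSpace U lam ∩ {B | ‖B‖ ≤ ρ} :=
    mem_of_superset (Ico_mem_nhdsLT ha) fun t ht => by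
      change g t ∈ phaseSpace U lam ∩ {B | ‖B‖ ≤ ρ}
      rw [← hgB ht]
      exact ⟨hBp t ht, hbdd t ht⟩
  have hga : g a ∈ phaseSpace U lam := by
    refine ⟨fun i => ?_, hU⟩
    have h1 : Tendsto (fun t => g t i) (𝓝[<] a) (𝓝 (g a i)) :=
      ((continuous_apply i).tendsto _).comp hgt
    exact isClosed_posSemidef.mem_of_tendsto h1 (hev.mono fun t ht => ht.1.1 i)
  have hgaρ : ‖g a‖ ≤ ρ := le_of_tendsto hgt.norm (hev.mono fun t ht => ht.2)
  obtain ⟨δ, hδ, y, hy0, hy⟩ := R.exists_local_solution (f := f) (h := h) hlam γ hga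
  set B' : ℝ → Fin d → MatP l := fun t => if t ≤ a then g t else y (t - a) with hB'
  have hB'1 : ∀ t ≤ a, B' t = g t := fun t ht => if_pos ht
  have hB'2 : ∀ t, a ≤ t → B' t = y (t - a) := fun t ht => by
    rcases ht.eq_or_lt with rfl | ht
    · rw [hB'1 _ le_rfl, sub_self, hy0]
    · exact if_neg (not_le.2 ht)
  have hB'B : ∀ t ∈ Ico 0 a, B' t = B t := fun t ht => by rw [hB'1 t ht.2.le, hgB ht]
  -- At the junction the left derivative is the limit of the derivatives from the left, by
  -- continuity of the field within the bounded part of the phase space; it agrees with the right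
  -- derivative of the new piece.
  have hleft : HasDerivWithinAt B' (odeField f h γ lam (g a)) (Iic a) a := by
    have hdB : ∀ t ∈ Ioo 0 a, HasDerivAt B' (odeField f h γ lam (g t)) t := fun t ht => by
      have h1 := ((hBd t (Ioo_subset_Ico_self ht)).hasDerivAt (Ico_mem_nhds ht.1 ht.2))
      rw [hgB (Ioo_subset_Ico_self ht)] at h1
      exact h1.congr_of_eventuallyEq (mem_of_superset (Ico_mem_nhds ht.1 ht.2) hB'B)
    have hcont : Tendsto (fun t => odeField f h γ lam (g t)) (𝓝[<] a)
        (𝓝 (odeField f h γ lam (g a))) := by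
      have h1 : ContinuousWithinAt (odeField f h γ lam) _ (g a) :=
        hκ.continuousOn (g a) ⟨hga, hgaρ⟩
      exact h1.tendsto.comp (tendsto_nhdsWithin_iff.2 ⟨hgt, hev⟩)
    refine hasDerivWithinAt_Iic_of_tendsto_deriv (s := Ioo 0 a)
      (fun t ht => (hdB t ht).differentiableAt.differentiableWithinAt) ?_ (Ioo_mem_nhdsLT ha) ?_
    · refine (hg.continuous.continuousWithinAt (s := Ioo 0 a) (x := a)).congr
        (fun t ht => hB'1 t ht.2.le) (hB'1 a le_rfl)
    · exact hcont.congr' (mem_of_superset (Ioo_mem_nhdsLT ha) fun t ht => (hdB t ht).deriv.symm)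
  have hright : ∀ t ∈ Ico a (a + δ), HasDerivWithinAt B' (odeField f h γ lam (B' t))
      (Ici a ∩ Iio (a + δ)) t := fun t ht => by
    have h1 := (hy (t - a) ⟨by linarith [ht.1], by linarith [ht.2]⟩).2
    have h2 : HasDerivWithinAt (fun s => y (s - a)) (odeField f h γ lam (y (t - a)))
        (Ici a ∩ Iio (a + δ)) t := by
      have h3 : HasDerivWithinAt (fun s : ℝ => s - a) 1 (Ici a ∩ Iio (a + δ)) t :=
        ((hasDerivAt_id t).sub_const a).hasDerivWithinAt
      have h4 := HasDerivWithinAt.scomp (t' := Icc 0 δ) t h1 h3 (fun s hs => by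
        have h5 : a ≤ s := hs.1
        have h6 : s < a + δ := hs.2
        exact ⟨by linarith, by linarith⟩)
      rwa [one_smul] at h4
    rw [hB'2 t ht.1]
    exact h2.congr (fun s hs => hB'2 s hs.1) (hB'2 t ht.1)
  have hphase : ∀ t ∈ Ico 0 (a + δ), B' t ∈ phaseSpace U lam := fun t ht => by
    rcases lt_or_ge t a with hta | hta
    · rw [hB'B t ⟨ht.1, hta⟩]; exact hBp t ⟨ht.1, hta⟩
    · rw [hB'2 t hta]; exact (hy (t - a) ⟨by linarith, by linarith [ht.2]⟩).1
  have hderiv : ∀ t ∈ Ico 0 (a + δ), HasDerivWithinAt B' (odeField f h γ lam (B' t))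
      (Ico 0 (a + δ)) t := fun t ht => by
    rcases lt_trichotomy t a with hta | rfl | hta
    · have h1 := hBd t ⟨ht.1, hta⟩
      rw [hB'B t ⟨ht.1, hta⟩]
      have h2 : HasDerivWithinAt B' (odeField f h γ lam (B t)) (Ico 0 a) t :=
        h1.congr hB'B (hB'B t ⟨ht.1, hta⟩)
      refine h2.mono_of_mem_nhdsWithin (mem_nhdsWithin.2 ⟨Iio a, isOpen_Iio, hta, fun s hs => ?_⟩)
      exact ⟨hs.2.1, hs.1⟩
    · have h1 := hright t ⟨le_rfl, ht.2⟩
      have h2 : HasDerivWithinAt B' (odeField f h γ lam (B' t)) (Iic t) t := by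
        rw [hB'1 t le_rfl]; exact hleft
      refine (h2.union h1).mono fun s hs => ?_
      rcases le_total s t with hst | hst
      · exact Or.inl hst
      · exact Or.inr ⟨hst, hs.2⟩
    · refine (hright t ⟨hta.le, ht.2⟩).mono_of_mem_nhdsWithin
        (mem_nhdsWithin.2 ⟨Ioi a, isOpen_Ioi, hta, fun s hs => ⟨(mem_Ioi.1 hs.1).le, hs.2.2⟩⟩)
  refine ⟨a + δ, by linarith, B', ?_⟩
  have hb : 0 < a + δ := by linarith
  refine ⟨by exact_mod_cast hb, fun i => ?_, fun t ht => ?_, fun t ht => ?_, fun t ht i => ?_⟩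
  · rw [hB'B 0 ⟨le_rfl, ha⟩]; exact hB.init i
  · rw [timeIco_coe] at ht; exact (hphase t ht).1
  · rw [timeIco_coe] at ht; exact (hphase t ht).2
  · rw [timeIco_coe] at ht ⊢; exact hasDerivWithinAt_pi.1 (hderiv t ht) i

/-- At a finite end of the maximal interval of existence, the average leaves `U`. -/
theorem IsMaximalODESolution.exists_limit (R : Regular f h U α Lf Lh LI μ θ L)
    (hlam : ∀ i, 0 ≤ hK.eigenvalues i) {ρ : ℝ}
    (hB : IsMaximalODESolution f h U γ hK X₀ Xs Θ B) (hbdd : ∀ t ∈ timeIco Θ, ‖B t‖ ≤ ρ)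
    (hΘ : Θ ≠ ⊤) :
    ∃ V ∉ U, Tendsto (fun t => avgB hK.eigenvalues (B t)) (𝓝[<] Θ.toReal) (𝓝 V) := by
  obtain ⟨hsol, hmax⟩ := hB
  have hΘ' : Θ ≠ ⊥ := (bot_le.trans_lt hsol.pos).ne'
  lift Θ to ℝ using ⟨hΘ, hΘ'⟩
  obtain ⟨x₁, hx₁, hext⟩ := hsol.exists_extension R hlam hbdd
  refine ⟨avgB hK.eigenvalues x₁, fun hU => ?_, ?_⟩
  · obtain ⟨b, hb, B', hB'⟩ := hext hU
    exact absurd (hmax b B' hB') (not_le.2 (EReal.coe_lt_coe_iff.2 hb))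
  · rw [EReal.toReal_coe]
    exact (continuous_avgB.tendsto x₁).comp hx₁

/-- If `Θ ≤ T`, the limit of the average at `Θ` would be a point outside `U` to which it comes
arbitrarily close before time `T`. -/
lemma IsMaximalODESolution.lt_of_far (R : Regular f h U α Lf Lh LI μ θ L)
    (hlam : ∀ i, 0 ≤ hK.eigenvalues i) {ρ T η : ℝ} (hη : 0 < η)
    (hB : IsMaximalODESolution f h U γ hK X₀ Xs Θ B) (hbdd : ∀ t ∈ timeIco Θ, ‖B t‖ ≤ ρ)
    (hfar : ∀ t ∈ timeIco Θ, t ≤ T → ∀ V ∉ U, η < ‖avgB hK.eigenvalues (B t) - V‖) :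
    (T : EReal) < Θ := by
  by_contra! hle
  have hΘ : Θ ≠ ⊤ := (hle.trans_lt (EReal.coe_lt_top T)).ne
  obtain ⟨V, hV, hlim⟩ := hB.exists_limit R hlam hbdd hΘ
  have hΘ' : Θ ≠ ⊥ := (bot_le.trans_lt hB.1.pos).ne'
  lift Θ to ℝ using ⟨hΘ, hΘ'⟩
  rw [EReal.toReal_coe] at hlim
  have hΘT : Θ ≤ T := EReal.coe_le_coe_iff.1 hle
  have hpos : 0 < Θ := by simpa using hB.1.pos
  have h1 : Tendsto (fun t => ‖avgB hK.eigenvalues (B t) - V‖) (𝓝[<] Θ) (𝓝 0) :=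
    tendsto_iff_norm_sub_tendsto_zero.1 hlim
  obtain ⟨t, ht1, ht2⟩ := ((h1.eventually_lt_const hη).and (Ico_mem_nhdsLT hpos)).exists
  have := hfar t ((timeIco_coe Θ).symm ▸ ht2) (ht2.2.le.trans hΘT) V hV
  linarith

end Maximal

/-! ### Independence of a sample from the past. -/

section Past

variable {Ω 𝓧 𝓨 : Type*} [MeasurableSpace 𝓧] [MeasurableSpace 𝓨]

/-- Integrating out an independent variable. -/
lemma integral_comp_indepFun [MeasurableSpace Ω] {P : Measure Ω} [IsProbabilityMeasure P] {Y : Ω → 𝓨} {ξ : Ω → 𝓧} {ν : Measure 𝓧} [IsProbabilityMeasure ν]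
    (hY : Measurable Y) (hξ : Measurable ξ) (hind : IndepFun Y ξ P) (hν : P.map ξ = ν)
    {G : 𝓨 → 𝓧 → ℝ} (hG : Measurable (Function.uncurry G))
    (hint : Integrable (fun ω => G (Y ω) (ξ ω)) P) :
    Integrable (fun ω => ∫ x, G (Y ω) x ∂ν) P ∧
      ∫ ω, G (Y ω) (ξ ω) ∂P = ∫ ω, ∫ x, G (Y ω) x ∂ν ∂P := by
  have hmap : P.map (fun ω => (Y ω, ξ ω)) = (P.map Y).prod ν := by
    rw [← hν]
    exact (indepFun_iff_map_prod_eq_prod_map_map hY.aemeasurable hξ.aemeasurable).1 hind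
  have : IsProbabilityMeasure (P.map Y) := Measure.isProbabilityMeasure_map hY.aemeasurable
  have h1 : Integrable (Function.uncurry G) ((P.map Y).prod ν) := by
    rw [← hmap]
    exact (integrable_map_measure hG.aestronglyMeasurable (hY.prodMk hξ).aemeasurable).2 hint
  have h2 : AEStronglyMeasurable (fun y => ∫ x, G y x ∂ν) (P.map Y) :=
    h1.aestronglyMeasurable.integral_prod_right'
  refine ⟨(integrable_map_measure h2 hY.aemeasurable).1 h1.integral_prod_left, ?_⟩
  have h3 : ∫ ω, G (Y ω) (ξ ω) ∂P = ∫ q, Function.uncurry G q ∂((P.map Y).prod ν) := by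
    rw [← hmap, integral_map (hY.prodMk hξ).aemeasurable hG.aestronglyMeasurable]
    rfl
  rw [h3, integral_prod _ h1]
  exact integral_map hY.aemeasurable h2

/-- The σ-algebra generated by the first `k` variables. -/
@[reducible] def past (ξ : ℕ → Ω → 𝓧) (k : ℕ) : MeasurableSpace Ω :=
  ⨆ i ∈ Iio k, MeasurableSpace.comap (ξ i) inferInstance

variable {ξ : ℕ → Ω → 𝓧}

lemma measurable_past {i k : ℕ} (h : i < k) : Measurable[past ξ k] (ξ i) :=
  Measurable.mono (comap_measurable (ξ i))
    (le_biSup (fun i => MeasurableSpace.comap (ξ i) inferInstance) (mem_Iio.2 h)) le_rfl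

lemma past_mono {j k : ℕ} (h : j ≤ k) : past ξ j ≤ past ξ k :=
  biSup_mono fun _ hi => lt_of_lt_of_le hi h

variable [mΩ : MeasurableSpace Ω] {P : Measure Ω}

lemma past_le (hξ : ∀ k, Measurable (ξ k)) (k : ℕ) : past ξ k ≤ mΩ :=
  iSup₂_le fun i _ => (hξ i).comap_le

lemma indepFun_of_past (hξ : ∀ k, Measurable (ξ k)) (hind : iIndepFun ξ P) {k : ℕ} {Y : Ω → 𝓨}
    (hY : Measurable[past ξ k] Y) : IndepFun Y (ξ k) P := by
  have h1 := indep_iSup_of_disjoint (fun i => (hξ i).comap_le) hind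
    (S := Iio k) (T := {k}) (by simp)
  rw [IndepFun_iff_Indep]
  refine indep_of_indep_of_le_left (indep_of_indep_of_le_right h1 ?_) hY.comap_le
  simp

end Past

/-! ### Moment and tail bounds for sums of centered increments. -/

section Martingale

/-- Binomial expansion. The term linear in `x` is kept exactly, since it will have mean zero; each
higher term is at most `s ^ p * x ^ 2` or `x ^ (p + 2)` according to which of `|s|`, `|x|` is
larger. -/
lemma add_pow_le_of_even {p : ℕ} (hp : Even p) (s x : ℝ) :
    (s + x) ^ (p + 2) ≤ s ^ (p + 2) + (p + 2) * (s ^ (p + 1) * x)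
      + 2 ^ (p + 2) * (s ^ p * x ^ 2 + x ^ (p + 2)) := by
  have hsp : 0 ≤ s ^ p := hp.pow_nonneg s
  have hxp : 0 ≤ x ^ (p + 2) := (hp.add even_two).pow_nonneg x
  have key : ∀ m ∈ Finset.range (p + 1), x ^ (m + 2) * s ^ (p - m) * ((p + 2).choose (m + 2) : ℝ)
      ≤ (s ^ p * x ^ 2 + x ^ (p + 2)) * ((p + 2).choose (m + 2) : ℝ) := by
    intro m hm
    have hm : m ≤ p := by simpa [Nat.lt_succ_iff] using hm
    refine mul_le_mul_of_nonneg_right ?_ (by positivity)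
    have h1 : |x ^ (m + 2) * s ^ (p - m)| = |x| ^ (m + 2) * |s| ^ (p - m) := by
      rw [abs_mul, abs_pow, abs_pow]
    refine (le_abs_self _).trans (h1.trans_le ?_)
    rcases le_total |x| |s| with hxs | hxs
    · have : |x| ^ (m + 2) * |s| ^ (p - m) ≤ s ^ p * x ^ 2 := by
        calc |x| ^ (m + 2) * |s| ^ (p - m) = |x| ^ m * |s| ^ (p - m) * |x| ^ 2 := by ring
          _ ≤ |s| ^ m * |s| ^ (p - m) * |x| ^ 2 := by gcongr
          _ = s ^ p * x ^ 2 := by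
            rw [← pow_add, Nat.add_sub_cancel' hm, sq_abs, hp.pow_abs]
      linarith
    · have : |x| ^ (m + 2) * |s| ^ (p - m) ≤ x ^ (p + 2) := by
        calc |x| ^ (m + 2) * |s| ^ (p - m) ≤ |x| ^ (m + 2) * |x| ^ (p - m) := by gcongr
          _ = |x| ^ (p + 2) := by rw [← pow_add]; congr 1; omega
          _ = x ^ (p + 2) := (hp.add even_two).pow_abs x
      have : 0 ≤ s ^ p * x ^ 2 := by positivity
      linarith
  have hch : ∑ m ∈ Finset.range (p + 1), ((p + 2).choose (m + 2) : ℝ) ≤ 2 ^ (p + 2) := by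
    have h1 := Nat.sum_range_choose (p + 2)
    rw [Finset.sum_range_succ', Finset.sum_range_succ'] at h1
    have h2 : ∑ m ∈ Finset.range (p + 1), (p + 2).choose (m + 2) ≤ 2 ^ (p + 2) := by
      have : ∑ m ∈ Finset.range (p + 1), (p + 2).choose (m + 2)
        = ∑ m ∈ Finset.range (p + 1), (p + 2).choose (m + 1 + 1) := rfl
      omega
    exact_mod_cast h2
  rw [add_comm s x, add_pow, Finset.sum_range_succ', Finset.sum_range_succ']
  have h3 : ∑ m ∈ Finset.range (p + 1), x ^ (m + 1 + 1) * s ^ (p + 2 - (m + 1 + 1))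
      * ((p + 2).choose (m + 1 + 1) : ℝ) ≤ 2 ^ (p + 2) * (s ^ p * x ^ 2 + x ^ (p + 2)) := by
    calc _ = ∑ m ∈ Finset.range (p + 1), x ^ (m + 2) * s ^ (p - m)
          * ((p + 2).choose (m + 2) : ℝ) := Finset.sum_congr rfl fun m _ => by
            rw [show p + 2 - (m + 1 + 1) = p - m by omega]
      _ ≤ _ := Finset.sum_le_sum key
      _ = (∑ m ∈ Finset.range (p + 1), ((p + 2).choose (m + 2) : ℝ))
          * (s ^ p * x ^ 2 + x ^ (p + 2)) := by rw [← Finset.mul_sum, mul_comm]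
      _ ≤ _ := mul_le_mul_of_nonneg_right hch (by positivity)
  have h4 : x ^ (0 + 1) * s ^ (p + 2 - (0 + 1)) * ((p + 2).choose (0 + 1) : ℝ)
      = (p + 2) * (s ^ (p + 1) * x) := by
    rw [show p + 2 - (0 + 1) = p + 1 by omega]
    simp; ring
  have h5 : x ^ 0 * s ^ (p + 2 - 0) * ((p + 2).choose 0 : ℝ) = s ^ (p + 2) := by simp
  rw [h4, h5]
  linarith

/-- Compare `n x²` with `s²`. The factor `1 / n` in front of the accumulated power is what allows
iteration over `n` steps. -/
lemma pow_mul_sq_le {m : ℕ} {n : ℝ} (hn : 1 ≤ n) (s x : ℝ) :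
    s ^ (2 * m) * x ^ 2 ≤ s ^ (2 * m + 2) / n + n ^ m * x ^ (2 * m + 2) := by
  have hn0 : 0 < n := by linarith
  have e1 : 0 ≤ s ^ (2 * m + 2) := (even_two_mul m |>.add even_two).pow_nonneg s
  have e2 : 0 ≤ x ^ (2 * m + 2) := (even_two_mul m |>.add even_two).pow_nonneg x
  rcases le_total (n * x ^ 2) (s ^ 2) with hc | hc
  · have h1 : x ^ 2 ≤ s ^ 2 / n := by rw [le_div_iff₀ hn0]; linarith
    calc s ^ (2 * m) * x ^ 2 ≤ s ^ (2 * m) * (s ^ 2 / n) := by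
          refine mul_le_mul_of_nonneg_left h1 ((even_two_mul m).pow_nonneg s)
      _ = s ^ (2 * m + 2) / n := by ring
      _ ≤ _ := le_add_of_nonneg_right (by positivity)
  · calc s ^ (2 * m) * x ^ 2 = (s ^ 2) ^ m * x ^ 2 := by rw [pow_mul]
      _ ≤ (n * x ^ 2) ^ m * x ^ 2 := by gcongr
      _ = n ^ m * x ^ (2 * m + 2) := by rw [mul_pow, ← pow_mul]; ring
      _ ≤ _ := le_add_of_nonneg_left (by positivity)

variable {Ω : Type*} [MeasurableSpace Ω] {P : Measure Ω} [IsProbabilityMeasure P]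

/-- Moments of a sum of `n` centered increments. -/
lemma integral_pow_martingale_le {m n : ℕ} (hn : 1 ≤ n) {S D : ℕ → Ω → ℝ}
    (hS0 : ∀ ω, S 0 ω = 0) (hS : ∀ k ω, S (k + 1) ω = S k ω + D k ω)
    (hSm : ∀ k, AllMoments (S k) P) (hDm : ∀ k, AllMoments (D k) P)
    (horth : ∀ k < n, ∫ ω, S k ω ^ (2 * m + 1) * D k ω ∂P = 0) {b : ℝ}
    (hb : ∀ k < n, ∫ ω, D k ω ^ (2 * m + 2) ∂P ≤ b) {k : ℕ} (hk : k ≤ n) :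
    ∫ ω, S k ω ^ (2 * m + 2) ∂P
      ≤ 2 ^ (2 * m + 3) * Real.exp (2 ^ (2 * m + 2)) * n ^ (m + 1) * b := by
  have hn1 : (1 : ℝ) ≤ n := by exact_mod_cast hn
  have hn0 : (0 : ℝ) < n := by linarith
  set c : ℝ := 2 ^ (2 * m + 2) with hc
  have hc0 : 0 < c := by positivity
  set q : ℝ := 1 + c / n with hq
  have hq1 : 1 ≤ q := by rw [hq]; linarith [div_pos hc0 hn0]
  set B : ℝ := 2 * c * n ^ m * b with hB
  have hb0 : 0 ≤ b := le_trans (integral_nonneg fun ω =>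
    (even_two_mul m |>.add even_two).pow_nonneg (D 0 ω)) (hb 0 hn)
  have hB0 : 0 ≤ B := by positivity
  -- Orthogonality removes the linear term, so one step multiplies the moment by at most `1 + c/n`
  -- and adds `B`, of order `n ^ m * b`.
  have hstep : ∀ k < n, ∫ ω, S (k + 1) ω ^ (2 * m + 2) ∂P
      ≤ q * ∫ ω, S k ω ^ (2 * m + 2) ∂P + B := by
    intro k hk
    have i1 : Integrable (fun ω => S k ω ^ (2 * m + 2)) P := ((hSm k).pow _).integrable
    have i2 : Integrable (fun ω => S k ω ^ (2 * m + 1) * D k ω) P :=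
      (((hSm k).pow _).mul (hDm k)).integrable
    have i3 : Integrable (fun ω => D k ω ^ (2 * m + 2)) P := ((hDm k).pow _).integrable
    have hpt : ∀ ω, S (k + 1) ω ^ (2 * m + 2) ≤ q * S k ω ^ (2 * m + 2)
        + (2 * m + 2) * (S k ω ^ (2 * m + 1) * D k ω) + 2 * c * n ^ m * D k ω ^ (2 * m + 2) := by
      intro ω
      have h1 := add_pow_le_of_even (even_two_mul m) (S k ω) (D k ω)
      have h2 := pow_mul_sq_le (m := m) hn1 (S k ω) (D k ω)
      have h3 : 0 ≤ D k ω ^ (2 * m + 2) := (even_two_mul m |>.add even_two).pow_nonneg _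
      have h4 : (1 : ℝ) ≤ n ^ m := one_le_pow₀ hn1
      have h5 : D k ω ^ (2 * m + 2) ≤ n ^ m * D k ω ^ (2 * m + 2) :=
        le_mul_of_one_le_left h3 h4
      rw [hS]
      refine h1.trans ?_
      have h6 : c * (S k ω ^ (2 * m) * D k ω ^ 2 + D k ω ^ (2 * m + 2))
          ≤ c * (S k ω ^ (2 * m + 2) / n + n ^ m * D k ω ^ (2 * m + 2)
            + n ^ m * D k ω ^ (2 * m + 2)) :=
        mul_le_mul_of_nonneg_left (by linarith) hc0.le
      have h7 : c * (S k ω ^ (2 * m + 2) / n) = c / n * S k ω ^ (2 * m + 2) := by ring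
      rw [hq]
      push_cast
      nlinarith
    refine (integral_mono ((hSm (k + 1)).pow _).integrable
      (((i1.const_mul q).add (i2.const_mul _)).add (i3.const_mul _)) hpt).trans ?_
    have e1 := integral_add ((i1.const_mul q).add (i2.const_mul (2 * m + 2 : ℝ)))
      (i3.const_mul (2 * c * n ^ m))
    have e2 := integral_add (i1.const_mul q) (i2.const_mul (2 * m + 2 : ℝ))
    simp only [Pi.add_apply] at e1 e2
    simp only [e1, e2, Pi.add_apply, integral_const_mul, horth k hk, mul_zero, add_zero]
    have := mul_le_mul_of_nonneg_left (hb k hk) (show 0 ≤ 2 * c * (n : ℝ) ^ m by positivity)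
    linarith
  -- Over `n` steps the factors stay below `exp c`, and `n` additions of `B` produce the power `n ^
  -- (m + 1)`.
  have hind : ∀ k ≤ n, ∫ ω, S k ω ^ (2 * m + 2) ∂P ≤ k * q ^ k * B := by
    intro k
    induction k with
    | zero => intro _; simp [hS0]
    | succ k ih =>
      intro hk
      refine (hstep k hk).trans ?_
      have h1 := mul_le_mul_of_nonneg_left (ih (by omega)) (show 0 ≤ q by linarith)
      have h2 : B ≤ q ^ (k + 1) * B := le_mul_of_one_le_left hB0 (one_le_pow₀ hq1)
      push_cast
      calc _ ≤ q * (k * q ^ k * B) + q ^ (k + 1) * B := add_le_add h1 h2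
        _ = _ := by ring
  refine (hind k hk).trans ?_
  have hkn : (k : ℝ) ≤ n := by exact_mod_cast hk
  have h1 : q ^ k ≤ Real.exp c := by
    calc q ^ k ≤ q ^ n := pow_le_pow_right₀ hq1 hk
      _ ≤ (Real.exp (c / n)) ^ n := by
        refine pow_le_pow_left₀ (by linarith) ?_ n
        rw [hq, add_comm]; exact Real.add_one_le_exp _
      _ = Real.exp c := by
        rw [← Real.exp_nat_mul]; congr 1; field_simp
  calc (k : ℝ) * q ^ k * B ≤ n * Real.exp c * B := by gcongr
    _ = _ := by rw [hB, hc]; ring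

lemma prob_le_of_integral_pow_le {S : Ω → ℝ} (hS : AllMoments S P) {q : ℕ} (hq : Even q) {b δ : ℝ}
    (hb : ∫ ω, S ω ^ q ∂P ≤ b) (hδ : 0 < δ) :
    P {ω | δ ≤ |S ω|} ≤ ENNReal.ofReal (b / δ ^ q) := by
  have h1 := mul_meas_ge_le_integral_of_nonneg (μ := P) (f := fun ω => S ω ^ q)
    (ae_of_all _ fun ω => hq.pow_nonneg _) (hS.pow q).integrable (δ ^ q)
  have h2 : {ω | δ ≤ |S ω|} ⊆ {ω | δ ^ q ≤ S ω ^ q} := fun ω hω => by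
    have hω : δ ≤ |S ω| := hω
    change δ ^ q ≤ S ω ^ q
    rw [← hq.pow_abs (S ω)]
    exact pow_le_pow_left₀ hδ.le hω q
  have h3 : P.real {ω | δ ≤ |S ω|} ≤ b / δ ^ q := by
    rw [le_div_iff₀ (by positivity), mul_comm]
    exact (mul_le_mul_of_nonneg_left (measureReal_mono h2) (by positivity)).trans (h1.trans hb)
  rw [← ofReal_measureReal]
  exact ENNReal.ofReal_le_ofReal h3

end Martingale

/-! ### One step of SGD: second moments and size of their increments. -/

section Step

variable {l d : ℕ} {f : OutP l → Out l → ℝ} {h : MatP l → ℝ} {U : Set (MatP l)}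
  {α Lf Lh LI μ θ L γ γb κ Q : ℝ} {lam : Fin d → ℝ} {Xs : Matrix (Fin d) (Fin l) ℝ}

/-- The setting of one step of the algorithm, in coordinates in which the covariance is
diagonal. -/
structure StepSetting (f : OutP l → Out l → ℝ) (h : MatP l → ℝ) (U : Set (MatP l))
    (α Lf Lh LI μ θ L γ γb κ Q : ℝ) (lam : Fin d → ℝ) (Xs : Matrix (Fin d) (Fin l) ℝ) : Prop where
  reg : Regular f h U α Lf Lh LI μ θ L
  one_le : 1 ≤ d
  lam_nonneg : ∀ i, 0 ≤ lam i
  lam_le : ∀ i, lam i ≤ κ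
  γ_nonneg : 0 ≤ γ
  γ_le : γ ≤ γb
  le_Q : 2 + 3 * ‖Xs‖ ^ 2 ≤ Q
  ae_isMinOn : ∀ᵐ p ∂(jointLaw l (Matrix.diagonal lam)),
    IsMinOn (slice f (lin Xsᵀ p.1) p.2) univ (lin Xsᵀ p.1)

lemma StepSetting.posSemidef (H : StepSetting f h U α Lf Lh LI μ θ L γ γb κ Q lam Xs) :
    (Matrix.diagonal lam).PosSemidef :=
  Matrix.PosSemidef.diagonal H.lam_nonneg

lemma StepSetting.κ_nonneg (H : StepSetting f h U α Lf Lh LI μ θ L γ γb κ Q lam Xs) : 0 ≤ κ :=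
  (H.lam_nonneg ⟨0, H.one_le⟩).trans (H.lam_le ⟨0, H.one_le⟩)

lemma StepSetting.d_pos (H : StepSetting f h U α Lf Lh LI μ θ L γ γb κ Q lam Xs) :
    (0 : ℝ) < d := by
  exact_mod_cast H.one_le

/-- The gradient of the loss at the parameter `x` and the sample `s`. -/
noncomputable def sgdGrad (f : OutP l → Out l → ℝ) (Xs x : Matrix (Fin d) (Fin l) ℝ)
    (s : EuclideanSpace ℝ (Fin d) × Out l) : Out l :=
  gradX f (lin (Matrix.fromCols x Xs)ᵀ s.1) s.2

/-- The weighted second moment `∑ᵢ βᵢ wᵢ wᵢᵀ` of the rows of `W`. -/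
def wMom {κ : Type*} (β : Fin d → ℝ) (W : Matrix (Fin d) κ ℝ) : Matrix κ κ ℝ :=
  Wᵀ * Matrix.diagonal β * W

lemma wMom_apply {κ : Type*} (β : Fin d → ℝ) (W : Matrix (Fin d) κ ℝ) (p q : κ) :
    wMom β W p q = ∑ i, β i * W i p * W i q := by
  simp only [wMom, Matrix.mul_apply, Matrix.transpose_apply, Matrix.diagonal_apply, mul_ite,
    mul_zero, Finset.sum_ite_eq', Finset.mem_univ, if_true]
  exact Finset.sum_congr rfl fun i _ => by ring

lemma wMom_transpose {κ : Type*} (β : Fin d → ℝ) (W : Matrix (Fin d) κ ℝ) :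
    (wMom β W)ᵀ = wMom β W := by
  ext p q
  rw [Matrix.transpose_apply, wMom_apply, wMom_apply]
  exact Finset.sum_congr rfl fun i _ => by ring

/-- The increment of an entry of `∑ᵢ βᵢ wᵢ wᵢᵀ` in one step. -/
noncomputable def incr (f : OutP l → Out l → ℝ) (γ : ℝ) (β : Fin d → ℝ)
    (Xs x : Matrix (Fin d) (Fin l) ℝ) (s : EuclideanSpace ℝ (Fin d) × Out l)
    (p q : Fin l ⊕ Fin l) : ℝ :=
  -(γ / d) * (lin (Matrix.diagonal β * Matrix.fromCols x Xs)ᵀ s.1 p * join (sgdGrad f Xs x s) 0 q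
    + join (sgdGrad f Xs x s) 0 p * lin (Matrix.diagonal β * Matrix.fromCols x Xs)ᵀ s.1 q)
  + (γ / d) ^ 2 * (∑ i, β i * s.1 i ^ 2)
    * (join (sgdGrad f Xs x s) 0 p * join (sgdGrad f Xs x s) 0 q)

lemma lin_diagonal_mul_apply {κ : Type*} [Fintype κ] (β : Fin d → ℝ) (W : Matrix (Fin d) κ ℝ)
    (a : EuclideanSpace ℝ (Fin d)) (p : κ) :
    lin (Matrix.diagonal β * W)ᵀ a p = ∑ i, β i * W i p * a i := by
  rw [lin_apply]
  exact Finset.sum_congr rfl fun i _ => by rw [Matrix.transpose_apply, Matrix.diagonal_mul]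

lemma wMom_step (γ : ℝ) (β : Fin d → ℝ) (x : Matrix (Fin d) (Fin l) ℝ)
    (s : EuclideanSpace ℝ (Fin d) × Out l) (p q : Fin l ⊕ Fin l) :
    wMom β (Matrix.fromCols (x - (γ / d) • Matrix.vecMulVec (fun i => s.1 i)
      (fun j => sgdGrad f Xs x s j)) Xs) p q
      = wMom β (Matrix.fromCols x Xs) p q + incr f γ β Xs x s p q := by
  have h1 : ∀ i r, Matrix.fromCols (x - (γ / d) • Matrix.vecMulVec (fun i => s.1 i)
      (fun j => sgdGrad f Xs x s j)) Xs i r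
      = Matrix.fromCols x Xs i r - γ / d * (s.1 i * join (sgdGrad f Xs x s) 0 r) := by
    rintro i (r | r)
    · simp [join_apply_inl, Matrix.vecMulVec_apply]
    · simp [join_apply_inr]
  rw [wMom_apply, wMom_apply, incr, lin_diagonal_mul_apply, lin_diagonal_mul_apply]
  simp only [h1, Finset.sum_mul, Finset.mul_sum, ← Finset.sum_add_distrib]
  exact Finset.sum_congr rfl fun i _ => by ring

lemma norm_sq_fromCols (x y : Matrix (Fin d) (Fin l) ℝ) :
    ‖Matrix.fromCols x y‖ ^ 2 = ‖x‖ ^ 2 + ‖y‖ ^ 2 := by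
  simp [frob_sq, Fintype.sum_sum_type, Finset.sum_add_distrib]

lemma StepSetting.norm_sq_fromCols_le (H : StepSetting f h U α Lf Lh LI μ θ L γ γb κ Q lam Xs)
    (x : Matrix (Fin d) (Fin l) ℝ) :
    ‖Matrix.fromCols x Xs‖ ^ 2 ≤ Q * (1 + ‖x - Xs‖ ^ 2) := by
  rw [norm_sq_fromCols]
  have h1 : ‖x‖ ≤ ‖x - Xs‖ + ‖Xs‖ := by simpa using norm_add_le (x - Xs) Xs
  have h2 := H.le_Q
  have h3 : ‖x‖ ^ 2 ≤ (‖x - Xs‖ + ‖Xs‖) ^ 2 := pow_le_pow_left₀ (norm_nonneg _) h1 2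
  nlinarith [sq_nonneg (‖x - Xs‖ - ‖Xs‖), sq_nonneg ‖x - Xs‖, sq_nonneg ‖Xs‖,
    mul_nonneg (sq_nonneg ‖x - Xs‖) (sq_nonneg ‖Xs‖)]

lemma norm_diagonal_mul_le {κ : Type*} [Fintype κ] {β : Fin d → ℝ} (hβ0 : ∀ i, 0 ≤ β i)
    (hβ1 : ∀ i, β i ≤ 1) (W : Matrix (Fin d) κ ℝ) : ‖Matrix.diagonal β * W‖ ≤ ‖W‖ := by
  refine (pow_le_pow_iff_left₀ (norm_nonneg _) (norm_nonneg _) two_ne_zero).1 ?_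
  rw [frob_sq, frob_sq]
  refine Finset.sum_le_sum fun i _ => Finset.sum_le_sum fun j _ => ?_
  rw [Matrix.diagonal_mul, mul_pow]
  exact mul_le_of_le_one_left (sq_nonneg _) (pow_le_one₀ (hβ0 i) (hβ1 i))

/-- Moments of linear functions of the sample. -/
lemma StepSetting.integral_norm_lin_pow_le
    (H : StepSetting f h U α Lf Lh LI μ θ L γ γb κ Q lam Xs) {n : Type*} [Fintype n]
    (A : Matrix (Fin d) n ℝ) (r : ℕ) :
    ∫ s, ‖lin Aᵀ s.1‖ ^ (2 * r) ∂(jointLaw l (Matrix.diagonal lam))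
      ≤ (κ * ‖A‖ ^ 2) ^ r * gaussMoment r := by
  have h1 : ∀ a, ‖lin Aᵀ a‖ ^ (2 * r)
      = (∑ j, (inner ℝ (WithLp.toLp 2 (fun i => A i j) : EuclideanSpace ℝ (Fin d)) a) ^ 2) ^ r := by
    intro a
    rw [pow_mul, EuclideanSpace.real_norm_sq_eq]
    congr 1
    refine Finset.sum_congr rfl fun j _ => ?_
    congr 1
    rw [lin_apply, PiLp.inner_apply]
    simp [mul_comm]
  have h2 : ∫ s, ‖lin Aᵀ s.1‖ ^ (2 * r) ∂(jointLaw l (Matrix.diagonal lam))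
      = ∫ a, ‖lin Aᵀ a‖ ^ (2 * r) ∂(multivariateGaussian 0 (Matrix.diagonal lam)) := by
    rw [← (measurePreserving_fst_jointLaw (l := l) (S := Matrix.diagonal lam)).map_eq,
      integral_map measurable_fst.aemeasurable]
    exact (by fun_prop : Continuous fun a => ‖lin Aᵀ a‖ ^ (2 * r)).aestronglyMeasurable
  rw [h2]
  simp only [h1]
  refine integral_sum_sq_pow_le H.posSemidef _ ?_ r
  rw [frob_sq, Finset.sum_comm, Finset.mul_sum]
  refine Finset.sum_le_sum fun j _ => ?_
  rw [Finset.mul_sum]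
  simp only [Matrix.mulVec_diagonal, dotProduct]
  refine Finset.sum_le_sum fun i _ => ?_
  nlinarith [H.lam_le i, sq_nonneg (A i j)]

lemma allMoments_norm_fst {S : Matrix (Fin d) (Fin d) ℝ} :
    AllMoments (fun p : EuclideanSpace ℝ (Fin d) × Out l => ‖p.1‖) (jointLaw l S) :=
  (allMoments_norm_of_isGaussian _).comp measurePreserving_fst_jointLaw

lemma StepSetting.integral_norm_fst_pow_le
    (H : StepSetting f h U α Lf Lh LI μ θ L γ γb κ Q lam Xs) (r : ℕ) :
    ∫ s, ‖s.1‖ ^ (2 * r) ∂(jointLaw l (Matrix.diagonal lam)) ≤ (κ * d) ^ r * gaussMoment r := by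
  have h1 := H.integral_norm_lin_pow_le (1 : Matrix (Fin d) (Fin d) ℝ) r
  have h2 : ∀ a : EuclideanSpace ℝ (Fin d), lin (1 : Matrix (Fin d) (Fin d) ℝ)ᵀ a = a := fun a => by
    ext i; simp [lin_apply, Matrix.one_apply]
  have h3 : ‖(1 : Matrix (Fin d) (Fin d) ℝ)‖ ^ 2 = d := by
    simp [frob_sq, Matrix.one_apply]
  simpa only [h2, h3] using h1

/-- Young's inequality with a free weight, used to balance factors that scale differently in `d`. -/
lemma mul_pow_le_half {a b t : ℝ} (ht : 0 < t) (m : ℕ) :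
    a ^ m * b ^ m ≤ 1 / 2 * (t * a ^ (2 * m) + t⁻¹ * b ^ (2 * m)) := by
  have h1 : 0 ≤ t⁻¹ * (t * a ^ m - b ^ m) ^ 2 := by positivity
  have h2 : t⁻¹ * (t * a ^ m - b ^ m) ^ 2
      = t * a ^ (2 * m) - 2 * (a ^ m * b ^ m) + t⁻¹ * b ^ (2 * m) := by
    field_simp
    ring
  linarith

/-- Almost surely, the gradient is controlled by the distance to the minimizer. -/
lemma StepSetting.ae_sgdGrad (H : StepSetting f h U α Lf Lh LI μ θ L γ γb κ Q lam Xs) :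
    ∀ᵐ s ∂(jointLaw l (Matrix.diagonal lam)), ∀ x : Matrix (Fin d) (Fin l) ℝ,
      ‖sgdGrad f Xs x s‖ ≤ L * ‖lin (x - Xs)ᵀ s.1‖ ∧
        0 ≤ inner ℝ (lin (x - Xs)ᵀ s.1) (sgdGrad f Xs x s) := by
  filter_upwards [H.ae_isMinOn] with s hs x
  have h1 : fstPart (lin (Matrix.fromCols x Xs)ᵀ s.1) = lin xᵀ s.1 := by
    rw [← join_lin]; rfl
  have h2 : sndPart (lin (Matrix.fromCols x Xs)ᵀ s.1) = lin Xsᵀ s.1 := by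
    rw [← join_lin]; rfl
  have h3 : lin xᵀ s.1 - lin Xsᵀ s.1 = lin (x - Xs)ᵀ s.1 := by
    ext i
    simp [lin_apply, sub_mul, Finset.sum_sub_distrib]
  have hmin : IsMinOn (slice f (sndPart (lin (Matrix.fromCols x Xs)ᵀ s.1)) s.2) univ
      (sndPart (lin (Matrix.fromCols x Xs)ᵀ s.1)) := by rw [h2]; exact hs
  have e1 := norm_gradX_le H.reg.L_pos H.reg.f_smooth hmin
  have e2 := rsi_gradX H.reg.f_rsi hmin
  rw [h1, h2, h3] at e1 e2
  refine ⟨e1, le_trans ?_ e2⟩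
  split_ifs
  · exact mul_nonneg H.reg.μ_pos.le (sq_nonneg _)
  · exact le_rfl

lemma abs_join_le (v : Out l) (p : Fin l ⊕ Fin l) : |join v 0 p| ≤ ‖v‖ :=
  (abs_apply_le_norm _ _).trans_eq (norm_join_zero v)

lemma abs_sum_sq_le {β : Fin d → ℝ} (hβ0 : ∀ i, 0 ≤ β i) (hβ1 : ∀ i, β i ≤ 1)
    (a : EuclideanSpace ℝ (Fin d)) : |∑ i, β i * a i ^ 2| ≤ ‖a‖ ^ 2 := by
  rw [abs_of_nonneg (Finset.sum_nonneg fun i _ => mul_nonneg (hβ0 i) (sq_nonneg _)),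
    EuclideanSpace.real_norm_sq_eq]
  exact Finset.sum_le_sum fun i _ => mul_le_of_le_one_left (sq_nonneg _) (hβ1 i)

lemma abs_incr_le (hγ : 0 ≤ γ) {β : Fin d → ℝ} (hβ0 : ∀ i, 0 ≤ β i) (hβ1 : ∀ i, β i ≤ 1)
    {x : Matrix (Fin d) (Fin l) ℝ} {s : EuclideanSpace ℝ (Fin d) × Out l}
    (hs : ‖sgdGrad f Xs x s‖ ≤ L * ‖lin (x - Xs)ᵀ s.1‖) (p q : Fin l ⊕ Fin l) :
    |incr f γ β Xs x s p q| ≤ 2 * γ * L / d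
        * (‖lin (Matrix.diagonal β * Matrix.fromCols x Xs)ᵀ s.1‖ * ‖lin (x - Xs)ᵀ s.1‖)
      + (γ * L / d) ^ 2 * (‖s.1‖ ^ 2 * ‖lin (x - Xs)ᵀ s.1‖ ^ 2) := by
  set u := lin (Matrix.diagonal β * Matrix.fromCols x Xs)ᵀ s.1
  set g := sgdGrad f Xs x s
  set z := lin (x - Xs)ᵀ s.1
  have hp := (abs_join_le g p).trans hs
  have hq := (abs_join_le g q).trans hs
  have hup := abs_apply_le_norm u p
  have huq := abs_apply_le_norm u q
  have hb := abs_sum_sq_le hβ0 hβ1 s.1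
  have hc : 0 ≤ γ / d := by positivity
  rw [incr]
  refine (abs_add_le _ _).trans (add_le_add ?_ ?_)
  · rw [abs_mul, abs_neg, abs_of_nonneg hc]
    calc γ / d * |u p * join g 0 q + join g 0 p * u q|
        ≤ γ / d * (‖u‖ * (L * ‖z‖) + (L * ‖z‖) * ‖u‖) := by
          refine mul_le_mul_of_nonneg_left ((abs_add_le _ _).trans ?_) hc
          rw [abs_mul, abs_mul]
          gcongr
          exact (abs_nonneg _).trans hp
      _ = _ := by ring
  · rw [abs_mul, abs_mul, abs_mul, abs_of_nonneg (sq_nonneg _)]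
    calc (γ / d) ^ 2 * |∑ i, β i * s.1 i ^ 2| * (|join g 0 p| * |join g 0 q|)
        ≤ (γ / d) ^ 2 * ‖s.1‖ ^ 2 * ((L * ‖z‖) * (L * ‖z‖)) := by
          gcongr
          exact (abs_nonneg _).trans hp
      _ = _ := by ring

/-- The constant in the moment bound of the increments. -/
noncomputable def incrConst (γ L κ Q : ℝ) (n : ℕ) : ℝ :=
  2 ^ n * ((2 * γ * L) ^ n * gaussMoment n * κ ^ n * Q ^ n
    + (γ * L) ^ (2 * n) * gaussMoment (2 * n) * κ ^ (2 * n))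

lemma incrConst_nonneg (hγ : 0 ≤ γ) (hL : 0 ≤ L) (hκ : 0 ≤ κ) (hQ : 0 ≤ Q) (n : ℕ) :
    0 ≤ incrConst γ L κ Q n := by
  have h1 := gaussMoment_nonneg n
  have h2 := gaussMoment_nonneg (2 * n)
  unfold incrConst
  positivity

/-- Moments of the increments, given the present state. -/
lemma StepSetting.integral_abs_incr_pow_le
    (H : StepSetting f h U α Lf Lh LI μ θ L γ γb κ Q lam Xs) {β : Fin d → ℝ}
    (hβ0 : ∀ i, 0 ≤ β i) (hβ1 : ∀ i, β i ≤ 1) (x : Matrix (Fin d) (Fin l) ℝ)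
    (p q : Fin l ⊕ Fin l) (n : ℕ) :
    ∫ s, |incr f γ β Xs x s p q| ^ n ∂(jointLaw l (Matrix.diagonal lam))
      ≤ incrConst γb L κ Q n * (1 + ‖x - Xs‖ ^ 2) ^ (2 * n) / d ^ n := by
  set ν := jointLaw l (Matrix.diagonal lam)
  have hd := H.d_pos
  have hκ := H.κ_nonneg
  have hL := H.reg.L_pos.le
  have hγ := H.γ_nonneg
  have hγb := H.γ_le
  have hQ1 : 1 ≤ Q := by nlinarith [H.le_Q, sq_nonneg ‖Xs‖]
  have hc1 := gaussMoment_nonneg n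
  have hc2 := gaussMoment_nonneg (2 * n)
  set V := ‖x - Xs‖ ^ 2 with hV
  have hV0 : 0 ≤ V := sq_nonneg _
  set A := Matrix.diagonal β * Matrix.fromCols x Xs with hA
  have hAn : ‖A‖ ^ 2 ≤ Q * (1 + V) :=
    (pow_le_pow_left₀ (norm_nonneg _) (norm_diagonal_mul_le hβ0 hβ1 _) 2).trans
      (H.norm_sq_fromCols_le x)
  have m1 : AllMoments (fun s : EuclideanSpace ℝ (Fin d) × Out l => ‖lin Aᵀ s.1‖) ν :=
    allMoments_norm_lin _
  have m2 : AllMoments (fun s : EuclideanSpace ℝ (Fin d) × Out l => ‖lin (x - Xs)ᵀ s.1‖) ν :=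
    allMoments_norm_lin _
  have m3 : AllMoments (fun s : EuclideanSpace ℝ (Fin d) × Out l => ‖s.1‖) ν :=
    allMoments_norm_fst
  set a₁ : ℝ := 2 ^ n * ((2 * γ * L / d) ^ n * (1 / 2)) with ha₁
  set a₂ : ℝ := 2 ^ n * ((γ * L / d) ^ (2 * n) * (1 / 2)) with ha₂
  -- The moments of `‖a‖` are of order `d ^ (2 * n)`, those of the projected error are free of `d`.
  -- This weight makes both terms of order `d ^ n`, and with the prefactor `d ^ (-2n)` the quadratic
  -- part of the increment is of order `d ^ (-n)`, like the linear part.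
  set t : ℝ := ((d : ℝ) ^ n)⁻¹ with ht
  have ht0 : 0 < t := by positivity
  have hpt : ∀ᵐ s ∂ν, |incr f γ β Xs x s p q| ^ n
      ≤ a₁ * (‖lin Aᵀ s.1‖ ^ (2 * n) + ‖lin (x - Xs)ᵀ s.1‖ ^ (2 * n))
        + a₂ * (t * ‖s.1‖ ^ (2 * (2 * n)) + t⁻¹ * ‖lin (x - Xs)ᵀ s.1‖ ^ (2 * (2 * n))) := by
    filter_upwards [H.ae_sgdGrad] with s hs
    have h1 := abs_incr_le hγ hβ0 hβ1 (hs x).1 p q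
    have h2 : |incr f γ β Xs x s p q| ^ n ≤ (_ + _) ^ n := pow_le_pow_left₀ (abs_nonneg _) h1 n
    refine h2.trans ((add_pow_le (by positivity) (by positivity) n).trans ?_)
    have e1 := mul_pow_le_half (a := ‖lin Aᵀ s.1‖) (b := ‖lin (x - Xs)ᵀ s.1‖) one_pos n
    have e2 := mul_pow_le_half (a := ‖s.1‖) (b := ‖lin (x - Xs)ᵀ s.1‖) ht0 (2 * n)
    rw [one_mul, inv_one, one_mul] at e1
    have e3 : (2 : ℝ) ^ (n - 1) ≤ 2 ^ n := pow_le_pow_right₀ one_le_two (Nat.sub_le _ _)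
    rw [mul_pow, mul_pow, mul_pow, ← pow_mul, mul_pow (‖s.1‖ ^ 2), ← pow_mul, ← pow_mul]
    calc _ ≤ (2 : ℝ) ^ n * ((2 * γ * L / d) ^ n * (1 / 2 * (‖lin Aᵀ s.1‖ ^ (2 * n)
          + ‖lin (x - Xs)ᵀ s.1‖ ^ (2 * n))) + (γ * L / d) ^ (2 * n) * (1 / 2 * (t * ‖s.1‖ ^ (2 * (2 * n))
          + t⁻¹ * ‖lin (x - Xs)ᵀ s.1‖ ^ (2 * (2 * n))))) := by
          gcongr
      _ = _ := by rw [ha₁, ha₂]; ring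
  have M1 := m1.pow (2 * n)
  have M2 := m2.pow (2 * n)
  have M3 := (m3.pow (2 * (2 * n))).const_mul t
  have M4 := (m2.pow (2 * (2 * n))).const_mul t⁻¹
  have M5 := (M1.add M2).const_mul a₁
  have M6 := (M3.add M4).const_mul a₂
  have hint : ∫ s, (a₁ * (‖lin Aᵀ s.1‖ ^ (2 * n) + ‖lin (x - Xs)ᵀ s.1‖ ^ (2 * n))
        + a₂ * (t * ‖s.1‖ ^ (2 * (2 * n)) + t⁻¹ * ‖lin (x - Xs)ᵀ s.1‖ ^ (2 * (2 * n)))) ∂ν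
      = a₁ * (∫ s, ‖lin Aᵀ s.1‖ ^ (2 * n) ∂ν + ∫ s, ‖lin (x - Xs)ᵀ s.1‖ ^ (2 * n) ∂ν)
        + a₂ * (t * ∫ s, ‖s.1‖ ^ (2 * (2 * n)) ∂ν
          + t⁻¹ * ∫ s, ‖lin (x - Xs)ᵀ s.1‖ ^ (2 * (2 * n)) ∂ν) := by
    rw [integral_add M5.integrable M6.integrable, integral_const_mul, integral_const_mul,
      integral_add M1.integrable M2.integrable, integral_add M3.integrable M4.integrable,
      integral_const_mul, integral_const_mul]
  refine (integral_mono_of_nonneg (ae_of_all _ fun s => by positivity)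
    (M5.add M6).integrable hpt).trans ?_
  rw [hint]
  have hV1 : 1 ≤ 1 + V := by linarith
  have b1 : ∫ s, ‖lin Aᵀ s.1‖ ^ (2 * n) ∂ν ≤ κ ^ n * Q ^ n * gaussMoment n * (1 + V) ^ (2 * n) := by
    refine (H.integral_norm_lin_pow_le A n).trans ?_
    calc (κ * ‖A‖ ^ 2) ^ n * gaussMoment n ≤ (κ * (Q * (1 + V))) ^ n * gaussMoment n := by gcongr
      _ = κ ^ n * Q ^ n * gaussMoment n * (1 + V) ^ n := by rw [mul_pow, mul_pow]; ring
      _ ≤ _ := by gcongr; linarith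
  have b2 : ∫ s, ‖lin (x - Xs)ᵀ s.1‖ ^ (2 * n) ∂ν
      ≤ κ ^ n * Q ^ n * gaussMoment n * (1 + V) ^ (2 * n) := by
    refine (H.integral_norm_lin_pow_le (x - Xs) n).trans ?_
    rw [← hV]
    calc (κ * V) ^ n * gaussMoment n ≤ (κ * (Q * (1 + V))) ^ n * gaussMoment n := by
          gcongr; nlinarith
      _ = κ ^ n * Q ^ n * gaussMoment n * (1 + V) ^ n := by rw [mul_pow, mul_pow]; ring
      _ ≤ _ := by gcongr; linarith
  have b3 : t * ∫ s, ‖s.1‖ ^ (2 * (2 * n)) ∂ν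
      ≤ d ^ n * κ ^ (2 * n) * gaussMoment (2 * n) * (1 + V) ^ (2 * n) := by
    have h1 := H.integral_norm_fst_pow_le (2 * n)
    calc t * ∫ s, ‖s.1‖ ^ (2 * (2 * n)) ∂ν ≤ t * ((κ * d) ^ (2 * n) * gaussMoment (2 * n)) := by
          gcongr
      _ = d ^ n * κ ^ (2 * n) * gaussMoment (2 * n) * 1 := by
          rw [ht, mul_pow, two_mul n, pow_add (d : ℝ)]; field_simp
      _ ≤ _ := by gcongr; exact one_le_pow₀ hV1
  have b4 : t⁻¹ * ∫ s, ‖lin (x - Xs)ᵀ s.1‖ ^ (2 * (2 * n)) ∂ν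
      ≤ d ^ n * κ ^ (2 * n) * gaussMoment (2 * n) * (1 + V) ^ (2 * n) := by
    have h1 := H.integral_norm_lin_pow_le (x - Xs) (2 * n)
    rw [← hV] at h1
    calc _ ≤ t⁻¹ * ((κ * V) ^ (2 * n) * gaussMoment (2 * n)) := by gcongr
      _ = d ^ n * κ ^ (2 * n) * gaussMoment (2 * n) * V ^ (2 * n) := by
          rw [ht, inv_inv, mul_pow]; ring
      _ ≤ _ := by gcongr; linarith
  calc _ ≤ a₁ * (κ ^ n * Q ^ n * gaussMoment n * (1 + V) ^ (2 * n)
          + κ ^ n * Q ^ n * gaussMoment n * (1 + V) ^ (2 * n))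
        + a₂ * (d ^ n * κ ^ (2 * n) * gaussMoment (2 * n) * (1 + V) ^ (2 * n)
          + d ^ n * κ ^ (2 * n) * gaussMoment (2 * n) * (1 + V) ^ (2 * n)) := by gcongr
    _ = incrConst γ L κ Q n * (1 + V) ^ (2 * n) / d ^ n := by
      have e1 : (2 * γ * L / d) ^ n = (2 * γ * L) ^ n / d ^ n := div_pow _ _ _
      have e2 : (γ * L / d) ^ (2 * n) = (γ * L) ^ (2 * n) / (d ^ n * d ^ n) := by
        rw [div_pow, ← pow_add, two_mul]
      rw [ha₁, ha₂, incrConst, e1, e2]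
      generalize (2 * γ * L) ^ n = y₁
      generalize (γ * L) ^ (2 * n) = y₂
      field_simp
      ring
    _ ≤ _ := by
      unfold incrConst
      have : 0 ≤ γb := hγ.trans hγb
      gcongr

end Step

/-! ### The conditional mean of one increment. -/

section Drift

variable {l d : ℕ} {f : OutP l → Out l → ℝ} {h : MatP l → ℝ} {U : Set (MatP l)}
  {α Lf Lh LI μ θ L γ γb κ Q : ℝ} {lam : Fin d → ℝ} {Xs : Matrix (Fin d) (Fin l) ℝ}

lemma StepSetting.allMoments_sgdGrad (H : StepSetting f h U α Lf Lh LI μ θ L γ γb κ Q lam Xs)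
    (x : Matrix (Fin d) (Fin l) ℝ) (p : Fin l ⊕ Fin l) :
    AllMoments (fun s => join (sgdGrad f Xs x s) 0 p) (jointLaw l (Matrix.diagonal lam)) := by
  refine ((allMoments_norm_lin (x - Xs)ᵀ).const_mul L).mono ?_ ?_
  · have h1 : Measurable (sgdGrad f Xs x) :=
      measurable_gradX_lin H.reg.f_meas H.reg.f_smooth (Matrix.fromCols x Xs)ᵀ
    rcases p with p | p
    · simp only [join_apply_inl]
      exact ((measurable_pi_apply p).comp
        ((PiLp.continuous_ofLp 2 (fun _ : Fin l => ℝ)).measurable.comp h1)).aestronglyMeasurable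
    · simp only [join_apply_inr]
      exact aestronglyMeasurable_const
  · filter_upwards [H.ae_sgdGrad] with s hs
    exact (abs_join_le _ p).trans (hs x).1

lemma allMoments_lin_apply {S : Matrix (Fin d) (Fin d) ℝ} {n : Type*} [Fintype n]
    (A : Matrix n (Fin d) ℝ) (p : n) :
    AllMoments (fun s : EuclideanSpace ℝ (Fin d) × Out l => lin A s.1 p) (jointLaw l S) := by
  simp only [lin_apply]
  exact AllMoments.sum _ fun i _ =>
    (AllMoments.comp (allMoments_coord i) measurePreserving_fst_jointLaw).const_mul _

/-- `integral_inner_gradX` for a direction `V` whose only nonzero column is column `q`, equal to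
column `p` of `diag(β) W`. For `q` in the second block both sides are zero. -/
lemma StepSetting.integral_lin_mul_sgdGrad
    (H : StepSetting f h U α Lf Lh LI μ θ L γ γb κ Q lam Xs) (β : Fin d → ℝ)
    {x : Matrix (Fin d) (Fin l) ℝ} (hx : wMom lam (Matrix.fromCols x Xs) ∈ U)
    (p q : Fin l ⊕ Fin l) :
    ∫ s, lin (Matrix.diagonal β * Matrix.fromCols x Xs)ᵀ s.1 p * join (sgdGrad f Xs x s) 0 q
        ∂(jointLaw l (Matrix.diagonal lam))
      = 2 * (upperRow (matGrad h (wMom lam (Matrix.fromCols x Xs)))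
          * wMom (fun i => β i * lam i) (Matrix.fromCols x Xs)) q p := by
  rcases q with q | q
  · set W := Matrix.fromCols x Xs with hW
    obtain ⟨V, hV⟩ : ∃ V : Matrix (Fin d) (Fin l) ℝ,
        ∀ i r, V i r = if r = q then β i * W i p else 0 :=
      ⟨Matrix.of fun i r => if r = q then β i * W i p else 0, fun _ _ => rfl⟩
    have key := integral_inner_gradX H.reg.α_nonneg H.reg.f_meas H.reg.f_int H.reg.f_lip
      H.reg.f_smooth H.reg.U_open H.reg.h_symm H.reg.h_risk H.reg.h_C1 H.posSemidef W hx V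
    have h1 : ∀ s : EuclideanSpace ℝ (Fin d) × Out l,
        inner ℝ (lin Vᵀ s.1) (gradX f (lin Wᵀ s.1) s.2)
          = lin (Matrix.diagonal β * W)ᵀ s.1 p * join (sgdGrad f Xs x s) 0 (Sum.inl q) := by
      intro s
      rw [PiLp.inner_apply, lin_diagonal_mul_apply, join_apply_inl]
      have h2 : ∀ r, lin Vᵀ s.1 r = if r = q then ∑ i, β i * W i p * s.1 i else 0 := fun r => by
        rw [lin_apply]
        simp only [Matrix.transpose_apply, hV]
        split_ifs with hr <;> simp
      simp only [h2, RCLike.inner_apply, conj_trivial, mul_ite, mul_zero, Finset.sum_ite_eq',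
        Finset.mem_univ, if_true]
      rw [mul_comm]; rfl
    simp only [h1] at key
    rw [key]
    have h3 : ∀ s r, (Wᵀ * Matrix.diagonal lam * V) s r
        = if r = q then wMom (fun i => β i * lam i) W s p else 0 := fun s r => by
      rw [wMom_apply]
      simp only [Matrix.mul_apply, Matrix.transpose_apply, Matrix.diagonal_apply, mul_ite,
        mul_zero, Finset.sum_ite_eq', Finset.mem_univ, if_true, hV]
      split_ifs with hr
      · exact Finset.sum_congr rfl fun i _ => by ring
      · simp
    simp only [h3, mul_ite, mul_zero]
    congr 1
    have h4 : ∀ r : Fin l, (∑ s, if r = q then matGrad h (Wᵀ * Matrix.diagonal lam * W) (Sum.inl r) s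
        * wMom (fun i => β i * lam i) W s p else 0)
        = if r = q then ∑ s, matGrad h (wMom lam W) (Sum.inl r) s
          * wMom (fun i => β i * lam i) W s p else 0 := fun r => by
      split_ifs with hr
      · rfl
      · simp
    simp only [h4, Finset.sum_ite_eq', Finset.mem_univ, if_true]
    rw [Matrix.mul_apply]
    refine Finset.sum_congr rfl fun s _ => ?_
    rcases s with s | s <;> simp [upperRow, Matrix.toBlocks₁₁, Matrix.toBlocks₁₂]
  · simp [join_apply_inr, Matrix.mul_apply, upperRow]

lemma StepSetting.integral_sgdGrad_mul
    (H : StepSetting f h U α Lf Lh LI μ θ L γ γb κ Q lam Xs) (x : Matrix (Fin d) (Fin l) ℝ)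
    (p q : Fin l ⊕ Fin l) :
    ∫ s, join (sgdGrad f Xs x s) 0 p * join (sgdGrad f Xs x s) 0 q
        ∂(jointLaw l (Matrix.diagonal lam))
      = upperLeft (fisher f (wMom lam (Matrix.fromCols x Xs))) p q := by
  rcases p with p | p
  · rcases q with q | q
    · simp only [join_apply_inl, upperLeft, Matrix.fromBlocks_apply₁₁, fisher]
      have h1 := measurable_gradX H.reg.f_meas H.reg.f_smooth
      have h2 : Measurable fun s : EuclideanSpace ℝ (Fin d) × Out l =>
          (lin (Matrix.fromCols x Xs)ᵀ s.1, s.2) := by fun_prop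
      rw [wMom, ← map_jointLaw H.posSemidef, integral_map h2.aemeasurable]
      · rfl
      · have h3 : ∀ r : Fin l, Measurable fun s : OutP l × Out l => gradX f s.1 s.2 r := fun r => by
          generalize gradX f = G at h1
          exact (measurable_pi_apply r).comp
            ((PiLp.continuous_ofLp 2 (fun _ : Fin l => ℝ)).measurable.comp h1)
        exact ((h3 p).mul (h3 q)).aestronglyMeasurable
    · simp [join_apply_inr, upperLeft]
  · rcases q with q | q <;> simp [join_apply_inr, upperLeft]

/-- The conditional mean of the increments. -/
lemma StepSetting.abs_integral_incr_sub_le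
    (H : StepSetting f h U α Lf Lh LI μ θ L γ γb κ Q lam Xs) {β : Fin d → ℝ}
    (hβ0 : ∀ i, 0 ≤ β i) (hβ1 : ∀ i, β i ≤ 1) {x : Matrix (Fin d) (Fin l) ℝ}
    (hx : wMom lam (Matrix.fromCols x Xs) ∈ U) (p q : Fin l ⊕ Fin l) :
    |∫ s, incr f γ β Xs x s p q ∂(jointLaw l (Matrix.diagonal lam))
      - (-(2 * γ / d) * symProd (upperRow (matGrad h (wMom lam (Matrix.fromCols x Xs))))
          (wMom (fun i => β i * lam i) (Matrix.fromCols x Xs)) p q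
        + (γ / d) ^ 2 * (∑ i, β i * lam i)
          * upperLeft (fisher f (wMom lam (Matrix.fromCols x Xs))) p q)|
      ≤ (γ / d) ^ 2 * (√d * ((κ ^ 2 + 2 * L ^ 4 * κ ^ 2) * (1 + ‖x - Xs‖ ^ 2) ^ 2)) := by
  set ν := jointLaw l (Matrix.diagonal lam)
  set W := Matrix.fromCols x Xs with hW
  have hd := H.d_pos
  have hκ := H.κ_nonneg
  have hsd : 0 < √(d : ℝ) := Real.sqrt_pos.2 hd
  set G := upperRow (matGrad h (wMom lam W)) with hG
  set u : EuclideanSpace ℝ (Fin d) × Out l → Fin l ⊕ Fin l → ℝ := fun s r =>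
    lin (Matrix.diagonal β * W)ᵀ s.1 r with hu
  set g : EuclideanSpace ℝ (Fin d) × Out l → Fin l ⊕ Fin l → ℝ := fun s r =>
    join (sgdGrad f Xs x s) 0 r with hg
  -- The fluctuation of `∑ᵢ βᵢ aᵢ²` about its mean. All other contributions to the conditional mean
  -- are exact, so the whole error is `(γ/d)² 𝔼[S g_p g_q]`.
  set S : EuclideanSpace ℝ (Fin d) × Out l → ℝ := fun s =>
    ∑ i, β i * s.1 i ^ 2 - ∑ i, β i * lam i with hS
  have mu : ∀ r, AllMoments (fun s => u s r) ν := fun r => allMoments_lin_apply _ r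
  have mg : ∀ r, AllMoments (fun s => g s r) ν := fun r => H.allMoments_sgdGrad x r
  have mS : AllMoments S ν := by
    refine AllMoments.sub (AllMoments.sum _ fun i _ => ?_) (AllMoments.const _)
    have h1 := (allMoments_coord (S := Matrix.diagonal lam) i).comp
      (measurePreserving_fst_jointLaw (l := l))
    exact (h1.pow 2).const_mul (β i)
  have mSg := mS.mul ((mg p).mul (mg q))
  have hdec : ∀ s, incr f γ β Xs x s p q = -(γ / d) * (u s p * g s q + g s p * u s q)
      + ((γ / d) ^ 2 * (S s * (g s p * g s q))
        + (γ / d) ^ 2 * (∑ i, β i * lam i) * (g s p * g s q)) := fun s => by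
    simp only [incr, hu, hg, hS]
    ring
  have M1 := (mu p).mul (mg q)
  have M2 := (mg p).mul (mu q)
  have M3 := (M1.add M2).const_mul (-(γ / d))
  have M4 := mSg.const_mul ((γ / d) ^ 2)
  have M5 := ((mg p).mul (mg q)).const_mul ((γ / d) ^ 2 * (∑ i, β i * lam i))
  have e1 : ∫ s, u s p * g s q ∂ν = 2 * (G * wMom (fun i => β i * lam i) W) q p :=
    H.integral_lin_mul_sgdGrad β hx p q
  have e2 : ∫ s, g s p * u s q ∂ν = 2 * (G * wMom (fun i => β i * lam i) W) p q := by
    rw [← H.integral_lin_mul_sgdGrad β hx q p]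
    exact integral_congr_ae (ae_of_all _ fun s => mul_comm _ _)
  have e3 : ∫ s, g s p * g s q ∂ν = upperLeft (fisher f (wMom lam W)) p q :=
    H.integral_sgdGrad_mul x p q
  have e4 : symProd G (wMom (fun i => β i * lam i) W) p q
      = (G * wMom (fun i => β i * lam i) W) p q + (G * wMom (fun i => β i * lam i) W) q p := by
    have h0 : wMom (fun i => β i * lam i) W * Gᵀ = (G * wMom (fun i => β i * lam i) W)ᵀ := by
      rw [Matrix.transpose_mul, wMom_transpose]
    rw [symProd, Matrix.add_apply, h0, Matrix.transpose_apply]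
  simp only [hdec]
  rw [integral_add M3.integrable (M4.add M5).integrable, integral_add M4.integrable M5.integrable,
    integral_const_mul, integral_const_mul, integral_const_mul,
    integral_add M1.integrable M2.integrable, e1, e2, e3, e4]
  have e5 : ∀ X Y Z A : ℝ, -(γ / d) * (2 * X + 2 * Y) + ((γ / d) ^ 2 * Z + A)
      - (-(2 * γ / d) * (Y + X) + A) = (γ / d) ^ 2 * Z := fun X Y Z A => by ring
  rw [e5, abs_mul, abs_of_nonneg (sq_nonneg _)]
  refine mul_le_mul_of_nonneg_left ?_ (sq_nonneg _)
  -- The variance of `S` is of order `d`, the fourth moment of the projected error is free of `d`;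
  -- this weight makes both contributions of order `√d`.
  set t : ℝ := (√d)⁻¹ with ht
  have ht0 : 0 < t := by positivity
  have mz : AllMoments (fun s : EuclideanSpace ℝ (Fin d) × Out l => ‖lin (x - Xs)ᵀ s.1‖) ν :=
    allMoments_norm_lin _
  have N1 := ((mS.pow 2).const_mul t).add ((mz.pow (2 * 2)).const_mul (t⁻¹ * L ^ 4))
  have hpt : ∀ᵐ s ∂ν, |S s * (g s p * g s q)|
      ≤ 1 / 2 * (t * S s ^ 2 + t⁻¹ * L ^ 4 * ‖lin (x - Xs)ᵀ s.1‖ ^ (2 * 2)) := by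
    filter_upwards [H.ae_sgdGrad] with s hs
    have h1 := mul_pow_le_half (a := |S s|) (b := |g s p * g s q|) ht0 1
    rw [pow_one, pow_one, ← abs_mul, mul_one, sq_abs, sq_abs] at h1
    refine h1.trans ?_
    have h2 := (hs x).1
    have h3 : |g s p| ≤ L * ‖lin (x - Xs)ᵀ s.1‖ := (abs_join_le _ p).trans h2
    have h4 : |g s q| ≤ L * ‖lin (x - Xs)ᵀ s.1‖ := (abs_join_le _ q).trans h2
    have h5 : (g s p * g s q) ^ 2 ≤ L ^ 4 * ‖lin (x - Xs)ᵀ s.1‖ ^ (2 * 2) := by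
      rw [← sq_abs, abs_mul]
      calc (|g s p| * |g s q|) ^ 2
          ≤ ((L * ‖lin (x - Xs)ᵀ s.1‖) * (L * ‖lin (x - Xs)ᵀ s.1‖)) ^ 2 := by
            gcongr
            exact (abs_nonneg _).trans h3
        _ = _ := by ring
    have h6 := mul_le_mul_of_nonneg_left h5 (inv_pos.2 ht0).le
    rw [mul_assoc t⁻¹]
    linarith
  refine (abs_integral_le_integral_abs).trans
    ((integral_mono_ae mSg.abs.integrable (N1.const_mul (1 / 2)).integrable hpt).trans ?_)
  rw [integral_const_mul, integral_add ((mS.pow 2).const_mul t).integrable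
    ((mz.pow (2 * 2)).const_mul (t⁻¹ * L ^ 4)).integrable, integral_const_mul, integral_const_mul]
  have b1 : ∫ s, S s ^ 2 ∂ν ≤ 2 * (d * κ ^ 2) := by
    have h1 : ∫ s, S s ^ 2 ∂ν = ∫ a, (∑ i, β i * a i ^ 2 - ∑ i, β i * lam i) ^ 2
        ∂(multivariateGaussian 0 (Matrix.diagonal lam)) := by
      rw [← (measurePreserving_fst_jointLaw (l := l) (S := Matrix.diagonal lam)).map_eq,
        integral_map measurable_fst.aemeasurable]
      exact (by fun_prop : Continuous fun a : EuclideanSpace ℝ (Fin d) =>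
        (∑ i, β i * a i ^ 2 - ∑ i, β i * lam i) ^ 2).aestronglyMeasurable
    rw [h1, integral_quadForm_sub_sq H.lam_nonneg]
    refine mul_le_mul_of_nonneg_left ?_ zero_le_two
    have h2 : ∑ i : Fin d, β i ^ 2 * lam i ^ 2 ≤ ∑ _i : Fin d, κ ^ 2 :=
      Finset.sum_le_sum fun i _ => by
        calc β i ^ 2 * lam i ^ 2 ≤ 1 * κ ^ 2 := mul_le_mul (pow_le_one₀ (hβ0 i) (hβ1 i))
              (pow_le_pow_left₀ (H.lam_nonneg i) (H.lam_le i) 2) (sq_nonneg _) zero_le_one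
          _ = κ ^ 2 := one_mul _
    simpa using h2
  have b2 := H.integral_norm_lin_pow_le (x - Xs) 2
  rw [gaussMoment_two] at b2
  set V := ‖x - Xs‖ ^ 2 with hV
  have hV0 : 0 ≤ V := sq_nonneg _
  have hdd : t * (2 * (d * κ ^ 2)) = 2 * (√d * κ ^ 2) := by
    rw [ht]
    nth_rewrite 2 [← Real.mul_self_sqrt hd.le]
    field_simp
  have hL4 : 0 ≤ L ^ 4 := by positivity
  calc 1 / 2 * (t * ∫ s, S s ^ 2 ∂ν + t⁻¹ * L ^ 4 * ∫ s, ‖lin (x - Xs)ᵀ s.1‖ ^ (2 * 2) ∂ν)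
      ≤ 1 / 2 * (t * (2 * (d * κ ^ 2)) + t⁻¹ * L ^ 4 * ((κ * V) ^ 2 * 3)) := by gcongr
    _ = √d * (κ ^ 2 + 3 / 2 * L ^ 4 * κ ^ 2 * V ^ 2) := by rw [hdd, ht, inv_inv]; ring
    _ ≤ _ := by
      refine mul_le_mul_of_nonneg_left ?_ hsd.le
      have h1 : 1 ≤ (1 + V) ^ 2 := by nlinarith
      have h2 : V ^ 2 ≤ (1 + V) ^ 2 := by nlinarith
      have h3 : κ ^ 2 * 1 ≤ κ ^ 2 * (1 + V) ^ 2 := mul_le_mul_of_nonneg_left h1 (sq_nonneg _)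
      have h4 : L ^ 4 * κ ^ 2 * V ^ 2 ≤ L ^ 4 * κ ^ 2 * (1 + V) ^ 2 :=
        mul_le_mul_of_nonneg_left h2 (by positivity)
      have h5 : 0 ≤ L ^ 4 * κ ^ 2 * (1 + V) ^ 2 := by positivity
      linarith

end Drift

/-! ### Growth of the moments of the distance to `X⋆`. -/

section Norm

variable {l d : ℕ} {f : OutP l → Out l → ℝ} {h : MatP l → ℝ} {U : Set (MatP l)}
  {α Lf Lh LI μ θ L γ γb κ Q : ℝ} {lam : Fin d → ℝ} {Xs : Matrix (Fin d) (Fin l) ℝ}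

/-- One step of the algorithm. -/
noncomputable def sgdStep (f : OutP l → Out l → ℝ) (γ : ℝ) (Xs x : Matrix (Fin d) (Fin l) ℝ)
    (s : EuclideanSpace ℝ (Fin d) × Out l) : Matrix (Fin d) (Fin l) ℝ :=
  x - (γ / d) • Matrix.vecMulVec (fun i => s.1 i) (fun j => sgdGrad f Xs x s j)

lemma norm_sq_sub_smul_vecMulVec (Z : Matrix (Fin d) (Fin l) ℝ) (c : ℝ)
    (a : EuclideanSpace ℝ (Fin d)) (v : Out l) :
    ‖Z - c • Matrix.vecMulVec (fun i => a i) (fun j => v j)‖ ^ 2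
      = ‖Z‖ ^ 2 - 2 * c * inner ℝ (lin Zᵀ a) v + c ^ 2 * (‖a‖ ^ 2 * ‖v‖ ^ 2) := by
  have h1 : inner ℝ (lin Zᵀ a) v = ∑ i, ∑ j, Z i j * a i * v j := by
    rw [PiLp.inner_apply, Finset.sum_comm]
    refine Finset.sum_congr rfl fun j _ => ?_
    rw [lin_apply]
    simp [Finset.mul_sum, mul_comm]
  rw [frob_sq, frob_sq, h1, EuclideanSpace.real_norm_sq_eq, EuclideanSpace.real_norm_sq_eq,
    Finset.sum_mul_sum]
  simp only [Finset.mul_sum, ← Finset.sum_add_distrib, ← Finset.sum_sub_distrib]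
  refine Finset.sum_congr rfl fun i _ => Finset.sum_congr rfl fun j _ => ?_
  simp only [Matrix.sub_apply, Matrix.smul_apply, Matrix.vecMulVec_apply, smul_eq_mul]
  ring

/-- The constant in the growth of the moments of the distance to the minimizer. -/
noncomputable def growthConst (γ L κ : ℝ) (n : ℕ) : ℝ :=
  ∑ r ∈ Finset.range (n + 1), (n.choose r : ℝ) * ((γ * L) ^ (2 * r) * κ ^ (2 * r)
    * gaussMoment (2 * r))

lemma growthConst_nonneg (hγ : 0 ≤ γ) (hL : 0 ≤ L) (hκ : 0 ≤ κ) (n : ℕ) :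
    0 ≤ growthConst γ L κ n :=
  Finset.sum_nonneg fun r _ => by
    have := gaussMoment_nonneg (2 * r)
    positivity

/-- In the expansion of the square the cross term has a favourable sign by the secant inequality,
almost surely and for every `x`, so it is dropped. Only the quadratic noise is left, with mean of
order `1/d`. -/
lemma StepSetting.norm_sq_sgdStep_le (H : StepSetting f h U α Lf Lh LI μ θ L γ γb κ Q lam Xs) :
    ∀ᵐ s ∂(jointLaw l (Matrix.diagonal lam)), ∀ x : Matrix (Fin d) (Fin l) ℝ,
      ‖sgdStep f γ Xs x s - Xs‖ ^ 2 ≤ ‖x - Xs‖ ^ 2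
        + (γ * L / d) ^ 2 * (‖s.1‖ ^ 2 * ‖lin (x - Xs)ᵀ s.1‖ ^ 2) := by
  filter_upwards [H.ae_sgdGrad] with s hs x
  have hγ := H.γ_nonneg
  have h1 : sgdStep f γ Xs x s - Xs = (x - Xs)
      - (γ / d) • Matrix.vecMulVec (fun i => s.1 i) (fun j => sgdGrad f Xs x s j) := by
    rw [sgdStep]; abel
  rw [h1, norm_sq_sub_smul_vecMulVec]
  have h2 : 0 ≤ 2 * (γ / d) * inner ℝ (lin (x - Xs)ᵀ s.1) (sgdGrad f Xs x s) :=
    mul_nonneg (by positivity) (hs x).2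
  have h3 : ‖sgdGrad f Xs x s‖ ^ 2 ≤ (L * ‖lin (x - Xs)ᵀ s.1‖) ^ 2 :=
    pow_le_pow_left₀ (norm_nonneg _) (hs x).1 2
  have h4 : (γ / d) ^ 2 * (‖s.1‖ ^ 2 * ‖sgdGrad f Xs x s‖ ^ 2)
      ≤ (γ / d) ^ 2 * (‖s.1‖ ^ 2 * (L * ‖lin (x - Xs)ᵀ s.1‖) ^ 2) := by gcongr
  have h5 : (γ / d) ^ 2 * (‖s.1‖ ^ 2 * (L * ‖lin (x - Xs)ᵀ s.1‖) ^ 2)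
      = (γ * L / d) ^ 2 * (‖s.1‖ ^ 2 * ‖lin (x - Xs)ᵀ s.1‖ ^ 2) := by ring
  linarith

/-- For the weight `a / b` the two terms of Young's inequality coincide. -/
lemma balanced_sum (y k g : ℝ) {a b : ℝ} (ha : a ≠ 0) (hb : b ≠ 0) :
    y / (b * b) * (1 / 2) * (a / b * (k * (b * b) * g) + b / a * (k * (a * a) * g))
      = y * k * g * a / b := by
  field_simp
  ring

lemma StepSetting.integral_noise_pow_le
    (H : StepSetting f h U α Lf Lh LI μ θ L γ γb κ Q lam Xs) (x : Matrix (Fin d) (Fin l) ℝ)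
    (r : ℕ) :
    ∫ s, ((γ * L / d) ^ 2 * (‖s.1‖ ^ 2 * ‖lin (x - Xs)ᵀ s.1‖ ^ 2)) ^ r
        ∂(jointLaw l (Matrix.diagonal lam))
      ≤ (γb * L) ^ (2 * r) * κ ^ (2 * r) * gaussMoment (2 * r) * (1 + ‖x - Xs‖ ^ 2) ^ r
        / d ^ r := by
  set ν := jointLaw l (Matrix.diagonal lam)
  have hd := H.d_pos
  have hκ := H.κ_nonneg
  have hL := H.reg.L_pos.le
  have hγ := H.γ_nonneg
  have hγb := H.γ_le
  have hγb0 : 0 ≤ γb := hγ.trans hγb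
  set V := ‖x - Xs‖ ^ 2 with hV
  have hV0 : 0 ≤ V := sq_nonneg _
  have hV1 : 0 < 1 + V := by linarith
  have m2 : AllMoments (fun s : EuclideanSpace ℝ (Fin d) × Out l => ‖lin (x - Xs)ᵀ s.1‖) ν :=
    allMoments_norm_lin _
  have m3 : AllMoments (fun s : EuclideanSpace ℝ (Fin d) × Out l => ‖s.1‖) ν :=
    allMoments_norm_fst
  have mY := ((m3.pow 2).mul (m2.pow 2)).const_mul ((γ * L / d) ^ 2)
  set t : ℝ := (1 + V) ^ r / d ^ r with ht
  have ht0 : 0 < t := by positivity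
  have hc := gaussMoment_nonneg (2 * r)
  have M1 := (m3.pow (2 * (2 * r))).const_mul t
  have M2 := (m2.pow (2 * (2 * r))).const_mul t⁻¹
  have hpt : ∀ s : EuclideanSpace ℝ (Fin d) × Out l,
      ((γ * L / d) ^ 2 * (‖s.1‖ ^ 2 * ‖lin (x - Xs)ᵀ s.1‖ ^ 2)) ^ r
      ≤ (γ * L / d) ^ (2 * r) * (1 / 2) * (t * ‖s.1‖ ^ (2 * (2 * r))
      + t⁻¹ * ‖lin (x - Xs)ᵀ s.1‖ ^ (2 * (2 * r))) := fun s => by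
    have h1 := mul_pow_le_half (a := ‖s.1‖) (b := ‖lin (x - Xs)ᵀ s.1‖) ht0 (2 * r)
    rw [mul_pow, ← pow_mul, mul_pow, ← pow_mul, ← pow_mul, mul_assoc]
    exact mul_le_mul_of_nonneg_left h1 (by positivity)
  refine (integral_mono (mY.pow r).integrable ((M1.add M2).const_mul _).integrable hpt).trans ?_
  rw [integral_const_mul, integral_add M1.integrable M2.integrable, integral_const_mul,
    integral_const_mul]
  have b1 := H.integral_norm_fst_pow_le (2 * r)
  have b2 := H.integral_norm_lin_pow_le (x - Xs) (2 * r)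
  rw [← hV] at b2
  have b2' : (κ * V) ^ (2 * r) * gaussMoment (2 * r)
      ≤ (κ * (1 + V)) ^ (2 * r) * gaussMoment (2 * r) := by gcongr; linarith
  calc _ ≤ (γb * L / d) ^ (2 * r) * (1 / 2) * (t * ((κ * d) ^ (2 * r) * gaussMoment (2 * r))
        + t⁻¹ * ((κ * (1 + V)) ^ (2 * r) * gaussMoment (2 * r))) := by
        refine (mul_le_mul_of_nonneg_left (add_le_add (mul_le_mul_of_nonneg_left b1 ht0.le)
          (mul_le_mul_of_nonneg_left (b2.trans b2') (inv_pos.2 ht0).le)) (by positivity)).trans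
          (mul_le_mul_of_nonneg_right ?_ (by positivity))
        gcongr
    _ = _ := by
      have e1 : (γb * L / d) ^ (2 * r) = (γb * L) ^ (2 * r) / ((d : ℝ) ^ r * (d : ℝ) ^ r) := by
        rw [div_pow, ← pow_add, ← two_mul]
      have e2 : (κ * d) ^ (2 * r) = κ ^ (2 * r) * ((d : ℝ) ^ r * (d : ℝ) ^ r) := by
        rw [mul_pow, ← pow_add, ← two_mul]
      have e3 : (κ * (1 + V)) ^ (2 * r) = κ ^ (2 * r) * ((1 + V) ^ r * (1 + V) ^ r) := by
        rw [mul_pow, ← pow_add, ← two_mul]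
      rw [e1, e2, e3, ht, inv_div]
      exact balanced_sum _ _ _ (pow_pos hV1 r).ne' (pow_pos hd r).ne'

/-- In the binomial expansion in the noise, the term of degree `0` reproduces the present value and
degree `r ≥ 1` contributes order `d ^ (-r)`, at most order `1/d`. A growth factor `1 + O(1/d)` stays
bounded over `T d` steps. -/
lemma StepSetting.integral_norm_sgdStep_pow_le
    (H : StepSetting f h U α Lf Lh LI μ θ L γ γb κ Q lam Xs) (x : Matrix (Fin d) (Fin l) ℝ)
    (n : ℕ) :
    ∫ s, (1 + ‖sgdStep f γ Xs x s - Xs‖ ^ 2) ^ n ∂(jointLaw l (Matrix.diagonal lam))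
      ≤ (1 + growthConst γb L κ n / d) * (1 + ‖x - Xs‖ ^ 2) ^ n := by
  set ν := jointLaw l (Matrix.diagonal lam)
  have hd := H.d_pos
  have hd1 : (1 : ℝ) ≤ d := by exact_mod_cast H.one_le
  have hκ := H.κ_nonneg
  have hL := H.reg.L_pos.le
  have hγ := H.γ_nonneg
  have hγb := H.γ_le
  have hγb0 : 0 ≤ γb := hγ.trans hγb
  set V := ‖x - Xs‖ ^ 2 with hV
  have hV0 : 0 ≤ V := sq_nonneg _
  have hV1 : 0 < 1 + V := by linarith
  set Y : EuclideanSpace ℝ (Fin d) × Out l → ℝ := fun s =>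
    (γ * L / d) ^ 2 * (‖s.1‖ ^ 2 * ‖lin (x - Xs)ᵀ s.1‖ ^ 2) with hY
  have m2 : AllMoments (fun s : EuclideanSpace ℝ (Fin d) × Out l => ‖lin (x - Xs)ᵀ s.1‖) ν :=
    allMoments_norm_lin _
  have m3 : AllMoments (fun s : EuclideanSpace ℝ (Fin d) × Out l => ‖s.1‖) ν :=
    allMoments_norm_fst
  have mY : AllMoments Y ν := ((m3.pow 2).mul (m2.pow 2)).const_mul _
  have hYr : ∀ r : ℕ, ∫ s, Y s ^ r ∂ν
      ≤ (γb * L) ^ (2 * r) * κ ^ (2 * r) * gaussMoment (2 * r) * (1 + V) ^ r / d ^ r :=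
    fun r => H.integral_noise_pow_le x r
  have hexp : ∀ s, (1 + V + Y s) ^ n
      = ∑ r ∈ Finset.range (n + 1), ((n.choose r : ℝ) * (1 + V) ^ (n - r)) * Y s ^ r := fun s => by
    rw [add_comm (1 + V), add_pow]
    exact Finset.sum_congr rfl fun r _ => by ring
  have hstep : ∀ᵐ s ∂ν, (1 + ‖sgdStep f γ Xs x s - Xs‖ ^ 2) ^ n
      ≤ ∑ r ∈ Finset.range (n + 1), ((n.choose r : ℝ) * (1 + V) ^ (n - r)) * Y s ^ r := by
    filter_upwards [H.norm_sq_sgdStep_le] with s hs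
    rw [← hexp]
    refine pow_le_pow_left₀ (by positivity) ?_ n
    have := hs x
    simp only [hY]
    linarith
  have MS : ∀ r ∈ Finset.range (n + 1),
      AllMoments (fun s => ((n.choose r : ℝ) * (1 + V) ^ (n - r)) * Y s ^ r) ν := fun r _ =>
    (mY.pow r).const_mul _
  refine (integral_mono_of_nonneg (ae_of_all _ fun s => by positivity)
    (AllMoments.sum _ MS).integrable hstep).trans ?_
  rw [integral_finsetSum _ fun r hr => (MS r hr).integrable]
  have hterm : ∀ r ∈ Finset.range (n + 1),
      ∫ s, ((n.choose r : ℝ) * (1 + V) ^ (n - r)) * Y s ^ r ∂ν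
        ≤ (1 + V) ^ n * ((if r = 0 then 1 else 0) + (n.choose r : ℝ) * ((γb * L) ^ (2 * r)
          * κ ^ (2 * r) * gaussMoment (2 * r)) / d) := by
    intro r hr
    have hrn : r ≤ n := by simpa [Nat.lt_succ_iff] using hr
    rw [integral_const_mul]
    have hc := gaussMoment_nonneg (2 * r)
    rcases Nat.eq_zero_or_pos r with rfl | hr0
    · simp only [Nat.choose_zero_right, Nat.cast_one, one_mul, Nat.sub_zero, pow_zero,
        integral_const, probReal_univ, smul_eq_mul, mul_one, if_true, mul_zero]
      refine le_mul_of_one_le_right (by positivity) ?_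
      rw [mul_zero] at hc
      have : 0 ≤ gaussMoment 0 / d := by positivity
      linarith
    · rw [if_neg hr0.ne', zero_add]
      have h1 : (1 + V) ^ (n - r) * (1 + V) ^ r = (1 + V) ^ n := by
        rw [← pow_add, Nat.sub_add_cancel hrn]
      have h2 : (d : ℝ) ≤ d ^ r := le_self_pow₀ hd1 hr0.ne'
      calc (n.choose r : ℝ) * (1 + V) ^ (n - r) * ∫ s, Y s ^ r ∂ν
          ≤ (n.choose r : ℝ) * (1 + V) ^ (n - r) * ((γb * L) ^ (2 * r) * κ ^ (2 * r)
            * gaussMoment (2 * r) * (1 + V) ^ r / d ^ r) := by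
            gcongr; exact hYr r
        _ = (1 + V) ^ n * ((n.choose r : ℝ) * ((γb * L) ^ (2 * r) * κ ^ (2 * r)
            * gaussMoment (2 * r)) / d ^ r) := by rw [← h1]; ring
        _ ≤ _ := by gcongr
  refine (Finset.sum_le_sum hterm).trans_eq ?_
  rw [← Finset.mul_sum, Finset.sum_add_distrib, Finset.sum_ite_eq', if_pos (by simp),
    ← Finset.sum_div, growthConst, mul_comm]

end Norm

/-- The product σ-algebra on matrices. -/
@[reducible] def matrixMeasurableSpace (m n : Type*) : MeasurableSpace (Matrix m n ℝ) :=
  MeasurableSpace.pi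

attribute [local instance] matrixMeasurableSpace

/-! ### Joint measurability in state and sample. -/

section Measurability

variable {l d : ℕ} {f : OutP l → Out l → ℝ} {L : ℝ}

lemma measurable_entry {m n : Type*} (i : m) (j : n) :
    Measurable fun x : Matrix m n ℝ => x i j :=
  (measurable_pi_apply j).comp (measurable_pi_apply i)

lemma measurable_matrix {Ω : Type*} [MeasurableSpace Ω] {m n : Type*} {X : Ω → Matrix m n ℝ}
    (h : ∀ i j, Measurable fun ω => X ω i j) : Measurable X :=
  measurable_pi_iff.2 fun i => measurable_pi_iff.2 fun j => h i j

lemma measurable_euclidean {Ω ι : Type*} [MeasurableSpace Ω] [Fintype ι]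
    {v : Ω → EuclideanSpace ℝ ι} (h : ∀ i, Measurable fun ω => v ω i) : Measurable v := by
  have h1 : Measurable fun ω => (v ω).ofLp := measurable_pi_iff.2 h
  exact (PiLp.continuous_toLp 2 (fun _ : ι => ℝ)).measurable.comp h1

lemma measurable_coord {ι : Type*} [Fintype ι] (i : ι) :
    Measurable fun v : EuclideanSpace ℝ ι => v i :=
  (measurable_pi_apply i).comp (PiLp.continuous_ofLp 2 (fun _ : ι => ℝ)).measurable

lemma measurable_lin {κ : Type*} [Fintype κ] :
    Measurable fun p : Matrix (Fin d) κ ℝ × EuclideanSpace ℝ (Fin d) => lin p.1ᵀ p.2 := by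
  refine measurable_euclidean fun q => ?_
  simp only [lin_apply, Matrix.transpose_apply]
  exact Finset.measurable_sum _ fun i _ => ((measurable_entry i q).comp measurable_fst).mul
    ((measurable_coord i).comp measurable_snd)

lemma measurable_fromCols (Xs : Matrix (Fin d) (Fin l) ℝ) :
    Measurable fun x : Matrix (Fin d) (Fin l) ℝ => Matrix.fromCols x Xs := by
  refine measurable_matrix fun i r => ?_
  rcases r with r | r
  · exact measurable_entry i r
  · exact measurable_const

lemma measurable_sgdGrad (hf_meas : Measurable (fun p : OutP l × Out l => f p.1 p.2))
    (hf_smooth : ∀ y e : Out l, LSmooth L (slice f y e)) (Xs : Matrix (Fin d) (Fin l) ℝ) :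
    Measurable fun p : Matrix (Fin d) (Fin l) ℝ × (EuclideanSpace ℝ (Fin d) × Out l) =>
      sgdGrad f Xs p.1 p.2 := by
  have h1 := measurable_gradX hf_meas hf_smooth
  have h2 : Measurable fun p : Matrix (Fin d) (Fin l) ℝ × (EuclideanSpace ℝ (Fin d) × Out l) =>
      (lin (Matrix.fromCols p.1 Xs)ᵀ p.2.1, p.2.2) :=
    (measurable_lin.comp (((measurable_fromCols Xs).comp measurable_fst).prodMk
      (measurable_fst.comp measurable_snd))).prodMk (measurable_snd.comp measurable_snd)
  unfold sgdGrad
  generalize gradX f = G at h1 ⊢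
  exact h1.comp h2

lemma measurable_sgdStep (hf_meas : Measurable (fun p : OutP l × Out l => f p.1 p.2))
    (hf_smooth : ∀ y e : Out l, LSmooth L (slice f y e)) (γ : ℝ) (Xs : Matrix (Fin d) (Fin l) ℝ) :
    Measurable fun p : Matrix (Fin d) (Fin l) ℝ × (EuclideanSpace ℝ (Fin d) × Out l) =>
      sgdStep f γ Xs p.1 p.2 := by
  have h1 := measurable_sgdGrad hf_meas hf_smooth Xs
  refine measurable_matrix fun i j => ?_
  simp only [sgdStep, Matrix.sub_apply, Matrix.smul_apply, Matrix.vecMulVec_apply, smul_eq_mul]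
  exact ((measurable_entry i j).comp measurable_fst).sub
    ((((measurable_coord i).comp (measurable_fst.comp measurable_snd)).mul
      ((measurable_coord j).comp h1)).const_mul _)

lemma measurable_join_zero (p : Fin l ⊕ Fin l) : Measurable fun v : Out l => join v 0 p := by
  rcases p with p | p
  · exact measurable_coord p
  · exact measurable_const

lemma measurable_incr (hf_meas : Measurable (fun p : OutP l × Out l => f p.1 p.2))
    (hf_smooth : ∀ y e : Out l, LSmooth L (slice f y e)) (γ : ℝ) (β : Fin d → ℝ)
    (Xs : Matrix (Fin d) (Fin l) ℝ) (p q : Fin l ⊕ Fin l) :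
    Measurable fun y : Matrix (Fin d) (Fin l) ℝ × (EuclideanSpace ℝ (Fin d) × Out l) =>
      incr f γ β Xs y.1 y.2 p q := by
  have h1 := measurable_sgdGrad hf_meas hf_smooth Xs
  have hg : ∀ r, Measurable fun y : Matrix (Fin d) (Fin l) ℝ × (EuclideanSpace ℝ (Fin d) × Out l) =>
      join (sgdGrad f Xs y.1 y.2) 0 r := fun r => (measurable_join_zero r).comp h1
  have hu : ∀ r, Measurable fun y : Matrix (Fin d) (Fin l) ℝ × (EuclideanSpace ℝ (Fin d) × Out l) =>
      lin (Matrix.diagonal β * Matrix.fromCols y.1 Xs)ᵀ y.2.1 r := fun r => by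
    simp only [lin_diagonal_mul_apply]
    exact Finset.measurable_sum _ fun i _ => (((measurable_entry i r).comp
      ((measurable_fromCols Xs).comp measurable_fst)).const_mul _).mul
      ((measurable_coord i).comp (measurable_fst.comp measurable_snd))
  have hb : Measurable fun y : Matrix (Fin d) (Fin l) ℝ × (EuclideanSpace ℝ (Fin d) × Out l) =>
      ∑ i, β i * y.2.1 i ^ 2 :=
    Finset.measurable_sum _ fun i _ => (((measurable_coord i).comp
      (measurable_fst.comp measurable_snd)).pow_const 2).const_mul _
  unfold incr
  exact ((((hu p).mul (hg q)).add ((hg p).mul (hu q))).const_mul _).add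
    ((hb.const_mul _).mul ((hg p).mul (hg q)))

end Measurability

/-! ### The iterates: moments over `T d` steps and the accumulated noise. -/

section Iterates

variable {l d : ℕ} {f : OutP l → Out l → ℝ} {h : MatP l → ℝ} {U : Set (MatP l)}
  {α Lf Lh LI μ θ L γ γb κ Q : ℝ} {lam : Fin d → ℝ} {X₀ Xs : Matrix (Fin d) (Fin l) ℝ}

/-- The iterates of the algorithm for the samples `s`. -/
noncomputable def traj (f : OutP l → Out l → ℝ) (γ : ℝ) (X₀ Xs : Matrix (Fin d) (Fin l) ℝ)
    (s : ℕ → EuclideanSpace ℝ (Fin d) × Out l) : ℕ → Matrix (Fin d) (Fin l) ℝ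
  | 0 => X₀
  | k + 1 => sgdStep f γ Xs (traj f γ X₀ Xs s k) (s k)

/-- The conditional mean of an increment, given the present state. -/
noncomputable def meanIncr (f : OutP l → Out l → ℝ) (γ : ℝ) (lam β : Fin d → ℝ)
    (Xs x : Matrix (Fin d) (Fin l) ℝ) (p q : Fin l ⊕ Fin l) : ℝ :=
  ∫ s, incr f γ β Xs x s p q ∂(jointLaw l (Matrix.diagonal lam))

lemma measurable_meanIncr (hf_meas : Measurable (fun p : OutP l × Out l => f p.1 p.2))
    (hf_smooth : ∀ y e : Out l, LSmooth L (slice f y e)) (γ : ℝ) (lam β : Fin d → ℝ)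
    (Xs : Matrix (Fin d) (Fin l) ℝ) (p q : Fin l ⊕ Fin l) :
    Measurable fun x => meanIncr f γ lam β Xs x p q :=
  (measurable_incr hf_meas hf_smooth γ β Xs p q).stronglyMeasurable.integral_prod_right'.measurable

/-- The centered increments. -/
noncomputable def noise (f : OutP l → Out l → ℝ) (γ : ℝ) (lam β : Fin d → ℝ)
    (X₀ Xs : Matrix (Fin d) (Fin l) ℝ) (s : ℕ → EuclideanSpace ℝ (Fin d) × Out l)
    (p q : Fin l ⊕ Fin l) (k : ℕ) : ℝ :=
  incr f γ β Xs (traj f γ X₀ Xs s k) (s k) p q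
    - meanIncr f γ lam β Xs (traj f γ X₀ Xs s k) p q

variable {Ω : Type*} {ξ : ℕ → Ω → EuclideanSpace ℝ (Fin d) × Out l}

lemma StepSetting.measurable_traj_past
    (H : StepSetting f h U α Lf Lh LI μ θ L γ γb κ Q lam Xs) (k : ℕ) :
    Measurable[past ξ k] fun ω => traj f γ X₀ Xs (fun i => ξ i ω) k := by
  induction k with
  | zero => exact measurable_const
  | succ k ih =>
    exact (measurable_sgdStep H.reg.f_meas H.reg.f_smooth γ Xs).comp
      ((ih.mono (past_mono k.le_succ) le_rfl).prodMk (measurable_past k.lt_succ_self))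

variable [MeasurableSpace Ω] {P : Measure Ω}

/-- Independent samples from the data distribution. -/
structure Samples (lam : Fin d → ℝ) (P : Measure Ω)
    (ξ : ℕ → Ω → EuclideanSpace ℝ (Fin d) × Out l) : Prop where
  meas : ∀ k, Measurable (ξ k)
  indep : iIndepFun ξ P
  law : ∀ k, P.map (ξ k) = jointLaw l (Matrix.diagonal lam)

lemma Samples.measurePreserving (hξ : Samples lam P ξ) (k : ℕ) :
    MeasurePreserving (ξ k) P (jointLaw l (Matrix.diagonal lam)) :=
  ⟨hξ.meas k, hξ.law k⟩

lemma StepSetting.measurable_traj (H : StepSetting f h U α Lf Lh LI μ θ L γ γb κ Q lam Xs)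
    (hξ : Samples lam P ξ) (k : ℕ) : Measurable fun ω => traj f γ X₀ Xs (fun i => ξ i ω) k :=
  (H.measurable_traj_past k).mono (past_le hξ.meas k) le_rfl

lemma Samples.allMoments_coord (hξ : Samples lam P ξ) (k : ℕ) (i : Fin d) :
    AllMoments (fun ω => (ξ k ω).1 i) P :=
  ((SGDEquiv.allMoments_coord i).comp measurePreserving_fst_jointLaw).comp (hξ.measurePreserving k)

variable [IsProbabilityMeasure P]

lemma norm_le_sum_abs {ι : Type*} [Fintype ι] (v : EuclideanSpace ℝ ι) : ‖v‖ ≤ ∑ i, |v i| := by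
  have h0 : 0 ≤ ∑ i, |v i| := Finset.sum_nonneg fun i _ => abs_nonneg _
  refine (pow_le_pow_iff_left₀ (norm_nonneg _) h0 two_ne_zero).1 ?_
  rw [EuclideanSpace.real_norm_sq_eq]
  simp only [← sq_abs (v _)]
  exact Finset.sum_sq_le_sq_sum_of_nonneg fun i _ => abs_nonneg _

lemma StepSetting.allMoments_traj_sgdGrad
    (H : StepSetting f h U α Lf Lh LI μ θ L γ γb κ Q lam Xs) (hξ : Samples lam P ξ) {k : ℕ}
    (hX : ∀ i j, AllMoments (fun ω => traj f γ X₀ Xs (fun i => ξ i ω) k i j) P)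
    (p : Fin l ⊕ Fin l) :
    AllMoments (fun ω => join (sgdGrad f Xs (traj f γ X₀ Xs (fun i => ξ i ω) k) (ξ k ω)) 0 p) P := by
  have hz : ∀ r, AllMoments
      (fun ω => lin (traj f γ X₀ Xs (fun i => ξ i ω) k - Xs)ᵀ (ξ k ω).1 r) P := fun r => by
    simp only [lin_apply, Matrix.transpose_apply, Matrix.sub_apply]
    exact AllMoments.sum _ fun i _ =>
      ((hX i r).sub (AllMoments.const _)).mul (hξ.allMoments_coord k i)
  refine ((AllMoments.sum Finset.univ fun r _ => (hz r).abs).const_mul L).mono ?_ ?_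
  · exact ((measurable_join_zero p).comp ((measurable_sgdGrad H.reg.f_meas H.reg.f_smooth Xs).comp
      ((H.measurable_traj hξ k).prodMk (hξ.meas k)))).aestronglyMeasurable
  · have h1 := (hξ.measurePreserving k).quasiMeasurePreserving.ae H.ae_sgdGrad
    filter_upwards [h1] with ω hω
    exact (abs_join_le _ p).trans ((hω _).1.trans
      (mul_le_mul_of_nonneg_left (norm_le_sum_abs _) H.reg.L_pos.le))

lemma StepSetting.allMoments_traj (H : StepSetting f h U α Lf Lh LI μ θ L γ γb κ Q lam Xs)
    (hξ : Samples lam P ξ) (k : ℕ) (i : Fin d) (j : Fin l) :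
    AllMoments (fun ω => traj f γ X₀ Xs (fun i => ξ i ω) k i j) P := by
  induction k generalizing i j with
  | zero => exact AllMoments.const _
  | succ k ih =>
    simp only [traj, sgdStep, Matrix.sub_apply, Matrix.smul_apply, Matrix.vecMulVec_apply,
      smul_eq_mul]
    exact (ih i j).sub (((hξ.allMoments_coord k i).mul
      (H.allMoments_traj_sgdGrad hξ ih (Sum.inl j))).const_mul _)

lemma StepSetting.allMoments_one_add_norm_sq
    (H : StepSetting f h U α Lf Lh LI μ θ L γ γb κ Q lam Xs) (hξ : Samples lam P ξ) (k : ℕ) :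
    AllMoments (fun ω => 1 + ‖traj f γ X₀ Xs (fun i => ξ i ω) k - Xs‖ ^ 2) P := by
  simp only [frob_sq, Matrix.sub_apply]
  exact (AllMoments.const 1).add (AllMoments.sum _ fun i _ => AllMoments.sum _ fun j _ =>
    ((H.allMoments_traj hξ k i j).sub (AllMoments.const _)).pow 2)

lemma StepSetting.allMoments_incr
    (H : StepSetting f h U α Lf Lh LI μ θ L γ γb κ Q lam Xs) (hξ : Samples lam P ξ)
    (β : Fin d → ℝ) (p q : Fin l ⊕ Fin l) (k : ℕ) :
    AllMoments (fun ω => incr f γ β Xs (traj f γ X₀ Xs (fun i => ξ i ω) k) (ξ k ω) p q) P := by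
  have hg := fun r => H.allMoments_traj_sgdGrad (X₀ := X₀) hξ (H.allMoments_traj hξ k) r
  have hW : ∀ i r, AllMoments
      (fun ω => Matrix.fromCols (traj f γ X₀ Xs (fun i => ξ i ω) k) Xs i r) P := fun i r => by
    rcases r with r | r
    · exact H.allMoments_traj hξ k i r
    · exact AllMoments.const _
  have hu : ∀ r, AllMoments (fun ω => lin (Matrix.diagonal β
      * Matrix.fromCols (traj f γ X₀ Xs (fun i => ξ i ω) k) Xs)ᵀ (ξ k ω).1 r) P := fun r => by
    simp only [lin_diagonal_mul_apply]
    exact AllMoments.sum _ fun i _ => ((hW i r).const_mul _).mul (hξ.allMoments_coord k i)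
  have hb : AllMoments (fun ω => ∑ i, β i * (ξ k ω).1 i ^ 2) P :=
    AllMoments.sum _ fun i _ => ((hξ.allMoments_coord k i).pow 2).const_mul _
  unfold incr
  exact ((((hu p).mul (hg q)).add ((hg p).mul (hu q))).const_mul _).add
    ((hb.const_mul _).mul ((hg p).mul (hg q)))

/-- Condition on the present state at each step and iterate the one-step growth. The bound does not
depend on `d`, so the moments are controlled without stopping the process. -/
lemma StepSetting.integral_norm_traj_pow_le
    (H : StepSetting f h U α Lf Lh LI μ θ L γ γb κ Q lam Xs) (hξ : Samples lam P ξ) (n : ℕ)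
    {T : ℝ} {k : ℕ} (hk : (k : ℝ) ≤ T * d) :
    ∫ ω, (1 + ‖traj f γ X₀ Xs (fun i => ξ i ω) k - Xs‖ ^ 2) ^ n ∂P
      ≤ Real.exp (growthConst γb L κ n * T) * (1 + ‖X₀ - Xs‖ ^ 2) ^ n := by
  have hd := H.d_pos
  have hg := growthConst_nonneg (H.γ_nonneg.trans H.γ_le) H.reg.L_pos.le H.κ_nonneg n
  set g := growthConst γb L κ n
  have hind : ∀ k, ∫ ω, (1 + ‖traj f γ X₀ Xs (fun i => ξ i ω) k - Xs‖ ^ 2) ^ n ∂P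
      ≤ (1 + g / d) ^ k * (1 + ‖X₀ - Xs‖ ^ 2) ^ n := by
    intro k
    induction k with
    | zero => simp [traj]
    | succ k ih =>
      have hmeas : Measurable (Function.uncurry fun (x : Matrix (Fin d) (Fin l) ℝ)
          (s : EuclideanSpace ℝ (Fin d) × Out l) => (1 + ‖sgdStep f γ Xs x s - Xs‖ ^ 2) ^ n) := by
        simp only [frob_sq, Matrix.sub_apply]
        refine (Measurable.const_add (Finset.measurable_sum _ fun i _ =>
          Finset.measurable_sum _ fun j _ => Measurable.pow_const (Measurable.sub_const ?_ _) 2)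
          1).pow_const n
        exact (measurable_entry i j).comp (measurable_sgdStep H.reg.f_meas H.reg.f_smooth γ Xs)
      have hint := ((H.allMoments_one_add_norm_sq (X₀ := X₀) hξ (k + 1)).pow n).integrable
      have h1 := integral_comp_indepFun (H.measurable_traj (X₀ := X₀) hξ k) (hξ.meas k)
        (indepFun_of_past hξ.meas hξ.indep (H.measurable_traj_past k)) (hξ.law k) hmeas hint
      have h2 : ∫ ω, (1 + ‖traj f γ X₀ Xs (fun i => ξ i ω) (k + 1) - Xs‖ ^ 2) ^ n ∂P
          = ∫ ω, ∫ s, (1 + ‖sgdStep f γ Xs (traj f γ X₀ Xs (fun i => ξ i ω) k) s - Xs‖ ^ 2) ^ n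
            ∂(jointLaw l (Matrix.diagonal lam)) ∂P := h1.2
      rw [h2]
      refine (integral_mono h1.1 (((H.allMoments_one_add_norm_sq (X₀ := X₀) hξ k).pow n).const_mul
        (1 + g / d)).integrable fun ω => H.integral_norm_sgdStep_pow_le _ n).trans ?_
      rw [integral_const_mul, pow_succ', mul_assoc]
      exact mul_le_mul_of_nonneg_left ih (by positivity)
  refine (hind k).trans (mul_le_mul_of_nonneg_right ?_ (by positivity))
  calc (1 + g / d) ^ k ≤ Real.exp (g / d) ^ k :=
        pow_le_pow_left₀ (by positivity) (by linarith [Real.add_one_le_exp (g / d)]) k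
    _ = Real.exp (k * (g / d)) := (Real.exp_nat_mul _ _).symm
    _ ≤ _ := by
      refine Real.exp_le_exp.2 ?_
      rw [← mul_div_assoc, div_le_iff₀ hd]
      calc k * g ≤ T * d * g := mul_le_mul_of_nonneg_right hk hg
        _ = g * T * d := by ring

lemma StepSetting.abs_meanIncr_le
    (H : StepSetting f h U α Lf Lh LI μ θ L γ γb κ Q lam Xs) {β : Fin d → ℝ}
    (hβ0 : ∀ i, 0 ≤ β i) (hβ1 : ∀ i, β i ≤ 1) (x : Matrix (Fin d) (Fin l) ℝ)
    (p q : Fin l ⊕ Fin l) :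
    |meanIncr f γ lam β Xs x p q| ≤ incrConst γb L κ Q 1 * (1 + ‖x - Xs‖ ^ 2) ^ 2 / d := by
  have h1 := H.integral_abs_incr_pow_le hβ0 hβ1 x p q 1
  simp only [pow_one, mul_one] at h1
  exact abs_integral_le_integral_abs.trans h1

lemma StepSetting.allMoments_noise
    (H : StepSetting f h U α Lf Lh LI μ θ L γ γb κ Q lam Xs) (hξ : Samples lam P ξ)
    {β : Fin d → ℝ} (hβ0 : ∀ i, 0 ≤ β i) (hβ1 : ∀ i, β i ≤ 1) (p q : Fin l ⊕ Fin l) (k : ℕ) :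
    AllMoments (fun ω => noise f γ lam β X₀ Xs (fun i => ξ i ω) p q k) P := by
  refine (H.allMoments_incr hξ β p q k).sub ?_
  refine (((H.allMoments_one_add_norm_sq (X₀ := X₀) hξ k).pow 2).const_mul
    (incrConst γb L κ Q 1 / d)).mono ?_ (ae_of_all _ fun ω => ?_)
  · exact ((measurable_meanIncr H.reg.f_meas H.reg.f_smooth γ lam β Xs p q).comp
      (H.measurable_traj hξ k)).aestronglyMeasurable
  · exact (H.abs_meanIncr_le hβ0 hβ1 _ p q).trans_eq (by ring)

/-- The constant in the moment bound of the centered increments. -/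
noncomputable def noiseConst (γ L κ Q V T : ℝ) (n : ℕ) : ℝ :=
  2 ^ n * (incrConst γ L κ Q n + incrConst γ L κ Q 1 ^ n)
    * (Real.exp (growthConst γ L κ (2 * n) * T) * (1 + V) ^ (2 * n))

/-- Given the state, the increment and its mean are of order `1/d` up to powers of `1 + ‖x - X⋆‖²`,
whose moments are bounded up to time `T`. -/
lemma StepSetting.integral_noise_pow_even_le
    (H : StepSetting f h U α Lf Lh LI μ θ L γ γb κ Q lam Xs) (hξ : Samples lam P ξ)
    {β : Fin d → ℝ} (hβ0 : ∀ i, 0 ≤ β i) (hβ1 : ∀ i, β i ≤ 1) (p q : Fin l ⊕ Fin l) {n : ℕ}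
    (hn : Even n) {T V : ℝ} (hV : ‖X₀ - Xs‖ ^ 2 ≤ V) {k : ℕ} (hk : (k : ℝ) ≤ T * d) :
    ∫ ω, noise f γ lam β X₀ Xs (fun i => ξ i ω) p q k ^ n ∂P
      ≤ noiseConst γb L κ Q V T n / d ^ n := by
  have hd := H.d_pos
  have hQ : 0 ≤ Q := by nlinarith [H.le_Q, sq_nonneg ‖Xs‖]
  have hγb := H.γ_nonneg.trans H.γ_le
  have hc := incrConst_nonneg hγb H.reg.L_pos.le H.κ_nonneg hQ n
  have hc1 := incrConst_nonneg hγb H.reg.L_pos.le H.κ_nonneg hQ 1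
  set c := incrConst γb L κ Q n
  set c₁ := incrConst γb L κ Q 1
  set X := fun ω => traj f γ X₀ Xs (fun i => ξ i ω) k with hX
  have MV := ((H.allMoments_one_add_norm_sq (X₀ := X₀) hξ k).pow (2 * n))
  have MI := H.allMoments_incr (X₀ := X₀) hξ β p q k
  have MIn := MI.abs.pow n
  have hpt : ∀ ω, noise f γ lam β X₀ Xs (fun i => ξ i ω) p q k ^ n
      ≤ 2 ^ n * (|incr f γ β Xs (X ω) (ξ k ω) p q| ^ n
        + c₁ ^ n / d ^ n * (1 + ‖X ω - Xs‖ ^ 2) ^ (2 * n)) := by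
    intro ω
    rw [← hn.pow_abs]
    have h1 : |noise f γ lam β X₀ Xs (fun i => ξ i ω) p q k|
        ≤ |incr f γ β Xs (X ω) (ξ k ω) p q| + c₁ * (1 + ‖X ω - Xs‖ ^ 2) ^ 2 / d :=
      (abs_sub _ _).trans (add_le_add le_rfl (H.abs_meanIncr_le hβ0 hβ1 _ p q))
    refine (pow_le_pow_left₀ (abs_nonneg _) h1 n).trans
      ((add_pow_le (abs_nonneg _) (by positivity) n).trans ?_)
    rw [div_pow, mul_pow, ← pow_mul, mul_div_right_comm]
    exact mul_le_mul_of_nonneg_right (pow_le_pow_right₀ one_le_two (Nat.sub_le _ _))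
      (by positivity)
  have hI : ∫ ω, |incr f γ β Xs (X ω) (ξ k ω) p q| ^ n ∂P
      ≤ c / d ^ n * ∫ ω, (1 + ‖X ω - Xs‖ ^ 2) ^ (2 * n) ∂P := by
    have hmeas : Measurable (Function.uncurry fun (x : Matrix (Fin d) (Fin l) ℝ)
        (s : EuclideanSpace ℝ (Fin d) × Out l) => |incr f γ β Xs x s p q| ^ n) :=
      ((measurable_incr H.reg.f_meas H.reg.f_smooth γ β Xs p q).abs).pow_const n
    have h1 := integral_comp_indepFun (H.measurable_traj (X₀ := X₀) hξ k) (hξ.meas k)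
      (indepFun_of_past hξ.meas hξ.indep (H.measurable_traj_past k)) (hξ.law k) hmeas
      MIn.integrable
    rw [h1.2, ← integral_const_mul]
    refine integral_mono h1.1 (MV.const_mul _).integrable fun ω => ?_
    exact (H.integral_abs_incr_pow_le hβ0 hβ1 _ p q n).trans_eq (by ring)
  have hE := H.integral_norm_traj_pow_le (X₀ := X₀) hξ (2 * n) hk
  have hE' : ∫ ω, (1 + ‖X ω - Xs‖ ^ 2) ^ (2 * n) ∂P
      ≤ Real.exp (growthConst γb L κ (2 * n) * T) * (1 + V) ^ (2 * n) :=
    hE.trans (by gcongr)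
  have hME := (MIn.add (MV.const_mul (c₁ ^ n / d ^ n))).const_mul (2 ^ n)
  refine (integral_mono ((H.allMoments_noise hξ hβ0 hβ1 p q k).pow n).integrable hME.integrable
    hpt).trans ?_
  rw [integral_const_mul, integral_add MIn.integrable (MV.const_mul _).integrable,
    integral_const_mul, noiseConst]
  calc _ ≤ 2 ^ n * (c / d ^ n * ∫ ω, (1 + ‖X ω - Xs‖ ^ 2) ^ (2 * n) ∂P
        + c₁ ^ n / d ^ n * ∫ ω, (1 + ‖X ω - Xs‖ ^ 2) ^ (2 * n) ∂P) :=
        mul_le_mul_of_nonneg_left (add_le_add hI le_rfl) (by positivity)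
    _ = 2 ^ n * (c + c₁ ^ n) * (∫ ω, (1 + ‖X ω - Xs‖ ^ 2) ^ (2 * n) ∂P) / d ^ n := by ring
    _ ≤ _ := by
      refine div_le_div_of_nonneg_right (mul_le_mul_of_nonneg_left hE' (by positivity))
        (by positivity)

/-- The accumulated noise. -/
noncomputable def noiseSum (f : OutP l → Out l → ℝ) (γ : ℝ) (lam β : Fin d → ℝ)
    (X₀ Xs : Matrix (Fin d) (Fin l) ℝ) (s : ℕ → EuclideanSpace ℝ (Fin d) × Out l)
    (p q : Fin l ⊕ Fin l) (k : ℕ) : ℝ :=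
  ∑ i ∈ Finset.range k, noise f γ lam β X₀ Xs s p q i

lemma StepSetting.measurable_noise_past
    (H : StepSetting f h U α Lf Lh LI μ θ L γ γb κ Q lam Xs) (β : Fin d → ℝ)
    (p q : Fin l ⊕ Fin l) (k : ℕ) :
    Measurable[past ξ (k + 1)] fun ω => noise f γ lam β X₀ Xs (fun i => ξ i ω) p q k := by
  have h1 : Measurable[past ξ (k + 1)] fun ω => traj f γ X₀ Xs (fun i => ξ i ω) k :=
    (H.measurable_traj_past k).mono (past_mono k.le_succ) le_rfl
  exact ((measurable_incr H.reg.f_meas H.reg.f_smooth γ β Xs p q).comp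
    (h1.prodMk (measurable_past k.lt_succ_self))).sub
    ((measurable_meanIncr H.reg.f_meas H.reg.f_smooth γ lam β Xs p q).comp h1)

lemma StepSetting.measurable_noiseSum_past
    (H : StepSetting f h U α Lf Lh LI μ θ L γ γb κ Q lam Xs) (β : Fin d → ℝ)
    (p q : Fin l ⊕ Fin l) (k : ℕ) :
    Measurable[past ξ k] fun ω => noiseSum f γ lam β X₀ Xs (fun i => ξ i ω) p q k := by
  refine Finset.measurable_sum _ fun i hi => ?_
  exact (H.measurable_noise_past β p q i).mono (past_mono (Finset.mem_range.1 hi)) le_rfl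

lemma StepSetting.allMoments_noiseSum
    (H : StepSetting f h U α Lf Lh LI μ θ L γ γb κ Q lam Xs) (hξ : Samples lam P ξ)
    {β : Fin d → ℝ} (hβ0 : ∀ i, 0 ≤ β i) (hβ1 : ∀ i, β i ≤ 1) (p q : Fin l ⊕ Fin l) (k : ℕ) :
    AllMoments (fun ω => noiseSum f γ lam β X₀ Xs (fun i => ξ i ω) p q k) P :=
  AllMoments.sum _ fun i _ => H.allMoments_noise hξ hβ0 hβ1 p q i

lemma StepSetting.integrable_incr
    (H : StepSetting f h U α Lf Lh LI μ θ L γ γb κ Q lam Xs) (β : Fin d → ℝ)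
    (x : Matrix (Fin d) (Fin l) ℝ) (p q : Fin l ⊕ Fin l) :
    Integrable (fun s => incr f γ β Xs x s p q) (jointLaw l (Matrix.diagonal lam)) := by
  have hg := fun r => H.allMoments_sgdGrad x r
  have hu := fun r => allMoments_lin_apply (l := l) (S := Matrix.diagonal lam)
    (Matrix.diagonal β * Matrix.fromCols x Xs)ᵀ r
  have hb : AllMoments (fun s : EuclideanSpace ℝ (Fin d) × Out l => ∑ i, β i * s.1 i ^ 2)
      (jointLaw l (Matrix.diagonal lam)) :=
    AllMoments.sum _ fun i _ => (((SGDEquiv.allMoments_coord i).comp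
      measurePreserving_fst_jointLaw).pow 2).const_mul _
  exact (((((hu p).mul (hg q)).add ((hg p).mul (hu q))).const_mul _).add
    ((hb.const_mul _).mul ((hg p).mul (hg q)))).integrable

/-- Integrate out the fresh sample with the state and the past sum fixed: the power of the sum
factors out and the centered increment has mean zero. This is the orthogonality used in
`integral_pow_martingale_le`. -/
lemma integral_pow_mul_centered {𝓧 𝓨 : Type*} [MeasurableSpace 𝓧] [MeasurableSpace 𝓨]
    {ζ : ℕ → Ω → 𝓧} {ν : Measure 𝓧} [IsProbabilityMeasure ν] (hζ : ∀ k, Measurable (ζ k))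
    (hind : iIndepFun ζ P) {k : ℕ} (hν : P.map (ζ k) = ν) {X : Ω → 𝓨} {S : Ω → ℝ}
    (hX : Measurable[past ζ k] X) (hS : Measurable[past ζ k] S) {F : 𝓨 × 𝓧 → ℝ}
    (hF : Measurable F) (hFi : ∀ y, Integrable (fun s => F (y, s)) ν) (r : ℕ)
    (hint : Integrable (fun ω => S ω ^ r * (F (X ω, ζ k ω) - ∫ s, F (X ω, s) ∂ν)) P) :
    ∫ ω, S ω ^ r * (F (X ω, ζ k ω) - ∫ s, F (X ω, s) ∂ν) ∂P = 0 := by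
  have hM : Measurable fun y => ∫ s, F (y, s) ∂ν :=
    hF.stronglyMeasurable.integral_prod_right'.measurable
  have hmeas : Measurable (Function.uncurry fun (y : 𝓨 × ℝ) (s : 𝓧) =>
      y.2 ^ r * (F (y.1, s) - ∫ s, F (y.1, s) ∂ν)) :=
    ((measurable_snd.comp measurable_fst).pow_const r).mul
      ((hF.comp ((measurable_fst.comp measurable_fst).prodMk measurable_snd)).sub
        (hM.comp (measurable_fst.comp measurable_fst)))
  refine (integral_comp_indepFun ((hX.prodMk hS).mono (past_le hζ k) le_rfl) (hζ k)
    (indepFun_of_past hζ hind (hX.prodMk hS)) hν hmeas hint).2.trans ?_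
  rw [integral_eq_zero_of_ae]
  refine ae_of_all _ fun ω => ?_
  simp only [Pi.zero_apply]
  rw [integral_const_mul, integral_sub (hFi _) (integrable_const _), integral_const]
  simp

lemma StepSetting.integral_noiseSum_pow_mul_noise
    (H : StepSetting f h U α Lf Lh LI μ θ L γ γb κ Q lam Xs) (hξ : Samples lam P ξ)
    {β : Fin d → ℝ} (hβ0 : ∀ i, 0 ≤ β i) (hβ1 : ∀ i, β i ≤ 1) (p q : Fin l ⊕ Fin l) (r k : ℕ) :
    ∫ ω, noiseSum f γ lam β X₀ Xs (fun i => ξ i ω) p q k ^ r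
      * noise f γ lam β X₀ Xs (fun i => ξ i ω) p q k ∂P = 0 := by
  have hint : Integrable (fun ω => noiseSum f γ lam β X₀ Xs (fun i => ξ i ω) p q k ^ r
      * noise f γ lam β X₀ Xs (fun i => ξ i ω) p q k) P :=
    (((H.allMoments_noiseSum hξ hβ0 hβ1 p q k).pow r).mul
      (H.allMoments_noise hξ hβ0 hβ1 p q k)).integrable
  exact integral_pow_mul_centered hξ.meas hξ.indep (hξ.law k)
    (H.measurable_traj_past (X₀ := X₀) k) (H.measurable_noiseSum_past (X₀ := X₀) β p q k)
    (measurable_incr H.reg.f_meas H.reg.f_smooth γ β Xs p q)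
    (fun x => H.integrable_incr β x p q) r hint

/-- The constant in the tail bound of the accumulated noise. -/
noncomputable def tailConst (γ L κ Q V T : ℝ) (m : ℕ) : ℝ :=
  2 ^ (2 * m + 3) * Real.exp (2 ^ (2 * m + 2)) * T ^ (m + 1)
    * noiseConst γ L κ Q V T (2 * m + 2)

/-- Tails of the accumulated noise. -/
lemma StepSetting.prob_noiseSum_le
    (H : StepSetting f h U α Lf Lh LI μ θ L γ γb κ Q lam Xs) (hξ : Samples lam P ξ)
    {β : Fin d → ℝ} (hβ0 : ∀ i, 0 ≤ β i) (hβ1 : ∀ i, β i ≤ 1) (p q : Fin l ⊕ Fin l) (m : ℕ)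
    {T V : ℝ} (hT : 1 ≤ T) (hV : ‖X₀ - Xs‖ ^ 2 ≤ V) {k : ℕ} (hk : (k : ℝ) ≤ T * d) {δ : ℝ}
    (hδ : 0 < δ) :
    P {ω | δ ≤ |noiseSum f γ lam β X₀ Xs (fun i => ξ i ω) p q k|}
      ≤ ENNReal.ofReal (tailConst γb L κ Q V T m / d ^ (m + 1) / δ ^ (2 * m + 2)) := by
  have hd := H.d_pos
  have hTd : 1 ≤ T * d := by
    have : (1 : ℝ) ≤ d := by exact_mod_cast H.one_le
    nlinarith
  -- The moment inequality needs a positive number of steps; hence the hypothesis `1 ≤ T`.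
  have hn1 : 1 ≤ ⌊T * d⌋₊ := Nat.one_le_floor_iff _ |>.2 hTd
  have hnT : ((⌊T * d⌋₊ : ℕ) : ℝ) ≤ T * d := Nat.floor_le (by linarith)
  have hkn : k ≤ ⌊T * d⌋₊ := Nat.le_floor hk
  have hb0 : 0 ≤ noiseConst γb L κ Q V T (2 * m + 2) / d ^ (2 * m + 2) :=
    (integral_nonneg fun ω => (even_two_mul m |>.add even_two).pow_nonneg _).trans
      (H.integral_noise_pow_even_le (X₀ := X₀) hξ hβ0 hβ1 p q
        ((even_two_mul m).add even_two) hV hk)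
  refine prob_le_of_integral_pow_le (H.allMoments_noiseSum hξ hβ0 hβ1 p q k) ((even_two_mul m).add even_two) ?_ hδ
  refine (integral_pow_martingale_le (n := ⌊T * d⌋₊) (m := m) hn1
    (S := fun k ω => noiseSum f γ lam β X₀ Xs (fun i => ξ i ω) p q k)
    (D := fun k ω => noise f γ lam β X₀ Xs (fun i => ξ i ω) p q k)
    (fun ω => Finset.sum_range_zero _) (fun k ω => Finset.sum_range_succ _ _)
    (fun k => H.allMoments_noiseSum hξ hβ0 hβ1 p q k)
    (fun k => H.allMoments_noise hξ hβ0 hβ1 p q k)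
    (fun k _ => H.integral_noiseSum_pow_mul_noise hξ hβ0 hβ1 p q (2 * m + 1) k)
    (fun i hi => H.integral_noise_pow_even_le hξ hβ0 hβ1 p q ((even_two_mul m).add even_two) hV
      ((Nat.cast_le.2 hi.le).trans hnT)) hkn).trans ?_
  -- About `T d` increments, each with moment of order `d ^ (-(2m+2))`, give `(T d) ^ (m+1) * d ^
  -- (-(2m+2))`: diffusive scaling, with typical size `d ^ (-1/2)`.
  calc _ ≤ 2 ^ (2 * m + 3) * Real.exp (2 ^ (2 * m + 2)) * (T * d) ^ (m + 1)
        * (noiseConst γb L κ Q V T (2 * m + 2) / d ^ (2 * m + 2)) := by gcongr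
    _ = _ := by
      have e : (d : ℝ) ^ (2 * m + 2) = d ^ (m + 1) * d ^ (m + 1) := by
        rw [← pow_add]
        congr 1
        ring
      rw [tailConst, mul_pow, e]
      generalize noiseConst γb L κ Q V T (2 * m + 2) = c
      have : (d : ℝ) ^ (m + 1) ≠ 0 := by positivity
      generalize (d : ℝ) ^ (m + 1) = D at this ⊢
      field_simp

end Iterates

/-! ### Discrete Gronwall inequality for the hierarchy. -/

section Gronwall

/-- A discrete Gronwall inequality for a hierarchy of errors with geometric weights. -/
lemma norm_le_of_hierarchy {E : Type*} [NormedAddCommGroup E] {Δ r R : ℕ → ℕ → E} {n : ℕ}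
    {δ ε₀ s Λ : ℝ} (hs : 0 ≤ s) (hΛ : 0 ≤ Λ) (hδ : 0 ≤ δ)
    (hΔ : ∀ j k, k ≤ n → Δ j k = ∑ i ∈ Finset.range k, r j i + R j k)
    (hR : ∀ j k, k ≤ n → ‖R j k‖ ≤ 2 ^ j * δ)
    (hr : ∀ k < n, ∀ ε, δ ≤ ε → ε ≤ ε₀ → (∀ j, ‖Δ j k‖ ≤ 2 ^ j * ε) →
      ∀ j, ‖r j k‖ ≤ 2 ^ j * (s * Λ * ε))
    (hε : δ * (1 + s * Λ) ^ n ≤ ε₀) :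
    ∀ k ≤ n, ∀ j, ‖Δ j k‖ ≤ 2 ^ j * (δ * (1 + s * Λ) ^ k) := by
  have h1 : 1 ≤ 1 + s * Λ := by nlinarith
  intro k
  -- All levels advance together: the remainder at level `j` may depend on every level, but only at
  -- earlier times.
  induction k using Nat.strong_induction_on with
  | _ k ih =>
    intro hk j
    rw [hΔ j k hk]
    have hi : ∀ i ∈ Finset.range k, ‖r j i‖ ≤ 2 ^ j * (s * Λ * (δ * (1 + s * Λ) ^ i)) := by
      intro i hi
      have hik := Finset.mem_range.1 hi
      refine hr i (hik.trans_le hk) _ (le_mul_of_one_le_right hδ (one_le_pow₀ h1)) ?_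
        (ih i hik (hik.le.trans hk)) j
      exact (mul_le_mul_of_nonneg_left (pow_le_pow_right₀ h1 (hik.le.trans hk)) hδ).trans hε
    refine (norm_add_le _ _).trans ((add_le_add ((norm_sum_le _ _).trans
      (Finset.sum_le_sum hi)) (hR j k hk)).trans_eq ?_)
    -- The accumulated remainders telescope as a geometric sum, and the `-1` is compensated by the
    -- noise bound `2 ^ j * δ`.
    have hg : s * Λ * ∑ i ∈ Finset.range k, (1 + s * Λ) ^ i = (1 + s * Λ) ^ k - 1 := by
      have := mul_geom_sum (1 + s * Λ) k
      rwa [add_sub_cancel_left] at this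
    rw [show ∑ i ∈ Finset.range k, (2 : ℝ) ^ j * (s * Λ * (δ * (1 + s * Λ) ^ i))
      = 2 ^ j * δ * (s * Λ * ∑ i ∈ Finset.range k, (1 + s * Λ) ^ i) by
        rw [Finset.mul_sum, Finset.mul_sum]; exact Finset.sum_congr rfl fun i _ => by ring, hg]
    ring

end Gronwall

/-! ### The velocity field of the weighted moments. -/

section Flow

variable {l d : ℕ} {f : OutP l → Out l → ℝ} {h : MatP l → ℝ} {U : Set (MatP l)}
  {α Lf Lh LI μ θ L γ γb κ Q c ρ M : ℝ} {lam : Fin d → ℝ}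

/-- The geometric weights. -/
noncomputable def wt (lam : Fin d → ℝ) (κ : ℝ) (j : ℕ) : Fin d → ℝ := fun i => (lam i / κ) ^ j

lemma wt_nonneg (hl : ∀ i, 0 ≤ lam i) (hκ : 0 < κ) (j : ℕ) (i : Fin d) : 0 ≤ wt lam κ j i :=
  pow_nonneg (div_nonneg (hl i) hκ.le) j

lemma wt_le_one (hl : ∀ i, 0 ≤ lam i) (hlκ : ∀ i, lam i ≤ κ) (hκ : 0 < κ) (j : ℕ) (i : Fin d) :
    wt lam κ j i ≤ 1 :=
  pow_le_one₀ (div_nonneg (hl i) hκ.le) ((div_le_one hκ).2 (hlκ i))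

lemma wt_zero (i : Fin d) : wt lam κ 0 i = 1 := pow_zero _

lemma wt_mul (hκ : 0 < κ) (j : ℕ) (i : Fin d) : wt lam κ j i * lam i = κ * wt lam κ (j + 1) i := by
  simp only [wt, pow_succ]
  field_simp

/-- The velocity of the weighted moments. -/
noncomputable def flow (f : OutP l → Out l → ℝ) (h : MatP l → ℝ) (γ κ a : ℝ) (A z : MatP l) :
    MatP l :=
  (-(2 * γ * κ)) • symProd (upperRow (matGrad h A)) z + (γ ^ 2 * a) • upperLeft (fisher f A)

/-- A bound for the velocity of the weighted moments. -/
noncomputable def flowBound (γ κ c M : ℝ) : ℝ := 2 * γ * κ * (2 * (c * M)) + γ ^ 2 * κ * c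

/-- A Lipschitz constant for the velocity of the weighted moments. -/
noncomputable def flowLip (γ κ c M : ℝ) : ℝ :=
  2 * γ * κ * (2 * (c * (2 * κ) * M) + 2 * (c * 2)) + γ ^ 2 * κ * (c * (2 * κ))

lemma norm_flow_le (hC : CoeffBound f h U ρ c) (hγ : 0 ≤ γ) (hγb : γ ≤ γb) (hκ : 0 ≤ κ) {a : ℝ}
    (ha0 : 0 ≤ a) (ha : a ≤ κ) {A z : MatP l} (hA : A ∈ U) (hAp : A.PosSemidef) (hAρ : ‖A‖ ≤ ρ)
    (hz : ‖z‖ ≤ M) : ‖flow f h γ κ a A z‖ ≤ flowBound γb κ c M := by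
  have hc := hC.nonneg
  have hM : 0 ≤ M := (norm_nonneg _).trans hz
  have hγb0 := hγ.trans hγb
  have h1 : ‖symProd (upperRow (matGrad h A)) z‖ ≤ 2 * (c * M) :=
    (norm_symProd_le _ _).trans (mul_le_mul_of_nonneg_left
      (mul_le_mul (hC.grad_le A hA hAp hAρ) hz (norm_nonneg _) hc) (by norm_num))
  refine (norm_add_le _ _).trans (add_le_add ?_ ?_)
  · rw [norm_smul, Real.norm_eq_abs, abs_neg, abs_of_nonneg (by positivity)]
    exact mul_le_mul (by gcongr) h1 (norm_nonneg _) (by positivity)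
  · rw [norm_smul, Real.norm_eq_abs, abs_of_nonneg (by positivity)]
    exact mul_le_mul (mul_le_mul (by gcongr) ha ha0 (by positivity)) (hC.fisher_le A hA hAp hAρ)
      (norm_nonneg _) (by positivity)

/-- Here `w` stands for `2 ^ j`. The moment argument is at level `j + 1`, with error `2 w ε`; the
average is `κ` times level `1`, with error `2 κ ε`. The resulting error is again proportional to
`w`, with a Lipschitz constant independent of the level. -/
lemma norm_flow_sub_le (hC : CoeffBound f h U ρ c) (hγ : 0 ≤ γ) (hγb : γ ≤ γb) (hκ : 0 ≤ κ) {a : ℝ}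
    (ha0 : 0 ≤ a) (ha : a ≤ κ) {A z A' z' : MatP l} (hA : A ∈ U) (hAp : A.PosSemidef)
    (hAρ : ‖A‖ ≤ ρ) (hA' : A' ∈ U) (hAp' : A'.PosSemidef) (hAρ' : ‖A'‖ ≤ ρ) (hz : ‖z‖ ≤ M)
    {w ε : ℝ} (hw : 1 ≤ w) (hε : 0 ≤ ε) (hAA : ‖A - A'‖ ≤ κ * (2 * ε))
    (hzz : ‖z - z'‖ ≤ w * 2 * ε) :
    ‖flow f h γ κ a A z - flow f h γ κ a A' z'‖ ≤ w * (flowLip γb κ c M * ε) := by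
  have hc := hC.nonneg
  have hM : 0 ≤ M := (norm_nonneg _).trans hz
  have hG : ‖upperRow (matGrad h A) - upperRow (matGrad h A')‖ ≤ c * (κ * (2 * ε)) :=
    (hC.grad_sub_le A hA hAp A' hA' hAp' hAρ hAρ').trans (mul_le_mul_of_nonneg_left hAA hc)
  have hF : ‖upperLeft (fisher f A) - upperLeft (fisher f A')‖ ≤ c * (κ * (2 * ε)) :=
    (hC.fisher_sub_le A hA hAp A' hA' hAp' hAρ hAρ').trans (mul_le_mul_of_nonneg_left hAA hc)
  have hγb0 := hγ.trans hγb
  have h1 : ‖symProd (upperRow (matGrad h A)) z - symProd (upperRow (matGrad h A')) z'‖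
      ≤ 2 * (c * (κ * (2 * ε)) * M) + 2 * (c * (w * 2 * ε)) := by
    refine (norm_symProd_sub_le _ _ _ _).trans (add_le_add ?_ ?_)
    · exact mul_le_mul_of_nonneg_left (mul_le_mul hG hz (norm_nonneg _) (by positivity))
        (by norm_num)
    · exact mul_le_mul_of_nonneg_left (mul_le_mul (hC.grad_le A' hA' hAp' hAρ') hzz (norm_nonneg _)
        hc) (by norm_num)
  have e : flow f h γ κ a A z - flow f h γ κ a A' z'
      = (-(2 * γ * κ)) • (symProd (upperRow (matGrad h A)) z
          - symProd (upperRow (matGrad h A')) z')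
        + (γ ^ 2 * a) • (upperLeft (fisher f A) - upperLeft (fisher f A')) := by
    simp only [flow, smul_sub]
    abel
  have h2 : ‖(-(2 * γ * κ)) • (symProd (upperRow (matGrad h A)) z
      - symProd (upperRow (matGrad h A')) z')‖
      ≤ 2 * γb * κ * (2 * (c * (κ * (2 * ε)) * M) + 2 * (c * (w * 2 * ε))) := by
    rw [norm_smul, Real.norm_eq_abs, abs_neg, abs_of_nonneg (by positivity)]
    exact mul_le_mul (by gcongr) h1 (norm_nonneg _) (by positivity)
  have h3 : ‖(γ ^ 2 * a) • (upperLeft (fisher f A) - upperLeft (fisher f A'))‖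
      ≤ γb ^ 2 * κ * (c * (κ * (2 * ε))) := by
    rw [norm_smul, Real.norm_eq_abs, abs_of_nonneg (by positivity)]
    exact mul_le_mul (mul_le_mul (by gcongr) ha ha0 (by positivity)) hF
      (norm_nonneg _) (by positivity)
  rw [e]
  refine (norm_add_le _ _).trans ((add_le_add h2 h3).trans ?_)
  have h4 : 0 ≤ (w - 1) * (2 * γb * κ * (2 * (c * (2 * κ) * M)) * ε
      + γb ^ 2 * κ * (c * (2 * κ)) * ε) :=
    mul_nonneg (by linarith) (by positivity)
  unfold flowLip
  linarith

end Flow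

/-! ### Weighted averages of solutions and of iterates. -/

section Averages

variable {l d : ℕ} {f : OutP l → Out l → ℝ} {h : MatP l → ℝ} {U : Set (MatP l)}
  {α Lf Lh LI μ θ L γ κ : ℝ} {lam : Fin d → ℝ}

lemma norm_le_of_entry_le {A : MatP l} {b : ℝ} (hb : 0 ≤ b) (hA : ∀ p q, |A p q| ≤ b) :
    ‖A‖ ≤ 2 * l * b := by
  refine (pow_le_pow_iff_left₀ (norm_nonneg _) (by positivity) two_ne_zero).1 ?_
  rw [frob_sq]
  calc ∑ p, ∑ q, A p q ^ 2 ≤ ∑ p : Fin l ⊕ Fin l, ∑ q : Fin l ⊕ Fin l, b ^ 2 :=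
        Finset.sum_le_sum fun p _ => Finset.sum_le_sum fun q _ => by
          rw [← sq_abs]; exact pow_le_pow_left₀ (abs_nonneg _) (hA p q) 2
    _ = (2 * l * b) ^ 2 := by
        simp
        ring

lemma abs_diffTrace_le (A : MatP l) : |diffTrace A| ≤ 4 * l * ‖A‖ := by
  rw [diffTrace_eq_sum]
  refine (Finset.abs_sum_le_sum_abs _ _).trans ?_
  refine (Finset.sum_le_sum fun j _ => (?_ : _ ≤ 4 * ‖A‖)).trans_eq ?_
  · have h1 := abs_le.1 (abs_entry_le_norm A (Sum.inl j) (Sum.inl j))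
    have h2 := abs_le.1 (abs_entry_le_norm A (Sum.inl j) (Sum.inr j))
    have h3 := abs_le.1 (abs_entry_le_norm A (Sum.inr j) (Sum.inr j))
    rw [abs_le]
    constructor <;> linarith [h1.1, h1.2, h2.1, h2.2, h3.1, h3.2]
  · simp
    ring

lemma norm_avgB_le_trace {β : Fin d → ℝ} (hβ0 : ∀ i, 0 ≤ β i) (hβ1 : ∀ i, β i ≤ 1)
    {B : Fin d → MatP l} (hB : ∀ i, (B i).PosSemidef) :
    ‖avgB β B‖ ≤ (1 / (d : ℝ)) * ∑ i, (B i).trace := by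
  rw [avgB, norm_smul, Real.norm_eq_abs, abs_of_nonneg (by positivity)]
  refine mul_le_mul_of_nonneg_left ((norm_sum_le _ _).trans (Finset.sum_le_sum fun i _ => ?_))
    (by positivity)
  rw [norm_smul, Real.norm_eq_abs, abs_of_nonneg (hβ0 i)]
  exact (mul_le_of_le_one_left (norm_nonneg _) (hβ1 i)).trans (norm_le_trace_of_posSemidef (hB i))

/-- The argument of the coefficients is itself a member of the hierarchy, since `λᵢ = κ (λᵢ/κ)`. -/
lemma avgB_wt_one (hκ : 0 < κ) (B : Fin d → MatP l) : avgB lam B = κ • avgB (wt lam κ 1) B := by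
  have : ∀ i, lam i = κ * wt lam κ 1 i := fun i => by rw [← wt_mul hκ 0, wt_zero, one_mul]
  simp only [avgB, smul_comm κ, Finset.smul_sum, smul_smul]
  exact Finset.sum_congr rfl fun i _ => by rw [this i, mul_assoc, mul_comm κ]

lemma wMom_wt_one (hκ : 0 < κ) (W : Matrix (Fin d) (Fin l ⊕ Fin l) ℝ) :
    wMom lam W = κ • wMom (wt lam κ 1) W := by
  have : ∀ i, lam i = κ * wt lam κ 1 i := fun i => by rw [← wt_mul hκ 0, wt_zero, one_mul]
  ext p q
  simp only [Matrix.smul_apply, wMom_apply, smul_eq_mul, Finset.mul_sum]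
  exact Finset.sum_congr rfl fun i _ => by rw [this i]; ring

lemma wMom_wt_mul (hκ : 0 < κ) (j : ℕ) (W : Matrix (Fin d) (Fin l ⊕ Fin l) ℝ) :
    wMom (fun i => wt lam κ j i * lam i) W = κ • wMom (wt lam κ (j + 1)) W := by
  ext p q
  simp only [Matrix.smul_apply, wMom_apply, smul_eq_mul, Finset.mul_sum, wt_mul hκ]
  exact Finset.sum_congr rfl fun i _ => by ring

lemma wMom_posSemidef {β : Fin d → ℝ} (hβ : ∀ i, 0 ≤ β i) (W : Matrix (Fin d) (Fin l ⊕ Fin l) ℝ) :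
    (wMom β W).PosSemidef := by
  have := (Matrix.PosSemidef.diagonal (n := Fin d) (R := ℝ) (d := β) hβ).conjTranspose_mul_mul_same W
  simpa [wMom] using this

/-- Level `0` has unit weights and carries the quantity to be compared. -/
lemma diffTrace_wMom_wt_zero (x y : Matrix (Fin d) (Fin l) ℝ) :
    diffTrace (wMom (wt lam κ 0) (Matrix.fromCols x y)) = ‖x - y‖ ^ 2 := by
  rw [diffTrace_eq_sum, frob_sq, Finset.sum_comm]
  refine Finset.sum_congr rfl fun j _ => ?_
  simp only [wMom_apply, wt_zero, Matrix.fromCols_apply_inl, Matrix.fromCols_apply_inr,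
    Matrix.sub_apply, Finset.mul_sum, ← Finset.sum_sub_distrib, ← Finset.sum_add_distrib]
  exact Finset.sum_congr rfl fun i _ => by ring

lemma distSq_eq_diffTrace (B : Fin d → MatP l) : distSq B = diffTrace (avgB (wt lam κ 0) B) := by
  rw [distSq_eq, diffTrace_avgB]
  simp only [wt_zero, one_mul]

/-- Every term of the equation has a factor `λᵢ`, which raises the weight by one level; thus the
velocity of level `j` is an exact function of the average and of level `j + 1`. -/
lemma Regular.avgB_odeRHS (R : Regular f h U α Lf Lh LI μ θ L) (hκ : 0 < κ) {A : MatP l}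
    (hA : A ∈ U) (hAp : A.PosSemidef) {B : Fin d → MatP l} (hB : ∀ i, (B i).PosSemidef) (j : ℕ) :
    avgB (wt lam κ j) (fun i => odeRHS f h γ A (lam i) (B i))
      = flow f h γ κ ((1 / (d : ℝ)) * ∑ i, wt lam κ j i * lam i) A
          (avgB (wt lam κ (j + 1)) B) := by
  have e : ∀ i, wt lam κ j i • odeRHS f h γ A (lam i) (B i)
      = (-(2 * γ * κ)) • symProd (upperRow (matGrad h A)) (wt lam κ (j + 1) i • B i)
        + (γ ^ 2 * (wt lam κ j i * lam i)) • upperLeft (fisher f A) := fun i => by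
    rw [R.odeRHS_eq γ (lam i) hA hAp (hB i), smul_add, smul_smul, smul_smul]
    have h1 : symProd (upperRow (matGrad h A)) (wt lam κ (j + 1) i • B i)
        = wt lam κ (j + 1) i • symProd (upperRow (matGrad h A)) (B i) := by
      simp [symProd]
    rw [h1, smul_smul]
    congr 2
    · linear_combination (-(2 * γ)) * wt_mul (lam := lam) hκ j i
    · ring
  have h2 : symProd (upperRow (matGrad h A)) (avgB (wt lam κ (j + 1)) B)
      = (1 / (d : ℝ)) • ∑ i, symProd (upperRow (matGrad h A)) (wt lam κ (j + 1) i • B i) := by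
    simp [symProd, avgB, Matrix.mul_sum, Matrix.sum_mul, Finset.sum_add_distrib]
  rw [flow, h2, avgB]
  simp only [e, Finset.sum_add_distrib, ← Finset.smul_sum, ← Finset.sum_smul, smul_add, smul_smul,
    ← Finset.mul_sum]
  congr 2 <;> ring

end Averages

attribute [local instance] matrixMeasurableSpace

/-! ### Deterministic moments, Euler steps, and mean increments of SGD. -/

section Compare

variable {l d : ℕ} {f : OutP l → Out l → ℝ} {h : MatP l → ℝ} {U : Set (MatP l)}
  {α Lf Lh LI μ θ L γ γb κ Q c T η M : ℝ} {lam : Fin d → ℝ} {X₀ Xs : Matrix (Fin d) (Fin l) ℝ}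
  {B : ℝ → Fin d → MatP l}

/-- The deterministic dynamics in eigencoordinates, on a compact time interval, at distance more
than `η` from the complement of `U`. -/
structure MeanField (f : OutP l → Out l → ℝ) (h : MatP l → ℝ) (U : Set (MatP l)) (γ : ℝ)
    (lam : Fin d → ℝ) (X₀ Xs : Matrix (Fin d) (Fin l) ℝ) (T η M : ℝ) (B : ℝ → Fin d → MatP l) :
    Prop where
  init : ∀ i p q, B 0 i p q = d * (Matrix.fromCols X₀ Xs i p * Matrix.fromCols X₀ Xs i q)
  psd : ∀ t ∈ Icc 0 T, ∀ i, (B t i).PosSemidef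
  η_pos : 0 < η
  far : ∀ t ∈ Icc 0 T, ∀ V ∉ U, η < ‖avgB lam (B t) - V‖
  deriv : ∀ t ∈ Icc 0 T, ∀ i, HasDerivWithinAt (fun s => B s i)
    (odeRHS f h γ (avgB lam (B t)) (lam i) (B t i)) (Icc 0 T) t
  trace_le : ∀ t ∈ Icc 0 T, (1 / (d : ℝ)) * ∑ i, (B t i).trace ≤ M

lemma MeanField.mem_of_dist_le (hB : MeanField f h U γ lam X₀ Xs T η M B) {t : ℝ}
    (ht : t ∈ Icc 0 T) {A : MatP l} (hA : ‖avgB lam (B t) - A‖ ≤ η) : A ∈ U := by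
  by_contra hAU
  exact (hB.far t ht A hAU).not_ge hA

lemma MeanField.mem (hB : MeanField f h U γ lam X₀ Xs T η M B) {t : ℝ} (ht : t ∈ Icc 0 T) :
    avgB lam (B t) ∈ U :=
  hB.mem_of_dist_le ht (by rw [sub_self, norm_zero]; exact hB.η_pos.le)

/-- The weights are in `[0, 1]` and the trace dominates the norm, so a single `M` serves all levels
and all `d`. -/
lemma MeanField.norm_avg_wt_le (H : StepSetting f h U α Lf Lh LI μ θ L γ γb κ Q lam Xs)
    (hB : MeanField f h U γ lam X₀ Xs T η M B) (hκ : 0 < κ) {t : ℝ} (ht : t ∈ Icc 0 T) (j : ℕ) :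
    ‖avgB (wt lam κ j) (B t)‖ ≤ M :=
  (norm_avgB_le_trace (wt_nonneg H.lam_nonneg hκ j) (wt_le_one H.lam_nonneg H.lam_le hκ j)
    (hB.psd t ht)).trans (hB.trace_le t ht)

lemma MeanField.norm_avg_le (H : StepSetting f h U α Lf Lh LI μ θ L γ γb κ Q lam Xs)
    (hB : MeanField f h U γ lam X₀ Xs T η M B) (hκ : 0 < κ) {t : ℝ} (ht : t ∈ Icc 0 T) :
    ‖avgB lam (B t)‖ ≤ κ * M := by
  rw [avgB_wt_one hκ, norm_smul, Real.norm_eq_abs, abs_of_pos hκ]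
  exact mul_le_mul_of_nonneg_left (hB.norm_avg_wt_le H hκ ht 1) hκ.le

/-- The average of the weighted eigenvalues. -/
noncomputable def wtMean (lam : Fin d → ℝ) (κ : ℝ) (j : ℕ) : ℝ :=
  (1 / (d : ℝ)) * ∑ i, wt lam κ j i * lam i

lemma StepSetting.wtMean_nonneg (H : StepSetting f h U α Lf Lh LI μ θ L γ γb κ Q lam Xs)
    (hκ : 0 < κ) (j : ℕ) : 0 ≤ wtMean lam κ j :=
  mul_nonneg (by positivity) (Finset.sum_nonneg fun i _ =>
    mul_nonneg (wt_nonneg H.lam_nonneg hκ j i) (H.lam_nonneg i))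

lemma StepSetting.wtMean_le (H : StepSetting f h U α Lf Lh LI μ θ L γ γb κ Q lam Xs)
    (hκ : 0 < κ) (j : ℕ) : wtMean lam κ j ≤ κ := by
  have hd := H.d_pos
  have h1 : ∑ i, wt lam κ j i * lam i ≤ ∑ _i : Fin d, κ := Finset.sum_le_sum fun i _ =>
    (mul_le_of_le_one_left (H.lam_nonneg i) (wt_le_one H.lam_nonneg H.lam_le hκ j i)).trans
      (H.lam_le i)
  rw [Finset.sum_const, Finset.card_univ, Fintype.card_fin, nsmul_eq_mul] at h1
  rw [wtMean, one_div, inv_mul_le_iff₀ hd]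
  exact h1

/-- The velocity of the `j`-th weighted moment. -/
noncomputable def vel (f : OutP l → Out l → ℝ) (h : MatP l → ℝ) (γ κ : ℝ) (lam : Fin d → ℝ)
    (B : Fin d → MatP l) (j : ℕ) : MatP l :=
  flow f h γ κ (wtMean lam κ j) (avgB lam B) (avgB (wt lam κ (j + 1)) B)

lemma MeanField.hasDerivWithinAt (H : StepSetting f h U α Lf Lh LI μ θ L γ γb κ Q lam Xs)
    (hB : MeanField f h U γ lam X₀ Xs T η M B) (hκ : 0 < κ) {t : ℝ} (ht : t ∈ Icc 0 T) (j : ℕ) :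
    HasDerivWithinAt (fun s => avgB (wt lam κ j) (B s)) (vel f h γ κ lam (B t) j) (Icc 0 T) t := by
  have h1 := (HasDerivWithinAt.fun_sum fun i (_ : i ∈ (Finset.univ : Finset (Fin d))) =>
    (hB.deriv t ht i).const_smul (wt lam κ j i)).const_smul (1 / (d : ℝ))
  have h2 := H.reg.avgB_odeRHS (γ := γ) (lam := lam) hκ (hB.mem ht)
    (avgB_posSemidef H.lam_nonneg (hB.psd t ht)) (hB.psd t ht) j
  rw [avgB] at h2
  unfold vel wtMean
  rw [← h2]
  exact h1

lemma MeanField.norm_vel_le (hC : CoeffBound f h U (κ * M + η) c)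
    (H : StepSetting f h U α Lf Lh LI μ θ L γ γb κ Q lam Xs)
    (hB : MeanField f h U γ lam X₀ Xs T η M B) (hκ : 0 < κ) {t : ℝ} (ht : t ∈ Icc 0 T) (j : ℕ) :
    ‖vel f h γ κ lam (B t) j‖ ≤ flowBound γb κ c M :=
  norm_flow_le hC H.γ_nonneg H.γ_le hκ.le (H.wtMean_nonneg hκ j) (H.wtMean_le hκ j) (hB.mem ht)
    (avgB_posSemidef H.lam_nonneg (hB.psd t ht))
    ((hB.norm_avg_le H hκ ht).trans (by linarith [hB.η_pos])) (hB.norm_avg_wt_le H hκ ht (j + 1))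

lemma MeanField.norm_sub_le (hC : CoeffBound f h U (κ * M + η) c)
    (H : StepSetting f h U α Lf Lh LI μ θ L γ γb κ Q lam Xs)
    (hB : MeanField f h U γ lam X₀ Xs T η M B) (hκ : 0 < κ) {s t : ℝ} (hs : s ∈ Icc 0 T)
    (ht : t ∈ Icc 0 T) (hst : s ≤ t) (j : ℕ) :
    ‖avgB (wt lam κ j) (B t) - avgB (wt lam κ j) (B s)‖ ≤ flowBound γb κ c M * (t - s) := by
  have := (convex_Icc 0 T).norm_image_sub_le_of_norm_hasDerivWithin_le
    (fun u hu => hB.hasDerivWithinAt H hκ hu j) (fun u hu => hB.norm_vel_le hC H hκ hu j) hs ht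
  rwa [Real.norm_eq_abs, abs_of_nonneg (sub_nonneg.2 hst)] at this

/-- The velocity is Lipschitz along the solution, which moves at bounded speed, so the mean value
inequality for `u ↦ 𝓑_j(u) - u v(s)` gives a quadratic error. -/
lemma MeanField.norm_euler_le (hC : CoeffBound f h U (κ * M + η) c)
    (H : StepSetting f h U α Lf Lh LI μ θ L γ γb κ Q lam Xs)
    (hB : MeanField f h U γ lam X₀ Xs T η M B) (hκ : 0 < κ) {s t : ℝ} (hs : s ∈ Icc 0 T)
    (ht : t ∈ Icc 0 T) (hst : s ≤ t) (j : ℕ) :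
    ‖avgB (wt lam κ j) (B t) - avgB (wt lam κ j) (B s) - (t - s) • vel f h γ κ lam (B s) j‖
      ≤ flowLip γb κ c M * (flowBound γb κ c M * (t - s)) * (t - s) := by
  have hsub : Icc s t ⊆ Icc 0 T := Icc_subset_Icc hs.1 ht.2
  have hd : ∀ u ∈ Icc s t, HasDerivWithinAt
      (fun u => avgB (wt lam κ j) (B u) - u • vel f h γ κ lam (B s) j)
      (vel f h γ κ lam (B u) j - (1 : ℝ) • vel f h γ κ lam (B s) j) (Icc s t) u := fun u hu =>
    ((hB.hasDerivWithinAt H hκ (hsub hu) j).mono hsub).sub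
      ((hasDerivWithinAt_id u _).smul_const _)
  have hb : ∀ u ∈ Icc s t, ‖vel f h γ κ lam (B u) j - (1 : ℝ) • vel f h γ κ lam (B s) j‖
      ≤ flowLip γb κ c M * (flowBound γb κ c M * (t - s)) := fun u hu => by
    have hu' := hsub hu
    have hε : 0 ≤ flowBound γb κ c M * (t - s) :=
      mul_nonneg ((norm_nonneg _).trans (hB.norm_vel_le hC H hκ hs j)) (sub_nonneg.2 hst)
    have hdist : ∀ i, ‖avgB (wt lam κ i) (B u) - avgB (wt lam κ i) (B s)‖
        ≤ flowBound γb κ c M * (t - s) := fun i =>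
      (hB.norm_sub_le hC H hκ hs hu' hu.1 i).trans (mul_le_mul_of_nonneg_left
        (by linarith [hu.2]) ((norm_nonneg _).trans (hB.norm_vel_le hC H hκ hs j)))
    rw [one_smul]
    have := norm_flow_sub_le (w := 1) hC H.γ_nonneg H.γ_le hκ.le (H.wtMean_nonneg hκ j)
      (H.wtMean_le hκ j) (hB.mem hu') (avgB_posSemidef H.lam_nonneg (hB.psd u hu'))
      ((hB.norm_avg_le H hκ hu').trans (by linarith [hB.η_pos])) (hB.mem hs)
      (avgB_posSemidef H.lam_nonneg (hB.psd s hs))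
      ((hB.norm_avg_le H hκ hs).trans (by linarith [hB.η_pos]))
      (hB.norm_avg_wt_le H hκ hu' (j + 1)) le_rfl hε
      (by
        rw [avgB_wt_one hκ (B u), avgB_wt_one hκ (B s), ← smul_sub, norm_smul, Real.norm_eq_abs,
          abs_of_pos hκ]
        exact mul_le_mul_of_nonneg_left ((hdist 1).trans (by linarith)) hκ.le)
      ((hdist (j + 1)).trans (by linarith))
    rwa [one_mul] at this
  have := (convex_Icc s t).norm_image_sub_le_of_norm_hasDerivWithin_le hd hb
    (left_mem_Icc.2 hst) (right_mem_Icc.2 hst)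
  rw [Real.norm_eq_abs, abs_of_nonneg (sub_nonneg.2 hst)] at this
  refine le_of_eq_of_le ?_ this
  congr 1
  rw [sub_smul]
  abel

/-- The conditional mean of the increments, as a matrix. -/
noncomputable def meanMat (f : OutP l → Out l → ℝ) (γ : ℝ) (lam β : Fin d → ℝ)
    (Xs x : Matrix (Fin d) (Fin l) ℝ) : MatP l :=
  Matrix.of fun p q => meanIncr f γ lam β Xs x p q

/-- The accumulated noise, as a matrix. -/
noncomputable def noiseMat (f : OutP l → Out l → ℝ) (γ : ℝ) (lam β : Fin d → ℝ)
    (X₀ Xs : Matrix (Fin d) (Fin l) ℝ) (s : ℕ → EuclideanSpace ℝ (Fin d) × Out l) (k : ℕ) :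
    MatP l :=
  Matrix.of fun p q => noiseSum f γ lam β X₀ Xs s p q k

/-- Doob decomposition of the weighted moments: initial value, conditional means, martingale. -/
lemma wMom_traj (β : Fin d → ℝ) (s : ℕ → EuclideanSpace ℝ (Fin d) × Out l) (k : ℕ) :
    wMom β (Matrix.fromCols (traj f γ X₀ Xs s k) Xs) = wMom β (Matrix.fromCols X₀ Xs)
      + ∑ i ∈ Finset.range k, meanMat f γ lam β Xs (traj f γ X₀ Xs s i)
      + noiseMat f γ lam β X₀ Xs s k := by
  ext p q
  simp only [Matrix.add_apply, Matrix.sum_apply, meanMat, noiseMat, Matrix.of_apply]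
  induction k with
  | zero => simp [traj, noiseSum]
  | succ k ih =>
    have := wMom_step (f := f) (Xs := Xs) γ β (traj f γ X₀ Xs s k) (s k) p q
    rw [noiseSum] at ih ⊢
    rw [Finset.sum_range_succ, Finset.sum_range_succ, noise, traj, sgdStep, this, ih]
    ring

/-- The constant of the error of the mean increments. -/
noncomputable def driftConst (l : ℕ) (γ κ L M : ℝ) : ℝ :=
  2 * l * (γ ^ 2 * ((κ ^ 2 + 2 * L ^ 4 * κ ^ 2) * (1 + 4 * l * M) ^ 2))

/-- The entrywise drift error, where the distance to `X⋆` is bounded through level `0`. One step has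
length `1/d`, and the relative error is of order `d ^ (-1/2)`. -/
lemma StepSetting.norm_meanMat_sub_le
    (H : StepSetting f h U α Lf Lh LI μ θ L γ γb κ Q lam Xs) (hκ : 0 < κ)
    {x : Matrix (Fin d) (Fin l) ℝ} (hx : wMom lam (Matrix.fromCols x Xs) ∈ U) (j : ℕ)
    (hM : ‖wMom (wt lam κ 0) (Matrix.fromCols x Xs)‖ ≤ M) :
    ‖meanMat f γ lam (wt lam κ j) Xs x - (1 / (d : ℝ)) • flow f h γ κ (wtMean lam κ j)
        (wMom lam (Matrix.fromCols x Xs)) (wMom (wt lam κ (j + 1)) (Matrix.fromCols x Xs))‖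
      ≤ 1 / d * (driftConst l γb κ L M * (1 / √d)) := by
  have hd := H.d_pos
  have hγ := H.γ_nonneg
  have hxs : ‖x - Xs‖ ^ 2 ≤ 4 * l * M := by
    rw [← diffTrace_wMom_wt_zero (lam := lam) (κ := κ)]
    exact (le_abs_self _).trans ((abs_diffTrace_le _).trans
      (mul_le_mul_of_nonneg_left hM (by positivity)))
  have hb : (γ / d) ^ 2 * (√d * ((κ ^ 2 + 2 * L ^ 4 * κ ^ 2) * (1 + ‖x - Xs‖ ^ 2) ^ 2))
      ≤ 1 / d * (γb ^ 2 * ((κ ^ 2 + 2 * L ^ 4 * κ ^ 2) * (1 + 4 * l * M) ^ 2) * (1 / √d)) := by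
    have e : (γ / d) ^ 2 * (√d * ((κ ^ 2 + 2 * L ^ 4 * κ ^ 2) * (1 + ‖x - Xs‖ ^ 2) ^ 2))
        = 1 / d * (γ ^ 2 * ((κ ^ 2 + 2 * L ^ 4 * κ ^ 2) * (1 + ‖x - Xs‖ ^ 2) ^ 2)
          * (1 / √d)) := by
      have h0 : 0 < √(d : ℝ) := Real.sqrt_pos.2 hd
      have h1 : (d : ℝ) = √d * √d := (Real.mul_self_sqrt hd.le).symm
      generalize √(d : ℝ) = r at h0 h1 ⊢
      rw [h1]
      field_simp
    rw [e]
    have := H.γ_le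
    gcongr
  refine (norm_le_of_entry_le (b := 1 / d * (γb ^ 2 * ((κ ^ 2 + 2 * L ^ 4 * κ ^ 2)
    * (1 + 4 * l * M) ^ 2) * (1 / √d))) (by positivity) fun p q => ?_).trans_eq ?_
  · refine le_of_eq_of_le ?_ ((H.abs_integral_incr_sub_le (wt_nonneg H.lam_nonneg hκ j)
      (wt_le_one H.lam_nonneg H.lam_le hκ j) hx p q).trans hb)
    rw [wMom_wt_mul hκ]
    congr 1
    simp only [meanMat, meanIncr, Matrix.sub_apply, Matrix.of_apply, flow, Matrix.smul_apply,
      Matrix.add_apply, symProd, Matrix.mul_smul, Matrix.smul_mul, smul_eq_mul, wtMean]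
    field_simp
  · rw [driftConst]
    ring

end Compare

attribute [local instance] matrixMeasurableSpace

/-! ### Pathwise comparison on the event of small noise. -/

section Pathwise

variable {l d : ℕ} {f : OutP l → Out l → ℝ} {h : MatP l → ℝ} {U : Set (MatP l)}
  {α Lf Lh LI μ θ L γ γb κ Q c T η M : ℝ} {lam : Fin d → ℝ} {X₀ Xs : Matrix (Fin d) (Fin l) ℝ}
  {B : ℝ → Fin d → MatP l}

/-- The rate in the discrete Gronwall argument. -/
noncomputable def gronConst (l : ℕ) (γ κ L c M η : ℝ) : ℝ :=
  driftConst l γ κ L (M + η / (2 * κ)) + flowLip γ κ c M * (1 + flowBound γ κ c M)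

lemma flowBound_nonneg (hγ : 0 ≤ γ) (hκ : 0 ≤ κ) (hc : 0 ≤ c) (hM : 0 ≤ M) :
    0 ≤ flowBound γ κ c M := by
  unfold flowBound
  positivity

lemma flowLip_nonneg (hγ : 0 ≤ γ) (hκ : 0 ≤ κ) (hc : 0 ≤ c) (hM : 0 ≤ M) :
    0 ≤ flowLip γ κ c M := by
  unfold flowLip
  positivity

lemma driftConst_nonneg : 0 ≤ driftConst l γ κ L M := by
  unfold driftConst
  positivity

lemma gronConst_nonneg (hγ : 0 ≤ γ) (hκ : 0 ≤ κ) (hc : 0 ≤ c) (hM : 0 ≤ M) :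
    0 ≤ gronConst l γ κ L c M η :=
  add_nonneg driftConst_nonneg (mul_nonneg (flowLip_nonneg hγ hκ hc hM)
    (by linarith [flowBound_nonneg hγ hκ hc hM]))

/-- The error of one step has three parts: replacing the mean increment by the velocity at the
iterate, comparing velocities at the iterate and at the solution, and the Euler error. The first and
the last are absorbed by `ε ≥ 1/√d`. -/
lemma MeanField.norm_step_sub_le (H : StepSetting f h U α Lf Lh LI μ θ L γ γb κ Q lam Xs)
    (hB : MeanField f h U γ lam X₀ Xs T η M B) (hC : CoeffBound f h U (κ * M + η) c) (hκ : 0 < κ)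
    {x : Matrix (Fin d) (Fin l) ℝ} {s t ε : ℝ} (hs : s ∈ Icc 0 T) (ht : t ∈ Icc 0 T)
    (hst : t - s = 1 / d) (hε : 1 / √d ≤ ε) (hεη : ε ≤ η / (2 * κ))
    (hx : ∀ j, ‖wMom (wt lam κ j) (Matrix.fromCols x Xs) - avgB (wt lam κ j) (B s)‖ ≤ 2 ^ j * ε)
    (j : ℕ) :
    ‖meanMat f γ lam (wt lam κ j) Xs x - (avgB (wt lam κ j) (B t) - avgB (wt lam κ j) (B s))‖
      ≤ 2 ^ j * (1 / d * gronConst l γb κ L c M η * ε) := by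
  have hd := H.d_pos
  have hγb : 0 ≤ γb := H.γ_nonneg.trans H.γ_le
  have hM : 0 ≤ M := (norm_nonneg _).trans (hB.norm_avg_wt_le H hκ hs 0)
  have hFL := flowLip_nonneg hγb hκ.le hC.nonneg hM
  have hFB := flowBound_nonneg hγb hκ.le hC.nonneg hM
  have hd1 : (1 : ℝ) ≤ d := by exact_mod_cast H.one_le
  have hε0 : 0 < ε := (by positivity : (0 : ℝ) < 1 / √d).trans_le hε
  have hdε : 1 / (d : ℝ) ≤ ε := by
    refine le_trans ?_ hε
    have : √(d : ℝ) ≤ d := Real.sqrt_le_iff.2 ⟨hd.le, by nlinarith⟩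
    gcongr
  have hw : (1 : ℝ) ≤ 2 ^ j := one_le_pow₀ (by norm_num)
  have hx1 : ‖avgB lam (B s) - wMom lam (Matrix.fromCols x Xs)‖ ≤ κ * (2 * ε) := by
    rw [avgB_wt_one hκ, wMom_wt_one hκ, ← smul_sub, norm_smul, Real.norm_eq_abs, abs_of_pos hκ,
      norm_sub_rev]
    exact mul_le_mul_of_nonneg_left ((hx 1).trans_eq (by ring)) hκ.le
  -- The restriction `ε ≤ η / (2κ)` keeps the average of the iterate within `η` of the solution,
  -- hence in `U`, where the drift formula is valid.
  have hκε : κ * (2 * ε) ≤ η := by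
    rw [le_div_iff₀ (by positivity)] at hεη
    linarith
  have hxU : wMom lam (Matrix.fromCols x Xs) ∈ U := hB.mem_of_dist_le hs (hx1.trans hκε)
  have hxρ : ‖wMom lam (Matrix.fromCols x Xs)‖ ≤ κ * M + η := by
    have := norm_sub_norm_le (wMom lam (Matrix.fromCols x Xs)) (avgB lam (B s))
    rw [norm_sub_rev] at this
    linarith [hB.norm_avg_le H hκ hs]
  have hx0 : ‖wMom (wt lam κ 0) (Matrix.fromCols x Xs)‖ ≤ M + η / (2 * κ) := by
    have := norm_sub_norm_le (wMom (wt lam κ 0) (Matrix.fromCols x Xs)) (avgB (wt lam κ 0) (B s))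
    have h2 := hx 0
    rw [pow_zero, one_mul] at h2
    linarith [hB.norm_avg_wt_le H hκ hs 0]
  have h1 := H.norm_meanMat_sub_le hκ hxU j hx0
  have h2 : ‖vel f h γ κ lam (B s) j - flow f h γ κ (wtMean lam κ j)
      (wMom lam (Matrix.fromCols x Xs)) (wMom (wt lam κ (j + 1)) (Matrix.fromCols x Xs))‖
      ≤ 2 ^ j * (flowLip γb κ c M * ε) :=
    norm_flow_sub_le hC H.γ_nonneg H.γ_le hκ.le (H.wtMean_nonneg hκ j) (H.wtMean_le hκ j)
      (hB.mem hs) (avgB_posSemidef H.lam_nonneg (hB.psd s hs))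
      ((hB.norm_avg_le H hκ hs).trans (by linarith [hB.η_pos])) hxU
      (wMom_posSemidef H.lam_nonneg _) hxρ (hB.norm_avg_wt_le H hκ hs (j + 1)) hw hε0.le hx1
      (by rw [norm_sub_rev]; exact (hx (j + 1)).trans_eq (by rw [pow_succ]))
  have h3 := hB.norm_euler_le hC H hκ hs ht (by linarith [show (0 : ℝ) < 1 / d by positivity]) j
  rw [hst] at h3
  generalize flow f h γ κ (wtMean lam κ j) (wMom lam (Matrix.fromCols x Xs))
    (wMom (wt lam κ (j + 1)) (Matrix.fromCols x Xs)) = F at h1 h2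
  generalize vel f h γ κ lam (B s) j = v at h2 h3
  have h2' : ‖(1 / (d : ℝ)) • (v - F)‖ ≤ 1 / d * (2 ^ j * (flowLip γb κ c M * ε)) := by
    rw [norm_smul, Real.norm_eq_abs, abs_of_nonneg (by positivity)]
    exact mul_le_mul_of_nonneg_left h2 (by positivity)
  rw [show meanMat f γ lam (wt lam κ j) Xs x - (avgB (wt lam κ j) (B t) - avgB (wt lam κ j) (B s))
    = (meanMat f γ lam (wt lam κ j) Xs x - (1 / (d : ℝ)) • F) - (1 / (d : ℝ)) • (v - F)
      - (avgB (wt lam κ j) (B t) - avgB (wt lam κ j) (B s) - (1 / (d : ℝ)) • v) by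
        rw [smul_sub]; abel]
  refine (_root_.norm_sub_le _ _).trans ((add_le_add ((_root_.norm_sub_le _ _).trans (add_le_add h1 h2'))
    h3).trans ?_)
  have h4 : 1 / d * (driftConst l γb κ L (M + η / (2 * κ)) * (1 / √d))
      ≤ 2 ^ j * (1 / d * driftConst l γb κ L (M + η / (2 * κ)) * ε) := by
    have h0 := driftConst_nonneg (l := l) (γ := γb) (κ := κ) (L := L) (M := M + η / (2 * κ))
    calc _ ≤ 1 / d * (driftConst l γb κ L (M + η / (2 * κ)) * ε) := by gcongr
      _ ≤ 2 ^ j * (1 / d * (driftConst l γb κ L (M + η / (2 * κ)) * ε)) :=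
        le_mul_of_one_le_left (by positivity) hw
      _ = _ := by ring
  have h5 : flowLip γb κ c M * (flowBound γb κ c M * (1 / d)) * (1 / d)
      ≤ 2 ^ j * (1 / d * (flowLip γb κ c M * flowBound γb κ c M) * ε) := by
    calc _ ≤ flowLip γb κ c M * (flowBound γb κ c M * ε) * (1 / d) := by gcongr
      _ ≤ 2 ^ j * (flowLip γb κ c M * (flowBound γb κ c M * ε) * (1 / d)) :=
        le_mul_of_one_le_left (by positivity) hw
      _ = _ := by ring
  rw [gronConst]
  linarith

lemma MeanField.init_wt (H : StepSetting f h U α Lf Lh LI μ θ L γ γb κ Q lam Xs)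
    (hB : MeanField f h U γ lam X₀ Xs T η M B) (j : ℕ) :
    avgB (wt lam κ j) (B 0) = wMom (wt lam κ j) (Matrix.fromCols X₀ Xs) := by
  have hd := H.d_pos.ne'
  ext p q
  simp only [avgB, Matrix.smul_apply, Matrix.sum_apply, smul_eq_mul, hB.init, wMom_apply,
    Finset.mul_sum]
  refine Finset.sum_congr rfl fun i _ => ?_
  field_simp

/-- If the noise is small, the weighted moments of the iterates follow the deterministic
dynamics. -/
lemma MeanField.norm_moment_sub_le (H : StepSetting f h U α Lf Lh LI μ θ L γ γb κ Q lam Xs)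
    (hB : MeanField f h U γ lam X₀ Xs T η M B) (hC : CoeffBound f h U (κ * M + η) c) (hκ : 0 < κ)
    {s : ℕ → EuclideanSpace ℝ (Fin d) × Out l} {δ : ℝ} (hδ : 1 / √d ≤ δ)
    (hN : ∀ j (k : ℕ) p q, (k : ℝ) ≤ T * d →
      |noiseSum f γ lam (wt lam κ j) X₀ Xs s p q k| ≤ 2 ^ j * δ)
    (hsmall : (2 * l + 1) * δ * Real.exp (gronConst l γb κ L c M η * T) ≤ η / (2 * κ))
    {k : ℕ} (hk : (k : ℝ) ≤ T * d) (j : ℕ) :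
    ‖wMom (wt lam κ j) (Matrix.fromCols (traj f γ X₀ Xs s k) Xs) - avgB (wt lam κ j) (B (k / d))‖
      ≤ 2 ^ j * ((2 * l + 1) * δ * Real.exp (gronConst l γb κ L c M η * T)) := by
  have hd := H.d_pos
  have hT : 0 ≤ T := by
    have : 0 ≤ T * d := (Nat.cast_nonneg k).trans hk
    exact nonneg_of_mul_nonneg_left this hd
  have hγb : 0 ≤ γb := H.γ_nonneg.trans H.γ_le
  have hM : 0 ≤ M := (norm_nonneg _).trans (hB.norm_avg_wt_le H hκ (left_mem_Icc.2 hT) 0)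
  have hΛ := gronConst_nonneg (l := l) (L := L) (η := η) hγb hκ.le hC.nonneg hM
  have hδ0 : 0 < δ := (by positivity : (0 : ℝ) < 1 / √d).trans_le hδ
  have hδ1 : δ ≤ (2 * l + 1) * δ :=
    le_mul_of_one_le_left hδ0.le (by linarith [(Nat.cast_nonneg l : (0 : ℝ) ≤ l)])
  set Λ := gronConst l γb κ L c M η with hΛdef
  have hmem : ∀ i ≤ k, ((i : ℝ) / d) ∈ Icc 0 T := fun i hi =>
    ⟨by positivity, (div_le_iff₀ hd).2 ((Nat.cast_le.2 hi).trans hk)⟩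
  have hexp : ∀ i ≤ k, (1 + 1 / d * Λ) ^ i ≤ Real.exp (Λ * T) := fun i hi => by
    have h1 : (1 + 1 / d * Λ) ≤ Real.exp (1 / d * Λ) := by
      linarith [Real.add_one_le_exp (1 / d * Λ)]
    refine (pow_le_pow_left₀ (by positivity) h1 i).trans ?_
    rw [← Real.exp_nat_mul]
    refine Real.exp_le_exp.2 ?_
    calc (i : ℝ) * (1 / d * Λ) = Λ * (i / d) := by ring
      _ ≤ Λ * T := mul_le_mul_of_nonneg_left (hmem i hi).2 hΛ
  -- In `(2 * l + 1) * δ` the term `2 l` converts the entrywise noise bound into a norm bound, and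
  -- the `1` ensures that errors are at least `δ ≥ 1/√d`, also for `l = 0`.
  have key := norm_le_of_hierarchy (n := k) (ε₀ := η / (2 * κ)) (s := 1 / d) (Λ := Λ)
    (δ := (2 * l + 1) * δ)
    (Δ := fun j i => wMom (wt lam κ j) (Matrix.fromCols (traj f γ X₀ Xs s i) Xs)
      - avgB (wt lam κ j) (B (i / d)))
    (r := fun j i => meanMat f γ lam (wt lam κ j) Xs (traj f γ X₀ Xs s i)
      - (avgB (wt lam κ j) (B ((i + 1 : ℕ) / d)) - avgB (wt lam κ j) (B (i / d))))
    (R := fun j i => noiseMat f γ lam (wt lam κ j) X₀ Xs s i) (by positivity) hΛ (by positivity)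
    (fun j i _ => by
      rw [wMom_traj, Finset.sum_sub_distrib, Finset.sum_range_sub
        (fun i : ℕ => avgB (wt lam κ j) (B (i / d))), Nat.cast_zero, zero_div, hB.init_wt H]
      abel)
    (fun j i hi => (norm_le_of_entry_le (b := 2 ^ j * δ) (by positivity)
      (fun p q => hN j i p q ((Nat.cast_le.2 hi).trans hk))).trans (by
        have : 0 ≤ 2 ^ j * δ := by positivity
        linarith))
    (fun i hi ε hε hε' hx => hB.norm_step_sub_le H hC hκ (hmem i hi.le) (hmem (i + 1) hi)
      (by push_cast; ring) (hδ.trans (hδ1.trans hε)) hε' hx)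
    ((mul_le_mul_of_nonneg_left (hexp k le_rfl) (by positivity)).trans hsmall) k le_rfl j
  exact key.trans (mul_le_mul_of_nonneg_left (mul_le_mul_of_nonneg_left (hexp k le_rfl)
    (by positivity)) (by positivity))

/-- The constant in the comparison of the distances. -/
noncomputable def compareConst (l : ℕ) (γ κ L c M η T : ℝ) : ℝ :=
  4 * l * ((2 * l + 1) * Real.exp (gronConst l γ κ L c M η * T) + flowBound γ κ c M)

/-- If the noise is small, the distance of the iterates to `X⋆` follows its deterministic
equivalent. -/
lemma MeanField.abs_sub_distSq_le (H : StepSetting f h U α Lf Lh LI μ θ L γ γb κ Q lam Xs)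
    (hB : MeanField f h U γ lam X₀ Xs T η M B) (hC : CoeffBound f h U (κ * M + η) c) (hκ : 0 < κ)
    {s : ℕ → EuclideanSpace ℝ (Fin d) × Out l} {δ : ℝ} (hδ : 1 / √d ≤ δ)
    (hN : ∀ j (k : ℕ) p q, (k : ℝ) ≤ T * d →
      |noiseSum f γ lam (wt lam κ j) X₀ Xs s p q k| ≤ 2 ^ j * δ)
    (hsmall : (2 * l + 1) * δ * Real.exp (gronConst l γb κ L c M η * T) ≤ η / (2 * κ))
    {t : ℝ} (ht : t ∈ Icc 0 T) :
    |‖traj f γ X₀ Xs s ⌊t * d⌋₊ - Xs‖ ^ 2 - distSq (B t)|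
      ≤ compareConst l γb κ L c M η T * δ := by
  have hd := H.d_pos
  have hd1 : (1 : ℝ) ≤ d := by exact_mod_cast H.one_le
  have htd : 0 ≤ t * d := mul_nonneg ht.1 hd.le
  have hk1 : (⌊t * d⌋₊ : ℝ) ≤ t * d := Nat.floor_le htd
  have hk2 : t * d < ⌊t * d⌋₊ + 1 := Nat.lt_floor_add_one _
  generalize ⌊t * d⌋₊ = k at hk1 hk2
  have hkT : (k : ℝ) ≤ T * d := hk1.trans (mul_le_mul_of_nonneg_right ht.2 hd.le)
  have hkt : (k : ℝ) / d ≤ t := (div_le_iff₀ hd).2 hk1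
  have hk0 : (k : ℝ) / d ∈ Icc 0 T := ⟨by positivity, hkt.trans ht.2⟩
  have hδd : 1 / (d : ℝ) ≤ δ := by
    refine le_trans ?_ hδ
    have : √(d : ℝ) ≤ d := Real.sqrt_le_iff.2 ⟨hd.le, by nlinarith⟩
    gcongr
  have hM : 0 ≤ M := (norm_nonneg _).trans (hB.norm_avg_wt_le H hκ ht 0)
  have hFB := flowBound_nonneg (H.γ_nonneg.trans H.γ_le) hκ.le hC.nonneg hM
  have h1 := hB.norm_moment_sub_le H hC hκ hδ hN hsmall hkT 0
  rw [pow_zero, one_mul] at h1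
  -- Between grid points the solution moves by at most its speed times `1/d ≤ δ`.
  have h2 : ‖avgB (wt lam κ 0) (B t) - avgB (wt lam κ 0) (B (k / d))‖
      ≤ flowBound γb κ c M * δ := by
    refine (hB.norm_sub_le hC H hκ hk0 ht hkt 0).trans (mul_le_mul_of_nonneg_left ?_ hFB)
    refine le_trans ?_ hδd
    rw [le_div_iff₀ hd, sub_mul, div_mul_cancel₀ _ hd.ne']
    linarith
  rw [← diffTrace_wMom_wt_zero (lam := lam) (κ := κ), distSq_eq_diffTrace (lam := lam) (κ := κ)]
  have h3 : ∀ A A' : MatP l, diffTrace A - diffTrace A' = diffTrace (A - A') := fun A A' => by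
    rw [sub_eq_add_neg A, ← neg_one_smul ℝ A', diffTrace_add, diffTrace_smul]
    ring
  rw [h3]
  refine (abs_diffTrace_le _).trans ?_
  rw [compareConst, mul_assoc (4 * (l : ℝ))]
  refine mul_le_mul_of_nonneg_left ?_ (by positivity : (0 : ℝ) ≤ 4 * l)
  rw [← sub_sub_sub_cancel_right _ _ (avgB (wt lam κ 0) (B (k / d)))]
  refine (_root_.norm_sub_le _ _).trans ((add_le_add h1 h2).trans_eq ?_)
  ring

end Pathwise

attribute [local instance] matrixMeasurableSpace

/-! ### From polynomial decay of every order to overwhelming probability. -/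

section Overwhelming

/-- Superpolynomial decay of the failure probability. -/
lemma withOverwhelmingProbability_of_forall {Ω : ℕ → Type*} [∀ d, MeasurableSpace (Ω d)]
    {P : ∀ d, Measure (Ω d)} [∀ d, IsProbabilityMeasure (P d)] {E : ∀ d, Set (Ω d)}
    (hE : ∀ n : ℕ, ∃ C : ℝ, ∀ d : ℕ, 1 ≤ d → P d (E d)ᶜ ≤ ENNReal.ofReal (C / (d : ℝ) ^ n)) :
    WithOverwhelmingProbability P E := by
  -- Adding `exp (-d)` keeps the logarithm meaningful when the failure probability is zero, without
  -- spoiling superpolynomial decay.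
  set q : ℕ → ℝ := fun d => (P d (E d)ᶜ).toReal + Real.exp (-(d : ℝ)) with hq
  have hq0 : ∀ d, 0 < q d := fun d => add_pos_of_nonneg_of_pos ENNReal.toReal_nonneg
    (Real.exp_pos _)
  refine ⟨fun d => -Real.log (q d), ?_, fun d _ => ?_⟩
  · refine tendsto_atTop.2 fun b => ?_
    -- One power more than `b`: the surplus `log d` eventually dominates the logarithm of the
    -- constant.
    obtain ⟨n, hn⟩ := exists_nat_ge (b + 1)
    obtain ⟨C, hC⟩ := hE n
    set C' : ℝ := max C 0 + n.factorial with hC'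
    have hfac : (0 : ℝ) < n.factorial := by exact_mod_cast n.factorial_pos
    have hC'0 : 0 < C' := add_pos_of_nonneg_of_pos (le_max_right _ _) hfac
    have hlog : Tendsto (fun d : ℕ => Real.log d) atTop atTop :=
      Real.tendsto_log_atTop.comp tendsto_natCast_atTop_atTop
    filter_upwards [hlog.eventually_ge_atTop (Real.log C'), eventually_ge_atTop 2] with d hd1 hd2
    have hd0 : (0 : ℝ) < d := by positivity
    have hl : 0 < Real.log d := Real.log_pos (by exact_mod_cast hd2)
    have h1 : q d ≤ C' / (d : ℝ) ^ n := by
      have h2 : (P d (E d)ᶜ).toReal ≤ max C 0 / (d : ℝ) ^ n := by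
        refine ENNReal.toReal_le_of_le_ofReal (by positivity) ((hC d (by omega)).trans
          (ENNReal.ofReal_le_ofReal ?_))
        gcongr
        exact le_max_left _ _
      have h3 : Real.exp (-(d : ℝ)) ≤ n.factorial / (d : ℝ) ^ n := by
        rw [Real.exp_neg, inv_le_comm₀ (Real.exp_pos _) (by positivity), inv_div]
        exact Real.pow_div_factorial_le_exp _ hd0.le n
      rw [hC', add_div]
      exact add_le_add h2 h3
    have h4 : Real.log (q d) ≤ Real.log C' - n * Real.log d := by
      rw [← Real.log_pow, ← Real.log_div hC'0.ne' (by positivity)]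
      exact Real.log_le_log (hq0 d) h1
    rw [le_div_iff₀ hl]
    have h5 : (b + 1) * Real.log d ≤ n * Real.log d := mul_le_mul_of_nonneg_right hn hl.le
    linarith
  · rw [neg_neg, Real.exp_log (hq0 d)]
    calc P d (E d)ᶜ = ENNReal.ofReal (P d (E d)ᶜ).toReal :=
          (ENNReal.ofReal_toReal (measure_ne_top _ _)).symm
      _ ≤ _ := ENNReal.ofReal_le_ofReal (le_add_of_nonneg_right (Real.exp_pos _).le)

end Overwhelming

/-! ### Union bound over levels, times and entries. -/

section Tail

variable {l d : ℕ} {f : OutP l → Out l → ℝ} {h : MatP l → ℝ} {U : Set (MatP l)}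
  {α Lf Lh LI μ θ L γ γb κ Q : ℝ} {lam : Fin d → ℝ} {X₀ Xs : Matrix (Fin d) (Fin l) ℝ}
  {Ω : Type*} [MeasurableSpace Ω] {P : Measure Ω} [IsProbabilityMeasure P]
  {ξ : ℕ → Ω → EuclideanSpace ℝ (Fin d) × Out l}

/-- The accumulated noise exceeds its threshold for some weight, at some time. -/
def noisyEvent (f : OutP l → Out l → ℝ) (γ κ : ℝ) (lam : Fin d → ℝ)
    (X₀ Xs : Matrix (Fin d) (Fin l) ℝ) (T δ : ℝ) :
    Set (ℕ → EuclideanSpace ℝ (Fin d) × Out l) :=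
  {s | ∃ (j k : ℕ) (p q : Fin l ⊕ Fin l), (k : ℝ) ≤ T * d ∧
    2 ^ j * δ < |noiseSum f γ lam (wt lam κ j) X₀ Xs s p q k|}

/-- The moment of order `4(n+1)` at threshold `2^j d^(-1/4)` gives `d^(-(n+1))` times at least a
factor `2^(-j)`. The latter sums over all levels, and the `O(d)` times cost one power of `d`. -/
lemma StepSetting.prob_noisyEvent_le
    (H : StepSetting f h U α Lf Lh LI μ θ L γ γb κ Q lam Xs) (hξ : Samples lam P ξ) (hκ : 0 < κ)
    {T V : ℝ} (hT : 1 ≤ T) (hV : ‖X₀ - Xs‖ ^ 2 ≤ V) {δ : ℝ} (hδ : 0 < δ)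
    (hδ4 : δ ^ 4 = 1 / d) (n : ℕ) :
    P {ω | (fun i => ξ i ω) ∈ noisyEvent f γ κ lam X₀ Xs T δ}
      ≤ ENNReal.ofReal (16 * T * l ^ 2 * |tailConst γb L κ Q V T (2 * n + 1)| / d ^ n) := by
  have hd := H.d_pos
  set C := |tailConst γb L κ Q V T (2 * n + 1)| with hC
  set N := ⌊T * d⌋₊ + 1 with hN
  have hsub : {ω | (fun i => ξ i ω) ∈ noisyEvent f γ κ lam X₀ Xs T δ} ⊆
      ⋃ j : ℕ, ⋃ k ∈ Finset.range N, ⋃ p ∈ (Finset.univ : Finset (Fin l ⊕ Fin l)),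
        ⋃ q ∈ (Finset.univ : Finset (Fin l ⊕ Fin l)),
        {ω | 2 ^ j * δ ≤ |noiseSum f γ lam (wt lam κ j) X₀ Xs (fun i => ξ i ω) p q k|} := by
    rintro ω ⟨j, k, p, q, hk, hω⟩
    simp only [mem_iUnion, Finset.mem_range, Finset.mem_univ, exists_prop, true_and]
    exact ⟨j, k, Nat.lt_succ_of_le (Nat.le_floor hk), p, q, hω.le⟩
  have hone : ∀ (j : ℕ), ∀ k ∈ Finset.range N, ∀ p q : Fin l ⊕ Fin l,
      P {ω | 2 ^ j * δ ≤ |noiseSum f γ lam (wt lam κ j) X₀ Xs (fun i => ξ i ω) p q k|}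
        ≤ ENNReal.ofReal ((1 / 2) ^ j * (C / d ^ (n + 1))) := by
    intro j k hk p q
    have hkT : (k : ℝ) ≤ T * d := (Nat.cast_le.2 (Nat.lt_succ_iff.1 (Finset.mem_range.1 hk))).trans
      (Nat.floor_le (by positivity))
    refine (H.prob_noiseSum_le hξ (wt_nonneg H.lam_nonneg hκ j)
      (wt_le_one H.lam_nonneg H.lam_le hκ j) p q (2 * n + 1) hT hV hkT
      (mul_pos (by positivity) hδ)).trans (ENNReal.ofReal_le_ofReal ?_)
    have e1 : (2 ^ j * δ) ^ (2 * (2 * n + 1) + 2)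
        = (2 ^ j) ^ (2 * (2 * n + 1) + 2) * (1 / (d : ℝ)) ^ (n + 1) := by
      rw [mul_pow, ← hδ4, ← pow_mul δ, show 4 * (n + 1) = 2 * (2 * n + 1) + 2 by ring]
    have e2 : (d : ℝ) ^ (2 * n + 1 + 1) = d ^ (n + 1) * d ^ (n + 1) := by
      rw [← pow_add]
      congr 1
      ring
    -- A single factor `2 ^ j` of the gain already makes the series over the levels converge.
    have h2 : (2 : ℝ) ^ j ≤ (2 ^ j) ^ (2 * (2 * n + 1) + 2) :=
      le_self_pow₀ (one_le_pow₀ (by norm_num)) (by omega)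
    rw [e1, e2, div_div]
    have hD : (0 : ℝ) < d ^ (n + 1) := by positivity
    calc tailConst γb L κ Q V T (2 * n + 1) / (d ^ (n + 1) * d ^ (n + 1)
          * ((2 ^ j) ^ (2 * (2 * n + 1) + 2) * (1 / (d : ℝ)) ^ (n + 1)))
        = tailConst γb L κ Q V T (2 * n + 1) / (d ^ (n + 1)
          * (2 ^ j) ^ (2 * (2 * n + 1) + 2)) := by
          rw [one_div, inv_pow]
          generalize (d : ℝ) ^ (n + 1) = D at hD
          congr 1
          field_simp
      _ ≤ C / (d ^ (n + 1) * (2 ^ j) ^ (2 * (2 * n + 1) + 2)) := by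
          gcongr
          exact le_abs_self _
      _ ≤ C / (d ^ (n + 1) * 2 ^ j) := by gcongr
      _ = _ := by
          rw [one_div, inv_pow]
          field_simp
  have hN2 : (N : ℝ) ≤ 2 * (T * d) := by
    have h1 : ((⌊T * d⌋₊ : ℕ) : ℝ) ≤ T * d := Nat.floor_le (by positivity)
    have h2 : (1 : ℝ) ≤ d := by exact_mod_cast H.one_le
    rw [hN]
    push_cast
    nlinarith
  have hj : ∀ j : ℕ, P (⋃ k ∈ Finset.range N, ⋃ p ∈ (Finset.univ : Finset (Fin l ⊕ Fin l)),
        ⋃ q ∈ (Finset.univ : Finset (Fin l ⊕ Fin l)),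
        {ω | 2 ^ j * δ ≤ |noiseSum f γ lam (wt lam κ j) X₀ Xs (fun i => ξ i ω) p q k|})
      ≤ ENNReal.ofReal ((1 / 2) ^ j * (8 * T * l ^ 2 * C / d ^ n)) := by
    intro j
    have h1 : P (⋃ k ∈ Finset.range N, ⋃ p ∈ (Finset.univ : Finset (Fin l ⊕ Fin l)),
        ⋃ q ∈ (Finset.univ : Finset (Fin l ⊕ Fin l)),
        {ω | 2 ^ j * δ ≤ |noiseSum f γ lam (wt lam κ j) X₀ Xs (fun i => ξ i ω) p q k|})
        ≤ ∑ k ∈ Finset.range N, ∑ p : Fin l ⊕ Fin l, ∑ q : Fin l ⊕ Fin l,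
          ENNReal.ofReal ((1 / 2) ^ j * (C / d ^ (n + 1))) :=
      (measure_biUnion_finset_le _ _).trans (Finset.sum_le_sum fun k hk =>
        (measure_biUnion_finset_le _ _).trans (Finset.sum_le_sum fun p _ =>
          (measure_biUnion_finset_le _ _).trans (Finset.sum_le_sum fun q _ => hone j k hk p q)))
    refine h1.trans ?_
    simp only [Finset.sum_const, Finset.card_range, Finset.card_univ, Fintype.card_sum,
      Fintype.card_fin, ← ENNReal.ofReal_nsmul]
    refine ENNReal.ofReal_le_ofReal ?_
    simp only [nsmul_eq_mul]
    push_cast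
    calc (N : ℝ) * ((l + l) * ((l + l) * ((1 / 2) ^ j * (C / d ^ (n + 1)))))
        ≤ 2 * (T * d) * ((l + l) * ((l + l) * ((1 / 2) ^ j * (C / d ^ (n + 1))))) := by gcongr
      _ = _ := by
        rw [pow_succ (d : ℝ)]
        have hD : (0 : ℝ) < d ^ n := by positivity
        generalize (d : ℝ) ^ n = D at hD
        field_simp
        ring
  calc P {ω | (fun i => ξ i ω) ∈ noisyEvent f γ κ lam X₀ Xs T δ}
      ≤ ∑' j : ℕ, ENNReal.ofReal ((1 / 2) ^ j * (8 * T * l ^ 2 * C / d ^ n)) :=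
        (measure_mono hsub).trans ((measure_iUnion_le _).trans (ENNReal.tsum_le_tsum hj))
    _ = ENNReal.ofReal (∑' j : ℕ, (1 / 2) ^ j * (8 * T * l ^ 2 * C / d ^ n)) :=
        (ENNReal.ofReal_tsum_of_nonneg (fun j => by positivity)
          (summable_geometric_two.mul_right _)).symm
    _ = _ := by
        rw [tsum_mul_right, tsum_geometric_two]
        congr 1
        ring

end Tail

attribute [local instance] matrixMeasurableSpace

/-! ### Rotation to eigencoordinates. -/

section Rotation

variable {l d : ℕ} {f : OutP l → Out l → ℝ} {h : MatP l → ℝ} {U : Set (MatP l)}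
  {α Lf Lh LI μ θ L γ : ℝ} {K : Matrix (Fin d) (Fin d) ℝ}
  {X₀ Xs : Matrix (Fin d) (Fin l) ℝ} {Θ : EReal} {B : ℝ → Fin d → MatP l}

/-- The sample in eigencoordinates. -/
noncomputable def rotSample (hK : K.IsHermitian) (s : EuclideanSpace ℝ (Fin d) × Out l) :
    EuclideanSpace ℝ (Fin d) × Out l :=
  (lin (hK.eigenvectorUnitary : Matrix (Fin d) (Fin d) ℝ)ᵀ s.1, s.2)

lemma measurable_rotSample (hK : K.IsHermitian) :
    Measurable (rotSample hK : EuclideanSpace ℝ (Fin d) × Out l → _) :=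
  ((lin _).continuous.measurable.comp measurable_fst).prodMk measurable_snd

lemma map_rotSample (hK : K.PosSemidef) :
    (jointLaw l K).map (rotSample hK.isHermitian)
      = jointLaw l (Matrix.diagonal hK.isHermitian.eigenvalues) := by
  set Q : Matrix (Fin d) (Fin d) ℝ :=
    (hK.isHermitian.eigenvectorUnitary : Matrix (Fin d) (Fin d) ℝ) with hQ
  have h1 : (multivariateGaussian 0 K).map (lin Qᵀ)
      = multivariateGaussian 0 (Matrix.diagonal hK.isHermitian.eigenvalues) := by
    rw [map_lin_multivariateGaussian hK Qᵀ]
    congr 1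
    have h2 := eq_unitary_diagonal hK.isHermitian
    have h3 := unitary_transpose_mul hK.isHermitian
    rw [← hQ] at h2 h3
    conv_lhs => rw [h2]
    rw [Matrix.transpose_transpose, ← Matrix.mul_assoc, ← Matrix.mul_assoc, h3, Matrix.one_mul,
      Matrix.mul_assoc, h3, Matrix.mul_one]
  have h2 := Measure.map_prod_map (multivariateGaussian 0 K) (stdGaussian (Out l))
    (lin Qᵀ).continuous.measurable measurable_id
  rw [h1, Measure.map_id] at h2
  exact h2.symm

lemma lin_rot_transpose {κ : Type*} [Fintype κ] (hK : K.IsHermitian) (X : Matrix (Fin d) κ ℝ)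
    (a : EuclideanSpace ℝ (Fin d)) :
    lin (rot hK X)ᵀ (lin (hK.eigenvectorUnitary : Matrix (Fin d) (Fin d) ℝ)ᵀ a) = lin Xᵀ a := by
  rw [lin_lin, rot, ← Matrix.transpose_mul, ← Matrix.mul_assoc, unitary_mul_transpose,
    Matrix.one_mul]

lemma rot_fromCols (hK : K.IsHermitian) (X Y : Matrix (Fin d) (Fin l) ℝ) :
    rot hK (Matrix.fromCols X Y) = Matrix.fromCols (rot hK X) (rot hK Y) := by
  ext i p
  rcases p with p | p
  · exact rot_fromCols_inl hK X Y i p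
  · exact rot_fromCols_inr hK X Y i p

lemma sgdGrad_rot (hK : K.IsHermitian) (X : Matrix (Fin d) (Fin l) ℝ)
    (s : EuclideanSpace ℝ (Fin d) × Out l) :
    sgdGrad f (rot hK Xs) (rot hK X) (rotSample hK s)
      = gradX f (join (contract X s.1) (contract Xs s.1)) s.2 := by
  rw [sgdGrad, rotSample, ← rot_fromCols, lin_rot_transpose, join_contract]

/-- SGD depends on the data only through inner products with the parameters, so it commutes with
orthogonal maps; the covariance may therefore be taken diagonal. -/
lemma rot_sgd (hK : K.IsHermitian) (a : ℕ → EuclideanSpace ℝ (Fin d)) (e : ℕ → Out l) (k : ℕ) :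
    rot hK (sgd f γ X₀ Xs a e k)
      = traj f γ (rot hK X₀) (rot hK Xs) (fun i => rotSample hK (a i, e i)) k := by
  induction k with
  | zero => rfl
  | succ k ih =>
    rw [traj, ← ih, sgdStep, sgd, rot_sub]
    congr 1
    simp only [sgdGrad_rot]
    ext i j
    simp only [rot, rotSample, Matrix.mul_apply, Matrix.smul_apply, Matrix.vecMulVec_apply,
      smul_eq_mul, lin_apply, Matrix.transpose_apply]
    rw [Finset.sum_mul, Finset.mul_sum]
    exact Finset.sum_congr rfl fun i _ => by ring

lemma samples_rot {Ω : Type*} [MeasurableSpace Ω] {P : Measure Ω} [IsProbabilityMeasure P]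
    (hK : K.PosSemidef) {s : ℕ → Ω → EuclideanSpace ℝ (Fin d) × Out l}
    (hs : ∀ k, Measurable (s k)) (hind : iIndepFun s P) (hlaw : ∀ k, P.map (s k) = jointLaw l K) :
    Samples hK.isHermitian.eigenvalues P (fun k ω => rotSample hK.isHermitian (s k ω)) where
  meas k := (measurable_rotSample _).comp (hs k)
  indep := hind.comp (fun _ => rotSample hK.isHermitian) fun _ => measurable_rotSample _
  law k := by
    rw [← map_rotSample hK, ← hlaw k, Measure.map_map (measurable_rotSample _) (hs k)]
    rfl

lemma ae_isMinOn_rot (hf_meas : Measurable (fun p : OutP l × Out l => f p.1 p.2))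
    (hf_smooth : ∀ y e : Out l, LSmooth L (slice f y e)) (hK : K.PosSemidef)
    (hmin : ∀ᵐ p ∂(jointLaw l K), IsMinOn (slice f (lin Xsᵀ p.1) p.2) univ (lin Xsᵀ p.1)) :
    ∀ᵐ p ∂(jointLaw l (Matrix.diagonal hK.isHermitian.eigenvalues)),
      IsMinOn (slice f (lin (rot hK.isHermitian Xs)ᵀ p.1) p.2) univ
        (lin (rot hK.isHermitian Xs)ᵀ p.1) := by
  have hm : MeasurableSet {p : EuclideanSpace ℝ (Fin d) × Out l |
      IsMinOn (slice f (lin (rot hK.isHermitian Xs)ᵀ p.1) p.2) univ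
        (lin (rot hK.isHermitian Xs)ᵀ p.1)} :=
    (((lin (rot hK.isHermitian Xs)ᵀ).continuous.measurable.comp measurable_fst).prodMk
      measurable_snd) (measurableSet_isMinOn hf_meas hf_smooth)
  rw [← map_rotSample hK, ae_map_iff (measurable_rotSample _).aemeasurable hm]
  simpa only [rotSample, lin_rot_transpose] using hmin

lemma IsODESolution.meanField {hK : K.IsHermitian} {T η M : ℝ}
    (hB : IsODESolution f h U γ hK X₀ Xs Θ B) (hη : 0 < η) (hΘ : (T : EReal) < Θ)
    (hfar : ∀ t ∈ timeIco Θ, t ≤ T → ∀ V ∉ U, η < ‖avgB hK.eigenvalues (B t) - V‖)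
    (htr : ∀ t ∈ timeIco Θ, (1 / (d : ℝ)) * ∑ i, (B t i).trace ≤ M) :
    MeanField f h U γ hK.eigenvalues (rot hK X₀) (rot hK Xs) T η M B := by
  have hsub : Icc 0 T ⊆ timeIco Θ := fun t ht =>
    ⟨ht.1, (EReal.coe_le_coe_iff.2 ht.2).trans_lt hΘ⟩
  exact
  { init := fun i p q => by rw [hB.init_apply, rot_fromCols]
    psd := fun t ht => hB.psd t (hsub ht)
    η_pos := hη
    far := fun t ht => hfar t (hsub ht) ht.2
    deriv := fun t ht i => (hB.deriv t (hsub ht) i).mono hsub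
    trace_le := fun t ht => htr t (hsub ht) }

/-- The bound grows with `d`; it serves only to continue the solution at fixed `d`. -/
lemma norm_le_of_sum_trace_le {B : Fin d → MatP l} (hd : 1 ≤ d) (hB : ∀ i, (B i).PosSemidef) {M : ℝ}
    (hM : (1 / (d : ℝ)) * ∑ i, (B i).trace ≤ M) : ‖B‖ ≤ d * M := by
  have hd0 : (0 : ℝ) < d := by positivity
  have h0 : ∀ i, 0 ≤ (B i).trace := fun i => (norm_nonneg _).trans
    (norm_le_trace_of_posSemidef (hB i))
  rw [one_div, inv_mul_le_iff₀ hd0] at hM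
  refine (pi_norm_le_iff_of_nonneg ((Finset.sum_nonneg fun i _ => h0 i).trans hM)).2 fun i => ?_
  exact (norm_le_trace_of_posSemidef (hB i)).trans
    ((Finset.single_le_sum (fun j _ => h0 j) (Finset.mem_univ i)).trans hM)

end Rotation

attribute [local instance] matrixMeasurableSpace

/-! ### Choice of scales and uniformity in the dimension. -/

section Uniform

variable {l : ℕ} {f : OutP l → Out l → ℝ} {h : MatP l → ℝ} {U : Set (MatP l)}
  {α Lf Lh LI μ θ L γb κ Q T η M V : ℝ} {γ : ℕ → ℝ} {lam : ∀ d : ℕ, Fin d → ℝ}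
  {X₀ Xs : ∀ d : ℕ, Matrix (Fin d) (Fin l) ℝ} {B : ∀ d : ℕ, ℝ → Fin d → MatP l}
  {Ω : ℕ → Type*} [∀ d, MeasurableSpace (Ω d)] {P : ∀ d, Measure (Ω d)}
  [∀ d, IsProbabilityMeasure (P d)]
  {ξ : ∀ d : ℕ, ℕ → Ω d → EuclideanSpace ℝ (Fin d) × Out l}

lemma exists_forall_rpow_le (D : ℝ) {b : ℝ} (hb : 0 < b) : ∃ d₀ : ℕ, 1 ≤ d₀ ∧ ∀ d : ℕ, d₀ ≤ d →
    D * (d : ℝ) ^ (-(1 / 8 : ℝ)) ≤ b := by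
  have h1 : Tendsto (fun d : ℕ => D * (d : ℝ) ^ (-(1 / 8 : ℝ))) atTop (𝓝 (D * 0)) :=
    ((tendsto_rpow_neg_atTop (by norm_num : (0 : ℝ) < 1 / 8)).comp
      tendsto_natCast_atTop_atTop).const_mul D
  rw [mul_zero] at h1
  obtain ⟨d₀, hd₀⟩ := eventually_atTop.1 (h1.eventually_le_const hb)
  exact ⟨max d₀ 1, le_max_right _ _, fun d hd => hd₀ d ((le_max_left _ _).trans hd)⟩

/-- The noise threshold `d^(-1/4)` is above the fluctuation scale `d^(-1/2)`, so exceeding it is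
superpolynomially unlikely, and it leaves a factor `d^(-1/8)` to beat the Gronwall constants. -/
theorem withOverwhelmingProbability_traj (R : Regular f h U α Lf Lh LI μ θ L) (hκ : 0 < κ)
    (H : ∀ d, 1 ≤ d → StepSetting f h U α Lf Lh LI μ θ L (γ d) γb κ Q (lam d) (Xs d))
    (hB : ∀ d, 1 ≤ d → MeanField f h U (γ d) (lam d) (X₀ d) (Xs d) T η M (B d)) (hη : 0 < η)
    (hV : ∀ d, 1 ≤ d → ‖X₀ d - Xs d‖ ^ 2 ≤ V)
    (hξ : ∀ d, 1 ≤ d → Samples (lam d) (P d) (ξ d)) :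
    WithOverwhelmingProbability P (fun d => {ω | ∀ t ∈ Icc 0 T,
      |‖traj f (γ d) (X₀ d) (Xs d) (fun i => ξ d i ω) ⌊t * d⌋₊ - Xs d‖ ^ 2 - distSq (B d t)|
        ≤ (d : ℝ) ^ (-(1 / 8 : ℝ))}) := by
  obtain ⟨c, hC⟩ := R.exists_coeffBound (κ * M + η)
  obtain ⟨d₁, hd₁, h1⟩ := exists_forall_rpow_le (compareConst l γb κ L c M η T) one_pos
  obtain ⟨d₂, hd₂, h2⟩ := exists_forall_rpow_le
    ((2 * l + 1) * Real.exp (gronConst l γb κ L c M η * T)) (b := η / (2 * κ)) (by positivity)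
  refine withOverwhelmingProbability_of_forall fun n => ?_
  -- The first entry makes the bound trivial for the finitely many `d` below the threshold; `max T
  -- 1` meets the requirement `1 ≤ T` of the noise estimate.
  refine ⟨max ((max d₁ d₂ : ℕ) ^ n)
    (16 * max T 1 * l ^ 2 * |tailConst γb L κ Q V (max T 1) (2 * n + 1)|), fun d hd => ?_⟩
  have hd0 : (0 : ℝ) < d := by positivity
  have hd1 : (1 : ℝ) ≤ d := by exact_mod_cast hd
  by_cases hdd : d < max d₁ d₂
  · refine prob_le_one.trans ?_
    rw [← ENNReal.ofReal_one]
    refine ENNReal.ofReal_le_ofReal ?_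
    rw [le_div_iff₀ (by positivity), one_mul]
    exact le_trans (pow_le_pow_left₀ hd0.le (Nat.cast_le.2 hdd.le) n) (le_max_left _ _)
  have hdd := not_lt.1 hdd
  set δ : ℝ := (d : ℝ) ^ (-(1 / 4 : ℝ)) with hδ
  have hδ0 : 0 < δ := Real.rpow_pos_of_pos hd0 _
  have hδ4 : δ ^ 4 = 1 / d := by
    rw [hδ, ← Real.rpow_natCast, ← Real.rpow_mul hd0.le]
    norm_num [Real.rpow_neg_one]
  have hδd : 1 / √(d : ℝ) ≤ δ := by
    rw [Real.sqrt_eq_rpow, one_div, ← Real.rpow_neg hd0.le, hδ]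
    exact Real.rpow_le_rpow_of_exponent_le hd1 (by norm_num)
  have hδ8 : δ = (d : ℝ) ^ (-(1 / 8 : ℝ)) * (d : ℝ) ^ (-(1 / 8 : ℝ)) := by
    rw [hδ, ← Real.rpow_add hd0]
    norm_num
  have he0 : 0 < (d : ℝ) ^ (-(1 / 8 : ℝ)) := Real.rpow_pos_of_pos hd0 _
  have he1 : (d : ℝ) ^ (-(1 / 8 : ℝ)) ≤ 1 :=
    Real.rpow_le_one_of_one_le_of_nonpos hd1 (by norm_num)
  have hδ8' : δ ≤ (d : ℝ) ^ (-(1 / 8 : ℝ)) := by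
    rw [hδ8]
    exact mul_le_of_le_one_left he0.le he1
  have hsub : {ω | ∀ t ∈ Icc 0 T,
      |‖traj f (γ d) (X₀ d) (Xs d) (fun i => ξ d i ω) ⌊t * d⌋₊ - Xs d‖ ^ 2 - distSq (B d t)|
        ≤ (d : ℝ) ^ (-(1 / 8 : ℝ))}ᶜ ⊆
      {ω | (fun i => ξ d i ω) ∈ noisyEvent f (γ d) κ (lam d) (X₀ d) (Xs d) (max T 1) δ} := by
    intro ω hω
    by_contra hn
    refine hω fun t ht => ?_
    refine ((hB d hd).abs_sub_distSq_le (H d hd) hC hκ hδd (fun j k p q hk => ?_) ?_ ht).trans ?_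
    · by_contra hlt
      exact hn ⟨j, k, p, q, hk.trans (mul_le_mul_of_nonneg_right (le_max_left _ _) hd0.le),
        not_le.1 hlt⟩
    · refine le_trans ?_ (h2 d ((le_max_right _ _).trans hdd))
      rw [mul_right_comm]
      exact mul_le_mul_of_nonneg_left hδ8' (by positivity)
    -- One of the two factors `d^(-1/8)` of `δ` cancels the comparison constant.
    · rw [hδ8, ← mul_assoc]
      exact mul_le_of_le_one_left he0.le (h1 d ((le_max_left _ _).trans hdd))
  refine (measure_mono hsub).trans (((H d hd).prob_noisyEvent_le (hξ d hd) hκ (le_max_right _ _)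
    (hV d hd) hδ0 hδ4 n).trans (ENNReal.ofReal_le_ofReal ?_))
  gcongr
  exact le_max_right _ _

end Uniform

end SGDEquiv

/-! ### Assembly of the theorem. -/

theorem mainTheorem6
    -- the outer function, the functions of covariance tensors, and the constants
    {l : ℕ} (f : OutP l → Out l → ℝ) (h : MatP l → ℝ) (U : Set (MatP l))
    (α Lf Lh LI : ℝ) (hα : 0 ≤ α)
    (μ θ L ζ₀ ζ C Kbar γbar η T : ℝ)
    (hμ : 0 < μ) (hθ : 0 < θ) (hL : 0 < L) (hζ₀ : 0 < ζ₀) (hζ₀' : ζ₀ < 1)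
    (hζ : 0 < ζ) (hζ' : ζ < 1 - ζ₀) (hη : 0 < η) (hT : 0 < T)
    -- regularity of `f`, `h` and the Fisher matrix
    (hf_meas : Measurable (fun p : OutP l × Out l => f p.1 p.2))
    (hf_int : Integrable (f 0) (stdGaussian (Out l)))
    (hf_lip : PseudoLipschitzOuter α Lf f)
    (hU : IsOpen U)
    (hh_symm : ∀ B, h Bᵀ = h B)
    (hh_risk : ∀ B ∈ U, B.PosSemidef → h B = meanLoss f B)
    (hh_C1 : ContDiffOn ℝ 1 h U)
    (hh_lip : PseudoLipschitzOn α Lh (matGrad h) U)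
    (hI_lip : PseudoLipschitzOn α LI (fisher f) (U ∩ {B | B.PosSemidef}))
    (hf_smooth : ∀ y e : Out l, LSmooth L (slice f y e))
    (hf_rsi : ∀ y e : Out l, RSI μ θ (slice f y e))
    -- for every dimension `d`: covariance, initialization and hidden parameters
    (K : ∀ d : ℕ, Matrix (Fin d) (Fin d) ℝ) (hK : ∀ d, (K d).PosDef)
    (X₀ Xs : ∀ d : ℕ, Matrix (Fin d) (Fin l) ℝ)
    (hK_bdd : ∀ d, 1 ≤ d → opNorm (K d) ≤ Kbar)
    (hX₀_bdd : ∀ d, 1 ≤ d → ‖X₀ d‖ ≤ C) (hXs_bdd : ∀ d, 1 ≤ d → ‖Xs d‖ ≤ C)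
    (hγ_bdd : ∀ d, 1 ≤ d → stepSize μ L ζ (K d) ≤ γbar)
    (hU_init : ∀ d, 1 ≤ d → covOf (K d) (X₀ d) (Xs d) ∈ U)
    (hXs_min : ∀ d, 1 ≤ d → IsMinOn (risk f (K d) (Xs d)) univ (Xs d))
    (hXs_loss : ∀ d, 1 ≤ d → ∀ᵐ p ∂(dataLaw l (K d)),
      IsMinOn (slice f (contract (Xs d) p.1) p.2) univ (contract (Xs d) p.1))
    (h_init : ∀ d, 1 ≤ d → max (‖X₀ d - Xs d‖ ^ 2) (‖Xs d‖ ^ 2) ≠ 0 →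
      10 * Real.exp (-(θ / (8 * opNorm (K d) * max (‖X₀ d - Xs d‖ ^ 2) (‖Xs d‖ ^ 2)))) < ζ₀)
    -- the deterministic dynamics, on the maximal interval of existence
    (Θ : ℕ → EReal) (B : ∀ d : ℕ, ℝ → Fin d → MatP l)
    (hB : ∀ d, 1 ≤ d → IsMaximalODESolution f h U (stepSize μ L ζ (K d)) (hK d).isHermitian
      (X₀ d) (Xs d) (Θ d) (B d))
    (hB_far : ∀ d, 1 ≤ d → ∀ t ∈ timeIco (Θ d), t ≤ T → ∀ V ∉ U,
      η < ‖avgB (hK d).isHermitian.eigenvalues (B d t) - V‖)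
    -- the samples
    {Ω : ℕ → Type*} [∀ d, MeasurableSpace (Ω d)] (P : ∀ d, Measure (Ω d))
    [∀ d, IsProbabilityMeasure (P d)]
    (a : ∀ d : ℕ, ℕ → Ω d → EuclideanSpace ℝ (Fin d)) (e : ∀ d : ℕ, ℕ → Ω d → Out l)
    (ha : ∀ d k, Measurable (a d k)) (he : ∀ d k, Measurable (e d k))
    (h_indep : ∀ d, 1 ≤ d → iIndepFun (fun k ω => (a d k ω, e d k ω)) (P d))
    (h_law : ∀ d, 1 ≤ d → ∀ k,
      Measure.map (fun ω => (a d k ω, e d k ω)) (P d) = dataLaw l (K d)) :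
    (∀ d, 1 ≤ d →
      (Θ d ≠ ⊤ → ∃ V ∉ U, Tendsto (fun t => avgB (hK d).isHermitian.eigenvalues (B d t))
        (𝓝[<] (Θ d).toReal) (𝓝 V)) ∧
      (T : EReal) < Θ d ∧
      ∀ t ∈ timeIco (Θ d),
        distSq (B d t) ≤
          2 * Real.exp (-(stepSize μ L ζ (K d) * (1 - ζ₀ - ζ) * μ *
            lamMin (hK d).isHermitian * t)) * ‖X₀ d - Xs d‖ ^ 2) ∧
    ∃ ε : ℝ, 0 < ε ∧ WithOverwhelmingProbability P (fun d => {ω | ∀ t ∈ Icc 0 T,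
      |‖sgd f (stepSize μ L ζ (K d)) (X₀ d) (Xs d) (fun k => a d k ω) (fun k => e d k ω) ⌊t * d⌋₊
          - Xs d‖ ^ 2 - distSq (B d t)| ≤ (d : ℝ) ^ (-ε)}) := by
  have R : Regular f h U α Lf Lh LI μ θ L :=
    ⟨hα, hμ, hθ, hL, hf_meas, hf_int, hf_lip, hU, hh_symm, hh_risk, hh_C1, hh_lip, hI_lip,
      hf_smooth, hf_rsi⟩
  have hmin : ∀ d, 1 ≤ d → ∀ᵐ p ∂(jointLaw l (K d)),
      IsMinOn (slice f (lin (Xs d)ᵀ p.1) p.2) univ (lin (Xs d)ᵀ p.1) := hXs_loss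
  have hlam : ∀ d i, 0 ≤ (hK d).isHermitian.eigenvalues i := fun d i =>
    ((hK d).eigenvalues_pos i).le
  have hdist : ∀ d, 1 ≤ d → ∀ t ∈ timeIco (Θ d), distSq (B d t) ≤ ‖X₀ d - Xs d‖ ^ 2 *
      Real.exp (-(stepSize μ L ζ (K d) * (1 - ζ₀ - ζ) * μ * lamMin (hK d).isHermitian) * t) :=
    fun d hd t ht => (hB d hd).1.distSq_le R hζ₀ hζ hζ' hd (hK d) (hmin d hd) (h_init d hd) ht
  have hγ0 : ∀ d, 1 ≤ d → 0 < stepSize μ L ζ (K d) := fun d hd => stepSize_pos hd hμ hL hζ (hK d)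
  have hdist' : ∀ d, 1 ≤ d → ∀ t ∈ timeIco (Θ d), distSq (B d t) ≤ ‖X₀ d - Xs d‖ ^ 2 :=
    fun d hd t ht => by
      refine (hdist d hd t ht).trans (mul_le_of_le_one_right (sq_nonneg _)
        (Real.exp_le_one_iff.2 ?_))
      have h1 := hγ0 d hd
      have h2 := lamMin_pos hd (hK d)
      have h3 : 0 < 1 - ζ₀ - ζ := by linarith
      have := ht.1
      rw [neg_mul, neg_nonpos]
      positivity
  have hdiff : ∀ d, 1 ≤ d → ‖X₀ d - Xs d‖ ^ 2 ≤ (2 * C) ^ 2 := fun d hd =>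
    pow_le_pow_left₀ (norm_nonneg _) ((norm_sub_le _ _).trans
      (by linarith [hX₀_bdd d hd, hXs_bdd d hd])) 2
  have hXs2 : ∀ d, 1 ≤ d → ‖Xs d‖ ^ 2 ≤ C ^ 2 := fun d hd =>
    pow_le_pow_left₀ (norm_nonneg _) (hXs_bdd d hd) 2
  -- The decay of `𝓓²` enters the comparison only here, as a bound on the mean trace common to all
  -- `d` and all times.
  have htr : ∀ d, 1 ≤ d → ∀ t ∈ timeIco (Θ d), (1 / (d : ℝ)) * ∑ i, (B d t i).trace
      ≤ 2 * (2 * C) ^ 2 + 3 * C ^ 2 := fun d hd t ht =>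
    ((hB d hd).1.sum_trace_le hd ht (hdist' d hd t ht)).trans
      (by linarith [hdiff d hd, hXs2 d hd])
  have hbdd : ∀ d, 1 ≤ d → ∀ t ∈ timeIco (Θ d), ‖B d t‖ ≤ d * (2 * (2 * C) ^ 2 + 3 * C ^ 2) :=
    fun d hd t ht => norm_le_of_sum_trace_le hd ((hB d hd).1.psd t ht) (htr d hd t ht)
  have hΘ : ∀ d, 1 ≤ d → (T : EReal) < Θ d := fun d hd =>
    (hB d hd).lt_of_far R (hlam d) hη (hbdd d hd) (hB_far d hd)
  refine ⟨fun d hd => ⟨(hB d hd).exists_limit R (hlam d) (hbdd d hd), hΘ d hd, fun t ht => ?_⟩,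
    1 / 8, by norm_num, ?_⟩
  -- The decay estimate already holds with constant `1`; the factor `2` is slack.
  · have h1 := hdist d hd t ht
    rw [neg_mul] at h1
    have h2 := mul_nonneg (Real.exp_pos (-(stepSize μ L ζ (K d) * (1 - ζ₀ - ζ) * μ *
      lamMin (hK d).isHermitian * t))).le (sq_nonneg ‖X₀ d - Xs d‖)
    linarith
  -- The eigenvalue bound is `max Kbar 1` because the weights divide by it and it must be positive
  -- and independent of `d`.
  · have H : ∀ d, 1 ≤ d → StepSetting f h U α Lf Lh LI μ θ L (stepSize μ L ζ (K d)) γbar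
        (max Kbar 1) (2 + 3 * C ^ 2) (hK d).isHermitian.eigenvalues
        (rot (hK d).isHermitian (Xs d)) := fun d hd =>
      { reg := R
        one_le := hd
        lam_nonneg := hlam d
        lam_le := fun i => (eigenvalues_le_opNorm _ i).trans
          ((hK_bdd d hd).trans (le_max_left _ _))
        γ_nonneg := (hγ0 d hd).le
        γ_le := hγ_bdd d hd
        le_Q := by rw [norm_rot]; linarith [hXs2 d hd]
        ae_isMinOn := ae_isMinOn_rot hf_meas hf_smooth (hK d).posSemidef (hmin d hd) }
    have := withOverwhelmingProbability_traj (P := P) R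
      (lt_of_lt_of_le one_pos (le_max_right Kbar 1)) H
      (fun d hd => (hB d hd).1.meanField hη (hΘ d hd) (hB_far d hd) (htr d hd)) hη
      (V := (2 * C) ^ 2) (fun d hd => by rw [← rot_sub, norm_rot]; exact hdiff d hd)
      (fun d hd => samples_rot (hK d).posSemidef (fun k => (ha d k).prodMk (he d k))
        (h_indep d hd) (h_law d hd))
    simpa only [← rot_sgd, ← rot_sub, norm_rot] using this
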